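/- Let $N\ge 1$ be an integer. For $\nu>0$ put $\nu_T=\nu+\frac1\nu$, $\mathcal L_T f=\nu_T f''+\frac12(\xi f)'$, $\phi_0(\xi)=(4\pi\nu_T)^{-1/2}e^{-\xi^2/(4\nu_T)}$, $\phi_k=\partial_\xi^k\phi_0$ and $H_k(\xi)=\frac{2^k\nu_T^k}{k!}e^{\xi^2/(4\nu_T)}\partial_\xi^k e^{-\xi^2/(4\nu_T)}$. For real $m$ let $L^2(m)$ be the space of real $f\in L^2(\mathbb R)$ with $\|f\|_{L^2(m)}^2=\int(1+\xi^2)^m|f|^2\,d\xi<\infty$. *The ODE system.* For functions $\alpha_k,\beta_k$ of $\tau\ge 0$, $0\le k\le N$, with $\alpha_j=\beta_j=0$ for $j<0$, consider $$\dot\alpha_k=-\tfrac k2\alpha_k-\left(\tfrac1\nu\alpha_{k-2}+\beta_{k-2}\right),\qquad \dot\beta_k=-\tfrac k2\beta_k-\tfrac1\nu\beta_{k-2}-e^\tau(\nu\beta_k+\alpha_k).\tag{1}$$ With $\eta=e^{-\tau}$ and the time $t=e^\tau-1$ it becomes an autonomous system for $(\alpha,\beta,\eta)$ in the $(2N+3)$-dimensional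 space $\mathbb R^{N+1}\times\mathbb R^{N+1}\times\mathbb R$: $\eta'=-\eta^2$, $\alpha_k'=-\eta\left(\frac k2\alpha_k+\frac1\nu\alpha_{k-2}+\beta_{k-2}\right)$, $\beta_k'=-(\nu\beta_k+\alpha_k)-\eta\left(\frac k2\beta_k+\frac1\nu\beta_{k-2}\right)$. A solution of (1) is said to lie on a set $S$ in this space if $(\alpha(\tau),\beta(\tau),e^{-\tau})\in S$ for all $\tau\ge0$. *Approximate solutions.* Let $P_n$ be the polynomials with $\partial_y^n e^{y^2}=P_n(y)e^{y^2}$ and $C^\nu_{j,l}=\binom jl\nu_T^{(j-l)/2}P_{j-l}(0)$. For a family $c=(c_0,\dots,c_N)$ put $$A_j[c](\sigma)=\frac1{j!\,i^j}\sum_{r=0}^N c_r\sum_{l=0}^j(-i)^l(1+e^{-\sigma})^{l/2}C^\nu_{j,l}\int\xi^l\phi_r(\xi)\,d\xi ,$$ which is real. Given a solution of (1), put, for $t>0$, $\sigma=\log t$ and $\tau=\log(1+t)$, $$\tilde w_{app}(x,t)=\frac1{\sqrt t}\sum_{j=0}^N A_j[\alpha(\tau)](\sigma)\,\phi_j\!\left(\tfrac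 x{\sqrt t}\right),\qquad \tilde v_{app}(x,t)=\frac1t\sum_{j=0}^N A_j[\beta(\tau)](\sigma)\,\phi_{j+1}\!\left(\tfrac x{\sqrt t}\right).$$ Pass to the scaling variables $\xi=x/\sqrt{1+t}$, $\tau=\log(1+t)$ by $\tilde w=(1+t)^{-1/2}w(\xi,\tau)$, $\tilde v=(1+t)^{-1}v(\xi,\tau)$, and in the same way from $\tilde w_{app},\tilde v_{app}$ to $w_{app},v_{app}$. *Decay exponents.* Let $r_k=\frac k4,\frac{k+1}4,\frac{k+2}4,\frac{k+3}4$ for $k\equiv0,1,2,3 \pmod 4$, respectively. *Solutions.* A solution of $$\tilde w_t=\nu\tilde w_{xx}-\tilde v_x,\qquad \tilde v_t=\nu\tilde v_{xx}-\nu\tilde v-\tilde w_x \tag{2}$$ with data $(\tilde w_0,\tilde v_0)$ is a pair in $C([0,\infty);L^2(\mathbb R))$ with these initial values that satisfies (2) for $t>0$ weakly (tested against Schwartz functions). **Theorem.** (a) For every $\nu>0$ and every $j\ge0$, $\phi_j\neq0$ lies in every $L^2(m)$, and $\mathcal L_T\phi_j=-\frac j2\phi_j$. (b) For every $\nu>0$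 the autonomous $(2N+3)$-dimensional system has an $(N+2)$-dimensional center manifold $S_\nu$ at the origin: a globally defined smooth invariant graph over the center subspace of the linearization, tangent to it at $0$, the remaining eigenvalues having negative real part. It attracts every solution with $\eta(0)\ge0$: the distance to $S_\nu$ is at most $Ke^{-\nu t}$ for all $t\ge0$, with $K$ depending on the solution. The $S_\nu$ can be chosen, depending only on $N$ and $\nu$, so that (c), (d) and (e) hold. (c) There is $C=C(N)$ such that for all $0<\nu\le1$ every solution of (1) lying on $S_\nu$ satisfies, for $\tau\ge0$ and $0\le k\le N$, $$|\alpha_k(\tau)|\le C\max_j|\alpha_j(0)|\,\nu^{-\max(k-1,0)}e^{-r_k\tau},\qquad |\beta_k(\tau)|\le C\max_j|\alpha_j(0)|\,\nu^{-(k+1)}e^{-r_k\tau}.$$ (d) The dynamics on $S_\nu$ is, to leading order, diffusion with the enhanced coefficient $\nu+\frac1\nu$: for all $m>N+\frac12$ and $\nu>0$ there is $K$ such that for every solution of (1) lying on $S_\nu$ the function $w_c=\sum_{k\le N}\alpha_k(\tau)\phi_k$ satisfies $\|\partial_\tau w_c-\mathcal L_Tw_c\|_{L^2(m)}\le Ke^{-\tau}\max_j|\alpha_j(\tau)|$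 for all $\tau>0$. (e) Let $m>N+\frac12$ and $\tilde w_0,\tilde v_0\in L^2(m)$. There is $C=C(m,N,\tilde w_0,\tilde v_0)$ such that for every $\nu>0$ and every solution of (2) with these data there is a solution $(\alpha,\beta)$ of (1) lying on $S_\nu$ such that for every $M>0$ with $N\ge4M$ $$\|w(\tau)-w_{app}(\tau)\|_{L^2(m)}+\|v(\tau)-v_{app}(\tau)\|_{L^2(m)}\le\frac C{\nu^{\frac N4+\frac m2}}e^{-M\tau}\tag{3}$$ for all sufficiently large $\tau$ (how large may depend on $\nu$). (f) Let in addition $\tilde v_0=\partial_x\tilde u_0$ with $\tilde u_0\in L^2(m)$. Then for every $\nu>0$ and every such solution $\tilde v=\partial_x\tilde u$ for some $\tilde u$ with $\tilde u(\cdot,0)=\tilde u_0$; with $\tilde u=(1+t)^{-1/2}u(\xi,\tau)$ one has $w(\tau),u(\tau)\in L^2(m)$ for all $\tau\ge0$, the Hermite coefficients $\alpha_k(\tau)=\int H_kw(\tau)\,d\xi$, $\beta_k(\tau)=\int H_ku(\tau)\,d\xi$ solve (1), and the approximate solutions built from them satisfy (3) for every $M>0$ with $N\ge 4M$ and all sufficiently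 large $\tau$, with $C$ independent of $\nu$. Moreover, if $\nu\le1$, then for $0\le k\le N$ and all sufficiently large $\tau$ (how large may depend on $\nu$) $$|\alpha_k(\tau)|\le C\nu^{-p_k}e^{-r_k\tau},\qquad|\beta_k(\tau)|\le C\nu^{-(k+1)}e^{-r_k\tau},$$ with $C$ independent of $\nu$, where $p_0=0$, $p_2=2$ and $p_k=k-1$ for all other $k$. -/

import Mathlib

open MeasureTheory Set Filter Topology
open scoped SchwartzMap ContDiff

namespace TaylorDispersion

noncomputable section

/-! ### Weighted spaces and the model system -/

/-- Real-valued `L²(ℝ)`. -/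
abbrev L2 : Type := Lp ℝ 2 (volume : Measure ℝ)

/-- `f ∈ L²(m)`: `f ∈ L²(ℝ)` and `∫ (1 + ξ²)^m |f(ξ)|² dξ < ∞`. -/
def MemL2m (m : ℝ) (f : ℝ → ℝ) : Prop :=
  MemLp f 2 volume ∧ Integrable (fun ξ : ℝ => (1 + ξ ^ 2) ^ m * f ξ ^ 2) volume

/-- The norm of `L²(m)`. -/
def normL2m (m : ℝ) (f : ℝ → ℝ) : ℝ :=
  Real.sqrt (∫ ξ : ℝ, (1 + ξ ^ 2) ^ m * f ξ ^ 2)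

/-- `(W, V) ∈ C([0,∞); L²(ℝ))²` is the (weak) solution of
`w_t = ν w_xx - v_x`, `v_t = ν v_xx - ν v - w_x` with initial data `(w₀, v₀)`:
the equations hold for `t > 0` after pairing with an arbitrary Schwartz function. -/
structure IsSolution (ν : ℝ) (w₀ v₀ : L2) (W V : ℝ → L2) : Prop where
  continuousOn_w : ContinuousOn W (Ici 0)
  continuousOn_v : ContinuousOn V (Ici 0)
  initial_w : W 0 = w₀
  initial_v : V 0 = v₀
  eq_w : ∀ φ : 𝓢(ℝ, ℝ), ∀ t : ℝ, 0 < t →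
    HasDerivAt (fun s => ∫ x, W s x * φ x)
      (∫ x, (W t x * (ν * iteratedDeriv 2 (⇑φ) x) + V t x * deriv (⇑φ) x)) t
  eq_v : ∀ φ : 𝓢(ℝ, ℝ), ∀ t : ℝ, 0 < t →
    HasDerivAt (fun s => ∫ x, V s x * φ x)
      (∫ x, (V t x * (ν * iteratedDeriv 2 (⇑φ) x - ν * φ x) + W t x * deriv (⇑φ) x)) t

/-- `v = ∂ₓ u` in the weak sense. -/
def IsWeakDeriv (u v : L2) : Prop :=
  ∀ φ : 𝓢(ℝ, ℝ), ∫ x, u x * deriv (⇑φ) x = - ∫ x, v x * φ x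

/-- `f(x,t) = (1+t)^{-1/2} g(x/√(1+t), log(1+t))`, solved for `g(ξ,τ)`. This is the scaling of the
`w` component, and of an antiderivative `u` of the `v` component. -/
def scaleHalf (F : ℝ → L2) (τ ξ : ℝ) : ℝ :=
  Real.exp (τ / 2) * F (Real.exp τ - 1) (Real.exp (τ / 2) * ξ)

/-- `f(x,t) = (1+t)^{-1} g(x/√(1+t), log(1+t))`, solved for `g(ξ,τ)`. This is the scaling of the
`v` component. -/
def scaleOne (F : ℝ → L2) (τ ξ : ℝ) : ℝ :=
  Real.exp τ * F (Real.exp τ - 1) (Real.exp (τ / 2) * ξ)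

/-! ### The operator with enhanced diffusion, Hermite functions and Hermite polynomials -/

/-- The enhanced (Taylor) diffusion coefficient `ν_T = ν + 1/ν`. -/
def nuT (ν : ℝ) : ℝ := ν + 1 / ν

/-- `L_T f = ν_T f'' + ½ (ξ f)'`. -/
def opLT (ν : ℝ) (f : ℝ → ℝ) (ξ : ℝ) : ℝ :=
  nuT ν * iteratedDeriv 2 f ξ + 1 / 2 * deriv (fun y => y * f y) ξ

/-- `φ_k = ∂^k φ_0`, where `φ_0(ξ) = (4 π ν_T)^{-1/2} exp(-ξ²/(4 ν_T))`. -/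
def hermiteFun (ν : ℝ) (k : ℕ) (ξ : ℝ) : ℝ :=
  iteratedDeriv k
    (fun y => 1 / Real.sqrt (4 * Real.pi * nuT ν) * Real.exp (-y ^ 2 / (4 * nuT ν))) ξ

/-- `H_k(ξ) = (2^k ν_T^k / k!) exp(ξ²/(4 ν_T)) ∂^k exp(-ξ²/(4 ν_T))`, a polynomial. -/
def hermitePoly (ν : ℝ) (k : ℕ) (ξ : ℝ) : ℝ :=
  2 ^ k * nuT ν ^ k / (k.factorial : ℝ) * Real.exp (ξ ^ 2 / (4 * nuT ν)) *
    iteratedDeriv k (fun y => Real.exp (-y ^ 2 / (4 * nuT ν))) ξ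

/-- The coefficients `⟨H_k, f⟩`, `0 ≤ k ≤ N`, of the spectral projection of `f`. -/
def hermiteCoeff (ν : ℝ) (N : ℕ) (f : ℝ → ℝ) (k : Fin (N + 1)) : ℝ :=
  ∫ ξ : ℝ, hermitePoly ν k ξ * f ξ

/-- `∑_{k ≤ N} a_k φ_k`. -/
def hermiteSum (ν : ℝ) {N : ℕ} (a : Fin (N + 1) → ℝ) (ξ : ℝ) : ℝ :=
  ∑ k : Fin (N + 1), a k * hermiteFun ν k ξ

/-! ### The system of ordinary differential equations -/

/-- `x_{k-2}`, read as `0` for `k < 2`. -/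
def lag {N : ℕ} (x : Fin (N + 1) → ℝ) (k : Fin (N + 1)) : ℝ :=
  if h : 2 ≤ (k : ℕ) then x ⟨(k : ℕ) - 2, by omega⟩ else 0

/-- The nonautonomous system for `α_0, …, α_N, β_0, …, β_N` in the slow time `τ ∈ [0, ∞)`. -/
def SolvesODE (ν : ℝ) {N : ℕ} (α β : ℝ → Fin (N + 1) → ℝ) : Prop :=
  ∀ τ : ℝ, 0 ≤ τ → ∀ k : Fin (N + 1),
    HasDerivWithinAt (fun s => α s k)
      (-((k : ℝ) / 2) * α τ k - (1 / ν * lag (α τ) k + lag (β τ) k)) (Ici 0) τ ∧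
    HasDerivWithinAt (fun s => β s k)
      (-((k : ℝ) / 2) * β τ k - 1 / ν * lag (β τ) k - Real.exp τ * (ν * β τ k + α τ k))
      (Ici 0) τ

/-- The phase space of the variables `(α, β, η)`. -/
abbrev Phase (N : ℕ) : Type := (Fin (N + 1) → ℝ) × (Fin (N + 1) → ℝ) × ℝ

/-- The same system as an autonomous one for `(α, β, η)`, in the fast time `t = e^τ - 1` and with
`η = e^{-τ} = 1/(1+t)`. -/
def fastField (ν : ℝ) (N : ℕ) (p : Phase N) : Phase N :=
  (fun k => -p.2.2 * ((k : ℝ) / 2 * p.1 k + 1 / ν * lag p.1 k + lag p.2.1 k),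
   fun k => -(ν * p.2.1 k + p.1 k) - p.2.2 * ((k : ℝ) / 2 * p.2.1 k + 1 / ν * lag p.2.1 k),
   -p.2.2 ^ 2)

/-- `S` is a (global) `d`-dimensional center manifold at the equilibrium `0` of the vector field
`X`, all of whose other directions are stable: the linearization `A` of `X` at `0` splits `E` into
an invariant subspace `Ec` of dimension `d`, on which all (complex) eigenvalues have real part
zero, and an invariant subspace `Es`, on which they have negative real part; `S` is the graph over
`Ec` of a smooth map `h` into `Es` with `h(0) = 0` and `Dh(0) = 0`; and `S` is invariant. -/
def IsCenterManifold {E : Type} [NormedAddCommGroup E] [NormedSpace ℝ E]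
    (X : E → E) (S : Set E) (d : ℕ) : Prop :=
  X 0 = 0 ∧
  (∃ (A : E →L[ℝ] E) (Ec Es : Submodule ℝ E)
      (hc : ∀ x ∈ Ec, (A : E →ₗ[ℝ] E) x ∈ Ec) (hs : ∀ x ∈ Es, (A : E →ₗ[ℝ] E) x ∈ Es),
    HasFDerivAt X A 0 ∧ IsCompl Ec Es ∧ Module.finrank ℝ Ec = d ∧
    (∀ z : ℂ, Polynomial.aeval z (minpoly ℝ ((A : E →ₗ[ℝ] E).restrict hc)) = 0 → z.re = 0) ∧
    (∀ z : ℂ, Polynomial.aeval z (minpoly ℝ ((A : E →ₗ[ℝ] E).restrict hs)) = 0 → z.re < 0) ∧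
    ∃ h : Ec → Es, ContDiff ℝ ∞ h ∧ h 0 = 0 ∧ HasFDerivAt h (0 : Ec →L[ℝ] Es) 0 ∧
      S = Set.range (fun x : Ec => (x : E) + (h x : E))) ∧
  (∀ (T : ℝ) (γ : ℝ → E), 0 < T →
    (∀ t ∈ Icc 0 T, HasDerivWithinAt γ (X (γ t)) (Icc 0 T) t) →
    γ 0 ∈ S → ∀ t ∈ Icc 0 T, γ t ∈ S)

/-- `S` attracts every solution of the autonomous system that starts with `η ≥ 0`, at the rate
`e^{-ν t}`. -/
def IsAttracting (ν : ℝ) (N : ℕ) (S : Set (Phase N)) : Prop :=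
  ∀ γ : ℝ → Phase N,
    (∀ t : ℝ, 0 ≤ t → HasDerivWithinAt γ (fastField ν N (γ t)) (Ici 0) t) →
    0 ≤ (γ 0).2.2 →
    ∃ K : ℝ, ∀ t : ℝ, 0 ≤ t → Metric.infDist (γ t) S ≤ K * Real.exp (-ν * t)

/-- The curve `(α(τ), β(τ), e^{-τ})`, `τ ≥ 0`, lies in `S`. -/
def LiesOn {N : ℕ} (S : Set (Phase N)) (α β : ℝ → Fin (N + 1) → ℝ) : Prop :=
  ∀ τ : ℝ, 0 ≤ τ → (α τ, β τ, Real.exp (-τ)) ∈ S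

/-- The decay exponent of the coefficients with index `k`: it is `k/4`, `(k+1)/4`, `(k+2)/4`,
`(k+3)/4` for `k ≡ 0, 1, 2, 3` modulo `4`. -/
def rate (k : ℕ) : ℝ := ((k : ℝ) + ((k % 4 : ℕ) : ℝ)) / 4

/-! ### The approximate solutions -/

/-- `C_{j,l} = binom(j,l) ν_T^{(j-l)/2} P_{j-l}(0)` where `∂_y^n e^{y²} = P_n(y) e^{y²}`;
it vanishes for odd `j - l`. -/
def appConst (ν : ℝ) (j l : ℕ) : ℝ :=
  (j.choose l : ℝ) * Real.sqrt (nuT ν) ^ (j - l) *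
    iteratedDeriv (j - l) (fun y : ℝ => Real.exp (y ^ 2)) 0

/-- The coefficient with index `j` of the approximate solution,
`1/(j! i^j) ∑_r c_r ∑_{l ≤ j} (-i)^l (1 + e^{-σ})^{l/2} C_{j,l} ∫ ξ^l φ_r(ξ) dξ`.
Only even `j + l` contribute, and then `(-i)^l / i^j = (-1)^{(j+l)/2}`. -/
def appCoeff (ν : ℝ) {N : ℕ} (c : Fin (N + 1) → ℝ) (σ : ℝ) (j : ℕ) : ℝ :=
  1 / (j.factorial : ℝ) * ∑ r : Fin (N + 1), c r *
    ∑ l ∈ Finset.range (j + 1), (-1 : ℝ) ^ ((j + l) / 2) *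
      Real.sqrt (1 + Real.exp (-σ)) ^ l * appConst ν j l * ∫ ξ : ℝ, ξ ^ l * hermiteFun ν r ξ

/-- `w_app` in the variables `y = x/√t`, `σ = log t`. -/
def wApp (ν : ℝ) {N : ℕ} (α : ℝ → Fin (N + 1) → ℝ) (y σ : ℝ) : ℝ :=
  ∑ j : Fin (N + 1),
    appCoeff ν (α (Real.log (1 + Real.exp σ))) σ j * hermiteFun ν j y

/-- `v_app` in the variables `y = x/√t`, `σ = log t`. As `v = ∂_ξ u` and the `β_k` are the
coefficients of `u`, this is the `y`-derivative of the same expression in the `β_k`. -/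
def vApp (ν : ℝ) {N : ℕ} (β : ℝ → Fin (N + 1) → ℝ) (y σ : ℝ) : ℝ :=
  ∑ j : Fin (N + 1),
    appCoeff ν (β (Real.log (1 + Real.exp σ))) σ j * hermiteFun ν ((j : ℕ) + 1) y

/-- `√((1+t)/t)` with `1 + t = e^τ`; thus `x/√t = stretch τ * ξ` for `ξ = x/√(1+t)`. -/
def stretch (τ : ℝ) : ℝ := Real.sqrt (Real.exp τ / (Real.exp τ - 1))

/-- `w_app` in the variables `ξ = x/√(1+t)`, `τ = log(1+t)`, so that
`(1+t)^{-1/2} w_app(ξ,τ) = t^{-1/2} w_app(y,σ)`. -/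
def wAppScaled (ν : ℝ) {N : ℕ} (α : ℝ → Fin (N + 1) → ℝ) (τ ξ : ℝ) : ℝ :=
  stretch τ * wApp ν α (stretch τ * ξ) (Real.log (Real.exp τ - 1))

/-- `v_app` in the variables `ξ = x/√(1+t)`, `τ = log(1+t)`, so that
`(1+t)^{-1} v_app(ξ,τ) = t^{-1} v_app(y,σ)`. -/
def vAppScaled (ν : ℝ) {N : ℕ} (β : ℝ → Fin (N + 1) → ℝ) (τ ξ : ℝ) : ℝ :=
  stretch τ ^ 2 * vApp ν β (stretch τ * ξ) (Real.log (Real.exp τ - 1))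

/-- At the time `τ` the solution in scaling variables differs in `L²(m) × L²(m)` from the
approximate solution built from `(α, β)` by at most `ε`. -/
def ApproxWithin (ν m : ℝ) {N : ℕ} (W V : ℝ → L2) (α β : ℝ → Fin (N + 1) → ℝ) (τ ε : ℝ) : Prop :=
  MemL2m m (fun ξ => scaleHalf W τ ξ - wAppScaled ν α τ ξ) ∧
  MemL2m m (fun ξ => scaleOne V τ ξ - vAppScaled ν β τ ξ) ∧
  normL2m m (fun ξ => scaleHalf W τ ξ - wAppScaled ν α τ ξ) +
    normL2m m (fun ξ => scaleOne V τ ξ - vAppScaled ν β τ ξ) ≤ ε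

end

end TaylorDispersion

open TaylorDispersion

namespace TaylorDispersion
noncomputable section
section Series
open PowerSeries

/-! ### Power series in the Fourier variable -/

/-- The series `g` with `ν g + X g² = 1`. -/
def catSeries (ν : ℝ) : ℝ⟦X⟧ :=
  C (1 / ν) * rescale (-1 / ν ^ 2) (PowerSeries.map (Nat.castRingHom ℝ) catalanSeries)

theorem catSeries_eq {ν : ℝ} (hν : ν ≠ 0) :
    C ν * catSeries ν + X * catSeries ν ^ 2 = 1 := by
  have h0 := congrArg (fun s => rescale (-1 / ν ^ 2) (PowerSeries.map (Nat.castRingHom ℝ) s))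
    catalanSeries_sq_mul_X_add_one
  simp only [map_add, map_mul, map_pow, map_one, map_X, rescale_X] at h0
  set c := rescale (-1 / ν ^ 2) (PowerSeries.map (Nat.castRingHom ℝ) catalanSeries) with hc
  have h1 : C ν * C (1 / ν) = (1 : ℝ⟦X⟧) := by
    rw [← map_mul, mul_one_div_cancel hν, map_one]
  have h2 : (C (-1 / ν ^ 2) : ℝ⟦X⟧) = - C (1 / ν) ^ 2 := by
    rw [← map_pow, ← map_neg]; congr 1; ring
  rw [h2] at h0
  unfold catSeries
  rw [← hc]
  linear_combination c * h1 - h0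

/-- The series `h_η` with `ν h + η X² h² = 1`. -/
def slowSeries (ν η : ℝ) : ℝ⟦X⟧ := expand 2 two_ne_zero (rescale η (catSeries ν))

theorem slowSeries_eq {ν : ℝ} (hν : ν ≠ 0) (η : ℝ) :
    C ν * slowSeries ν η + C η * X ^ 2 * slowSeries ν η ^ 2 = 1 := by
  have h0 := congrArg (fun s => expand 2 two_ne_zero (rescale η s)) (catSeries_eq hν)
  have h1 : ∀ x : ℝ, rescale η (C x) = (C x : ℝ⟦X⟧) := fun x => by
    ext i; rw [coeff_rescale, coeff_C]; split_ifs with h <;> simp [h]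
  have h2 : ∀ x : ℝ, expand 2 two_ne_zero (C x) = (C x : ℝ⟦X⟧) := fun x => by
    rw [PowerSeries.expand_C]
  simpa [rescale_X, expand_X, slowSeries, h1, h2] using h0

theorem coeff_catSeries (ν : ℝ) (i : ℕ) :
    coeff i (catSeries ν) = (-1) ^ i * catalan i / ν ^ (2 * i + 1) := by
  simp only [catSeries, coeff_C_mul, coeff_rescale, coeff_map, catalanSeries_coeff]
  rw [div_pow, ← pow_mul, pow_succ, eq_natCast]
  field_simp

theorem coeff_slowSeries (ν η : ℝ) (i : ℕ) :
    coeff i (slowSeries ν η) = coeff i (slowSeries ν 1) * η ^ (i / 2) := by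
  simp only [slowSeries, coeff_expand, coeff_rescale]
  split_ifs <;> simp [mul_comm]

theorem coeff_slowSeries_odd (ν : ℝ) {η : ℝ} {i : ℕ} (hi : ¬ 2 ∣ i) :
    coeff i (slowSeries ν η) = 0 := by
  simp [slowSeries, coeff_expand, hi]

theorem abs_coeff_slowSeries_le {ν : ℝ} (hν : 0 < ν) (i : ℕ) :
    |coeff i (slowSeries ν 1)| ≤ catalan (i / 2) / ν ^ (i + 1) := by
  by_cases hi : 2 ∣ i
  · obtain ⟨j, rfl⟩ := hi
    simp [slowSeries, coeff_expand, coeff_catSeries, abs_div, abs_of_pos (pow_pos hν _)]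
  · rw [coeff_slowSeries_odd ν hi, abs_zero]; positivity

theorem coeff_zero_slowSeries (ν η : ℝ) : coeff 0 (slowSeries ν η) = 1 / ν := by
  simp [slowSeries, coeff_expand, coeff_catSeries]

/-- `exp (c X²)`. -/
def gaussSeries (c : ℝ) : ℝ⟦X⟧ := expand 2 two_ne_zero (rescale c (PowerSeries.exp ℝ))

theorem gaussSeries_mul (a b : ℝ) : gaussSeries a * gaussSeries b = gaussSeries (a + b) := by
  simp only [gaussSeries, ← map_mul, PowerSeries.exp_mul_exp_eq_exp_add]

theorem coeff_gaussSeries (c : ℝ) (i : ℕ) :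
    coeff i (gaussSeries c) = if 2 ∣ i then c ^ (i / 2) / ((i / 2).factorial : ℝ) else 0 := by
  simp [gaussSeries, coeff_expand, coeff_rescale, coeff_exp, div_eq_mul_inv]

theorem gaussSeries_zero : gaussSeries 0 = 1 := by
  ext i
  rw [coeff_gaussSeries, coeff_one]
  rcases eq_or_ne i 0 with rfl | hi
  · simp
  · rw [if_neg hi]
    split_ifs with h
    · have : i / 2 ≠ 0 := by omega
      simp [this]
    · rfl

theorem gaussSeries_mul_neg (c : ℝ) : gaussSeries c * gaussSeries (-c) = 1 := by
  rw [gaussSeries_mul, add_neg_cancel, gaussSeries_zero]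

/-! ### Coefficientwise derivatives -/

/-- The coefficients up to the order `n` have the derivatives given by the series `F'`. -/
def CoeffDeriv (n : ℕ) (F : ℝ → ℝ⟦X⟧) (F' : ℝ⟦X⟧) (s : Set ℝ) (t : ℝ) : Prop :=
  ∀ k ≤ n, HasDerivWithinAt (fun u => coeff k (F u)) (coeff k F') s t

variable {n : ℕ} {F G : ℝ → ℝ⟦X⟧} {F' G' : ℝ⟦X⟧} {s : Set ℝ} {t : ℝ}

theorem CoeffDeriv.const (P : ℝ⟦X⟧) : CoeffDeriv n (fun _ => P) 0 s t := fun k _ => by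
  simpa using hasDerivWithinAt_const t s (coeff k P)

theorem CoeffDeriv.add (hF : CoeffDeriv n F F' s t) (hG : CoeffDeriv n G G' s t) :
    CoeffDeriv n (fun u => F u + G u) (F' + G') s t := fun k hk => by
  simpa only [map_add] using (hF k hk).fun_add (hG k hk)

theorem CoeffDeriv.sub (hF : CoeffDeriv n F F' s t) (hG : CoeffDeriv n G G' s t) :
    CoeffDeriv n (fun u => F u - G u) (F' - G') s t := fun k hk => by
  simpa only [map_sub] using (hF k hk).fun_sub (hG k hk)

theorem CoeffDeriv.mul (hF : CoeffDeriv n F F' s t) (hG : CoeffDeriv n G G' s t) :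
    CoeffDeriv n (fun u => F u * G u) (F' * G t + F t * G') s t := fun k hk => by
  simp only [coeff_mul, map_add, ← Finset.sum_add_distrib]
  refine HasDerivWithinAt.fun_sum fun x hx => ?_
  have := Finset.HasAntidiagonal.mem_antidiagonal.1 hx
  exact (hF x.1 (by omega)).mul (hG x.2 (by omega))

theorem CoeffDeriv.const_mul (P : ℝ⟦X⟧) (hG : CoeffDeriv n G G' s t) :
    CoeffDeriv n (fun u => P * G u) (P * G') s t := by
  simpa using (CoeffDeriv.const P).mul hG

theorem CoeffDeriv.congr_deriv (hF : CoeffDeriv n F F' s t) (h : F' = G') :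
    CoeffDeriv n F G' s t := h ▸ hF

theorem coeff_X_pow_mul_of_lt (P : ℝ⟦X⟧) {d k : ℕ} (h : k < d) : coeff k (X ^ d * P) = 0 := by
  rw [coeff_X_pow_mul', if_neg (by omega)]

/-! ### Flows of multiplication operators -/

/-- `exp (t F) * Y`, for a series `F` without constant term. -/
def flow (F : ℝ⟦X⟧) (t : ℝ) (Y : ℝ⟦X⟧) : ℝ⟦X⟧ :=
  mk fun n => ∑ p ∈ Finset.range (n + 1), t ^ p / (p.factorial : ℝ) * coeff n (F ^ p * Y)

theorem coeff_pow_mul_of_lt {d : ℕ} (G Y : ℝ⟦X⟧) {p n : ℕ} (h : n < d * p) :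
    coeff n ((X ^ d * G) ^ p * Y) = 0 := by
  rw [mul_pow, ← pow_mul, mul_assoc, coeff_X_pow_mul_of_lt _ h]

theorem flow_zero (F Y : ℝ⟦X⟧) : flow F 0 Y = Y := by
  ext n
  rw [flow, coeff_mk, Finset.sum_range_succ', Finset.sum_eq_zero]
  · simp
  · intro p _; simp

theorem coeff_flow {d : ℕ} (hd : 0 < d) (G Y : ℝ⟦X⟧) (t : ℝ) (n : ℕ) :
    coeff n (flow (X ^ d * G) t Y) = ∑ p ∈ Finset.range (n / d + 1),
      t ^ p / (p.factorial : ℝ) * coeff n ((X ^ d * G) ^ p * Y) := by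
  rw [flow, coeff_mk]
  symm
  refine Finset.sum_subset (fun p hp => ?_) fun p _ hp => ?_
  · rw [Finset.mem_range] at *
    exact lt_of_lt_of_le hp (Nat.succ_le_succ (Nat.div_le_self n d))
  · rw [Finset.mem_range, not_lt] at hp
    rw [coeff_pow_mul_of_lt, mul_zero]
    have := Nat.lt_mul_div_succ n hd
    calc n < d * (n / d + 1) := this
      _ ≤ d * p := Nat.mul_le_mul_left _ hp

theorem hasDerivAt_coeff_flow {d : ℕ} (hd : 0 < d) (G Y : ℝ⟦X⟧) (t : ℝ) (n : ℕ) :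
    HasDerivAt (fun t => coeff n (flow (X ^ d * G) t Y))
      (coeff n ((X ^ d * G) * flow (X ^ d * G) t Y)) t := by
  set F := X ^ d * G with hF
  have hz : ∀ j p : ℕ, j < p → coeff j (F ^ p * Y) = 0 := fun j p h => by
    rw [hF]; exact coeff_pow_mul_of_lt G Y (by nlinarith)
  have e1 : coeff n (F * flow F t Y) =
      ∑ p ∈ Finset.range (n + 1), t ^ p / (p.factorial : ℝ) * coeff n (F ^ (p + 1) * Y) := by
    have : ∀ p, F ^ (p + 1) * Y = F * (F ^ p * Y) := fun p => by ring
    simp only [coeff_mul n F, this, Finset.mul_sum]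
    rw [Finset.sum_comm]
    refine Finset.sum_congr rfl fun x hx => ?_
    have hx := Finset.HasAntidiagonal.mem_antidiagonal.1 hx
    rw [flow, coeff_mk, Finset.mul_sum]
    refine (Finset.sum_subset (fun p hp => ?_) fun p _ hp => ?_).trans
      (Finset.sum_congr rfl fun p _ => by ring)
    · rw [Finset.mem_range] at *; omega
    · rw [Finset.mem_range] at hp
      rw [hz _ _ (by omega)]; simp
  rw [e1, Finset.sum_range_succ, hz n (n + 1) (by omega), mul_zero, add_zero]
  have e2 : (fun t => coeff n (flow F t Y)) = fun t => (∑ p ∈ Finset.range n,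
      t ^ (p + 1) / ((p + 1).factorial : ℝ) * coeff n (F ^ (p + 1) * Y)) + coeff n Y := by
    funext t
    rw [flow, coeff_mk, Finset.sum_range_succ']
    simp
  rw [e2]
  refine HasDerivAt.add_const _ (HasDerivAt.fun_sum fun p _ => HasDerivAt.mul_const ?_ _)
  have := (hasDerivAt_pow (p + 1) t).div_const ((p + 1).factorial : ℝ)
  convert this using 1
  rw [Nat.factorial_succ]
  push_cast
  have : (p : ℝ) + 1 ≠ 0 := by positivity
  field_simp

theorem CoeffDeriv.flow {d : ℕ} (hd : 0 < d) (G Y : ℝ⟦X⟧) :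
    CoeffDeriv n (fun t => flow (X ^ d * G) t Y) ((X ^ d * G) * TaylorDispersion.flow (X ^ d * G) t Y)
      s t := fun k _ => (hasDerivAt_coeff_flow hd G Y t k).hasDerivWithinAt

/-! ### The solution of the system for the Taylor coefficients -/

/-- `1 / (1 + X² h²)`. -/
def invSeries (ν : ℝ) : ℝ⟦X⟧ := (1 + X ^ 2 * slowSeries ν 1 ^ 2)⁻¹

theorem mul_invSeries (ν : ℝ) : (1 + X ^ 2 * slowSeries ν 1 ^ 2) * invSeries ν = 1 :=
  PowerSeries.mul_inv_cancel _ (by simp)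

/-- The slow part of data `(a, c)`. -/
def slowData (ν : ℝ) (a₀ c₀ : ℝ⟦X⟧) : ℝ⟦X⟧ := a₀ - X * slowSeries ν 1 * c₀

/-- The fast part of data `(a, c)`. -/
def fastData (ν : ℝ) (a₀ c₀ : ℝ⟦X⟧) : ℝ⟦X⟧ := c₀ + X * slowSeries ν 1 * a₀

/-- The slow mode. -/
def slowMode (ν : ℝ) (a₀ c₀ : ℝ⟦X⟧) (t : ℝ) : ℝ⟦X⟧ :=
  flow (X ^ 4 * (C (-1 / ν) * slowSeries ν 1 ^ 2)) t (slowData ν a₀ c₀)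

/-- The fast mode. -/
def fastMode (ν : ℝ) (a₀ c₀ : ℝ⟦X⟧) (t : ℝ) : ℝ⟦X⟧ :=
  C (Real.exp (-ν * t)) *
    flow (X ^ 2 * (-(C (1 / ν) + slowSeries ν 1))) t (fastData ν a₀ c₀)

/-- The first component of the solution with the data `(a₀, c₀)`. -/
def solA (ν : ℝ) (a₀ c₀ : ℝ⟦X⟧) (t : ℝ) : ℝ⟦X⟧ :=
  invSeries ν * (slowMode ν a₀ c₀ t + X * slowSeries ν 1 * fastMode ν a₀ c₀ t)

/-- The second component of the solution with the data `(a₀, c₀)`. -/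
def solC (ν : ℝ) (a₀ c₀ : ℝ⟦X⟧) (t : ℝ) : ℝ⟦X⟧ :=
  fastMode ν a₀ c₀ t - X * slowSeries ν 1 * solA ν a₀ c₀ t

variable {ν : ℝ} (a₀ c₀ : ℝ⟦X⟧)

theorem solA_zero : solA ν a₀ c₀ 0 = a₀ := by
  simp only [solA, slowMode, fastMode, flow_zero, slowData, fastData]
  simp only [mul_zero, Real.exp_zero, map_one, one_mul]
  linear_combination a₀ * mul_invSeries ν

theorem solC_zero : solC ν a₀ c₀ 0 = c₀ := by
  simp only [solC, solA_zero, fastMode, flow_zero, fastData]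
  simp

theorem fastMode_deriv : CoeffDeriv n (fastMode ν a₀ c₀)
    ((-C ν - X ^ 2 * (C (1 / ν) + slowSeries ν 1)) * fastMode ν a₀ c₀ t) s t := by
  have h1 : CoeffDeriv n (fun t => (C (Real.exp (-ν * t)) : ℝ⟦X⟧))
      (C (-ν * Real.exp (-ν * t))) s t := fun k _ => by
    simp only [coeff_C]
    split_ifs
    · have : HasDerivAt (fun u => Real.exp (-ν * u)) (Real.exp (-ν * t) * (-ν * 1)) t :=
        ((hasDerivAt_id t).const_mul (-ν)).exp
      rw [show -ν * Real.exp (-ν * t) = Real.exp (-ν * t) * (-ν * 1) by ring]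
      exact this.hasDerivWithinAt
    · exact hasDerivWithinAt_const _ _ _
  refine (h1.mul (CoeffDeriv.flow two_pos _ (fastData ν a₀ c₀))).congr_deriv ?_
  simp only [fastMode, map_mul, map_neg]
  ring

theorem solA_deriv (hν : ν ≠ 0) : CoeffDeriv n (solA ν a₀ c₀)
    (-(C (1 / ν) * X ^ 2 * solA ν a₀ c₀ t) - X * solC ν a₀ c₀ t) s t := by
  refine (CoeffDeriv.const_mul (invSeries ν) (CoeffDeriv.add
    (CoeffDeriv.flow (t := t) four_pos _ (slowData ν a₀ c₀))
    (CoeffDeriv.const_mul (X * slowSeries ν 1) (fastMode_deriv a₀ c₀)))).congr_deriv ?_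
  change invSeries ν * (_ * slowMode ν a₀ c₀ t + _) = _
  have e1 := mul_invSeries ν
  have e2 := slowSeries_eq hν 1
  have e3 : C ν * C (1 / ν) = (1 : ℝ⟦X⟧) := by rw [← map_mul, mul_one_div_cancel hν, map_one]
  have e4 : (C (-1 / ν) : ℝ⟦X⟧) = - C (1 / ν) := by rw [← map_neg]; congr 1; ring
  rw [e4]
  unfold solC solA
  set h := slowSeries ν 1
  set I := invSeries ν
  set P := slowMode ν a₀ c₀ t
  set D := fastMode ν a₀ c₀ t
  set K : ℝ⟦X⟧ := C ν
  set M : ℝ⟦X⟧ := C (1 / ν)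
  have e2' : K * h + X ^ 2 * h ^ 2 = 1 := by simpa using e2
  have e5 : h = M - M * X ^ 2 * h ^ 2 := by linear_combination M * e2' - h * e3
  linear_combination (-X * D) * e1 + (-I * X * D + 0) * e2' + (I * P * X ^ 2) * (-e5)

theorem solC_deriv (hν : ν ≠ 0) : CoeffDeriv n (solC ν a₀ c₀)
    (-(C ν * solC ν a₀ c₀ t) - C (1 / ν) * X ^ 2 * solC ν a₀ c₀ t - X * solA ν a₀ c₀ t) s t := by
  refine ((fastMode_deriv a₀ c₀).sub
    (CoeffDeriv.const_mul (X * slowSeries ν 1) (solA_deriv a₀ c₀ hν))).congr_deriv ?_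
  have e2 : C ν * slowSeries ν 1 + X ^ 2 * slowSeries ν 1 ^ 2 = 1 := by
    simpa using slowSeries_eq hν 1
  unfold solC
  linear_combination (-X * solA ν a₀ c₀ t) * e2

end Series
end
end TaylorDispersion

namespace TaylorDispersion
noncomputable section
section Growth
open PowerSeries

/-! ### Growth and decay of the coefficients in time -/

theorem exists_rpow_le_exp (y : ℝ) {δ : ℝ} (hδ : 0 < δ) :
    ∃ C : ℝ, 0 < C ∧ ∀ t : ℝ, 0 ≤ t → (1 + t) ^ y ≤ C * Real.exp (δ * t) := by
  obtain ⟨n, hn⟩ := exists_nat_ge y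
  refine ⟨(n.factorial : ℝ) / δ ^ n * Real.exp δ, by positivity, fun t ht => ?_⟩
  have h1 : (1 + t) ^ y ≤ (1 + t) ^ n := by
    rw [← Real.rpow_natCast]
    exact Real.rpow_le_rpow_of_exponent_le (by linarith) hn
  have h2 := Real.pow_div_factorial_le_exp (δ * (1 + t)) (by positivity) n
  rw [mul_pow, div_le_iff₀ (by positivity)] at h2
  rw [mul_assoc, ← Real.exp_add, show δ + δ * t = δ * (1 + t) by ring, div_mul_eq_mul_div,
    le_div_iff₀ (by positivity)]
  nlinarith [pow_pos hδ n]

/-- The coefficient of order `j` is `O((1+t)^((j-d)/4))`. -/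
def Growth (d : ℝ) (F : ℝ → ℝ⟦X⟧) : Prop :=
  ∀ j : ℕ, ∃ C : ℝ, ∀ t : ℝ, 0 ≤ t → |coeff j (F t)| ≤ C * (1 + t) ^ (((j : ℝ) - d) / 4)

/-- The coefficients decay exponentially. -/
def Decay (δ : ℝ) (F : ℝ → ℝ⟦X⟧) : Prop :=
  ∀ j : ℕ, ∃ C : ℝ, ∀ t : ℝ, 0 ≤ t → |coeff j (F t)| ≤ C * Real.exp (-δ * t)

variable {d δ : ℝ} {F G : ℝ → ℝ⟦X⟧}

theorem Growth.add (hF : Growth d F) (hG : Growth d G) : Growth d (fun t => F t + G t) := fun j => by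
  obtain ⟨A, hA⟩ := hF j
  obtain ⟨B, hB⟩ := hG j
  refine ⟨A + B, fun t ht => ?_⟩
  rw [map_add, add_mul]
  exact (abs_add_le _ _).trans (add_le_add (hA t ht) (hB t ht))

theorem abs_coeff_mul_le (P Q : ℝ⟦X⟧) (j : ℕ) :
    |coeff j (P * Q)| ≤ ∑ x ∈ Finset.HasAntidiagonal.antidiagonal j, |coeff x.1 P| * |coeff x.2 Q| := by
  rw [coeff_mul]
  exact (Finset.abs_sum_le_sum_abs _ _).trans_eq (Finset.sum_congr rfl fun x _ => abs_mul _ _)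

theorem Growth.const_mul (P : ℝ⟦X⟧) (hF : Growth d F) : Growth d (fun t => P * F t) := fun j => by
  choose C hC using hF
  refine ⟨∑ x ∈ Finset.HasAntidiagonal.antidiagonal j, |coeff x.1 P| * |C x.2|, fun t ht => ?_⟩
  refine (abs_coeff_mul_le _ _ _).trans ?_
  rw [Finset.sum_mul]
  refine Finset.sum_le_sum fun x hx => ?_
  have hx := Finset.HasAntidiagonal.mem_antidiagonal.1 hx
  rw [mul_assoc]
  refine mul_le_mul_of_nonneg_left ((hC x.2 t ht).trans ?_) (abs_nonneg _)
  have : (x.2 : ℝ) ≤ j := by exact_mod_cast (by omega : x.2 ≤ j)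
  refine mul_le_mul (le_abs_self _) (Real.rpow_le_rpow_of_exponent_le (by linarith) ?_)
    (by positivity) (abs_nonneg _)
  linarith

theorem Growth.neg (hF : Growth d F) : Growth d (fun t => -F t) := fun j => by
  simpa using hF j

theorem Growth.X_mul (hF : Growth d F) : Growth (d + 1) (fun t => X * F t) := fun j => by
  cases j with
  | zero => exact ⟨0, fun t ht => by simp⟩
  | succ j =>
    obtain ⟨C, hC⟩ := hF j
    refine ⟨C, fun t ht => ?_⟩
    rw [coeff_succ_X_mul]
    convert hC t ht using 4
    push_cast; ring

theorem Decay.growth (hδ : 0 < δ) (hF : Decay δ F) (d : ℝ) : Growth d F := fun j => by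
  obtain ⟨C, hC⟩ := hF j
  obtain ⟨K, hK, h⟩ := exists_rpow_le_exp (-(((j : ℝ) - d) / 4)) hδ
  refine ⟨|C| * K, fun t ht => (hC t ht).trans ?_⟩
  rw [mul_assoc]
  refine mul_le_mul (le_abs_self _) ?_ (by positivity) (abs_nonneg _)
  have h1 := h t ht
  rw [Real.rpow_neg (by linarith), inv_le_iff_one_le_mul₀ (by positivity)] at h1
  rw [neg_mul, Real.exp_neg, inv_le_iff_one_le_mul₀ (by positivity)]
  linarith

theorem Decay.const_mul (P : ℝ⟦X⟧) (hF : Decay δ F) : Decay δ (fun t => P * F t) := fun j => by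
  choose C hC using hF
  refine ⟨∑ x ∈ Finset.HasAntidiagonal.antidiagonal j, |coeff x.1 P| * C x.2, fun t ht => ?_⟩
  refine (abs_coeff_mul_le _ _ _).trans ?_
  rw [Finset.sum_mul]
  refine Finset.sum_le_sum fun x _ => ?_
  rw [mul_assoc]
  exact mul_le_mul_of_nonneg_left (hC x.2 t ht) (abs_nonneg _)

theorem Decay.add (hF : Decay δ F) (hG : Decay δ G) : Decay δ (fun t => F t + G t) := fun j => by
  obtain ⟨A, hA⟩ := hF j
  obtain ⟨B, hB⟩ := hG j
  refine ⟨A + B, fun t ht => ?_⟩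
  rw [map_add, add_mul]
  exact (abs_add_le _ _).trans (add_le_add (hA t ht) (hB t ht))

theorem abs_coeff_flow_le {m : ℕ} (hm : 0 < m) (P Y : ℝ⟦X⟧) (n : ℕ) :
    ∃ C : ℝ, ∀ t : ℝ, 0 ≤ t → |coeff n (flow (X ^ m * P) t Y)| ≤ C * (1 + t) ^ (n / m) := by
  refine ⟨∑ p ∈ Finset.range (n / m + 1), |coeff n ((X ^ m * P) ^ p * Y)|, fun t ht => ?_⟩
  rw [coeff_flow hm, Finset.sum_mul]
  refine (Finset.abs_sum_le_sum_abs _ _).trans (Finset.sum_le_sum fun p hp => ?_)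
  rw [abs_mul, mul_comm,
    abs_of_nonneg (show (0 : ℝ) ≤ t ^ p / (p.factorial : ℝ) by positivity)]
  refine mul_le_mul_of_nonneg_left ?_ (abs_nonneg _)
  have hp : p ≤ n / m := Nat.lt_succ_iff.1 (Finset.mem_range.1 hp)
  calc t ^ p / (p.factorial : ℝ) ≤ t ^ p :=
        div_le_self (by positivity) (by exact_mod_cast Nat.succ_le_of_lt p.factorial_pos)
    _ ≤ (1 + t) ^ p := pow_le_pow_left₀ ht (by linarith) p
    _ ≤ _ := pow_le_pow_right₀ (by linarith) hp

theorem slowMode_growth (ν : ℝ) (a₀ c₀ : ℝ⟦X⟧) : Growth 0 (slowMode ν a₀ c₀) := fun j => by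
  obtain ⟨C, hC⟩ := abs_coeff_flow_le four_pos (C (-1 / ν) * slowSeries ν 1 ^ 2)
    (slowData ν a₀ c₀) j
  refine ⟨|C|, fun t ht => (hC t ht).trans (mul_le_mul (le_abs_self _) ?_ (by positivity)
    (abs_nonneg _))⟩
  rw [← Real.rpow_natCast]
  refine Real.rpow_le_rpow_of_exponent_le (by linarith) ?_
  rw [sub_zero]
  exact_mod_cast Nat.cast_div_le (α := ℝ) (m := j) (n := 4)

theorem fastMode_decay {ν : ℝ} (hν : 0 < ν) (a₀ c₀ : ℝ⟦X⟧) :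
    Decay (ν / 2) (fastMode ν a₀ c₀) := fun j => by
  obtain ⟨B, hB⟩ := abs_coeff_flow_le two_pos (-(C (1 / ν) + slowSeries ν 1))
    (fastData ν a₀ c₀) j
  obtain ⟨K, hK, h⟩ := exists_rpow_le_exp ((j / 2 : ℕ) : ℝ) (half_pos hν)
  refine ⟨|B| * K, fun t ht => ?_⟩
  rw [fastMode, coeff_C_mul, abs_mul, abs_of_pos (Real.exp_pos _)]
  have h1 := h t ht
  rw [Real.rpow_natCast] at h1
  have h2 : Real.exp (-ν * t) * Real.exp (ν / 2 * t) = Real.exp (-(ν / 2) * t) := by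
    rw [← Real.exp_add]; congr 1; ring
  calc _ ≤ Real.exp (-ν * t) * (|B| * (K * Real.exp (ν / 2 * t))) := by
        refine mul_le_mul_of_nonneg_left ((hB t ht).trans ?_) (Real.exp_pos _).le
        exact mul_le_mul (le_abs_self _) h1 (by positivity) (abs_nonneg _)
    _ = |B| * K * (Real.exp (-ν * t) * Real.exp (ν / 2 * t)) := by ring
    _ = _ := by rw [h2]

variable {ν : ℝ} (a₀ c₀ : ℝ⟦X⟧)

theorem solA_growth (hν : 0 < ν) : Growth 0 (solA ν a₀ c₀) :=
  Growth.const_mul _ ((slowMode_growth ν a₀ c₀).add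
    (Growth.const_mul _ ((fastMode_decay hν a₀ c₀).growth (half_pos hν) 0)))

theorem solC_growth (hν : 0 < ν) : Growth 1 (solC ν a₀ c₀) := by
  have := (((solA_growth a₀ c₀ hν).const_mul (slowSeries ν 1)).X_mul).neg.add
    ((fastMode_decay hν a₀ c₀).growth (half_pos hν) (0 + 1))
  rw [zero_add] at this
  convert this using 1
  funext t; rw [solC]; ring

/-- On the slow mode `c` and `-X a/ν` agree to leading order. -/
theorem solA_add_solC_growth (hν : 0 < ν) :
    Growth 3 (fun t => C (1 / ν) * (X * solA ν a₀ c₀ t) + solC ν a₀ c₀ t) := by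
  have := (((solA_growth a₀ c₀ hν).const_mul (C (1 / ν) * slowSeries ν 1 ^ 2)).X_mul.X_mul.X_mul).add
    ((fastMode_decay hν a₀ c₀).growth (half_pos hν) (0 + 1 + 1 + 1))
  norm_num at this
  convert this using 1
  funext t
  have e2 : C ν * slowSeries ν 1 + X ^ 2 * slowSeries ν 1 ^ 2 = 1 := by
    simpa using slowSeries_eq hν.ne' 1
  have e3 : C ν * C (1 / ν) = (1 : ℝ⟦X⟧) := by rw [← map_mul, mul_one_div_cancel hν.ne', map_one]
  rw [solC]
  rw [one_div] at *
  linear_combination (-C ν⁻¹ * X * solA ν a₀ c₀ t) * e2 + X * slowSeries ν 1 * solA ν a₀ c₀ t * e3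

theorem mul_flow {m : ℕ} (hm : 0 < m) (Q P Y : ℝ⟦X⟧) (t : ℝ) :
    Q * flow (X ^ m * P) t Y = flow (X ^ m * P) t (Q * Y) := by
  ext n
  set F := X ^ m * P with hF
  have hz : ∀ j p : ℕ, j < p → coeff j (F ^ p * Y) = 0 := fun j p h => by
    rw [hF]; exact coeff_pow_mul_of_lt P Y (by nlinarith)
  have : ∀ p, F ^ p * (Q * Y) = Q * (F ^ p * Y) := fun p => by ring
  rw [flow, flow, coeff_mk]
  simp only [this, coeff_mul n Q, Finset.mul_sum]
  rw [Finset.sum_comm]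
  refine Finset.sum_congr rfl fun x hx => ?_
  have hx := Finset.HasAntidiagonal.mem_antidiagonal.1 hx
  rw [coeff_mk, Finset.mul_sum]
  refine (Finset.sum_subset (fun p hp => ?_) fun p _ hp => ?_).trans
    (Finset.sum_congr rfl fun p _ => by ring)
  · rw [Finset.mem_range] at *; omega
  · rw [Finset.mem_range] at hp
    rw [hz _ _ (by omega)]; simp

/-- Only the highest power of `t` matters for large times. -/
theorem eventually_abs_coeff_flow_le {m : ℕ} (hm : 0 < m) (P Y : ℝ⟦X⟧) (n : ℕ) :
    ∀ᶠ t : ℝ in atTop, |coeff n (flow (X ^ m * P) t Y)| ≤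
      (|coeff n ((X ^ m * P) ^ (n / m) * Y)| + 1) * t ^ (n / m) := by
  have h1 : ∀ p ∈ Finset.range (n / m), ∀ᶠ t : ℝ in atTop,
      |t ^ p / (p.factorial : ℝ) * coeff n ((X ^ m * P) ^ p * Y)| ≤
        1 / ((n / m : ℕ) + 1 : ℝ) * t ^ (n / m) := fun p hp => by
    have hp := Finset.mem_range.1 hp
    have h2 : (fun t : ℝ => t ^ p / (p.factorial : ℝ) * coeff n ((X ^ m * P) ^ p * Y)) =o[atTop]
        fun t : ℝ => t ^ (n / m) := by
      have := (Asymptotics.isLittleO_pow_pow_atTop_of_lt (𝕜 := ℝ) hp).const_mul_left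
        ((p.factorial : ℝ)⁻¹ * coeff n ((X ^ m * P) ^ p * Y))
      refine this.congr_left fun t => by ring
    have h3 := h2.bound (show (0 : ℝ) < 1 / ((n / m : ℕ) + 1 : ℝ) by positivity)
    filter_upwards [h3, eventually_ge_atTop 0] with t ht h0
    simpa [abs_of_nonneg h0, abs_div] using ht
  have h2 := (Finset.eventually_all (Finset.range (n / m))).2 h1
  filter_upwards [h2, eventually_ge_atTop 0] with t ht h0
  rw [coeff_flow hm, Finset.sum_range_succ]
  refine (abs_add_le _ _).trans ?_
  have e1 : |∑ p ∈ Finset.range (n / m), t ^ p / (p.factorial : ℝ) *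
      coeff n ((X ^ m * P) ^ p * Y)| ≤ t ^ (n / m) := by
    refine (Finset.abs_sum_le_sum_abs _ _).trans ((Finset.sum_le_sum ht).trans ?_)
    rw [Finset.sum_const, Finset.card_range, nsmul_eq_mul, ← mul_assoc]
    refine mul_le_of_le_one_left (by positivity) ?_
    rw [mul_one_div, div_le_one (by positivity)]
    linarith
  have e2 : |t ^ (n / m) / ((n / m).factorial : ℝ) * coeff n ((X ^ m * P) ^ (n / m) * Y)| ≤
      |coeff n ((X ^ m * P) ^ (n / m) * Y)| * t ^ (n / m) := by
    rw [abs_mul, mul_comm,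
      abs_of_nonneg (show (0 : ℝ) ≤ t ^ (n / m) / ((n / m).factorial : ℝ) by positivity)]
    exact mul_le_mul_of_nonneg_left (div_le_self (by positivity)
      (by exact_mod_cast Nat.succ_le_of_lt (Nat.factorial_pos _))) (abs_nonneg _)
  linarith

/-! ### Dependence of the coefficients on `ν` -/

/-- For `0 < ν ≤ 1` the coefficient of order `i` is `O(ν^{-(e+i)})`. -/
def OrderLE (e : ℕ) (F : ℝ → ℝ⟦X⟧) : Prop :=
  ∀ i : ℕ, ∃ C : ℝ, ∀ ν : ℝ, 0 < ν → ν ≤ 1 → |coeff i (F ν)| ≤ C / ν ^ (e + i)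

variable {e e' : ℕ} {P Q : ℝ → ℝ⟦X⟧}

theorem div_pow_le_div_pow {ν : ℝ} (h0 : 0 < ν) (h1 : ν ≤ 1) {c C : ℝ} (hc : c ≤ C) (hC : 0 ≤ C)
    {a b : ℕ} (hab : a ≤ b) : c / ν ^ a ≤ C / ν ^ b :=
  div_le_div₀ hC hc (pow_pos h0 _) (pow_le_pow_of_le_one h0.le h1 hab)

theorem abs_coeff_mul_le_of_order (i : ℕ)
    (hP : ∀ j ≤ i, ∃ C : ℝ, ∀ ν : ℝ, 0 < ν → ν ≤ 1 → |coeff j (P ν)| ≤ C / ν ^ (e + j))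
    (hQ : ∀ j ≤ i, ∃ C : ℝ, ∀ ν : ℝ, 0 < ν → ν ≤ 1 → |coeff j (Q ν)| ≤ C / ν ^ (e' + j)) :
    ∃ C : ℝ, ∀ ν : ℝ, 0 < ν → ν ≤ 1 → |coeff i (P ν * Q ν)| ≤ C / ν ^ (e + e' + i) := by
  choose! A hA using hP
  choose! B hB using hQ
  refine ⟨∑ x ∈ Finset.HasAntidiagonal.antidiagonal i, |A x.1| * |B x.2|, fun ν h0 h1 => ?_⟩
  refine (abs_coeff_mul_le _ _ _).trans ?_
  rw [Finset.sum_div]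
  refine Finset.sum_le_sum fun x hx => ?_
  have hx := Finset.HasAntidiagonal.mem_antidiagonal.1 hx
  have e1 : |A x.1| * |B x.2| / ν ^ (e + e' + i) = (|A x.1| / ν ^ (e + x.1)) *
      (|B x.2| / ν ^ (e' + x.2)) := by
    rw [div_mul_div_comm, ← pow_add, ← hx]; congr 2; omega
  rw [e1]
  exact mul_le_mul ((hA _ (by omega) ν h0 h1).trans
      (div_pow_le_div_pow h0 h1 (le_abs_self _) (abs_nonneg _) le_rfl))
    ((hB _ (by omega) ν h0 h1).trans
      (div_pow_le_div_pow h0 h1 (le_abs_self _) (abs_nonneg _) le_rfl)) (abs_nonneg _)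
    (by positivity)

theorem OrderLE.mul (hP : OrderLE e P) (hQ : OrderLE e' Q) :
    OrderLE (e + e') (fun ν => P ν * Q ν) :=
  fun i => abs_coeff_mul_le_of_order i (fun j _ => hP j) fun j _ => hQ j

theorem OrderLE.mono (hP : OrderLE e P) (h : e ≤ e') : OrderLE e' P := fun i => by
  obtain ⟨C, hC⟩ := hP i
  exact ⟨|C|, fun ν h0 h1 => (hC ν h0 h1).trans
    (div_pow_le_div_pow h0 h1 (le_abs_self _) (abs_nonneg _) (by omega))⟩

theorem OrderLE.const (Y : ℝ⟦X⟧) : OrderLE 0 (fun _ => Y) := fun i =>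
  ⟨|coeff i Y|, fun ν h0 h1 => by
    simpa using div_pow_le_div_pow h0 h1 le_rfl (abs_nonneg (coeff i Y)) (Nat.zero_le (0 + i))⟩

theorem OrderLE.sub (hP : OrderLE e P) (hQ : OrderLE e Q) :
    OrderLE e (fun ν => P ν - Q ν) := fun i => by
  obtain ⟨A, hA⟩ := hP i
  obtain ⟨B, hB⟩ := hQ i
  refine ⟨A + B, fun ν h0 h1 => ?_⟩
  rw [map_sub, add_div]
  exact (abs_sub _ _).trans (add_le_add (hA ν h0 h1) (hB ν h0 h1))

theorem OrderLE.pow (hP : OrderLE e P) (p : ℕ) : OrderLE (p * e) (fun ν => P ν ^ p) := by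
  induction p with
  | zero => simpa using OrderLE.const 1
  | succ p ih =>
    have := ih.mul hP
    simp only [← pow_succ] at this
    convert this using 1
    ring

theorem OrderLE.X_pow_mul (m : ℕ) (hP : OrderLE m P) : OrderLE 0 (fun ν => X ^ m * P ν) :=
  fun i => by
    by_cases h : m ≤ i
    · obtain ⟨C, hC⟩ := hP (i - m)
      refine ⟨C, fun ν h0 h1 => ?_⟩
      rw [coeff_X_pow_mul', if_pos h]
      convert hC ν h0 h1 using 3
      omega
    · exact ⟨0, fun ν h0 h1 => by rw [coeff_X_pow_mul_of_lt _ (by omega)]; simp⟩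

theorem slowSeries_order : OrderLE 1 (fun ν => slowSeries ν 1) := fun i =>
  ⟨catalan (i / 2), fun ν h0 _ => by rw [add_comm 1]; exact abs_coeff_slowSeries_le h0 i⟩

theorem C_order : OrderLE 1 (fun ν => C (-1 / ν)) := fun i => by
  refine ⟨1, fun ν h0 h1 => ?_⟩
  rw [coeff_C]
  split_ifs with h
  · subst h; simp [abs_div, abs_of_pos h0]
  · rw [abs_zero]; positivity

theorem invSeries_order : OrderLE 0 invSeries := fun i => by
  induction i using Nat.strong_induction_on with
  | _ i ih =>
    have h2 : OrderLE 2 (fun ν => slowSeries ν 1 ^ 2) := slowSeries_order.pow 2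
    have e1 : ∀ ν, invSeries ν = 1 - X ^ 2 * (slowSeries ν 1 ^ 2 * invSeries ν) := fun ν => by
      linear_combination mul_invSeries ν
    by_cases hi : i < 2
    · refine ⟨1, fun ν h0 h1 => ?_⟩
      rw [e1, map_sub, coeff_X_pow_mul_of_lt _ hi, sub_zero, coeff_one]
      split_ifs with h
      · subst h; simp
      · rw [abs_zero]; positivity
    · obtain ⟨C, hC⟩ := abs_coeff_mul_le_of_order (i - 2) (fun j _ => h2 j)
        (fun j hj => ih j (by omega))
      refine ⟨C, fun ν h0 h1 => ?_⟩
      rw [e1, map_sub, coeff_X_pow_mul', if_pos (by omega), coeff_one, if_neg (by omega), zero_sub,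
        abs_neg]
      convert hC ν h0 h1 using 3
      omega

theorem nuT_pos {ν : ℝ} (hν : 0 < ν) : 0 < nuT ν := by unfold nuT; positivity

theorem gaussSeries_order : OrderLE 0 (fun ν => gaussSeries (-nuT ν)) := fun i => by
  refine ⟨2 ^ (i / 2), fun ν h0 h1 => ?_⟩
  rw [coeff_gaussSeries]
  split_ifs with h
  · rw [abs_div, abs_pow, abs_neg, abs_of_pos (nuT_pos h0), Nat.abs_cast]
    have h3 : nuT ν ≤ 2 / ν := by
      rw [nuT, le_div_iff₀ h0, add_mul, one_div_mul_cancel h0.ne']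
      nlinarith
    calc nuT ν ^ (i / 2) / ((i / 2).factorial : ℝ) ≤ nuT ν ^ (i / 2) :=
          div_le_self (pow_nonneg (nuT_pos h0).le _)
            (by exact_mod_cast Nat.succ_le_of_lt (Nat.factorial_pos _))
      _ ≤ (2 / ν) ^ (i / 2) := pow_le_pow_left₀ (nuT_pos h0).le h3 _
      _ = 2 ^ (i / 2) / ν ^ (i / 2) := div_pow _ _ _
      _ ≤ _ := div_pow_le_div_pow h0 h1 le_rfl (by positivity) (by omega)
  · rw [abs_zero]; positivity

end Growth
end
end TaylorDispersion

namespace TaylorDispersion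
noncomputable section
section Manifold
open PowerSeries

/-! ### The center manifold -/

/-- Extension of a finite family by zero, as a power series. -/
def extSeries {N : ℕ} (x : Fin (N + 1) → ℝ) : ℝ⟦X⟧ :=
  mk fun j => if h : j < N + 1 then x ⟨j, h⟩ else 0

variable {N : ℕ}

theorem coeff_extSeries (x : Fin (N + 1) → ℝ) (k : Fin (N + 1)) :
    coeff (k : ℕ) (extSeries x) = x k := by
  rw [extSeries, coeff_mk, dif_pos k.2]

theorem coeff_extSeries_of_lt (x : Fin (N + 1) → ℝ) {j : ℕ} (h : j < N + 1) :
    coeff j (extSeries x) = x ⟨j, h⟩ := by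
  rw [extSeries, coeff_mk, dif_pos h]

theorem abs_coeff_extSeries_le (x : Fin (N + 1) → ℝ) (j : ℕ) :
    |coeff j (extSeries x)| ≤ ‖x‖ := by
  by_cases h : j < N + 1
  · rw [coeff_extSeries_of_lt x h]; exact norm_le_pi_norm x _
  · rw [extSeries, coeff_mk, dif_neg h, abs_zero]; exact norm_nonneg _

theorem lag_eq (x : Fin (N + 1) → ℝ) (k : Fin (N + 1)) :
    lag x k = coeff (k : ℕ) (X ^ 2 * extSeries x) := by
  have hk := k.2
  rw [lag, coeff_X_pow_mul']
  split_ifs with h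
  · rw [coeff_extSeries_of_lt x (by omega)]
  · rfl

/-- The invariant manifold `β = -h_η α`. -/
def slowManifold (ν : ℝ) (N : ℕ) : Set (Phase N) :=
  {p | ∀ k : Fin (N + 1), p.2.1 k = -coeff (k : ℕ) (slowSeries ν p.2.2 * extSeries p.1)}

/-- The deviation `β + h_η α` from the invariant manifold. -/
def deviation (ν : ℝ) (p : Phase N) : ℝ⟦X⟧ :=
  extSeries p.2.1 + slowSeries ν p.2.2 * extSeries p.1

theorem coeff_deviation (ν : ℝ) (p : Phase N) (k : Fin (N + 1)) :
    coeff (k : ℕ) (deviation ν p) =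
      p.2.1 k + coeff (k : ℕ) (slowSeries ν p.2.2 * extSeries p.1) := by
  rw [deviation, map_add, coeff_extSeries]

theorem mem_slowManifold_iff (ν : ℝ) (p : Phase N) :
    p ∈ slowManifold ν N ↔ ∀ k ≤ N, coeff k (deviation ν p) = 0 := by
  constructor
  · intro h k hk
    rw [coeff_deviation ν p ⟨k, by omega⟩, h ⟨k, by omega⟩]
    simp
  · intro h k
    have := h k (by omega)
    rw [coeff_deviation] at this
    linarith

/-- The Euler operator `X d/dX`. -/
def euler (F : ℝ⟦X⟧) : ℝ⟦X⟧ := mk fun k => k * coeff k F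

theorem euler_mul (F G : ℝ⟦X⟧) : euler (F * G) = euler F * G + F * euler G := by
  ext k
  simp only [euler, coeff_mk, coeff_mul, map_add, Finset.mul_sum, ← Finset.sum_add_distrib]
  refine Finset.sum_congr rfl fun x hx => ?_
  rw [← Finset.HasAntidiagonal.mem_antidiagonal.1 hx]
  push_cast; ring

theorem euler_add (F G : ℝ⟦X⟧) : euler (F + G) = euler F + euler G := by
  ext k; simp [euler, mul_add]

variable {ν : ℝ} {γ : ℝ → Phase N} {s : Set ℝ} {t : ℝ}

theorem hasDerivWithinAt_components
    (h : HasDerivWithinAt γ (fastField ν N (γ t)) s t) :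
    (∀ k, HasDerivWithinAt (fun u => (γ u).1 k) ((fastField ν N (γ t)).1 k) s t) ∧
    (∀ k, HasDerivWithinAt (fun u => (γ u).2.1 k) ((fastField ν N (γ t)).2.1 k) s t) ∧
    HasDerivWithinAt (fun u => (γ u).2.2) (-(γ t).2.2 ^ 2) s t := by
  have h2 := (ContinuousLinearMap.snd ℝ (Fin (N + 1) → ℝ)
    ((Fin (N + 1) → ℝ) × ℝ)).hasFDerivAt.comp_hasDerivWithinAt t h
  exact ⟨hasDerivWithinAt_pi.1 ((ContinuousLinearMap.fst ℝ (Fin (N + 1) → ℝ)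
      ((Fin (N + 1) → ℝ) × ℝ)).hasFDerivAt.comp_hasDerivWithinAt t h),
    hasDerivWithinAt_pi.1 ((ContinuousLinearMap.fst ℝ
      (Fin (N + 1) → ℝ) ℝ).hasFDerivAt.comp_hasDerivWithinAt t h2),
    (ContinuousLinearMap.snd ℝ (Fin (N + 1) → ℝ) ℝ).hasFDerivAt.comp_hasDerivWithinAt t h2⟩

theorem deviation_deriv (hν : ν ≠ 0) (h : HasDerivWithinAt γ (fastField ν N (γ t)) s t) :
    CoeffDeriv N (fun u => deviation ν (γ u))
      (-(C ((γ t).2.2 / 2) * euler (deviation ν (γ t))) - C ν * deviation ν (γ t)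
        - C ((γ t).2.2) * (X ^ 2 * ((C (1 / ν) + slowSeries ν (γ t).2.2) * deviation ν (γ t))))
      s t := by
  obtain ⟨h1, h2, h3⟩ := hasDerivWithinAt_components h
  set η := (γ t).2.2 with hη
  set A := extSeries (γ t).1 with hA
  set B := extSeries (γ t).2.1 with hB
  set H := slowSeries ν η with hH
  have dA : CoeffDeriv N (fun u => extSeries (γ u).1)
      (-(C η * (C (1 / 2) * euler A + X ^ 2 * (C (1 / ν) * A + B)))) s t := fun k hk => by
    have := h1 ⟨k, by omega⟩
    simp only [fastField, lag_eq] at this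
    simp only [coeff_extSeries_of_lt _ (show k < N + 1 by omega)]
    convert this using 1
    have e : coeff k A = (γ t).1 ⟨k, by omega⟩ := coeff_extSeries_of_lt _ _
    rw [mul_add (X ^ 2), mul_left_comm (X ^ 2)]
    simp only [map_neg, map_add, coeff_C_mul, euler, coeff_mk, ← hη, ← hA, ← hB, e]
    ring
  have dB : CoeffDeriv N (fun u => extSeries (γ u).2.1)
      (-(C ν * B + A) - C η * (C (1 / 2) * euler B + X ^ 2 * (C (1 / ν) * B))) s t := fun k hk => by
    have := h2 ⟨k, by omega⟩
    simp only [fastField, lag_eq] at this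
    simp only [coeff_extSeries_of_lt _ (show k < N + 1 by omega)]
    convert this using 1
    have e : coeff k A = (γ t).1 ⟨k, by omega⟩ := coeff_extSeries_of_lt _ _
    have e' : coeff k B = (γ t).2.1 ⟨k, by omega⟩ := coeff_extSeries_of_lt _ _
    rw [mul_left_comm (X ^ 2)]
    simp only [map_neg, map_sub, map_add, coeff_C_mul, euler, coeff_mk, ← hη, ← hB, e, e']
    ring
  have dH : CoeffDeriv N (fun u => slowSeries ν (γ u).2.2) (-(C η * (C (1 / 2) * euler H))) s t :=
    fun k _ => by
    simp only [fun u => coeff_slowSeries ν (γ u).2.2 k]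
    have e : coeff k (-(C η * (C (1 / 2) * euler H))) =
        coeff k (slowSeries ν 1) * (((k / 2 : ℕ) : ℝ) * η ^ (k / 2 - 1) * (-η ^ 2)) := by
      simp only [map_neg, coeff_C_mul, euler, coeff_mk, hH, coeff_slowSeries ν η k]
      by_cases hk : 2 ∣ k
      · obtain ⟨j, rfl⟩ := hk
        rcases j with _ | j
        · simp
        · rw [Nat.mul_div_cancel_left _ two_pos, Nat.add_sub_cancel]
          push_cast; ring
      · rw [coeff_slowSeries_odd ν hk]; ring
    rw [e]
    exact (h3.pow (k / 2)).const_mul _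
  refine (dB.add (dH.mul dA)).congr_deriv ?_
  have e2 : C ν * H + C η * X ^ 2 * H ^ 2 = 1 := slowSeries_eq hν η
  have e3 : (C (η / 2) : ℝ⟦X⟧) = C η * C (1 / 2) := by rw [← map_mul]; congr 1; ring
  change _ = -(C (η / 2) * euler (B + H * A)) - C ν * (B + H * A)
    - C η * (X ^ 2 * ((C (1 / ν) + H) * (B + H * A)))
  change _ + (_ * A + H * _) = _
  rw [euler_add, euler_mul, e3]
  linear_combination A * e2

theorem slowManifold_invariant (hν : ν ≠ 0) {T : ℝ}
    (h : ∀ t ∈ Icc 0 T, HasDerivWithinAt γ (fastField ν N (γ t)) (Icc 0 T) t)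
    (h0 : γ 0 ∈ slowManifold ν N) : ∀ t ∈ Icc 0 T, γ t ∈ slowManifold ν N := by
  suffices H : ∀ k ≤ N, ∀ t ∈ Icc 0 T, coeff k (deviation ν (γ t)) = 0 from fun t ht =>
    (mem_slowManifold_iff ν _).2 fun k hk => H k hk t ht
  have hη : ContinuousOn (fun t => (γ t).2.2) (Icc 0 T) := fun t ht =>
    (hasDerivWithinAt_components (h t ht)).2.2.continuousWithinAt
  intro k
  induction k using Nat.strong_induction_on with
  | _ k ih =>
    intro hk
    have hd : ∀ t ∈ Icc 0 T, HasDerivWithinAt (fun u => coeff k (deviation ν (γ u)))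
        (-((γ t).2.2 / 2 * k + ν) * coeff k (deviation ν (γ t))) (Icc 0 T) t := fun t ht => by
      convert deviation_deriv hν (h t ht) k hk using 1
      have : coeff k (X ^ 2 * ((C (1 / ν) + slowSeries ν (γ t).2.2) * deviation ν (γ t))) = 0 := by
        rw [coeff_X_pow_mul']
        split_ifs with h2
        · rw [coeff_mul]
          refine Finset.sum_eq_zero fun x hx => ?_
          have hx := Finset.HasAntidiagonal.mem_antidiagonal.1 hx
          rw [ih x.2 (by omega) (by omega) t ht, mul_zero]
        · rfl
      simp only [map_sub, map_neg, coeff_C_mul, this, euler, coeff_mk]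
      ring
    obtain ⟨K, hK⟩ := isCompact_Icc.exists_bound_of_continuousOn
      (f := fun t => -((γ t).2.2 / 2 * k + ν)) (s := Icc 0 T) (by fun_prop)
    refine eq_zero_of_abs_deriv_le_mul_abs_self_of_eq_zero_right (K := K)
      (fun t ht => (hd t ht).continuousWithinAt)
      (fun t ht => ((hd t (Ico_subset_Icc_self ht)).mono_of_mem_nhdsWithin
        (Icc_mem_nhdsGE_of_mem ht)))
      ((mem_slowManifold_iff ν _).1 h0 k hk) fun t ht => ?_
    rw [norm_mul]
    exact mul_le_mul_of_nonneg_right (hK t (Ico_subset_Icc_self ht)) (norm_nonneg _)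

/-! ### Attraction -/

/-- A bound for a function from a bound for its derivative on the half-line. -/
theorem norm_le_of_norm_deriv_le {E : Type*} [NormedAddCommGroup E] [NormedSpace ℝ E]
    {f f' : ℝ → E} {B B' : ℝ → ℝ} (hf : ∀ t, 0 ≤ t → HasDerivWithinAt f (f' t) (Ici 0) t)
    (hB : ∀ t, 0 ≤ t → HasDerivWithinAt B (B' t) (Ici 0) t)
    (h : ∀ t, 0 ≤ t → ‖f' t‖ ≤ B' t) (t : ℝ) (ht : 0 ≤ t) : ‖f t‖ ≤ ‖f 0‖ + (B t - B 0) := by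
  have hm : ∀ x ∈ Ico 0 t, Ici (0 : ℝ) ∈ 𝓝[≥] x := fun x hx =>
    mem_of_superset self_mem_nhdsWithin (Ici_subset_Ici.2 hx.1)
  refine image_norm_le_of_norm_deriv_right_le_deriv_boundary' (a := 0) (b := t) (f := f) (f' := f')
    (B := fun t => ‖f 0‖ + (B t - B 0)) (B' := B')
    (fun x hx => ((hf x hx.1).continuousWithinAt).mono Icc_subset_Ici_self)
    (fun x hx => (hf x hx.1).mono (Ici_subset_Ici.2 hx.1)) (by simp)
    (fun x hx => ?_) (fun x hx => ?_) (fun x hx => h x hx.1) (right_mem_Icc.2 ht)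
  · exact continuousWithinAt_const.add ((((hB x hx.1).continuousWithinAt).mono
      Icc_subset_Ici_self).sub continuousWithinAt_const)
  · exact (((hB x hx.1).sub_const _).const_add _).mono (Ici_subset_Ici.2 hx.1)

theorem eta_eq {η : ℝ → ℝ} (h : ∀ t, 0 ≤ t → HasDerivWithinAt η (-η t ^ 2) (Ici 0) t) :
    ∀ t, 0 ≤ t → η t * (1 + η 0 * t) = η 0 := by
  intro T hT
  have hd : ∀ t, 0 ≤ t → HasDerivWithinAt (fun t => η t * (1 + η 0 * t) - η 0)
      (-η t * (η t * (1 + η 0 * t) - η 0)) (Ici 0) t := fun t ht => by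
    have h1 : HasDerivWithinAt (fun t => 1 + η 0 * t) (η 0 * 1) (Ici 0) t :=
      ((hasDerivWithinAt_id t _).const_mul _).const_add _
    refine (((h t ht).fun_mul h1).sub_const (η 0)).congr_deriv ?_
    ring
  have hc : ContinuousOn η (Icc 0 T) := fun t ht =>
    (h t ht.1).continuousWithinAt.mono Icc_subset_Ici_self
  obtain ⟨K, hK⟩ := isCompact_Icc.exists_bound_of_continuousOn (f := fun t => -η t) hc.neg
  have := eq_zero_of_abs_deriv_le_mul_abs_self_of_eq_zero_right (K := K) (a := 0) (b := T)
    (fun t ht => (hd t ht.1).continuousWithinAt.mono Icc_subset_Ici_self)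
    (fun t ht => (hd t ht.1).mono (Ici_subset_Ici.2 ht.1)) (by simp)
    (fun t ht => by
      rw [norm_mul]
      exact mul_le_mul_of_nonneg_right (hK t (Ico_subset_Icc_self ht)) (norm_nonneg _))
    T (right_mem_Icc.2 hT)
  linarith

theorem deviation_decay (hν : 0 < ν)
    (h : ∀ t : ℝ, 0 ≤ t → HasDerivWithinAt γ (fastField ν N (γ t)) (Ici 0) t)
    (h0 : 0 ≤ (γ 0).2.2) (k : ℕ) (hk : k ≤ N) : ∃ K : ℝ, ∀ t : ℝ, 0 ≤ t →
      |coeff k (deviation ν (γ t))| ≤ K * Real.exp (-ν * t) := by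
  set η₀ := (γ 0).2.2 with hη₀
  have hη : ∀ t, 0 ≤ t → (γ t).2.2 = η₀ / (1 + η₀ * t) := fun t ht => by
    rw [eq_div_iff (by positivity)]
    exact eta_eq (η := fun t => (γ t).2.2)
      (fun t ht => (hasDerivWithinAt_components (h t ht)).2.2) t ht
  induction k using Nat.strong_induction_on with
  | _ k ih =>
    choose! K hK using ih
    -- the inhomogeneity
    set R : ℝ → ℝ := fun t => coeff k
      (X ^ 2 * ((C (1 / ν) + slowSeries ν (γ t).2.2) * deviation ν (γ t))) with hR
    have hRb : ∃ M, 0 ≤ M ∧ ∀ t, 0 ≤ t → |R t| ≤ M * Real.exp (-ν * t) := by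
      by_cases h2 : 2 ≤ k
      swap
      · exact ⟨0, le_rfl, fun t ht => by simp [hR, coeff_X_pow_mul', h2]⟩
      refine ⟨∑ x ∈ Finset.HasAntidiagonal.antidiagonal (k - 2),
        (1 / ν + |coeff x.1 (slowSeries ν 1)| * (1 + η₀) ^ (x.1 / 2)) * |K x.2|,
        Finset.sum_nonneg fun x _ => by positivity, fun t ht => ?_⟩
      simp only [hR, coeff_X_pow_mul', if_pos h2]
      refine (abs_coeff_mul_le _ _ _).trans ?_
      rw [Finset.sum_mul]
      refine Finset.sum_le_sum fun x hx => ?_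
      have hx := Finset.HasAntidiagonal.mem_antidiagonal.1 hx
      rw [mul_assoc]
      refine mul_le_mul ?_ ((hK x.2 (by omega) (by omega) t ht).trans
        (mul_le_mul_of_nonneg_right (le_abs_self _) (Real.exp_pos _).le)) (abs_nonneg _)
        (by positivity)
      rw [map_add]
      refine (abs_add_le _ _).trans (add_le_add ?_ ?_)
      · rw [coeff_C]; split_ifs
        · rw [abs_of_pos (by positivity)]
        · rw [abs_zero]; positivity
      · rw [coeff_slowSeries, abs_mul, abs_pow]
        refine mul_le_mul_of_nonneg_left (pow_le_pow_left₀ (abs_nonneg _) ?_ _) (abs_nonneg _)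
        rw [hη t ht, abs_of_nonneg (by positivity)]
        exact (div_le_self h0 (by nlinarith)).trans (by linarith)
    obtain ⟨M, hM0, hM⟩ := hRb
    set L : ℝ → ℝ := fun t => 1 + η₀ * t with hL
    have hLd : ∀ t, HasDerivWithinAt L η₀ (Ici 0) t := fun t => by
      simpa only [mul_one, id] using ((hasDerivWithinAt_id t (Ici 0)).const_mul η₀).const_add 1
    have hL1 : ∀ t, 0 ≤ t → 1 ≤ L t := fun t ht => by
      have : 0 ≤ η₀ * t := by positivity
      simp only [hL]; linarith
    have hLp : ∀ t, 0 ≤ t → HasDerivWithinAt (fun t => L t ^ ((k : ℝ) / 2))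
        (η₀ * ((k : ℝ) / 2) * L t ^ ((k : ℝ) / 2 - 1)) (Ici 0) t := fun t ht =>
      (hLd t).rpow_const (Or.inl (by linarith [hL1 t ht]))
    have hEd : ∀ t : ℝ, HasDerivWithinAt (fun t => Real.exp (ν * t)) (Real.exp (ν * t) * (ν * 1))
        (Ici 0) t := fun t => ((hasDerivWithinAt_id t _).const_mul ν).exp
    have hfd : ∀ t, 0 ≤ t → HasDerivWithinAt
        (fun t => L t ^ ((k : ℝ) / 2) * (Real.exp (ν * t) * coeff k (deviation ν (γ t))))
        (-(η₀ * L t ^ ((k : ℝ) / 2 - 1) * (Real.exp (ν * t) * R t))) (Ici 0) t := fun t ht => by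
      have hd := deviation_deriv hν.ne' (h t ht) k hk
      refine ((hLp t ht).fun_mul ((hEd t).fun_mul hd)).congr_deriv ?_
      simp only [map_sub, map_neg, coeff_C_mul, euler, coeff_mk]
      rw [hη t ht]
      have e1 : L t ^ ((k : ℝ) / 2) = L t ^ ((k : ℝ) / 2 - 1) * L t := by
        rw [Real.rpow_sub_one (by linarith [hL1 t ht])]
        have := hL1 t ht
        field_simp
      have e2 : η₀ / (1 + η₀ * t) * L t = η₀ := by
        have := hL1 t ht
        simp only [hL] at *
        field_simp
      rw [e1]
      simp only [hR, hη t ht]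
      set Z := coeff k (X ^ 2 * ((C (1 / ν) + slowSeries ν (η₀ / (1 + η₀ * t))) * deviation ν (γ t)))
      set Y := L t ^ ((k : ℝ) / 2 - 1)
      set e := Real.exp (ν * t)
      set x := coeff k (deviation ν (γ t))
      linear_combination (-(Y * e * (k * x / 2 + Z))) * e2
    rcases Nat.eq_zero_or_pos k with hk0 | hk0
    · have := norm_le_of_norm_deriv_le hfd (B := fun _ => 0) (B' := fun _ => 0)
        (fun t _ => hasDerivWithinAt_const _ _ _) (fun t ht => by simp [hR, hk0, coeff_X_pow_mul'])
      refine ⟨|coeff k (deviation ν (γ 0))|, fun t ht => ?_⟩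
      have h1 := this t ht
      simp [hk0] at h1
      rw [neg_mul, Real.exp_neg, hk0]
      simp
      rw [← div_eq_mul_inv, le_div_iff₀ (Real.exp_pos _)]
      linarith
    · have hk' : (0 : ℝ) < k := by exact_mod_cast hk0
      have := norm_le_of_norm_deriv_le hfd
        (B := fun t => M * (2 / k) * L t ^ ((k : ℝ) / 2))
        (fun t ht => (hLp t ht).const_mul _) (fun t ht => by
          rw [norm_neg, norm_mul, norm_mul, Real.norm_eq_abs, Real.norm_eq_abs, Real.norm_eq_abs,
            abs_of_nonneg h0, abs_of_nonneg (Real.rpow_nonneg (by linarith [hL1 t ht]) _), abs_mul,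
            abs_of_pos (Real.exp_pos _)]
          have e1 : Real.exp (ν * t) * |R t| ≤ M := by
            have := hM t ht
            rw [neg_mul, Real.exp_neg, ← div_eq_mul_inv, le_div_iff₀ (Real.exp_pos _)] at this
            linarith
          have e2 : M * (2 / k) * (η₀ * ((k : ℝ) / 2) * L t ^ ((k : ℝ) / 2 - 1)) =
              η₀ * L t ^ ((k : ℝ) / 2 - 1) * M := by field_simp
          rw [e2]
          exact mul_le_mul_of_nonneg_left e1
            (mul_nonneg h0 (Real.rpow_nonneg (by linarith [hL1 t ht]) _)))
      refine ⟨|coeff k (deviation ν (γ 0))| + M * (2 / k), fun t ht => ?_⟩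
      have h1 := this t ht
      set x := coeff k (deviation ν (γ t))
      set x0 := coeff k (deviation ν (γ 0))
      have hp : 1 ≤ L t ^ ((k : ℝ) / 2) := Real.one_le_rpow (hL1 t ht) (by positivity)
      set P := L t ^ ((k : ℝ) / 2)
      simp only [hL, mul_zero, add_zero, Real.one_rpow, one_mul, Real.exp_zero, mul_one,
        Real.norm_eq_abs, abs_mul, abs_of_pos (Real.exp_pos _), abs_of_pos (by linarith : 0 < P)]
        at h1
      rw [neg_mul, Real.exp_neg, ← div_eq_mul_inv, le_div_iff₀ (Real.exp_pos _)]
      have hq : 0 ≤ M * (2 / k) := by positivity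
      have h2 : P * (Real.exp (ν * t) * |x|) ≤ P * (|x0| + M * (2 / k)) := by
        nlinarith [abs_nonneg x0]
      have := le_of_mul_le_mul_left h2 (by linarith)
      linarith

theorem slowManifold_attracting (hν : 0 < ν) : IsAttracting ν N (slowManifold ν N) := by
  intro γ h h0
  choose! K hK using fun k hk => deviation_decay hν h h0 k hk
  refine ⟨∑ k ∈ Finset.range (N + 1), |K k|, fun t ht => ?_⟩
  set q : Phase N := ((γ t).1, fun k : Fin (N + 1) =>
    -coeff (k : ℕ) (slowSeries ν (γ t).2.2 * extSeries (γ t).1), (γ t).2.2) with hq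
  have hqS : q ∈ slowManifold ν N := fun k => rfl
  refine (Metric.infDist_le_dist_of_mem hqS).trans ?_
  have hn : 0 ≤ (∑ k ∈ Finset.range (N + 1), |K k|) * Real.exp (-ν * t) :=
    mul_nonneg (Finset.sum_nonneg fun _ _ => abs_nonneg _) (Real.exp_pos _).le
  rw [Prod.dist_eq, Prod.dist_eq]
  refine max_le (by simpa [hq] using hn) (max_le ?_ (by simpa [hq] using hn))
  refine (dist_pi_le_iff hn).2 fun k => ?_
  have h1 := hK k (by omega) t ht
  rw [coeff_deviation] at h1
  rw [Real.dist_eq, hq]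
  simp only [sub_neg_eq_add]
  refine h1.trans (mul_le_mul_of_nonneg_right ((le_abs_self _).trans ?_) (Real.exp_pos _).le)
  exact Finset.single_le_sum (f := fun k => |K k|) (fun _ _ => abs_nonneg _)
    (Finset.mem_range.2 k.2)

end Manifold
end
end TaylorDispersion

namespace TaylorDispersion
noncomputable section
section Manifold
open PowerSeries

variable {N : ℕ} {ν : ℝ}

/-- The linearization of the system at the origin. -/
def linField (ν : ℝ) (N : ℕ) : Phase N →L[ℝ] Phase N :=
  (0 : Phase N →L[ℝ] (Fin (N + 1) → ℝ)).prod
    ((-(ν • ContinuousLinearMap.fst ℝ (Fin (N + 1) → ℝ) ℝ ∘L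
        ContinuousLinearMap.snd ℝ (Fin (N + 1) → ℝ) ((Fin (N + 1) → ℝ) × ℝ) +
        ContinuousLinearMap.fst ℝ (Fin (N + 1) → ℝ) ((Fin (N + 1) → ℝ) × ℝ))).prod
      (0 : Phase N →L[ℝ] ℝ))

theorem linField_apply (p : Phase N) : linField ν N p = (0, -(ν • p.2.1 + p.1), 0) := rfl

theorem hasFDerivAt_mul_zero {E : Type*} [NormedAddCommGroup E] [NormedSpace ℝ E] {f g : E → ℝ}
    (hf : DifferentiableAt ℝ f 0) (hg : DifferentiableAt ℝ g 0) (hf0 : f 0 = 0) (hg0 : g 0 = 0) :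
    HasFDerivAt (fun x => f x * g x) (0 : E →L[ℝ] ℝ) 0 := by
  have := hf.hasFDerivAt.fun_mul hg.hasFDerivAt
  simpa [hf0, hg0] using this

theorem differentiable_lag (k : Fin (N + 1)) : Differentiable ℝ (fun x : Fin (N + 1) → ℝ => lag x k) := by
  unfold lag
  split_ifs <;> fun_prop

theorem lag_zero (k : Fin (N + 1)) : lag (0 : Fin (N + 1) → ℝ) k = 0 := by
  simp [lag]

theorem hasFDerivAt_fastField : HasFDerivAt (fastField ν N) (linField ν N) 0 := by
  have hl1 : ∀ k, DifferentiableAt ℝ (fun p : Phase N => lag p.1 k) 0 := fun k =>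
    ((differentiable_lag k).comp differentiable_fst).differentiableAt
  have hl2 : ∀ k, DifferentiableAt ℝ (fun p : Phase N => lag p.2.1 k) 0 := fun k =>
    ((differentiable_lag k).comp (differentiable_fst.comp differentiable_snd)).differentiableAt
  refine HasFDerivAt.prodMk (hasFDerivAt_pi'.2 fun k => ?_)
    (HasFDerivAt.prodMk (hasFDerivAt_pi'.2 fun k => ?_) ?_)
  · rw [ContinuousLinearMap.comp_zero]
    refine hasFDerivAt_mul_zero (by fun_prop) ?_ (by simp) (by simp [lag_zero])
    exact (DifferentiableAt.add (by fun_prop) ((hl1 k).const_mul _)).add (hl2 k)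
  · have h1 := ((ContinuousLinearMap.proj (R := ℝ) (φ := fun _ : Fin (N + 1) => ℝ) k).comp
      (-(ν • ContinuousLinearMap.fst ℝ (Fin (N + 1) → ℝ) ℝ ∘L
        ContinuousLinearMap.snd ℝ (Fin (N + 1) → ℝ) ((Fin (N + 1) → ℝ) × ℝ) +
        ContinuousLinearMap.fst ℝ (Fin (N + 1) → ℝ) ((Fin (N + 1) → ℝ) × ℝ)))).hasFDerivAt (x := 0)
    have h2 := hasFDerivAt_mul_zero (f := fun p : Phase N => p.2.2)
      (g := fun p : Phase N => (k : ℝ) / 2 * p.2.1 k + 1 / ν * lag p.2.1 k) (by fun_prop)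
      (DifferentiableAt.add (by fun_prop) ((hl2 k).const_mul _)) (by simp) (by simp [lag_zero])
    have h3 := h1.fun_sub h2
    rw [sub_zero] at h3
    exact h3
  · have := (hasFDerivAt_mul_zero (f := fun p : Phase N => p.2.2) (g := fun p : Phase N => p.2.2)
      (by fun_prop) (by fun_prop) (by simp) (by simp)).fun_neg
    simpa [pow_two] using this

/-- The parametrization of the center subspace. -/
def centerMap (ν : ℝ) (N : ℕ) : ((Fin (N + 1) → ℝ) × ℝ) →ₗ[ℝ] Phase N where
  toFun q := (q.1, -(1 / ν) • q.1, q.2)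
  map_add' x y := by ext <;> simp [mul_add]
  map_smul' c x := by ext <;> simp [mul_left_comm]

/-- The parametrization of the stable subspace. -/
def stableMap (N : ℕ) : (Fin (N + 1) → ℝ) →ₗ[ℝ] Phase N where
  toFun b := (0, b, 0)
  map_add' x y := by ext <;> simp
  map_smul' c x := by ext <;> simp

theorem isCompl_center_stable :
    IsCompl (LinearMap.range (centerMap ν N)) (LinearMap.range (stableMap N)) := by
  constructor
  · rw [Submodule.disjoint_def]
    rintro _ ⟨q, rfl⟩ ⟨b, hb⟩
    have h1 : (0 : Fin (N + 1) → ℝ) = q.1 := congrArg Prod.fst hb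
    have h2 : (0 : ℝ) = q.2 := congrArg (fun p => p.2.2) hb
    have : q = 0 := Prod.ext h1.symm h2.symm
    rw [this, map_zero]
  · rw [codisjoint_iff, eq_top_iff]
    rintro p -
    rw [Submodule.mem_sup]
    refine ⟨_, ⟨(p.1, p.2.2), rfl⟩, _, ⟨p.2.1 + (1 / ν) • p.1, rfl⟩, ?_⟩
    simp only [centerMap, stableMap, LinearMap.coe_mk, AddHom.coe_mk]
    ext <;> simp

/-- The nonlinear part of the graph. -/
def graphPart (ν : ℝ) (N : ℕ) (p : Phase N) (k : Fin (N + 1)) : ℝ :=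
  1 / ν * p.1 k - coeff (k : ℕ) (slowSeries ν p.2.2 * extSeries p.1)

theorem graphPart_eq (p : Phase N) (k : Fin (N + 1)) : graphPart ν N p k =
    -∑ x ∈ (Finset.HasAntidiagonal.antidiagonal (k : ℕ)).erase (0, (k : ℕ)),
      (coeff x.1 (slowSeries ν 1) * p.2.2 ^ (x.1 / 2)) * coeff x.2 (extSeries p.1) := by
  have h0 : ((0 : ℕ), (k : ℕ)) ∈ Finset.HasAntidiagonal.antidiagonal (k : ℕ) :=
    Finset.HasAntidiagonal.mem_antidiagonal.2 (zero_add _)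
  rw [graphPart, coeff_mul, ← Finset.add_sum_erase _ _ h0]
  simp only [coeff_zero_slowSeries, coeff_extSeries, fun i => coeff_slowSeries ν p.2.2 i]
  ring

theorem contDiff_coeff_extSeries (j : ℕ) :
    ContDiff ℝ ∞ (fun p : Phase N => coeff j (extSeries p.1)) := by
  simp only [extSeries, coeff_mk]
  split_ifs <;> fun_prop

theorem contDiff_graphPart : ContDiff ℝ ∞ (graphPart ν N) := by
  rw [contDiff_pi]
  intro k
  simp only [fun p => graphPart_eq (ν := ν) p k]
  refine (ContDiff.sum fun x _ => ?_).neg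
  exact ContDiff.mul (by fun_prop) (contDiff_coeff_extSeries _)

theorem hasFDerivAt_graphPart :
    HasFDerivAt (graphPart ν N) (0 : Phase N →L[ℝ] (Fin (N + 1) → ℝ)) 0 := by
  rw [hasFDerivAt_pi']
  intro k
  simp only [fun p => graphPart_eq (ν := ν) p k]
  refine (HasFDerivAt.fun_neg (HasFDerivAt.fun_sum (A' := fun _ => (0 : Phase N →L[ℝ] ℝ))
    fun x hx => ?_)).congr_fderiv (by simp)
  have hx' := Finset.HasAntidiagonal.mem_antidiagonal.1 (Finset.mem_of_mem_erase hx)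
  have h0 : extSeries (0 : Fin (N + 1) → ℝ) = 0 := by ext j; simp [extSeries]
  by_cases h2 : 2 ∣ x.1
  · refine hasFDerivAt_mul_zero (by fun_prop)
      ((contDiff_coeff_extSeries x.2).differentiable (by simp)).differentiableAt ?_ (by simp [h0])
    have : x.1 ≠ 0 := fun h => (Finset.mem_erase.1 hx).1 (Prod.ext h (by simp; omega))
    have : x.1 / 2 ≠ 0 := by omega
    simp [this]
  · simp only [coeff_slowSeries_odd ν h2, zero_mul]
    exact hasFDerivAt_const _ _

theorem minpoly_root {V : Type*} [AddCommGroup V] [Module ℝ V] {f : V →ₗ[ℝ] V} {c : ℝ}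
    (hf : f = c • LinearMap.id) {z : ℂ} (hz : Polynomial.aeval z (minpoly ℝ f) = 0) : z = c := by
  have h1 : minpoly ℝ f ∣ Polynomial.X - Polynomial.C c := minpoly.dvd ℝ f (by
    rw [map_sub, Polynomial.aeval_X, Polynomial.aeval_C, hf, Algebra.algebraMap_eq_smul_one]
    exact sub_self _)
  obtain ⟨q, hq⟩ := h1
  have := congrArg (Polynomial.aeval z) hq
  rw [map_mul, hz, zero_mul, map_sub, Polynomial.aeval_X, Polynomial.aeval_C, sub_eq_zero] at this
  exact this

theorem slowManifold_isCenterManifold (hν : 0 < ν) :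
    IsCenterManifold (fastField ν N) (slowManifold ν N) (N + 2) := by
  refine ⟨?_, ⟨linField ν N, LinearMap.range (centerMap ν N), LinearMap.range (stableMap N),
    ?_, ?_, hasFDerivAt_fastField, isCompl_center_stable, ?_, ?_, ?_, ?_⟩, ?_⟩
  · ext k <;> simp [fastField, lag_zero]
  · rintro _ ⟨q, rfl⟩
    convert Submodule.zero_mem _
    change linField ν N (centerMap ν N q) = 0
    rw [linField_apply]
    ext <;> simp [centerMap, hν.ne']
  · rintro _ ⟨b, rfl⟩
    refine ⟨-(ν • b), ?_⟩
    change _ = linField ν N (stableMap N b)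
    rw [linField_apply]
    ext <;> simp [stableMap]
  · rw [LinearMap.finrank_range_of_inj]
    · simp
    · intro x y h
      exact Prod.ext (congrArg (fun p : Phase N => p.1) h) (congrArg (fun p : Phase N => p.2.2) h)
  · intro z hz
    have := minpoly_root (c := 0) (by
      ext ⟨_, q, rfl⟩ : 1
      rw [zero_smul]
      refine Subtype.ext ?_
      change linField ν N (centerMap ν N q) = 0
      rw [linField_apply]
      ext <;> simp [centerMap, hν.ne']) hz
    rw [this]; simp
  · intro z hz
    have := minpoly_root (c := -ν) (by
      ext ⟨_, b, rfl⟩ : 1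
      refine Subtype.ext ?_
      change linField ν N (stableMap N b) = -ν • stableMap N b
      rw [linField_apply]
      ext <;> simp [stableMap]) hz
    rw [this]; simpa using hν
  · set ι : (Fin (N + 1) → ℝ) →L[ℝ] LinearMap.range (stableMap N) :=
      LinearMap.toContinuousLinearMap (stableMap N).rangeRestrict with hι
    refine ⟨fun x => ι (graphPart ν N x), ?_, ?_, ?_, ?_⟩
    · exact ι.contDiff.comp (contDiff_graphPart.comp
        (LinearMap.range (centerMap ν N)).subtypeL.contDiff)
    · have : graphPart ν N 0 = 0 := by
        funext k
        have h0 : extSeries (0 : Fin (N + 1) → ℝ) = 0 := by ext j; simp [extSeries]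
        simp [graphPart, h0]
      simp [this]
    · have h1 : HasFDerivAt (graphPart ν N) (0 : Phase N →L[ℝ] (Fin (N + 1) → ℝ))
          ((LinearMap.range (centerMap ν N)).subtypeL 0) := by
        simpa using hasFDerivAt_graphPart
      have h2 := h1.comp (0 : LinearMap.range (centerMap ν N))
        ((LinearMap.range (centerMap ν N)).subtypeL.hasFDerivAt)
      have h3 := ι.hasFDerivAt.comp (0 : LinearMap.range (centerMap ν N)) h2
      rw [ContinuousLinearMap.zero_comp, ContinuousLinearMap.comp_zero] at h3
      exact h3
    · ext p
      constructor
      · intro hp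
        refine ⟨⟨centerMap ν N (p.1, p.2.2), _, rfl⟩, ?_⟩
        change centerMap ν N (p.1, p.2.2) + stableMap N (graphPart ν N (centerMap ν N (p.1, p.2.2)))
          = p
        refine Prod.ext (by simp [centerMap, stableMap]) (Prod.ext ?_
          (by simp [centerMap, stableMap]))
        funext k
        rw [hp k]
        simp [centerMap, stableMap, graphPart]
        ring
      · rintro ⟨⟨_, q, rfl⟩, rfl⟩
        intro k
        change (centerMap ν N q + stableMap N (graphPart ν N (centerMap ν N q))).2.1 k = -coeff (k : ℕ)
          (slowSeries ν (centerMap ν N q + stableMap N (graphPart ν N (centerMap ν N q))).2.2 *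
          extSeries (centerMap ν N q + stableMap N (graphPart ν N (centerMap ν N q))).1)
        simp [centerMap, stableMap, graphPart]
        ring
  · intro T γ _ h h0
    exact slowManifold_invariant hν.ne' h h0

end Manifold
end
end TaylorDispersion

namespace TaylorDispersion
noncomputable section
section Coefficients
open PowerSeries

variable {N : ℕ} {ν : ℝ}

/-! ### Decay on the center manifold -/

theorem rate_eq (k : ℕ) : rate k = (k : ℝ) / 2 - ((k / 4 : ℕ) : ℝ) := by
  have h : (k : ℝ) = 4 * ((k / 4 : ℕ) : ℝ) + ((k % 4 : ℕ) : ℝ) := by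
    exact_mod_cast (Nat.div_add_mod k 4).symm
  rw [rate]; linarith

theorem liesOn_beta {α β : ℝ → Fin (N + 1) → ℝ} (h : LiesOn (slowManifold ν N) α β) {τ : ℝ}
    (hτ : 0 ≤ τ) (k : ℕ) (hk : k < N + 1) : β τ ⟨k, hk⟩ =
      -∑ x ∈ Finset.HasAntidiagonal.antidiagonal k, (coeff x.1 (slowSeries ν 1) *
        Real.exp (-τ) ^ (x.1 / 2)) * coeff x.2 (extSeries (α τ)) := by
  have := h τ hτ ⟨k, hk⟩
  simp only at this
  rw [this, coeff_mul]
  simp only [fun i => coeff_slowSeries ν (Real.exp (-τ)) i]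

/-- The combination that drives the slow coefficients. -/
theorem liesOn_drive {α β : ℝ → Fin (N + 1) → ℝ} (h : LiesOn (slowManifold ν N) α β) {τ : ℝ}
    (hτ : 0 ≤ τ) (k : Fin (N + 1)) (hk : 2 ≤ (k : ℕ)) : 1 / ν * lag (α τ) k + lag (β τ) k =
      -∑ x ∈ (Finset.HasAntidiagonal.antidiagonal ((k : ℕ) - 2)).erase (0, (k : ℕ) - 2),
        (coeff x.1 (slowSeries ν 1) * Real.exp (-τ) ^ (x.1 / 2)) * coeff x.2 (extSeries (α τ)) := by
  have h0 : ((0 : ℕ), (k : ℕ) - 2) ∈ Finset.HasAntidiagonal.antidiagonal ((k : ℕ) - 2) :=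
    Finset.HasAntidiagonal.mem_antidiagonal.2 (zero_add _)
  have hk' := k.2
  rw [lag, lag, dif_pos hk, dif_pos hk, liesOn_beta h hτ, ← Finset.add_sum_erase _ _ h0,
    coeff_extSeries_of_lt _ (by omega), coeff_zero_slowSeries]
  simp

theorem abs_beta_le {α β : ℝ → Fin (N + 1) → ℝ} (h : LiesOn (slowManifold ν N) α β) {τ : ℝ}
    (hτ : 0 ≤ τ) (k : ℕ) (hk : k < N + 1) : |β τ ⟨k, hk⟩| ≤
      ∑ x ∈ Finset.HasAntidiagonal.antidiagonal k, |coeff x.1 (slowSeries ν 1)| *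
        Real.exp (-τ) ^ (x.1 / 2) * |coeff x.2 (extSeries (α τ))| := by
  rw [liesOn_beta h hτ, abs_neg]
  refine (Finset.abs_sum_le_sum_abs _ _).trans_eq (Finset.sum_congr rfl fun x _ => ?_)
  rw [abs_mul, abs_mul, abs_of_pos (pow_pos (Real.exp_pos _) _)]

theorem alpha_decay (N k : ℕ) (hk : k < N + 1) : ∃ C : ℝ, 0 ≤ C ∧ ∀ ν : ℝ, 0 < ν → ν ≤ 1 →
    ∀ α β : ℝ → Fin (N + 1) → ℝ, SolvesODE ν α β → LiesOn (slowManifold ν N) α β →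
      ∀ τ : ℝ, 0 ≤ τ → |α τ ⟨k, hk⟩| ≤ C * ‖α 0‖ / ν ^ (k - 1) * Real.exp (-rate k * τ) := by
  induction k using Nat.strong_induction_on with
  | _ k ih =>
    choose! C hC0 hC using ih
    set M : ℝ := ∑ x ∈ Finset.HasAntidiagonal.antidiagonal (k - 2),
      (catalan (x.1 / 2) : ℝ) * |C x.2| with hM
    have hM0 : 0 ≤ M := Finset.sum_nonneg fun x _ => by positivity
    refine ⟨1 + M, by positivity, fun ν h0 h1 α β hode hlies τ hτ => ?_⟩
    have hE : ∀ (a : ℝ) (t : ℝ), HasDerivWithinAt (fun t => Real.exp (a * t))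
        (Real.exp (a * t) * (a * 1)) (Ici 0) t := fun a t =>
      ((hasDerivWithinAt_id t _).const_mul a).exp
    have hd : ∀ t, 0 ≤ t → HasDerivWithinAt (fun t => Real.exp ((k : ℝ) / 2 * t) * α t ⟨k, hk⟩)
        (-(Real.exp ((k : ℝ) / 2 * t) * (1 / ν * lag (α t) ⟨k, hk⟩ + lag (β t) ⟨k, hk⟩)))
        (Ici 0) t := fun t ht => by
      refine ((hE _ t).fun_mul (hode t ht ⟨k, hk⟩).1).congr_deriv ?_
      simp only
      ring
    set K : ℝ := M * ‖α 0‖ / ν ^ (k - 1) with hK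
    have hK0 : 0 ≤ K := by positivity
    have hb : ∀ t, 0 ≤ t →
        ‖-(Real.exp ((k : ℝ) / 2 * t) * (1 / ν * lag (α t) ⟨k, hk⟩ + lag (β t) ⟨k, hk⟩))‖ ≤
          K * (Real.exp (((k / 4 : ℕ) : ℝ) * t) * (((k / 4 : ℕ) : ℝ) * 1)) := fun t ht => by
      rw [norm_neg, norm_mul, Real.norm_eq_abs, Real.norm_eq_abs, abs_of_pos (Real.exp_pos _)]
      by_cases h2 : 2 ≤ k
      swap
      · rw [lag, lag, dif_neg h2, dif_neg h2]; simp; positivity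
      rw [liesOn_drive hlies ht ⟨k, hk⟩ h2, abs_neg]
      have hstep : ∀ x ∈ (Finset.HasAntidiagonal.antidiagonal (k - 2)).erase (0, k - 2),
          |(coeff x.1 (slowSeries ν 1) * Real.exp (-t) ^ (x.1 / 2)) *
            coeff x.2 (extSeries (α t))| ≤ (catalan (x.1 / 2) : ℝ) * |C x.2| *
            (‖α 0‖ / ν ^ (k - 1) * (Real.exp ((((k / 4 : ℕ) : ℝ) - k / 2) * t) *
              ((k / 4 : ℕ) : ℝ))) := fun x hx => by
        have hx' := Finset.HasAntidiagonal.mem_antidiagonal.1 (Finset.mem_of_mem_erase hx)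
        have hx0 : x.1 ≠ 0 := fun h => (Finset.mem_erase.1 hx).1 (Prod.ext h (by simp; omega))
        by_cases hd : 2 ∣ x.1
        swap
        · rw [coeff_slowSeries_odd ν hd, zero_mul, zero_mul, abs_zero]; positivity
        obtain ⟨i, hi⟩ := hd
        have hxk : x.2 < k := by omega
        have hxN : x.2 < N + 1 := by omega
        rw [abs_mul, abs_mul, abs_of_pos (pow_pos (Real.exp_pos (-t)) _),
          coeff_extSeries_of_lt _ hxN]
        have e1 := abs_coeff_slowSeries_le h0 x.1
        have e2 := hC x.2 hxk hxN ν h0 h1 α β hode hlies t ht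
        have e3 : Real.exp (-t) ^ (x.1 / 2) * Real.exp (-rate x.2 * t) ≤
            Real.exp ((((k / 4 : ℕ) : ℝ) - k / 2) * t) * ((k / 4 : ℕ) : ℝ) := by
          have q1 : (1 : ℝ) ≤ ((k / 4 : ℕ) : ℝ) := by exact_mod_cast (by omega : 1 ≤ k / 4)
          have q2 : ((x.2 / 4 : ℕ) : ℝ) + 1 ≤ ((k / 4 : ℕ) : ℝ) := by
            exact_mod_cast (by omega : x.2 / 4 + 1 ≤ k / 4)
          have q3 : (k : ℝ) = 2 * i + x.2 + 2 := by
            exact_mod_cast (by omega : k = 2 * i + x.2 + 2)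
          rw [← Real.exp_nat_mul, ← Real.exp_add, show x.1 / 2 = i by omega]
          refine (Real.exp_le_exp.2 ?_).trans (le_mul_of_one_le_right (Real.exp_pos _).le q1)
          rw [rate_eq]
          nlinarith
        have e4 : ν ^ (k - 1) ≤ ν ^ (x.1 + 1) * ν ^ (x.2 - 1) := by
          rw [← pow_add]
          exact pow_le_pow_of_le_one h0.le h1 (by omega)
        calc _ ≤ (catalan (x.1 / 2) / ν ^ (x.1 + 1)) * Real.exp (-t) ^ (x.1 / 2) *
              (C x.2 * ‖α 0‖ / ν ^ (x.2 - 1) * Real.exp (-rate x.2 * t)) := by gcongr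
          _ = (catalan (x.1 / 2) * C x.2 * ‖α 0‖) / (ν ^ (x.1 + 1) * ν ^ (x.2 - 1)) *
              (Real.exp (-t) ^ (x.1 / 2) * Real.exp (-rate x.2 * t)) := by
                field_simp
          _ ≤ (catalan (x.1 / 2) * |C x.2| * ‖α 0‖) / ν ^ (k - 1) *
              (Real.exp ((((k / 4 : ℕ) : ℝ) - k / 2) * t) * ((k / 4 : ℕ) : ℝ)) := by
                gcongr
                exact le_abs_self _
          _ = _ := by ring
      have hsum : |∑ x ∈ (Finset.HasAntidiagonal.antidiagonal (k - 2)).erase (0, k - 2),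
          (coeff x.1 (slowSeries ν 1) * Real.exp (-t) ^ (x.1 / 2)) *
            coeff x.2 (extSeries (α t))| ≤ M *
            (‖α 0‖ / ν ^ (k - 1) * (Real.exp ((((k / 4 : ℕ) : ℝ) - k / 2) * t) *
              ((k / 4 : ℕ) : ℝ))) := by
        refine (Finset.abs_sum_le_sum_abs _ _).trans ((Finset.sum_le_sum hstep).trans ?_)
        rw [hM, Finset.sum_mul]
        exact Finset.sum_le_sum_of_subset_of_nonneg (Finset.erase_subset _ _)
          fun x _ _ => by positivity
      have e5 : Real.exp ((k : ℝ) / 2 * t) * Real.exp ((((k / 4 : ℕ) : ℝ) - k / 2) * t) =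
          Real.exp (((k / 4 : ℕ) : ℝ) * t) := by
        rw [← Real.exp_add]; congr 1; ring
      calc _ ≤ Real.exp ((k : ℝ) / 2 * t) * (M * (‖α 0‖ / ν ^ (k - 1) *
            (Real.exp ((((k / 4 : ℕ) : ℝ) - k / 2) * t) * ((k / 4 : ℕ) : ℝ)))) :=
            mul_le_mul_of_nonneg_left hsum (Real.exp_pos _).le
        _ = K * ((Real.exp ((k : ℝ) / 2 * t) * Real.exp ((((k / 4 : ℕ) : ℝ) - k / 2) * t)) *
            (((k / 4 : ℕ) : ℝ) * 1)) := by rw [hK]; ring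
        _ = _ := by rw [e5]
    have h3 := norm_le_of_norm_deriv_le hd
      (B := fun t => K * Real.exp (((k / 4 : ℕ) : ℝ) * t))
      (fun t _ => (hE _ t).const_mul K) hb τ hτ
    simp only [mul_zero, Real.exp_zero, one_mul, mul_one, norm_mul, Real.norm_eq_abs,
      abs_of_pos (Real.exp_pos _)] at h3
    have h4 : |α 0 ⟨k, hk⟩| ≤ ‖α 0‖ / ν ^ (k - 1) :=
      (norm_le_pi_norm (α 0) ⟨k, hk⟩).trans
        (le_div_self (norm_nonneg _) (pow_pos h0 _) (pow_le_one₀ h0.le h1))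
    have h5 : (1 : ℝ) ≤ Real.exp (((k / 4 : ℕ) : ℝ) * τ) := Real.one_le_exp (by positivity)
    have h6 : Real.exp ((k : ℝ) / 2 * τ) * |α τ ⟨k, hk⟩| ≤
        (1 + M) * ‖α 0‖ / ν ^ (k - 1) * Real.exp (((k / 4 : ℕ) : ℝ) * τ) := by
      have e : (1 + M) * ‖α 0‖ / ν ^ (k - 1) = ‖α 0‖ / ν ^ (k - 1) + K := by rw [hK]; ring
      rw [e]
      have : 0 ≤ ‖α 0‖ / ν ^ (k - 1) := by positivity
      nlinarith
    have e7 : Real.exp (-rate k * τ) =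
        Real.exp (((k / 4 : ℕ) : ℝ) * τ) / Real.exp ((k : ℝ) / 2 * τ) := by
      rw [← Real.exp_sub, rate_eq]; congr 1; ring
    rw [e7, ← mul_div_assoc, le_div_iff₀ (Real.exp_pos _)]
    linarith

theorem slowManifold_decay (N : ℕ) : ∃ C : ℝ, ∀ ν : ℝ, 0 < ν → ν ≤ 1 →
    ∀ α β : ℝ → Fin (N + 1) → ℝ, SolvesODE ν α β → LiesOn (slowManifold ν N) α β →
      ∀ τ : ℝ, 0 ≤ τ → ∀ k : Fin (N + 1),
        |α τ k| ≤ C * ‖α 0‖ / ν ^ ((k : ℕ) - 1) * Real.exp (-rate k * τ) ∧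
        |β τ k| ≤ C * ‖α 0‖ / ν ^ ((k : ℕ) + 1) * Real.exp (-rate k * τ) := by
  choose C hC0 hC using alpha_decay N
  set A : ℝ := ∑ k : Fin (N + 1), C k k.2 with hA
  have hCA : ∀ k : Fin (N + 1), C k k.2 ≤ A := fun k =>
    Finset.single_le_sum (f := fun k : Fin (N + 1) => C k k.2) (fun k _ => hC0 k k.2)
      (Finset.mem_univ k)
  have hA0 : 0 ≤ A := Finset.sum_nonneg fun k _ => hC0 k k.2
  set B : ℝ := ∑ k ∈ Finset.range (N + 1), ∑ x ∈ Finset.HasAntidiagonal.antidiagonal k,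
    (catalan (x.1 / 2) : ℝ) * A with hB
  have hB0 : 0 ≤ B := Finset.sum_nonneg fun k _ => Finset.sum_nonneg fun x _ => by positivity
  refine ⟨A + B, fun ν h0 h1 α β hode hlies τ hτ k => ⟨?_, ?_⟩⟩
  · refine (hC k k.2 ν h0 h1 α β hode hlies τ hτ).trans ?_
    gcongr
    linarith [hCA k]
  · refine (abs_beta_le hlies hτ k k.2).trans ?_
    have hstep : ∀ x ∈ Finset.HasAntidiagonal.antidiagonal (k : ℕ), |coeff x.1 (slowSeries ν 1)| *
        Real.exp (-τ) ^ (x.1 / 2) * |coeff x.2 (extSeries (α τ))| ≤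
        (catalan (x.1 / 2) : ℝ) * A * (‖α 0‖ / ν ^ ((k : ℕ) + 1) * Real.exp (-rate k * τ)) :=
      fun x hx => by
      have hx' := Finset.HasAntidiagonal.mem_antidiagonal.1 hx
      by_cases hd : 2 ∣ x.1
      swap
      · rw [coeff_slowSeries_odd ν hd, abs_zero, zero_mul, zero_mul]; positivity
      obtain ⟨i, hi⟩ := hd
      have hxN : x.2 < N + 1 := by omega
      rw [coeff_extSeries_of_lt _ hxN]
      have e1 := abs_coeff_slowSeries_le h0 x.1
      have e2 := hC x.2 hxN ν h0 h1 α β hode hlies τ hτ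
      have e3 : Real.exp (-τ) ^ (x.1 / 2) * Real.exp (-rate x.2 * τ) ≤ Real.exp (-rate k * τ) := by
        have q2 : ((x.2 / 4 : ℕ) : ℝ) ≤ (((k : ℕ) / 4 : ℕ) : ℝ) := by
          exact_mod_cast (by omega : x.2 / 4 ≤ (k : ℕ) / 4)
        have q3 : ((k : ℕ) : ℝ) = 2 * i + x.2 := by
          exact_mod_cast (by omega : (k : ℕ) = 2 * i + x.2)
        rw [← Real.exp_nat_mul, ← Real.exp_add, show x.1 / 2 = i by omega]
        refine Real.exp_le_exp.2 ?_
        rw [rate_eq, rate_eq]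
        nlinarith
      have e4 : ν ^ ((k : ℕ) + 1) ≤ ν ^ (x.1 + 1) * ν ^ (x.2 - 1) := by
        rw [← pow_add]
        exact pow_le_pow_of_le_one h0.le h1 (by omega)
      have e5 := hCA ⟨x.2, hxN⟩
      calc _ ≤ (catalan (x.1 / 2) / ν ^ (x.1 + 1)) * Real.exp (-τ) ^ (x.1 / 2) *
            (C x.2 hxN * ‖α 0‖ / ν ^ (x.2 - 1) * Real.exp (-rate x.2 * τ)) := by gcongr
        _ = (catalan (x.1 / 2) * C x.2 hxN * ‖α 0‖) / (ν ^ (x.1 + 1) * ν ^ (x.2 - 1)) *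
            (Real.exp (-τ) ^ (x.1 / 2) * Real.exp (-rate x.2 * τ)) := by
              field_simp
        _ ≤ (catalan (x.1 / 2) * A * ‖α 0‖) / ν ^ ((k : ℕ) + 1) * Real.exp (-rate k * τ) := by
              gcongr
        _ = _ := by ring
    refine (Finset.sum_le_sum hstep).trans ?_
    rw [← Finset.sum_mul]
    have : ∑ x ∈ Finset.HasAntidiagonal.antidiagonal (k : ℕ), (catalan (x.1 / 2) : ℝ) * A ≤ B :=
      Finset.single_le_sum (f := fun k => ∑ x ∈ Finset.HasAntidiagonal.antidiagonal k,
        (catalan (x.1 / 2) : ℝ) * A) (fun k _ => Finset.sum_nonneg fun x _ => by positivity)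
        (Finset.mem_range.2 k.2)
    calc _ ≤ (A + B) * (‖α 0‖ / ν ^ ((k : ℕ) + 1) * Real.exp (-rate k * τ)) := by
          gcongr; linarith
      _ = _ := by ring

/-- On the manifold the coefficients follow the diffusion with coefficient `ν + 1/ν` up to
`O(e^{-τ})`. -/
theorem slowManifold_drive_le (ν : ℝ) (N : ℕ) : ∃ K : ℝ, ∀ α β : ℝ → Fin (N + 1) → ℝ,
    LiesOn (slowManifold ν N) α β → ∀ τ : ℝ, 0 ≤ τ → ∀ k : Fin (N + 1),
      |1 / ν * lag (α τ) k + lag (β τ) k| ≤ K * Real.exp (-τ) * ‖α τ‖ := by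
  set K : ℝ := ∑ k ∈ Finset.range (N + 1), ∑ x ∈ Finset.HasAntidiagonal.antidiagonal k,
    |coeff x.1 (slowSeries ν 1)| with hK
  have hK0 : 0 ≤ K := Finset.sum_nonneg fun k _ => Finset.sum_nonneg fun x _ => abs_nonneg _
  refine ⟨K, fun α β hlies τ hτ k => ?_⟩
  by_cases h2 : 2 ≤ (k : ℕ)
  swap
  · rw [lag, lag, dif_neg h2, dif_neg h2]; simp; positivity
  rw [liesOn_drive hlies hτ k h2, abs_neg]
  have hstep : ∀ x ∈ (Finset.HasAntidiagonal.antidiagonal ((k : ℕ) - 2)).erase (0, (k : ℕ) - 2),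
      |(coeff x.1 (slowSeries ν 1) * Real.exp (-τ) ^ (x.1 / 2)) * coeff x.2 (extSeries (α τ))| ≤
      |coeff x.1 (slowSeries ν 1)| * (Real.exp (-τ) * ‖α τ‖) := fun x hx => by
    have hx' := Finset.HasAntidiagonal.mem_antidiagonal.1 (Finset.mem_of_mem_erase hx)
    have hx0 : x.1 ≠ 0 := fun h => (Finset.mem_erase.1 hx).1 (Prod.ext h (by simp; omega))
    by_cases hd : 2 ∣ x.1
    swap
    · rw [coeff_slowSeries_odd ν hd, zero_mul, zero_mul, abs_zero, zero_mul]
    rw [abs_mul, abs_mul, abs_of_pos (pow_pos (Real.exp_pos (-τ)) _), mul_assoc]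
    refine mul_le_mul_of_nonneg_left (mul_le_mul ?_ (abs_coeff_extSeries_le _ _) (abs_nonneg _)
      (Real.exp_pos _).le) (abs_nonneg _)
    exact pow_le_of_le_one (Real.exp_pos _).le (Real.exp_le_one_iff.2 (by linarith)) (by omega)
  refine (Finset.abs_sum_le_sum_abs _ _).trans ((Finset.sum_le_sum hstep).trans ?_)
  rw [← Finset.sum_mul, mul_assoc]
  refine mul_le_mul_of_nonneg_right ?_ (by positivity)
  refine (Finset.sum_le_sum_of_subset_of_nonneg (Finset.erase_subset _ _)
    fun x _ _ => abs_nonneg _).trans ?_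
  exact Finset.single_le_sum (f := fun k => ∑ x ∈ Finset.HasAntidiagonal.antidiagonal k,
    |coeff x.1 (slowSeries ν 1)|) (fun k _ => Finset.sum_nonneg fun x _ => abs_nonneg _)
    (Finset.mem_range.2 (by omega))

/-! ### Solutions of the system from solutions for the Taylor coefficients -/

/-- The Hermite coefficients that belong to the Taylor coefficients `a`. -/
def toHermite (ν : ℝ) (N : ℕ) (F : ℝ → ℝ⟦X⟧) (τ : ℝ) (k : Fin (N + 1)) : ℝ :=
  Real.exp (-((k : ℝ) / 2) * τ) * coeff (k : ℕ) (gaussSeries (-nuT ν) * F (Real.exp τ - 1))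

/-- Division of a power series by `X`. -/
def shiftSeries (F : ℝ⟦X⟧) : ℝ⟦X⟧ := mk fun j => coeff (j + 1) F

theorem X_mul_shiftSeries {F : ℝ⟦X⟧} (h : coeff 0 F = 0) : X * shiftSeries F = F := by
  ext j
  cases j with
  | zero => simp [h]
  | succ j => rw [coeff_succ_X_mul, shiftSeries, coeff_mk]

theorem coeff_shift_mul {F : ℝ⟦X⟧} (h : coeff 0 F = 0) (P : ℝ⟦X⟧) (k : ℕ) :
    coeff k (P * shiftSeries F) = coeff (k + 1) (P * F) := by
  conv_rhs => rw [← X_mul_shiftSeries h, mul_left_comm, coeff_succ_X_mul]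

theorem coeff_zero_fastMode (a₀ c₀ : ℝ⟦X⟧) (t : ℝ) :
    coeff 0 (fastMode ν a₀ c₀ t) = Real.exp (-ν * t) * coeff 0 c₀ := by
  rw [fastMode, coeff_C_mul, flow, coeff_mk]
  simp [fastData]

theorem coeff_zero_solC {a₀ c₀ : ℝ⟦X⟧} (h : coeff 0 c₀ = 0) (t : ℝ) :
    coeff 0 (solC ν a₀ c₀ t) = 0 := by
  rw [solC, map_sub, coeff_zero_fastMode, h, mul_assoc, coeff_zero_X_mul]
  simp

theorem lag_toHermite (F : ℝ → ℝ⟦X⟧) (τ : ℝ) (k : Fin (N + 1)) :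
    lag (toHermite ν N F τ) k = Real.exp (-((k : ℝ) / 2) * τ) * (Real.exp τ *
      coeff (k : ℕ) (X ^ 2 * (gaussSeries (-nuT ν) * F (Real.exp τ - 1)))) := by
  rw [lag, coeff_X_pow_mul']
  split_ifs with h
  · rw [toHermite, ← mul_assoc, ← Real.exp_add]
    congr 2
    simp only
    push_cast [Nat.cast_sub h]
    ring
  · simp

theorem solvesODE_toHermite (hν : 0 < ν) {a₀ c₀ : ℝ⟦X⟧} (h : coeff 0 c₀ = 0) :
    SolvesODE ν (toHermite ν N (solA ν a₀ c₀))
      (toHermite ν N fun t => shiftSeries (solC ν a₀ c₀ t)) := by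
  intro τ _ k
  set E := gaussSeries (-nuT ν)
  have hE : HasDerivAt (fun s => Real.exp (-((k : ℝ) / 2) * s))
      (Real.exp (-((k : ℝ) / 2) * τ) * (-((k : ℝ) / 2) * 1)) τ :=
    ((hasDerivAt_id τ).const_mul _).exp
  have ht : HasDerivAt (fun s => Real.exp s - 1) (Real.exp τ) τ :=
    (Real.hasDerivAt_exp τ).sub_const 1
  set t := Real.exp τ - 1
  have hA := (CoeffDeriv.const_mul E (solA_deriv (n := (k : ℕ)) (s := univ) (t := t)
    a₀ c₀ hν.ne')) k le_rfl
  have hC := (CoeffDeriv.const_mul E (solC_deriv (n := (k : ℕ) + 1) (s := univ) (t := t)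
    a₀ c₀ hν.ne')) (k + 1) le_rfl
  rw [hasDerivWithinAt_univ] at hA hC
  have hc0 := coeff_zero_solC (ν := ν) (a₀ := a₀) h
  have hcX := fun t => X_mul_shiftSeries (hc0 t)
  constructor
  · refine HasDerivAt.hasDerivWithinAt ?_
    refine (hE.fun_mul (hA.comp τ ht)).congr_deriv ?_
    rw [lag_toHermite, lag_toHermite, toHermite]
    have e1 : E * (-(C (1 / ν) * X ^ 2 * solA ν a₀ c₀ t) - X * solC ν a₀ c₀ t) =
        -(C (1 / ν) * (X ^ 2 * (E * solA ν a₀ c₀ t))) -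
          X ^ 2 * (E * shiftSeries (solC ν a₀ c₀ t)) := by
      linear_combination (X * E) * hcX t
    rw [e1, map_sub, map_neg, coeff_C_mul]
    simp only [Function.comp_apply, E, t]
    ring
  · refine HasDerivAt.hasDerivWithinAt ?_
    have e0 : (fun s => toHermite ν N (fun t => shiftSeries (solC ν a₀ c₀ t)) s k) = fun s =>
        Real.exp (-((k : ℝ) / 2) * s) * coeff ((k : ℕ) + 1) (E * solC ν a₀ c₀ (Real.exp s - 1)) := by
      funext s
      rw [toHermite, coeff_shift_mul (hc0 _)]
    rw [e0]
    refine (hE.fun_mul (hC.comp τ ht)).congr_deriv ?_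
    rw [lag_toHermite, toHermite, toHermite]
    have e1 : E * (-(C ν * solC ν a₀ c₀ t) - C (1 / ν) * X ^ 2 * solC ν a₀ c₀ t -
        X * solA ν a₀ c₀ t) = X * (-(C ν * (E * shiftSeries (solC ν a₀ c₀ t))) -
          C (1 / ν) * (X ^ 2 * (E * shiftSeries (solC ν a₀ c₀ t))) - E * solA ν a₀ c₀ t) := by
      have := hcX t
      linear_combination (E * C ν + E * C (1 / ν) * X ^ 2) * this
    rw [e1, coeff_succ_X_mul, map_sub, map_sub, map_neg, coeff_C_mul, coeff_C_mul]
    simp only [Function.comp_apply, ← coeff_shift_mul (hc0 _), E, t]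
    ring

/-- The slow part of data. -/
def slowProj (ν : ℝ) (a₀ c₀ : ℝ⟦X⟧) : ℝ⟦X⟧ := invSeries ν * slowData ν a₀ c₀

theorem slowData_slowProj (a₀ c₀ : ℝ⟦X⟧) :
    slowData ν (slowProj ν a₀ c₀) (-(X * slowSeries ν 1 * slowProj ν a₀ c₀)) =
      slowData ν a₀ c₀ := by
  rw [slowData, slowProj]
  linear_combination slowData ν a₀ c₀ * mul_invSeries ν

theorem fastData_slowProj (a₀ c₀ : ℝ⟦X⟧) :
    fastData ν (slowProj ν a₀ c₀) (-(X * slowSeries ν 1 * slowProj ν a₀ c₀)) = 0 := by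
  rw [fastData]; ring

theorem flow_zero_right (F : ℝ⟦X⟧) (t : ℝ) : flow F t 0 = 0 := by
  ext n; simp [flow]

/-- The slow part of the solution. -/
theorem solA_slowProj (a₀ c₀ : ℝ⟦X⟧) (t : ℝ) :
    solA ν (slowProj ν a₀ c₀) (-(X * slowSeries ν 1 * slowProj ν a₀ c₀)) t =
      invSeries ν * slowMode ν a₀ c₀ t := by
  rw [solA, slowMode, fastMode, slowData_slowProj, fastData_slowProj, flow_zero_right, slowMode]
  simp

theorem solC_slowProj (a₀ c₀ : ℝ⟦X⟧) (t : ℝ) :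
    solC ν (slowProj ν a₀ c₀) (-(X * slowSeries ν 1 * slowProj ν a₀ c₀)) t =
      -(X * slowSeries ν 1 * (invSeries ν * slowMode ν a₀ c₀ t)) := by
  rw [solC, solA_slowProj, fastMode, fastData_slowProj, flow_zero_right]
  simp

theorem solA_sub_slow (hν : 0 < ν) (a₀ c₀ : ℝ⟦X⟧) : Decay (ν / 2) (fun t => solA ν a₀ c₀ t -
    solA ν (slowProj ν a₀ c₀) (-(X * slowSeries ν 1 * slowProj ν a₀ c₀)) t) := by
  have := (fastMode_decay hν a₀ c₀).const_mul (invSeries ν * (X * slowSeries ν 1))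
  convert this using 1
  funext t
  rw [solA_slowProj, solA]; ring

theorem solC_sub_slow (hν : 0 < ν) (a₀ c₀ : ℝ⟦X⟧) : Decay (ν / 2) (fun t => solC ν a₀ c₀ t -
    solC ν (slowProj ν a₀ c₀) (-(X * slowSeries ν 1 * slowProj ν a₀ c₀)) t) := by
  have := (fastMode_decay hν a₀ c₀).const_mul
    (1 - X * slowSeries ν 1 * (invSeries ν * (X * slowSeries ν 1)))
  convert this using 1
  funext t
  rw [solC_slowProj, solC, solA]; ring

theorem liesOn_toHermite (a₀ c₀ : ℝ⟦X⟧) : LiesOn (slowManifold ν N)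
    (toHermite ν N (solA ν (slowProj ν a₀ c₀) (-(X * slowSeries ν 1 * slowProj ν a₀ c₀))))
    (toHermite ν N fun t => shiftSeries
      (solC ν (slowProj ν a₀ c₀) (-(X * slowSeries ν 1 * slowProj ν a₀ c₀)) t)) := by
  intro τ _ k
  simp only
  set t := Real.exp τ - 1
  set A := solA ν (slowProj ν a₀ c₀) (-(X * slowSeries ν 1 * slowProj ν a₀ c₀)) t with hA
  have hC : solC ν (slowProj ν a₀ c₀) (-(X * slowSeries ν 1 * slowProj ν a₀ c₀)) t =
      X * -(slowSeries ν 1 * A) := by rw [hA, solA_slowProj, solC_slowProj]; ring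
  have h0 : coeff 0 (solC ν (slowProj ν a₀ c₀)
      (-(X * slowSeries ν 1 * slowProj ν a₀ c₀)) t) = 0 := by rw [hC, coeff_zero_X_mul]
  rw [toHermite, coeff_shift_mul h0, hC, mul_left_comm, coeff_succ_X_mul, mul_neg, map_neg,
    mul_neg, neg_inj, mul_left_comm, coeff_mul, coeff_mul, Finset.mul_sum]
  refine Finset.sum_congr rfl fun x hx => ?_
  have hx' := Finset.HasAntidiagonal.mem_antidiagonal.1 hx
  by_cases hd : 2 ∣ x.1
  swap
  · rw [coeff_slowSeries_odd ν hd, coeff_slowSeries_odd ν hd]; simp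
  obtain ⟨i, hi⟩ := hd
  have hxN : x.2 < N + 1 := by omega
  rw [coeff_extSeries_of_lt _ hxN, toHermite, coeff_slowSeries ν (Real.exp (-τ)),
    ← Real.exp_nat_mul]
  have q3 : ((k : ℕ) : ℝ) = 2 * i + x.2 := by
    exact_mod_cast (by omega : (k : ℕ) = 2 * i + x.2)
  have e : Real.exp (-((k : ℝ) / 2) * τ) = Real.exp (((x.1 / 2 : ℕ) : ℝ) * -τ) *
      Real.exp (-((x.2 : ℝ) / 2) * τ) := by
    rw [← Real.exp_add, show x.1 / 2 = i by omega, q3]; congr 1; ring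
  rw [e]
  simp only [A, t]
  ring

end Coefficients
end
end TaylorDispersion

namespace TaylorDispersion
noncomputable section
section LargeTimes
open PowerSeries

/-! ### Large times -/

/-- Only even powers occur. -/
def IsEvenSeries (P : ℝ⟦X⟧) : Prop := ∀ i : ℕ, ¬ 2 ∣ i → coeff i P = 0

theorem IsEvenSeries.mul {P Q : ℝ⟦X⟧} (hP : IsEvenSeries P) (hQ : IsEvenSeries Q) :
    IsEvenSeries (P * Q) := fun i hi => by
  rw [coeff_mul]
  refine Finset.sum_eq_zero fun x hx => ?_
  have hx := Finset.HasAntidiagonal.mem_antidiagonal.1 hx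
  by_cases h : 2 ∣ x.1
  · rw [hQ x.2 (by omega), mul_zero]
  · rw [hP x.1 h, zero_mul]

theorem isEvenSeries_slowSeries (ν : ℝ) : IsEvenSeries (slowSeries ν 1) := fun _ hi =>
  coeff_slowSeries_odd ν hi

theorem isEvenSeries_gaussSeries (c : ℝ) : IsEvenSeries (gaussSeries c) := fun i hi => by
  rw [coeff_gaussSeries, if_neg hi]

theorem isEvenSeries_invSeries (ν : ℝ) : IsEvenSeries (invSeries ν) := fun i => by
  induction i using Nat.strong_induction_on with
  | _ i ih =>
    intro hi
    have e1 : invSeries ν = 1 - X ^ 2 * (slowSeries ν 1 ^ 2 * invSeries ν) := by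
      linear_combination mul_invSeries ν
    have h2 : IsEvenSeries (slowSeries ν 1 ^ 2) := by
      rw [pow_two]; exact (isEvenSeries_slowSeries ν).mul (isEvenSeries_slowSeries ν)
    rw [e1, map_sub, coeff_one, if_neg (by omega), coeff_X_pow_mul', zero_sub, neg_eq_zero]
    split_ifs with h
    · rw [coeff_mul]
      refine Finset.sum_eq_zero fun x hx => ?_
      have hx := Finset.HasAntidiagonal.mem_antidiagonal.1 hx
      by_cases h : 2 ∣ x.1
      · rw [ih x.2 (by omega) (by omega), mul_zero]
      · rw [h2 x.1 h, zero_mul]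
    · rfl

theorem abs_coeff_even_mul_le {e : ℕ} {P : ℝ → ℝ⟦X⟧} (hP : OrderLE e P)
    (hPe : ∀ ν, IsEvenSeries (P ν)) (Y : ℝ⟦X⟧) {k : ℕ} (hk : ¬ 2 ∣ k) :
    ∃ C : ℝ, 0 ≤ C ∧ ∀ ν : ℝ, 0 < ν → ν ≤ 1 → |coeff k (P ν * Y)| ≤ C / ν ^ (e + (k - 1)) := by
  choose C hC using hP
  refine ⟨∑ x ∈ Finset.HasAntidiagonal.antidiagonal k, |C x.1| * |coeff x.2 Y|,
    Finset.sum_nonneg fun x _ => by positivity, fun ν h0 h1 => ?_⟩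
  refine (abs_coeff_mul_le _ _ _).trans ?_
  rw [Finset.sum_div]
  refine Finset.sum_le_sum fun x hx => ?_
  have hx := Finset.HasAntidiagonal.mem_antidiagonal.1 hx
  by_cases h : 2 ∣ x.1
  · rw [mul_div_right_comm]
    refine mul_le_mul_of_nonneg_right ((hC x.1 ν h0 h1).trans ?_) (abs_nonneg _)
    exact div_pow_le_div_pow h0 h1 (le_abs_self _) (abs_nonneg _) (by omega)
  · rw [hPe ν x.1 h, abs_zero, zero_mul]; positivity

theorem coeff_X_pow_four_mul_pow_mul (P Y : ℝ⟦X⟧) (k : ℕ) :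
    coeff k ((X ^ 4 * P) ^ (k / 4) * Y) = coeff (k % 4) (P ^ (k / 4) * Y) := by
  rw [mul_pow, ← pow_mul, mul_assoc, coeff_X_pow_mul', if_pos (by omega)]
  congr 1
  congr 1
  omega

/-- The slow data in the Hermite normalization. -/
def slowHermite (ν : ℝ) (a₀ c₀ : ℝ⟦X⟧) : ℝ⟦X⟧ := gaussSeries (-nuT ν) * slowProj ν a₀ c₀

theorem slowHermite_eq (ν : ℝ) (a₀ : ℝ⟦X⟧) {c₀ : ℝ⟦X⟧} (h : coeff 0 c₀ = 0) :
    slowHermite ν a₀ c₀ = gaussSeries (-nuT ν) * invSeries ν * a₀ -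
      X ^ 2 * (gaussSeries (-nuT ν) * invSeries ν * slowSeries ν 1 * shiftSeries c₀) := by
  rw [slowHermite, slowProj, slowData]
  linear_combination (X * gaussSeries (-nuT ν) * invSeries ν * slowSeries ν 1) * X_mul_shiftSeries h

theorem gauss_inv_order : OrderLE 0 (fun ν => gaussSeries (-nuT ν) * invSeries ν) := by
  simpa using gaussSeries_order.mul invSeries_order

theorem gauss_inv_slow_order :
    OrderLE 1 (fun ν => gaussSeries (-nuT ν) * invSeries ν * slowSeries ν 1) := by
  simpa using gauss_inv_order.mul slowSeries_order

theorem slowHermite_order (a₀ : ℝ⟦X⟧) {c₀ : ℝ⟦X⟧} (h : coeff 0 c₀ = 0) :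
    OrderLE 0 (fun ν => slowHermite ν a₀ c₀) := by
  simp only [fun ν => slowHermite_eq ν a₀ h]
  have h1 := gauss_inv_order.mul (OrderLE.const a₀)
  have h2 := (gauss_inv_slow_order.mul (OrderLE.const (shiftSeries c₀))).mono
    (show 1 + 0 ≤ 2 by omega)
  exact h1.sub (h2.X_pow_mul 2)

/-- The exponent of `1/ν` for the coefficient with index `k`. -/
def nuExponent (k : ℕ) : ℕ := if k = 2 then 2 else k - 1

theorem leading_alpha_le (a₀ : ℝ⟦X⟧) {c₀ : ℝ⟦X⟧} (h : coeff 0 c₀ = 0) (k : ℕ) :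
    ∃ K : ℝ, 0 ≤ K ∧ ∀ ν : ℝ, 0 < ν → ν ≤ 1 →
      |coeff k ((X ^ 4 * (C (-1 / ν) * slowSeries ν 1 ^ 2)) ^ (k / 4) * slowHermite ν a₀ c₀)| ≤
        K / ν ^ nuExponent k := by
  have hord := ((C_order.mul (slowSeries_order.pow 2)).pow (k / 4)).mul (slowHermite_order a₀ h)
  obtain ⟨K, hK⟩ := hord (k % 4)
  by_cases hk : ¬ 2 ∣ k ∧ k < 4
  · obtain ⟨h2, h4⟩ := hk
    obtain ⟨A, hA0, hA⟩ := abs_coeff_even_mul_le gauss_inv_order (fun ν =>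
      (isEvenSeries_gaussSeries _).mul (isEvenSeries_invSeries ν)) a₀ h2
    obtain ⟨B, hB0, hB⟩ := abs_coeff_even_mul_le gauss_inv_slow_order (fun ν =>
      ((isEvenSeries_gaussSeries _).mul (isEvenSeries_invSeries ν)).mul (isEvenSeries_slowSeries ν))
      (shiftSeries c₀) (show ¬ 2 ∣ 1 by norm_num)
    refine ⟨A + B, by positivity, fun ν h0 h1 => ?_⟩
    rw [show k / 4 = 0 by omega, pow_zero, one_mul, slowHermite_eq ν a₀ h, map_sub, add_div]
    refine (abs_sub _ _).trans (add_le_add ((hA ν h0 h1).trans ?_) ?_)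
    · refine div_pow_le_div_pow h0 h1 le_rfl hA0 ?_
      rw [nuExponent, if_neg (by omega)]; omega
    · rw [coeff_X_pow_mul']
      split_ifs with h3
      · obtain rfl : k = 3 := by omega
        refine (hB ν h0 h1).trans (div_pow_le_div_pow h0 h1 le_rfl hB0 ?_)
        norm_num [nuExponent]
      · rw [abs_zero]; positivity
  · refine ⟨|K|, abs_nonneg _, fun ν h0 h1 => ?_⟩
    rw [coeff_X_pow_four_mul_pow_mul]
    refine (hK ν h0 h1).trans (div_pow_le_div_pow h0 h1 (le_abs_self _) (abs_nonneg _) ?_)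
    rw [nuExponent]
    split_ifs <;> omega

theorem leading_beta_le (a₀ : ℝ⟦X⟧) {c₀ : ℝ⟦X⟧} (h : coeff 0 c₀ = 0) (k : ℕ) :
    ∃ K : ℝ, 0 ≤ K ∧ ∀ ν : ℝ, 0 < ν → ν ≤ 1 →
      |coeff k ((X ^ 4 * (C (-1 / ν) * slowSeries ν 1 ^ 2)) ^ (k / 4) *
        (-(slowSeries ν 1 * slowHermite ν a₀ c₀)))| ≤ K / ν ^ (k + 1) := by
  have hord := ((C_order.mul (slowSeries_order.pow 2)).pow (k / 4)).mul
    (slowSeries_order.mul (slowHermite_order a₀ h))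
  obtain ⟨K, hK⟩ := hord (k % 4)
  refine ⟨|K|, abs_nonneg _, fun ν h0 h1 => ?_⟩
  rw [mul_neg, map_neg, abs_neg, coeff_X_pow_four_mul_pow_mul]
  refine (hK ν h0 h1).trans (div_pow_le_div_pow h0 h1 (le_abs_self _) (abs_nonneg _) ?_)
  omega

theorem eventually_abs_coeff_add_le {δ : ℝ} (hδ : 0 < δ) (P Y : ℝ⟦X⟧) {D : ℝ → ℝ⟦X⟧}
    (hD : Decay δ D) (k : ℕ) : ∀ᶠ t : ℝ in atTop,
      |coeff k (flow (X ^ 4 * P) t Y + D t)| ≤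
        (|coeff k ((X ^ 4 * P) ^ (k / 4) * Y)| + 2) * (1 + t) ^ (k / 4) := by
  obtain ⟨K, hK⟩ := hD k
  have h1 : Tendsto (fun t : ℝ => |K| * Real.exp (-δ * t)) atTop (𝓝 (|K| * 0)) := by
    refine Tendsto.const_mul _ (Real.tendsto_exp_atBot.comp ?_)
    exact tendsto_id.const_mul_atTop_of_neg (by linarith)
  rw [mul_zero] at h1
  filter_upwards [eventually_abs_coeff_flow_le four_pos P Y k, eventually_ge_atTop 0,
    h1.eventually (gt_mem_nhds one_pos)] with t h2 h0 h3
  rw [map_add]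
  refine (abs_add_le _ _).trans ?_
  have h4 : t ^ (k / 4) ≤ (1 + t) ^ (k / 4) := pow_le_pow_left₀ h0 (by linarith) _
  have h5 : 1 ≤ (1 + t) ^ (k / 4) := one_le_pow₀ (by linarith)
  have h6 : |coeff k (D t)| ≤ 1 := by
    refine (hK t h0).trans (le_trans ?_ h3.le)
    exact mul_le_mul_of_nonneg_right (le_abs_self _) (Real.exp_pos _).le
  nlinarith [abs_nonneg (coeff k ((X ^ 4 * P) ^ (k / 4) * Y))]

theorem gauss_solA (ν : ℝ) (a₀ c₀ : ℝ⟦X⟧) (t : ℝ) : gaussSeries (-nuT ν) * solA ν a₀ c₀ t =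
    flow (X ^ 4 * (C (-1 / ν) * slowSeries ν 1 ^ 2)) t (slowHermite ν a₀ c₀) +
      gaussSeries (-nuT ν) * invSeries ν * X * slowSeries ν 1 * fastMode ν a₀ c₀ t := by
  rw [slowHermite, slowProj, ← mul_flow four_pos, ← mul_flow four_pos, solA, slowMode]
  ring

theorem gauss_shift_solC (ν : ℝ) (a₀ : ℝ⟦X⟧) {c₀ : ℝ⟦X⟧} (h : coeff 0 c₀ = 0) (t : ℝ) :
    gaussSeries (-nuT ν) * shiftSeries (solC ν a₀ c₀ t) =
    flow (X ^ 4 * (C (-1 / ν) * slowSeries ν 1 ^ 2)) t (-(slowSeries ν 1 * slowHermite ν a₀ c₀)) +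
      gaussSeries (-nuT ν) * (shiftSeries (fastMode ν a₀ c₀ t) -
        slowSeries ν 1 * (invSeries ν * X * slowSeries ν 1 * fastMode ν a₀ c₀ t)) := by
  have h1 := X_mul_shiftSeries (coeff_zero_solC (ν := ν) (a₀ := a₀) h t)
  have h2 := X_mul_shiftSeries (F := fastMode ν a₀ c₀ t) (by rw [coeff_zero_fastMode, h, mul_zero])
  rw [slowHermite, slowProj, show -(slowSeries ν 1 * (gaussSeries (-nuT ν) *
    (invSeries ν * slowData ν a₀ c₀))) = (-(slowSeries ν 1 * gaussSeries (-nuT ν) * invSeries ν)) *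
      slowData ν a₀ c₀ by ring, ← mul_flow four_pos]
  change _ = _ * slowMode ν a₀ c₀ t + _
  refine mul_left_cancel₀ (X_ne_zero (R := ℝ)) ?_
  have h3 : solC ν a₀ c₀ t = fastMode ν a₀ c₀ t - X * slowSeries ν 1 * (invSeries ν *
    (slowMode ν a₀ c₀ t + X * slowSeries ν 1 * fastMode ν a₀ c₀ t)) := by rw [solC, solA]
  linear_combination gaussSeries (-nuT ν) * h1 - gaussSeries (-nuT ν) * h2 +
    gaussSeries (-nuT ν) * h3

theorem toHermite_eventually (N : ℕ) (a₀ : ℝ⟦X⟧) {c₀ : ℝ⟦X⟧} (h : coeff 0 c₀ = 0) :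
    ∃ K : ℝ, 0 ≤ K ∧ ∀ ν : ℝ, 0 < ν → ν ≤ 1 → ∃ τ₀ : ℝ, 0 < τ₀ ∧ ∀ τ : ℝ, τ₀ ≤ τ →
      ∀ k : Fin (N + 1),
        |toHermite ν N (solA ν a₀ c₀) τ k| ≤ K / ν ^ nuExponent k * Real.exp (-rate k * τ) ∧
        |toHermite ν N (fun t => shiftSeries (solC ν a₀ c₀ t)) τ k| ≤
          K / ν ^ ((k : ℕ) + 1) * Real.exp (-rate k * τ) := by
  choose A hA0 hA using leading_alpha_le a₀ h
  choose B hB0 hB using leading_beta_le a₀ h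
  set K : ℝ := (∑ k ∈ Finset.range (N + 1), A k) + (∑ k ∈ Finset.range (N + 1), B k) + 2 with hK
  have hSA : ∀ k : Fin (N + 1), A k ≤ ∑ k ∈ Finset.range (N + 1), A k := fun k =>
    Finset.single_le_sum (f := A) (fun k _ => hA0 k) (Finset.mem_range.2 k.2)
  have hSB : ∀ k : Fin (N + 1), B k ≤ ∑ k ∈ Finset.range (N + 1), B k := fun k =>
    Finset.single_le_sum (f := B) (fun k _ => hB0 k) (Finset.mem_range.2 k.2)
  have hSA0 : 0 ≤ ∑ k ∈ Finset.range (N + 1), A k := Finset.sum_nonneg fun k _ => hA0 k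
  have hSB0 : 0 ≤ ∑ k ∈ Finset.range (N + 1), B k := Finset.sum_nonneg fun k _ => hB0 k
  refine ⟨K, by positivity, fun ν h0 h1 => ?_⟩
  have hev : ∀ k : Fin (N + 1), ∀ᶠ t : ℝ in atTop,
      |coeff (k : ℕ) (gaussSeries (-nuT ν) * solA ν a₀ c₀ t)| ≤
        K / ν ^ nuExponent k * (1 + t) ^ ((k : ℕ) / 4) ∧
      |coeff (k : ℕ) (gaussSeries (-nuT ν) * shiftSeries (solC ν a₀ c₀ t))| ≤
        K / ν ^ ((k : ℕ) + 1) * (1 + t) ^ ((k : ℕ) / 4) := fun k => by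
    have hs : Decay (ν / 2) (fun t => shiftSeries (fastMode ν a₀ c₀ t)) := fun j => by
      simpa [shiftSeries] using fastMode_decay h0 a₀ c₀ (j + 1)
    have d1 := (fastMode_decay h0 a₀ c₀).const_mul
      (gaussSeries (-nuT ν) * invSeries ν * X * slowSeries ν 1)
    have d2 : Decay (ν / 2) (fun t => gaussSeries (-nuT ν) * (shiftSeries (fastMode ν a₀ c₀ t) -
        slowSeries ν 1 * (invSeries ν * X * slowSeries ν 1 * fastMode ν a₀ c₀ t))) := by
      have := (hs.add ((fastMode_decay h0 a₀ c₀).const_mul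
        (-(slowSeries ν 1 * (invSeries ν * X * slowSeries ν 1))))).const_mul (gaussSeries (-nuT ν))
      convert this using 1
      funext t; ring
    have hp : ∀ e : ℕ, (2 : ℝ) ≤ 2 / ν ^ e := fun e =>
      le_div_self (by norm_num) (pow_pos h0 _) (pow_le_one₀ h0.le h1)
    filter_upwards [eventually_abs_coeff_add_le (half_pos h0) _ _ d1 k,
      eventually_abs_coeff_add_le (half_pos h0) _ _ d2 k, eventually_ge_atTop 0] with t e1 e2 ht
    rw [← gauss_solA] at e1
    rw [← gauss_shift_solC ν a₀ h] at e2
    refine ⟨e1.trans (mul_le_mul_of_nonneg_right ?_ (by positivity)),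
      e2.trans (mul_le_mul_of_nonneg_right ?_ (by positivity))⟩
    · refine (add_le_add (hA k ν h0 h1) (hp (nuExponent k))).trans ?_
      rw [← add_div]
      exact div_le_div_of_nonneg_right (by linarith [hSA k]) (by positivity)
    · refine (add_le_add (hB k ν h0 h1) (hp ((k : ℕ) + 1))).trans ?_
      rw [← add_div]
      exact div_le_div_of_nonneg_right (by linarith [hSB k]) (by positivity)
  obtain ⟨T, hT⟩ := eventually_atTop.1 (eventually_all.2 hev)
  refine ⟨max 1 (Real.log (1 + |T|)), by positivity, fun τ hτ k => ?_⟩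
  have hτT : T ≤ Real.exp τ - 1 := by
    have : 1 + |T| ≤ Real.exp τ := by
      rw [← Real.log_le_iff_le_exp (by positivity)]
      exact (le_max_right _ _).trans hτ
    linarith [le_abs_self T]
  have hk := hT _ hτT k
  have e : (1 + (Real.exp τ - 1)) ^ ((k : ℕ) / 4) * Real.exp (-((k : ℝ) / 2) * τ) =
      Real.exp (-rate k * τ) := by
    rw [add_sub_cancel, ← Real.exp_nat_mul, ← Real.exp_add, rate_eq]; congr 1; ring
  simp only [toHermite, abs_mul, abs_of_pos (Real.exp_pos _)]
  rw [← e]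
  constructor
  · calc _ ≤ Real.exp (-((k : ℝ) / 2) * τ) * _ :=
        mul_le_mul_of_nonneg_left hk.1 (Real.exp_pos _).le
      _ = _ := by ring
  · calc _ ≤ Real.exp (-((k : ℝ) / 2) * τ) * _ :=
        mul_le_mul_of_nonneg_left hk.2 (Real.exp_pos _).le
      _ = _ := by ring

end LargeTimes
end
end TaylorDispersion

namespace TaylorDispersion
noncomputable section
section Hermite

open PowerSeries

/-! ### Weighted spaces -/

theorem MemL2m.of_abs_le {m C : ℝ} {f g : ℝ → ℝ} (hg : MemL2m m g)
    (hf : AEStronglyMeasurable f volume) (hC : 0 ≤ C) (h : ∀ᵐ ξ, |f ξ| ≤ C * |g ξ|) :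
    MemL2m m f ∧ normL2m m f ≤ C * normL2m m g := by
  have hsq : ∀ᵐ ξ : ℝ, (1 + ξ ^ 2) ^ m * f ξ ^ 2 ≤ C ^ 2 * ((1 + ξ ^ 2) ^ m * g ξ ^ 2) := by
    filter_upwards [h] with ξ hξ
    have h0 : (0 : ℝ) ≤ (1 + ξ ^ 2) ^ m := by positivity
    have h1 : f ξ ^ 2 ≤ C ^ 2 * g ξ ^ 2 := by
      rw [← mul_pow, ← sq_abs (f ξ), ← sq_abs (C * g ξ), abs_mul C, abs_of_nonneg hC]
      exact pow_le_pow_left₀ (abs_nonneg _) hξ 2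
    calc _ ≤ (1 + ξ ^ 2) ^ m * (C ^ 2 * g ξ ^ 2) := mul_le_mul_of_nonneg_left h1 h0
      _ = _ := by ring
  have hm : AEStronglyMeasurable (fun ξ : ℝ => (1 + ξ ^ 2) ^ m * f ξ ^ 2) volume :=
    ((measurable_const.add (measurable_id.pow_const 2)).pow_const m).aestronglyMeasurable.mul
      (hf.pow 2)
  have hint : Integrable (fun ξ : ℝ => (1 + ξ ^ 2) ^ m * f ξ ^ 2) volume := by
    refine (hg.2.const_mul (C ^ 2)).mono' hm ?_
    filter_upwards [hsq] with ξ hξ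
    rw [Real.norm_of_nonneg (by positivity)]
    exact hξ
  refine ⟨⟨hg.1.of_le_mul hf (c := C) (by simpa using h), hint⟩, ?_⟩
  rw [normL2m, normL2m, ← Real.sqrt_sq hC, ← Real.sqrt_mul (sq_nonneg C)]
  refine Real.sqrt_le_sqrt ?_
  rw [← integral_const_mul]
  exact integral_mono_ae hint (hg.2.const_mul _) hsq

theorem MemL2m.add {m : ℝ} {f g : ℝ → ℝ} (hf : MemL2m m f) (hg : MemL2m m g) :
    MemL2m m (fun ξ => f ξ + g ξ) ∧
      normL2m m (fun ξ => f ξ + g ξ) ≤ 2 * (normL2m m f + normL2m m g) := by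
  have hsq : ∀ ξ : ℝ, (1 + ξ ^ 2) ^ m * (f ξ + g ξ) ^ 2 ≤
      2 * ((1 + ξ ^ 2) ^ m * f ξ ^ 2) + 2 * ((1 + ξ ^ 2) ^ m * g ξ ^ 2) := fun ξ => by
    have h0 : (0 : ℝ) ≤ (1 + ξ ^ 2) ^ m := by positivity
    nlinarith [mul_nonneg h0 (sq_nonneg (f ξ - g ξ))]
  have hm : AEStronglyMeasurable (fun ξ : ℝ => (1 + ξ ^ 2) ^ m * (f ξ + g ξ) ^ 2) volume :=
    ((measurable_const.add (measurable_id.pow_const 2)).pow_const m).aestronglyMeasurable.mul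
      ((hf.1.1.add hg.1.1).pow 2)
  have hr := (hf.2.const_mul 2).add (hg.2.const_mul 2)
  have hint : Integrable (fun ξ : ℝ => (1 + ξ ^ 2) ^ m * (f ξ + g ξ) ^ 2) volume := by
    refine hr.mono' hm (Eventually.of_forall fun ξ => ?_)
    rw [Real.norm_of_nonneg (by positivity)]
    exact hsq ξ
  refine ⟨⟨hf.1.add hg.1, hint⟩, ?_⟩
  have hf0 : 0 ≤ ∫ ξ : ℝ, (1 + ξ ^ 2) ^ m * f ξ ^ 2 := integral_nonneg fun ξ => by positivity
  have hg0 : 0 ≤ ∫ ξ : ℝ, (1 + ξ ^ 2) ^ m * g ξ ^ 2 := integral_nonneg fun ξ => by positivity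
  have h1 : ∫ ξ : ℝ, (1 + ξ ^ 2) ^ m * (f ξ + g ξ) ^ 2 ≤
      2 * (∫ ξ : ℝ, (1 + ξ ^ 2) ^ m * f ξ ^ 2) + 2 * ∫ ξ : ℝ, (1 + ξ ^ 2) ^ m * g ξ ^ 2 := by
    rw [← integral_const_mul, ← integral_const_mul,
      ← integral_add (hf.2.const_mul 2) (hg.2.const_mul 2)]
    exact integral_mono hint hr hsq
  unfold normL2m
  refine Real.sqrt_le_iff.2 ⟨by positivity, h1.trans ?_⟩
  nlinarith [Real.sq_sqrt hf0, Real.sq_sqrt hg0, mul_nonneg (Real.sqrt_nonneg (∫ ξ : ℝ, (1 + ξ ^ 2)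
    ^ m * f ξ ^ 2)) (Real.sqrt_nonneg (∫ ξ : ℝ, (1 + ξ ^ 2) ^ m * g ξ ^ 2))]

theorem memL2m_exp_neg_abs (m : ℝ) : MemL2m m (fun ξ => Real.exp (-|ξ|)) := by
  have key : ∀ p : ℝ, Integrable (fun ξ : ℝ => (1 + ξ ^ 2) ^ p * Real.exp (-|ξ|) ^ 2) volume := by
    intro p
    obtain ⟨C, hC, h⟩ := exists_rpow_le_exp (2 * |p| + 2) (δ := 2) (by norm_num)
    refine (integrable_inv_one_add_sq.const_mul C).mono' ?_ (Eventually.of_forall fun ξ => ?_)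
    · exact (((measurable_const.add (measurable_id.pow_const 2)).pow_const p).mul
        ((continuous_abs.neg.rexp.pow 2).measurable)).aestronglyMeasurable
    · rw [Real.norm_of_nonneg (by positivity)]
      have hξ := h |ξ| (abs_nonneg ξ)
      have h1 : 1 + ξ ^ 2 ≤ (1 + |ξ|) ^ 2 := by
        nlinarith [abs_nonneg ξ, sq_abs ξ]
      have h2 : (1 + ξ ^ 2) ^ p * (1 + ξ ^ 2) ≤ (1 + |ξ|) ^ (2 * |p| + 2) := by
        calc (1 + ξ ^ 2) ^ p * (1 + ξ ^ 2) ≤ (1 + ξ ^ 2) ^ |p| * (1 + ξ ^ 2) := by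
              gcongr
              · nlinarith [sq_nonneg ξ]
              · exact le_abs_self p
          _ = (1 + ξ ^ 2) ^ (|p| + 1) := by
              rw [Real.rpow_add (by positivity), Real.rpow_one]
          _ ≤ ((1 + |ξ|) ^ 2) ^ (|p| + 1) :=
              Real.rpow_le_rpow (by positivity) h1 (by positivity)
          _ = _ := by
              rw [← Real.rpow_natCast, ← Real.rpow_mul (by positivity)]
              congr 1; push_cast; ring
      rw [← Real.exp_nat_mul, ← div_eq_mul_inv, le_div_iff₀ (by positivity)]
      calc _ = (1 + ξ ^ 2) ^ p * (1 + ξ ^ 2) * Real.exp ((2 : ℕ) * -|ξ|) := by ring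
        _ ≤ C * Real.exp (2 * |ξ|) * Real.exp ((2 : ℕ) * -|ξ|) := by
            exact mul_le_mul_of_nonneg_right (h2.trans hξ) (Real.exp_pos _).le
        _ = C := by
            rw [mul_assoc, ← Real.exp_add]
            norm_num
  refine ⟨(memLp_two_iff_integrable_sq continuous_abs.neg.rexp.aestronglyMeasurable).2 ?_, key m⟩
  simpa using key 0

/-! ### Hermite functions and polynomials -/

/-- The generating series `exp (c X² + 2 c y X)` of `∂^n e^{c y²} / (n! e^{c y²})`. -/
def gaussGen (c y : ℝ) : ℝ⟦X⟧ := gaussSeries c * rescale (2 * c * y) (PowerSeries.exp ℝ)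

theorem derivative_gaussSeries (c : ℝ) :
    d⁄dX ℝ (gaussSeries c) = C (2 * c) * X * gaussSeries c := by
  ext n
  rw [coeff_derivative, mul_assoc, coeff_C_mul]
  rcases n with _ | n
  · simp [coeff_gaussSeries]
  · rw [coeff_succ_X_mul, coeff_gaussSeries, coeff_gaussSeries]
    by_cases h : 2 ∣ n
    · obtain ⟨i, rfl⟩ := h
      have h2 : (2 * i + 1 + 1) / 2 = i + 1 := by omega
      rw [if_pos (by omega), if_pos (by omega), h2, Nat.mul_div_cancel_left _ (by norm_num),
        Nat.factorial_succ]
      have : (i.factorial : ℝ) ≠ 0 := by positivity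
      push_cast
      field_simp
      ring
    · rw [if_neg (by omega), if_neg (by omega)]; simp

theorem derivative_gaussGen (c y : ℝ) :
    d⁄dX ℝ (gaussGen c y) = C (2 * c) * X * gaussGen c y + C (2 * c * y) * gaussGen c y := by
  have h : d⁄dX ℝ (rescale (2 * c * y) (PowerSeries.exp ℝ)) =
      C (2 * c * y) * rescale (2 * c * y) (PowerSeries.exp ℝ) := by
    ext n
    rw [coeff_derivative, coeff_C_mul, coeff_rescale, coeff_rescale, coeff_exp, coeff_exp,
      Nat.factorial_succ]
    have : (n.factorial : ℝ) ≠ 0 := by positivity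
    simp only [one_div, map_inv₀, map_natCast]
    push_cast
    field_simp
    ring
  rw [gaussGen, Derivation.leibniz, derivative_gaussSeries, h]
  simp only [smul_eq_mul]
  ring

theorem coeff_succ_gaussGen (c y : ℝ) (n : ℕ) : (n + 1 : ℝ) * coeff (n + 1) (gaussGen c y) =
    2 * c * coeff n (X * gaussGen c y) + 2 * c * y * coeff n (gaussGen c y) := by
  have := congrArg (coeff n) (derivative_gaussGen c y)
  rw [coeff_derivative, map_add, mul_assoc, coeff_C_mul, coeff_C_mul] at this
  rw [← this]; ring

theorem gaussGen_deriv (c : ℝ) (n : ℕ) (y : ℝ) :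
    HasDerivAt (fun y => coeff n (gaussGen c y)) (2 * c * coeff n (X * gaussGen c y)) y := by
  have h : CoeffDeriv n (fun y => rescale (2 * c * y) (PowerSeries.exp ℝ))
      (C (2 * c) * (X * rescale (2 * c * y) (PowerSeries.exp ℝ))) univ y := by
    intro k _
    rw [hasDerivWithinAt_univ, coeff_C_mul]
    simp only [coeff_rescale, coeff_exp]
    have h1 := (((hasDerivAt_id y).const_mul (2 * c)).pow k).mul_const
      (algebraMap ℚ ℝ (1 / (k.factorial : ℚ)))
    refine h1.congr_deriv ?_
    rcases k with _ | k
    · simp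
    · rw [coeff_succ_X_mul, coeff_rescale, coeff_exp, Nat.factorial_succ]
      have : (k.factorial : ℝ) ≠ 0 := by positivity
      simp only [one_div, map_inv₀, map_natCast, id, Nat.add_sub_cancel]
      push_cast
      field_simp
  have h2 := (h.const_mul (gaussSeries c)) n le_rfl
  rw [hasDerivWithinAt_univ] at h2
  refine h2.congr_deriv ?_
  rw [gaussGen, ← coeff_C_mul]
  congr 1; ring

theorem iteratedDeriv_exp_sq (c : ℝ) (n : ℕ) : iteratedDeriv n (fun y => Real.exp (c * y ^ 2)) =
    fun y => (n.factorial : ℝ) * coeff n (gaussGen c y) * Real.exp (c * y ^ 2) := by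
  induction n with
  | zero =>
    funext y
    rw [gaussGen, coeff_mul]
    simp [coeff_gaussSeries]
  | succ n ih =>
    funext y
    rw [iteratedDeriv_succ, ih]
    have he : HasDerivAt (fun y : ℝ => Real.exp (c * y ^ 2)) (Real.exp (c * y ^ 2) *
        (c * (2 * y))) y := by
      simpa using (((hasDerivAt_id y).pow 2).const_mul c).exp
    rw [(((gaussGen_deriv c n y).const_mul (n.factorial : ℝ)).fun_mul he).deriv, Nat.factorial_succ]
    push_cast
    linear_combination (-(n.factorial : ℝ) * Real.exp (c * y ^ 2)) * coeff_succ_gaussGen c y n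

theorem contDiff_exp_sq (c : ℝ) : ContDiff ℝ ∞ (fun y : ℝ => Real.exp (c * y ^ 2)) := by
  fun_prop

theorem hermiteFun_eq (ν : ℝ) (k : ℕ) (ξ : ℝ) :
    hermiteFun ν k ξ = 1 / Real.sqrt (4 * Real.pi * nuT ν) * ((k.factorial : ℝ) *
      coeff k (gaussGen (-1 / (4 * nuT ν)) ξ) * Real.exp (-1 / (4 * nuT ν) * ξ ^ 2)) := by
  have h : (fun y : ℝ => 1 / Real.sqrt (4 * Real.pi * nuT ν) * Real.exp (-y ^ 2 / (4 * nuT ν))) =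
      fun y => 1 / Real.sqrt (4 * Real.pi * nuT ν) * Real.exp (-1 / (4 * nuT ν) * y ^ 2) := by
    funext y; congr 2; ring
  rw [hermiteFun, h, iteratedDeriv_const_mul _
    ((contDiff_exp_sq _).contDiffAt.of_le (by exact_mod_cast le_top)), iteratedDeriv_exp_sq]

theorem deriv_hermiteFun (ν : ℝ) (k : ℕ) : deriv (hermiteFun ν k) = hermiteFun ν (k + 1) := by
  change deriv (iteratedDeriv k _) = _
  rw [← iteratedDeriv_succ]
  rfl

theorem contDiff_hermiteFun (ν : ℝ) (k : ℕ) : ContDiff ℝ ∞ (hermiteFun ν k) := by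
  have : hermiteFun ν k = deriv^[k] fun y : ℝ =>
      1 / Real.sqrt (4 * Real.pi * nuT ν) * Real.exp (-y ^ 2 / (4 * nuT ν)) :=
    funext fun x => by rw [hermiteFun, iteratedDeriv_eq_iterate]
  rw [this]
  exact ContDiff.iterate_deriv k (by fun_prop)

theorem differentiable_hermiteFun (ν : ℝ) (k : ℕ) : Differentiable ℝ (hermiteFun ν k) :=
  (contDiff_hermiteFun ν k).differentiable (by simp)

theorem hermiteFun_recurrence {ν : ℝ} (hν : 0 < ν) (j : ℕ) (ξ : ℝ) :
    nuT ν * hermiteFun ν (j + 2) ξ =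
      -(1 / 2) * ξ * hermiteFun ν (j + 1) ξ - (j + 1 : ℝ) / 2 * hermiteFun ν j ξ := by
  have h := coeff_succ_gaussGen (-1 / (4 * nuT ν)) ξ (j + 1)
  rw [coeff_succ_X_mul] at h
  have hT := (nuT_pos hν).ne'
  rw [hermiteFun_eq, hermiteFun_eq, hermiteFun_eq, Nat.factorial_succ (j + 1), Nat.factorial_succ j]
  push_cast at h ⊢
  have h' : nuT ν * ((j + 1 + 1 : ℝ) * coeff (j + 1 + 1) (gaussGen (-1 / (4 * nuT ν)) ξ)) =
      -(1 / 2) * coeff j (gaussGen (-1 / (4 * nuT ν)) ξ) -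
        1 / 2 * ξ * coeff (j + 1) (gaussGen (-1 / (4 * nuT ν)) ξ) := by
    rw [h]; field_simp; ring
  linear_combination (1 / Real.sqrt (4 * Real.pi * nuT ν) * ((j + 1) * j.factorial : ℝ) *
    Real.exp (-1 / (4 * nuT ν) * ξ ^ 2)) * h'

theorem opLT_eq (ν : ℝ) {f f' f'' : ℝ → ℝ} (h1 : ∀ x, HasDerivAt f (f' x) x)
    (h2 : ∀ x, HasDerivAt f' (f'' x) x) (ξ : ℝ) :
    opLT ν f ξ = nuT ν * f'' ξ + 1 / 2 * (f ξ + ξ * f' ξ) := by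
  have e1 : deriv f = f' := funext fun x => (h1 x).deriv
  rw [opLT, iteratedDeriv_succ, iteratedDeriv_one, e1, (h2 ξ).deriv,
    ((hasDerivAt_id' ξ).fun_mul (h1 ξ)).deriv]
  simp

theorem hasDerivAt_hermiteFun (ν : ℝ) (k : ℕ) (ξ : ℝ) :
    HasDerivAt (hermiteFun ν k) (hermiteFun ν (k + 1) ξ) ξ := by
  rw [← deriv_hermiteFun]
  exact (differentiable_hermiteFun ν k ξ).hasDerivAt

theorem opLT_hermiteSum {ν : ℝ} (hν : 0 < ν) {N : ℕ} (a : Fin (N + 1) → ℝ) (ξ : ℝ) :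
    opLT ν (hermiteSum ν a) ξ = ∑ k : Fin (N + 1), -((k : ℝ) / 2) * a k * hermiteFun ν k ξ := by
  have h1 : ∀ x, HasDerivAt (hermiteSum ν a) (∑ k : Fin (N + 1), a k * hermiteFun ν (k + 1) x) x :=
    fun x => HasDerivAt.fun_sum fun k _ => (hasDerivAt_hermiteFun ν k x).const_mul (a k)
  have h2 : ∀ x, HasDerivAt (fun x => ∑ k : Fin (N + 1), a k * hermiteFun ν (k + 1) x)
      (∑ k : Fin (N + 1), a k * hermiteFun ν (k + 2) x) x :=
    fun x => HasDerivAt.fun_sum fun k _ => (hasDerivAt_hermiteFun ν (k + 1) x).const_mul (a k)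
  rw [opLT_eq ν h1 h2, hermiteSum, Finset.mul_sum, Finset.mul_sum, ← Finset.sum_add_distrib,
    Finset.mul_sum, ← Finset.sum_add_distrib]
  refine Finset.sum_congr rfl fun k _ => ?_
  linear_combination a k * hermiteFun_recurrence hν k ξ

theorem opLT_hermiteFun {ν : ℝ} (hν : 0 < ν) (j : ℕ) (ξ : ℝ) :
    opLT ν (hermiteFun ν j) ξ = -((j : ℝ) / 2) * hermiteFun ν j ξ := by
  rw [opLT_eq ν (hasDerivAt_hermiteFun ν j) (hasDerivAt_hermiteFun ν (j + 1))]
  linear_combination hermiteFun_recurrence hν j ξ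

theorem hermiteFun_ne_zero {ν : ℝ} (hν : 0 < ν) (j : ℕ) : hermiteFun ν j ≠ 0 := by
  have hT := nuT_pos hν
  have key : ∀ n : ℕ, ¬ ∀ y, coeff n (gaussGen (-1 / (4 * nuT ν)) y) = 0 := by
    intro n
    induction n with
    | zero => 
      intro h
      have := h 0
      rw [gaussGen, coeff_mul] at this
      simp [coeff_gaussSeries] at this
    | succ n ih =>
      refine fun h => ih fun y => ?_
      have h1 := gaussGen_deriv (-1 / (4 * nuT ν)) (n + 1) y
      rw [coeff_succ_X_mul, show (fun y => coeff (n + 1) (gaussGen (-1 / (4 * nuT ν)) y)) =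
        fun _ => 0 from funext h] at h1
      have h2 := h1.unique (hasDerivAt_const y 0)
      have h3 : 2 * (-1 / (4 * nuT ν)) ≠ 0 := by
        have : nuT ν ≠ 0 := hT.ne'
        simp [this]
      exact (mul_eq_zero.1 h2).resolve_left h3
  intro h
  refine key j fun y => ?_
  have h1 := congrFun h y
  rw [hermiteFun_eq] at h1
  have : 0 < Real.sqrt (4 * Real.pi * nuT ν) := Real.sqrt_pos.2 (by positivity)
  simpa [this.ne', Nat.factorial_ne_zero, Real.exp_ne_zero] using h1

theorem abs_coeff_rescale_exp_le (b : ℝ) (n : ℕ) :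
    |coeff n (rescale b (PowerSeries.exp ℝ))| ≤ Real.exp |b| := by
  rw [coeff_rescale, coeff_exp]
  simp only [one_div, map_inv₀, map_natCast]
  rw [← div_eq_mul_inv, abs_div, abs_pow, Nat.abs_cast]
  exact Real.pow_div_factorial_le_exp _ (abs_nonneg b) n

theorem exists_hermiteFun_le {ν : ℝ} (hν : 0 < ν) (k : ℕ) :
    ∃ C : ℝ, 0 ≤ C ∧ ∀ ξ, |hermiteFun ν k ξ| ≤ C * Real.exp (-|ξ|) := by
  have hT := nuT_pos hν
  set c : ℝ := 1 / (4 * nuT ν) with hc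
  have hc0 : 0 < c := by positivity
  set B : ℝ := ∑ x ∈ Finset.HasAntidiagonal.antidiagonal k, |coeff x.1 (gaussSeries (-c))|
  have hB : 0 ≤ B := Finset.sum_nonneg fun _ _ => abs_nonneg _
  set s : ℝ := Real.sqrt (4 * Real.pi * nuT ν)
  refine ⟨1 / s * (k.factorial * B * Real.exp ((2 * c + 1) ^ 2 / (4 * c))), by positivity,
    fun ξ => ?_⟩
  have h1 : |coeff k (gaussGen (-c) ξ)| ≤ B * Real.exp (2 * c * |ξ|) := by
    rw [gaussGen, coeff_mul, Finset.sum_mul]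
    refine (Finset.abs_sum_le_sum_abs _ _).trans (Finset.sum_le_sum fun x _ => ?_)
    rw [abs_mul]
    refine mul_le_mul_of_nonneg_left ((abs_coeff_rescale_exp_le _ _).trans (le_of_eq ?_))
      (abs_nonneg _)
    rw [abs_mul, abs_mul, abs_neg, abs_of_pos hc0, abs_of_pos (by norm_num : (0 : ℝ) < 2)]
  have e : -1 / (4 * nuT ν) = -c := by rw [hc, neg_div]
  rw [hermiteFun_eq, e, abs_mul, abs_mul, abs_mul, abs_of_nonneg (by positivity : 0 ≤ 1 / s),
    Nat.abs_cast, abs_of_pos (Real.exp_pos _)]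
  calc _ ≤ 1 / s * (k.factorial * (B * Real.exp (2 * c * |ξ|)) * Real.exp (-c * ξ ^ 2)) := by
        gcongr
    _ = 1 / s * (k.factorial * B * Real.exp (2 * c * |ξ| + -c * ξ ^ 2)) := by
        rw [Real.exp_add]; ring
    _ ≤ 1 / s * (k.factorial * B * Real.exp ((2 * c + 1) ^ 2 / (4 * c) + -|ξ|)) := by
        refine mul_le_mul_of_nonneg_left (mul_le_mul_of_nonneg_left (Real.exp_le_exp.2 ?_)
          (by positivity)) (by positivity)
        rw [← sq_abs ξ]
        have : (2 * c + 1) ^ 2 / (4 * c) - (2 * c * |ξ| + |ξ|) + c * |ξ| ^ 2 =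
            (2 * c + 1 - 2 * c * |ξ|) ^ 2 / (4 * c) := by
          field_simp; ring
        have h2 : 0 ≤ (2 * c + 1 - 2 * c * |ξ|) ^ 2 / (4 * c) := by positivity
        linarith
    _ = _ := by rw [Real.exp_add]; ring

theorem memL2m_hermiteFun {ν : ℝ} (hν : 0 < ν) (k : ℕ) (m : ℝ) : MemL2m m (hermiteFun ν k) := by
  obtain ⟨C, hC, h⟩ := exists_hermiteFun_le hν k
  refine ((memL2m_exp_neg_abs m).of_abs_le
    (contDiff_hermiteFun ν k).continuous.aestronglyMeasurable hC (Eventually.of_forall fun ξ => ?_)).1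
  simpa using h ξ

/-- On the slow manifold the Hermite expansion solves the enhanced diffusion equation up to
`O(e^{-τ})`. -/
theorem slowManifold_diffusion {ν : ℝ} (hν : 0 < ν) (N : ℕ) (m : ℝ) :
    ∃ K : ℝ, ∀ α β : ℝ → Fin (N + 1) → ℝ,
      SolvesODE ν α β → LiesOn (slowManifold ν N) α β → ∀ τ : ℝ, 0 < τ →
        (∀ ξ : ℝ, DifferentiableAt ℝ (fun s => hermiteSum ν (α s) ξ) τ) ∧
        MemL2m m (fun ξ =>
          deriv (fun s => hermiteSum ν (α s) ξ) τ - opLT ν (hermiteSum ν (α τ)) ξ) ∧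
        normL2m m (fun ξ =>
          deriv (fun s => hermiteSum ν (α s) ξ) τ - opLT ν (hermiteSum ν (α τ)) ξ)
          ≤ K * Real.exp (-τ) * ‖α τ‖ := by
  obtain ⟨K, hK⟩ := slowManifold_drive_le ν N
  choose B hB0 hB using fun k : ℕ => exists_hermiteFun_le hν k
  set G : ℝ := normL2m m (fun ξ => Real.exp (-|ξ|))
  have hG : 0 ≤ G := Real.sqrt_nonneg _
  set B' : ℝ := ∑ k : Fin (N + 1), B k
  have hB' : 0 ≤ B' := Finset.sum_nonneg fun k _ => hB0 k
  refine ⟨|K| * B' * G, fun α β hs hl τ hτ => ?_⟩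
  have hd : ∀ ξ, HasDerivAt (fun s => hermiteSum ν (α s) ξ)
      (∑ k : Fin (N + 1), (-((k : ℝ) / 2) * α τ k - (1 / ν * lag (α τ) k + lag (β τ) k)) *
        hermiteFun ν k ξ) τ := fun ξ =>
    HasDerivAt.fun_sum fun k _ =>
      (((hs τ hτ.le k).1.hasDerivAt (Ici_mem_nhds hτ)).mul_const (hermiteFun ν k ξ))
  have he : (fun ξ => deriv (fun s => hermiteSum ν (α s) ξ) τ - opLT ν (hermiteSum ν (α τ)) ξ) =
      fun ξ => ∑ k : Fin (N + 1), -(1 / ν * lag (α τ) k + lag (β τ) k) * hermiteFun ν k ξ := by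
    funext ξ
    rw [(hd ξ).deriv, opLT_hermiteSum hν, ← Finset.sum_sub_distrib]
    exact Finset.sum_congr rfl fun k _ => by ring
  rw [he]
  have hb := (memL2m_exp_neg_abs m).of_abs_le (C := |K| * Real.exp (-τ) * ‖α τ‖ * B')
    (f := fun ξ => ∑ k : Fin (N + 1), -(1 / ν * lag (α τ) k + lag (β τ) k) * hermiteFun ν k ξ)
    (Continuous.aestronglyMeasurable (continuous_finsetSum _ fun k _ =>
      continuous_const.mul (contDiff_hermiteFun ν k).continuous)) (by positivity)
    (Eventually.of_forall fun ξ => by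
      rw [abs_of_pos (Real.exp_pos _), Finset.mul_sum, Finset.sum_mul]
      refine (Finset.abs_sum_le_sum_abs _ _).trans (Finset.sum_le_sum fun k _ => ?_)
      rw [abs_mul, abs_neg, mul_assoc _ (B k)]
      refine mul_le_mul ((hK α β hl τ hτ.le k).trans ?_) (hB k ξ) (abs_nonneg _) (by positivity)
      gcongr
      exact le_abs_self K)
  refine ⟨fun ξ => (hd ξ).differentiableAt, hb.1, hb.2.trans (le_of_eq ?_)⟩
  ring

end Hermite
end
end TaylorDispersion

namespace TaylorDispersion
noncomputable section
section Multipliers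

/-! ### The fundamental solution of `S'' = -ν S' - k² S` -/

/-- The generator of `(S, S')` for `S'' = -ν S' - k² S`. -/
def oscGen (ν : ℝ) (k : ℂ) : (ℂ × ℂ) →L[ℂ] (ℂ × ℂ) :=
  ((ContinuousLinearMap.snd ℂ ℂ ℂ).prod (-(ν : ℂ) • ContinuousLinearMap.snd ℂ ℂ ℂ)) +
    k ^ 2 • ((0 : (ℂ × ℂ) →L[ℂ] ℂ).prod (-ContinuousLinearMap.fst ℂ ℂ ℂ))

theorem oscGen_apply (ν : ℝ) (k : ℂ) (p : ℂ × ℂ) :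
    oscGen ν k p = (p.2, -ν * p.2 - k ^ 2 * p.1) := by
  ext
  · simp [oscGen]
  · simp [oscGen]; ring

/-- The propagator of the oscillator. -/
def oscFlow (ν t : ℝ) (k : ℂ) : ℂ × ℂ := NormedSpace.exp (t • oscGen ν k) (0, 1)

/-- The solution `S` of `S'' = -ν S' - k² S` with `S(0) = 0`, `S'(0) = 1`. -/
def oscS (ν t : ℝ) (k : ℂ) : ℂ := (oscFlow ν t k).1

/-- Its derivative. -/
def oscD (ν t : ℝ) (k : ℂ) : ℂ := (oscFlow ν t k).2

/-- The combination `S' + ν S`. -/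
def oscC (ν t : ℝ) (k : ℂ) : ℂ := oscD ν t k + ν * oscS ν t k

variable {ν : ℝ} {k : ℂ}

theorem hasDerivAt_oscFlow (ν t : ℝ) (k : ℂ) :
    HasDerivAt (fun t => oscFlow ν t k) (oscD ν t k, -ν * oscD ν t k - k ^ 2 * oscS ν t k) t := by
  have h1 := hasDerivAt_exp_smul_const' (𝕂 := ℝ) (oscGen ν k) t
  have h2 := ((ContinuousLinearMap.apply ℂ (ℂ × ℂ) ((0, 1) : ℂ × ℂ)).restrictScalars
    ℝ).hasFDerivAt.comp_hasDerivAt t h1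
  refine h2.congr_deriv ?_
  change oscGen ν k (oscFlow ν t k) = _
  rw [oscGen_apply]
  rfl

theorem hasDerivAt_oscS (ν t : ℝ) (k : ℂ) :
    HasDerivAt (fun t => oscS ν t k) (oscD ν t k) t :=
  (hasDerivAt_oscFlow ν t k).fst

theorem hasDerivAt_oscD (ν t : ℝ) (k : ℂ) :
    HasDerivAt (fun t => oscD ν t k) (-ν * oscD ν t k - k ^ 2 * oscS ν t k) t :=
  (hasDerivAt_oscFlow ν t k).snd

theorem hasDerivAt_oscC (ν t : ℝ) (k : ℂ) :
    HasDerivAt (fun t => oscC ν t k) (-(k ^ 2 * oscS ν t k)) t :=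
  ((hasDerivAt_oscD ν t k).add ((hasDerivAt_oscS ν t k).const_mul (ν : ℂ))).congr_deriv (by ring)

@[simp] theorem oscFlow_zero (ν : ℝ) (k : ℂ) : oscFlow ν 0 k = (0, 1) := by
  have h : (0 : ℝ) • oscGen ν k = 0 := by
    ext <;> simp
  rw [oscFlow, h, NormedSpace.exp_zero]
  rfl

@[simp] theorem oscS_zero (ν : ℝ) (k : ℂ) : oscS ν 0 k = 0 := by simp [oscS]

@[simp] theorem oscD_zero (ν : ℝ) (k : ℂ) : oscD ν 0 k = 1 := by simp [oscD]

@[simp] theorem oscC_zero (ν : ℝ) (k : ℂ) : oscC ν 0 k = 1 := by simp [oscC]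

theorem differentiable_oscFlow (ν t : ℝ) : Differentiable ℂ (oscFlow ν t) := by
  have h1 : Differentiable ℂ (NormedSpace.exp : ((ℂ × ℂ) →L[ℂ] (ℂ × ℂ)) → _) := fun x =>
    (NormedSpace.exp_analytic x).differentiableAt
  have h2 : Differentiable ℂ (fun k => t • oscGen ν k) := by
    unfold oscGen; fun_prop
  exact fun k => ((h1.comp h2) k).clm_apply (differentiableAt_const _)

theorem differentiable_oscS (ν t : ℝ) : Differentiable ℂ (oscS ν t) :=
  (differentiable_oscFlow ν t).fst

theorem differentiable_oscD (ν t : ℝ) : Differentiable ℂ (oscD ν t) :=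
  (differentiable_oscFlow ν t).snd

theorem differentiable_oscC (ν t : ℝ) : Differentiable ℂ (oscC ν t) :=
  (differentiable_oscD ν t).add ((differentiable_oscS ν t).const_mul _)

theorem continuous_oscFlow (ν : ℝ) : Continuous fun p : ℝ × ℂ => oscFlow ν p.1 p.2 := by
  have h1 : Continuous (NormedSpace.exp : ((ℂ × ℂ) →L[ℂ] (ℂ × ℂ)) → _) :=
    continuous_iff_continuousAt.2 fun x =>
      (NormedSpace.exp_analytic (𝕂 := ℂ) x).continuousAt
  have h2 : Continuous (fun p : ℝ × ℂ => p.1 • oscGen ν p.2) := by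
    unfold oscGen; fun_prop
  exact (h1.comp h2).clm_apply continuous_const

theorem continuous_oscS (ν : ℝ) : Continuous fun p : ℝ × ℂ => oscS ν p.1 p.2 :=
  (continuous_oscFlow ν).fst

theorem continuous_oscD (ν : ℝ) : Continuous fun p : ℝ × ℂ => oscD ν p.1 p.2 :=
  (continuous_oscFlow ν).snd

theorem continuous_oscC (ν : ℝ) : Continuous fun p : ℝ × ℂ => oscC ν p.1 p.2 :=
  (continuous_oscD ν).add (continuous_const.mul (continuous_oscS ν))

/-! ### Bounds -/

/-- The energy estimate for `w' = -ik v`, `v' = -ν v - ik w`. -/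
theorem energy_le (hν : 0 < ν) {w v : ℝ → ℂ}
    (hw : ∀ t, HasDerivAt w (-(Complex.I * k) * v t) t)
    (hv : ∀ t, HasDerivAt v (-ν * v t - Complex.I * k * w t) t) {t : ℝ} (ht : 0 ≤ t) :
    ‖w t‖ ^ 2 + ‖v t‖ ^ 2 ≤ Real.exp (2 * (k.im ^ 2 / ν) * t) * (‖w 0‖ ^ 2 + ‖v 0‖ ^ 2) := by
  set g : ℝ → ℝ := fun s => Real.exp (-(2 * (k.im ^ 2 / ν) * s)) * (‖w s‖ ^ 2 + ‖v s‖ ^ 2)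
  have hg : ∀ s, HasDerivAt g (Real.exp (-(2 * (k.im ^ 2 / ν) * s)) *
      (-(2 * (k.im ^ 2 / ν) * 1)) * (‖w s‖ ^ 2 + ‖v s‖ ^ 2) +
      Real.exp (-(2 * (k.im ^ 2 / ν) * s)) * (2 * inner ℝ (w s) (-(Complex.I * k) * v s) +
        2 * inner ℝ (v s) (-ν * v s - Complex.I * k * w s))) s := fun s =>
    (((hasDerivAt_id s).const_mul _).neg.exp).mul ((hw s).norm_sq.add (hv s).norm_sq)
  have hanti : AntitoneOn g univ := by
    refine antitoneOn_of_deriv_nonpos convex_univ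
      (fun s _ => (hg s).continuousAt.continuousWithinAt)
      (fun s _ => (hg s).differentiableAt.differentiableWithinAt) fun s _ => ?_
    rw [(hg s).deriv, mul_assoc, ← mul_add]
    refine mul_nonpos_of_nonneg_of_nonpos (Real.exp_pos _).le ?_
    have e1 : ∀ x : ℂ, ‖x‖ ^ 2 = x.re ^ 2 + x.im ^ 2 := fun x => by
      rw [Complex.sq_norm, Complex.normSq_apply]; ring
    rw [e1, e1]
    simp only [Complex.inner, Complex.mul_re, Complex.mul_im, Complex.neg_re, Complex.neg_im,
      Complex.sub_re, Complex.sub_im, Complex.I_re, Complex.I_im, Complex.conj_re, Complex.conj_im,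
      Complex.ofReal_re, Complex.ofReal_im]
    set b := k.im
    have h1 : b ^ 2 / ν * ν = b ^ 2 := by field_simp
    have h2 : 0 ≤ b ^ 2 / ν := by positivity
    have h3 : ∀ x y : ℝ, 2 * b * (x * y) ≤ b ^ 2 / ν * x ^ 2 + ν * y ^ 2 := fun x y => by
      have : b ^ 2 / ν * x ^ 2 + ν * y ^ 2 - 2 * b * (x * y) = (b * x - ν * y) ^ 2 / ν := by
        field_simp; ring
      have h4 : 0 ≤ (b * x - ν * y) ^ 2 / ν := by positivity
      linarith
    nlinarith [h3 (w s).re (v s).re, h3 (w s).im (v s).im, mul_nonneg h2 (sq_nonneg (v s).re),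
      mul_nonneg h2 (sq_nonneg (v s).im)]
  have h0 := hanti (mem_univ 0) (mem_univ t) ht
  simp only [g, mul_zero, neg_zero, Real.exp_zero, one_mul] at h0
  calc _ = Real.exp (2 * (k.im ^ 2 / ν) * t) *
        (Real.exp (-(2 * (k.im ^ 2 / ν) * t)) * (‖w t‖ ^ 2 + ‖v t‖ ^ 2)) := by
        rw [← mul_assoc, ← Real.exp_add, add_neg_cancel, Real.exp_zero, one_mul]
    _ ≤ _ := mul_le_mul_of_nonneg_left h0 (Real.exp_pos _).le

/-- The growth factor of the complex-frequency propagators. -/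
def oscBound (ν t : ℝ) (k : ℂ) : ℝ := Real.exp (k.im ^ 2 / ν * t)

theorem oscBound_sq (ν t : ℝ) (k : ℂ) :
    oscBound ν t k ^ 2 = Real.exp (2 * (k.im ^ 2 / ν) * t) := by
  rw [oscBound, ← Real.exp_nat_mul]; congr 1; push_cast; ring

theorem oscBound_pos (ν t : ℝ) (k : ℂ) : 0 < oscBound ν t k := Real.exp_pos _

theorem norm_oscC_le (hν : 0 < ν) {t : ℝ} (ht : 0 ≤ t) : ‖oscC ν t k‖ ≤ oscBound ν t k := by
  have h := energy_le hν (k := k) (w := fun t => oscC ν t k)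
    (v := fun t => -(Complex.I * k) * oscS ν t k)
    (fun t => (hasDerivAt_oscC ν t k).congr_deriv (by
      linear_combination -(k ^ 2 * oscS ν t k) * Complex.I_sq))
    (fun t => ((hasDerivAt_oscS ν t k).const_mul _).congr_deriv (by simp only [oscC]; ring)) ht
  simp only [oscC_zero, oscS_zero, mul_zero, norm_zero, norm_one] at h
  rw [← oscBound_sq] at h
  exact (sq_le_sq₀ (norm_nonneg _) (oscBound_pos _ _ _).le).1 (by nlinarith [sq_nonneg ‖-(Complex.I * k) * oscS ν t k‖])

theorem norm_oscS_mul_le (hν : 0 < ν) {t : ℝ} (ht : 0 ≤ t) :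
    ‖k * oscS ν t k‖ ≤ oscBound ν t k ∧ ‖oscD ν t k‖ ≤ oscBound ν t k := by
  have h := energy_le hν (k := k) (w := fun t => -(Complex.I * k) * oscS ν t k)
    (v := fun t => oscD ν t k)
    (fun t => (hasDerivAt_oscS ν t k).const_mul _)
    (fun t => (hasDerivAt_oscD ν t k).congr_deriv (by
      linear_combination -(k ^ 2 * oscS ν t k) * Complex.I_sq)) ht
  simp only [oscD_zero, oscS_zero, mul_zero, norm_zero, norm_one] at h
  rw [← oscBound_sq] at h
  have e : ‖-(Complex.I * k) * oscS ν t k‖ = ‖k * oscS ν t k‖ := by simp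
  rw [e] at h
  constructor
  · exact (sq_le_sq₀ (norm_nonneg _) (oscBound_pos _ _ _).le).1 (by nlinarith [sq_nonneg ‖oscD ν t k‖])
  · exact (sq_le_sq₀ (norm_nonneg _) (oscBound_pos _ _ _).le).1 (by nlinarith [sq_nonneg ‖k * oscS ν t k‖])

/-- A damped scalar equation `y' = -ν y + g` with `|g| ≤ G e^{ct}`. -/
theorem damped_le (hν : 0 < ν) {y g : ℝ → ℂ} {G c : ℝ} (hG : 0 ≤ G) (hc : 0 ≤ c)
    (hy : ∀ t, HasDerivAt y (-ν * y t + g t) t) (hg : ∀ t, 0 ≤ t → ‖g t‖ ≤ G * Real.exp (c * t))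
    {t : ℝ} (ht : 0 ≤ t) : ‖y t‖ ≤ Real.exp (-ν * t) * ‖y 0‖ + G / ν * Real.exp (c * t) := by
  have he : ∀ s : ℝ, HasDerivAt (fun s : ℝ => (Real.exp (ν * s) : ℂ))
      ((Real.exp (ν * s) * (ν * 1) : ℝ) : ℂ) s := fun s =>
    HasDerivAt.ofReal_comp (((hasDerivAt_id s).const_mul ν).exp)
  have h := norm_le_of_norm_deriv_le (f := fun s => (Real.exp (ν * s) : ℂ) * y s)
    (B := fun s => G / ν * Real.exp ((ν + c) * s))
    (f' := fun s => (Real.exp (ν * s) : ℂ) * g s)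
    (B' := fun s => G / ν * (Real.exp ((ν + c) * s) * ((ν + c) * 1)))
    (fun s _ => (((he s).mul (hy s)).congr_deriv (by push_cast; ring)).hasDerivWithinAt)
    (fun s _ => ((((hasDerivAt_id s).const_mul (ν + c)).exp).const_mul (G / ν)).hasDerivWithinAt)
    (fun s hs => by
      rw [norm_mul, Complex.norm_real, Real.norm_of_nonneg (Real.exp_pos _).le]
      calc _ ≤ Real.exp (ν * s) * (G * Real.exp (c * s)) :=
            mul_le_mul_of_nonneg_left (hg s hs) (Real.exp_pos _).le
        _ = G * Real.exp ((ν + c) * s) := by rw [add_mul, Real.exp_add]; ring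
        _ ≤ G / ν * (ν + c) * Real.exp ((ν + c) * s) := by
            refine mul_le_mul_of_nonneg_right ?_ (Real.exp_pos _).le
            rw [div_mul_eq_mul_div, le_div_iff₀ hν]
            nlinarith
        _ = _ := by ring) t ht
  simp only [mul_zero, Real.exp_zero, Complex.ofReal_one, one_mul, mul_one] at h
  rw [norm_mul, Complex.norm_real, Real.norm_of_nonneg (Real.exp_pos _).le] at h
  have h2 : 0 ≤ G / ν := by positivity
  calc ‖y t‖ = Real.exp (-ν * t) * (Real.exp (ν * t) * ‖y t‖) := by
        rw [← mul_assoc, ← Real.exp_add]; simp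
    _ ≤ Real.exp (-ν * t) * (‖y 0‖ + G / ν * Real.exp ((ν + c) * t)) :=
        mul_le_mul_of_nonneg_left (by linarith) (Real.exp_pos _).le
    _ = Real.exp (-ν * t) * ‖y 0‖ + G / ν * (Real.exp (-ν * t) * Real.exp ((ν + c) * t)) := by
        ring
    _ = _ := by rw [← Real.exp_add]; congr 3; ring

theorem norm_oscS_le (hν : 0 < ν) {t : ℝ} (ht : 0 ≤ t) :
    ‖oscS ν t k‖ ≤ 1 / ν * oscBound ν t k := by
  have h := damped_le hν (y := fun t => oscS ν t k) (g := fun t => oscC ν t k) (G := 1)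
    (c := k.im ^ 2 / ν) zero_le_one (by positivity)
    (fun t => (hasDerivAt_oscS ν t k).congr_deriv (by simp only [oscC]; ring))
    (fun t ht => by simpa [oscBound] using norm_oscC_le hν (k := k) ht) ht
  simpa [oscBound] using h

theorem norm_oscD_le (hν : 0 < ν) {t : ℝ} (ht : 0 ≤ t) :
    ‖oscD ν t k‖ ≤ Real.exp (-ν * t) + ‖k‖ ^ 2 / ν ^ 2 * oscBound ν t k := by
  have h := damped_le hν (y := fun t => oscD ν t k) (g := fun t => -(k ^ 2 * oscS ν t k))
    (G := ‖k‖ ^ 2 / ν) (c := k.im ^ 2 / ν) (by positivity) (by positivity)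
    (fun t => (hasDerivAt_oscD ν t k).congr_deriv (by ring))
    (fun t ht => by
      rw [norm_neg, norm_mul, norm_pow]
      calc _ ≤ ‖k‖ ^ 2 * (1 / ν * oscBound ν t k) := by
            gcongr; exact norm_oscS_le hν ht
        _ = _ := by rw [oscBound]; ring) ht
  simp only [oscD_zero, norm_one, mul_one] at h
  refine h.trans (le_of_eq ?_)
  rw [oscBound]; field_simp

end Multipliers
end
end TaylorDispersion

namespace TaylorDispersion
noncomputable section
section Synthesis

/-! ### Fourier synthesis of functions that are analytic in a strip -/

/-- `(1/2π) ∫ H(κ) e^{iκξ} dκ`. -/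
def syn (H : ℝ → ℂ) (ξ : ℝ) : ℂ :=
  (1 / (2 * Real.pi) : ℂ) * ∫ κ : ℝ, H κ * Complex.exp (Complex.I * κ * ξ)

/-- `H` is entire with `|H(κ)| ≤ B e^{-c (Re κ)²}` in the strip `|Im κ| ≤ 1`. -/
structure StripBound (c B : ℝ) (H : ℂ → ℂ) : Prop where
  differentiable : Differentiable ℂ H
  le : ∀ κ : ℂ, |κ.im| ≤ 1 → ‖H κ‖ ≤ B * Real.exp (-c * κ.re ^ 2)

variable {c B : ℝ} {H : ℂ → ℂ}

theorem StripBound.nonneg (h : StripBound c B H) : 0 ≤ B := by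
  have := (norm_nonneg _).trans (h.le 0 (by simp))
  simpa using this

theorem StripBound.real_le (h : StripBound c B H) (x : ℝ) : ‖H x‖ ≤ B * Real.exp (-c * x ^ 2) := by
  simpa using h.le x (by simp)

theorem StripBound.continuous (h : StripBound c B H) : Continuous fun x : ℝ => H x :=
  h.differentiable.continuous.comp Complex.continuous_ofReal

theorem StripBound.integrable (hc : 0 < c) (h : StripBound c B H) :
    Integrable fun x : ℝ => H x :=
  ((integrable_exp_neg_mul_sq hc).const_mul B).mono' h.continuous.aestronglyMeasurable
    (Eventually.of_forall h.real_le)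

/-- Shift of the path of integration. -/
theorem StripBound.integral_shift (hc : 0 < c) (h : StripBound c B H) {s : ℝ} (hs : |s| ≤ 1) :
    ∫ x : ℝ, H (x + s * Complex.I) = ∫ x : ℝ, H x := by
  have him : ∀ x : ℝ, ∀ y : ℝ, ((x : ℂ) + y * Complex.I).im = y := fun x y => by simp
  have hre : ∀ x : ℝ, ∀ y : ℝ, ((x : ℂ) + y * Complex.I).re = x := fun x y => by simp
  have hi : Integrable fun x : ℝ => H (x + s * Complex.I) := by
    refine ((integrable_exp_neg_mul_sq hc).const_mul B).mono'
      (h.differentiable.continuous.comp (by fun_prop)).aestronglyMeasurable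
      (Eventually.of_forall fun x => ?_)
    simpa only [hre] using h.le (x + s * Complex.I) (by rwa [him])
  have hv : ∀ T : ℝ, ‖∫ y : ℝ in (0 : ℝ)..s, H (T + y * Complex.I)‖ ≤
      B * Real.exp (-c * T ^ 2) * |s - 0| := fun T =>
    intervalIntegral.norm_integral_le_of_norm_le_const fun y hy => by
      have hy1 : |y| ≤ 1 := by
        have := abs_sub_left_of_mem_uIcc (uIoc_subset_uIcc hy)
        simp only [sub_zero] at this
        exact this.trans hs
      simpa only [hre] using h.le (T + y * Complex.I) (by rwa [him])
  have h0 : Tendsto (fun T : ℝ => B * Real.exp (-c * T ^ 2) * |s - 0|) atTop (𝓝 0) := by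
    have : Tendsto (fun T : ℝ => Real.exp (-c * T ^ 2)) atTop (𝓝 0) := by
      refine Real.tendsto_exp_atBot.comp ?_
      exact (tendsto_pow_atTop two_ne_zero).const_mul_atTop_of_neg (by linarith)
    simpa using (this.const_mul B).mul_const |s - 0|
  have hv1 : Tendsto (fun T : ℝ => ∫ y : ℝ in (0 : ℝ)..s, H (T + y * Complex.I)) atTop (𝓝 0) :=
    squeeze_zero_norm hv h0
  have hv2 : Tendsto (fun T : ℝ => ∫ y : ℝ in (0 : ℝ)..s, H ((-T : ℝ) + y * Complex.I)) atTop
      (𝓝 0) :=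
    squeeze_zero_norm (fun T => (hv (-T)).trans (by rw [neg_sq])) h0
  have hrect : ∀ T : ℝ, (∫ x : ℝ in -T..T, H x) - (∫ x : ℝ in -T..T, H (x + s * Complex.I)) +
      Complex.I * (∫ y : ℝ in (0 : ℝ)..s, H (T + y * Complex.I)) -
      Complex.I * (∫ y : ℝ in (0 : ℝ)..s, H ((-T : ℝ) + y * Complex.I)) = 0 := fun T => by
    have := Complex.integral_boundary_rect_eq_zero_of_differentiableOn H ((-T : ℝ) : ℂ)
      (T + s * Complex.I) h.differentiable.differentiableOn
    simpa using this
  have hl := (((intervalIntegral_tendsto_integral (h.integrable hc) tendsto_neg_atTop_atBot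
    tendsto_id).sub (intervalIntegral_tendsto_integral hi tendsto_neg_atTop_atBot
    tendsto_id)).add (hv1.const_mul Complex.I)).sub (hv2.const_mul Complex.I)
  simp only [id, hrect, mul_zero, add_zero, sub_zero] at hl
  exact (sub_eq_zero.1 (tendsto_nhds_unique tendsto_const_nhds hl).symm).symm

/-- The constant in the Paley–Wiener estimate. -/
def pwConst (c : ℝ) : ℝ := 1 / (2 * Real.pi) * Real.sqrt (Real.pi / c)

theorem pwConst_nonneg (c : ℝ) : 0 ≤ pwConst c := by unfold pwConst; positivity

/-- Exponential decay of the synthesis of a function analytic in a strip. -/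
theorem StripBound.norm_syn_le (hc : 0 < c) (h : StripBound c B H) (ξ : ℝ) :
    ‖syn (fun κ => H κ) ξ‖ ≤ B * pwConst c * Real.exp (-|ξ|) := by
  obtain ⟨s, hs, hsξ⟩ : ∃ s : ℝ, |s| ≤ 1 ∧ s * ξ = |ξ| := by
    rcases le_total 0 ξ with h0 | h0
    · exact ⟨1, by simp, by rw [abs_of_nonneg h0, one_mul]⟩
    · exact ⟨-1, by simp, by rw [abs_of_nonpos h0]; ring⟩
  have hn : ∀ κ : ℂ, ‖H κ * Complex.exp (Complex.I * κ * ξ)‖ =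
      ‖H κ‖ * Real.exp (-(κ.im * ξ)) := fun κ => by
    rw [norm_mul, Complex.norm_exp]
    congr 2
    simp
  have hg : StripBound c (B * Real.exp |ξ|) (fun κ => H κ * Complex.exp (Complex.I * κ * ξ)) := by
    refine ⟨h.differentiable.mul (by fun_prop), fun κ hκ => ?_⟩
    rw [hn]
    calc _ ≤ (B * Real.exp (-c * κ.re ^ 2)) * Real.exp |ξ| := by
          refine mul_le_mul (h.le κ hκ) (Real.exp_le_exp.2 ?_) (Real.exp_pos _).le
            (mul_nonneg h.nonneg (Real.exp_pos _).le)
          calc -(κ.im * ξ) ≤ |κ.im * ξ| := neg_le_abs _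
            _ = |κ.im| * |ξ| := abs_mul _ _
            _ ≤ 1 * |ξ| := by gcongr
            _ = |ξ| := one_mul _
      _ = _ := by ring
  have hint : ‖∫ κ : ℝ, H κ * Complex.exp (Complex.I * κ * ξ)‖ ≤
      ∫ x : ℝ, B * Real.exp (-|ξ|) * Real.exp (-c * x ^ 2) := by
    rw [← hg.integral_shift hc hs]
    refine norm_integral_le_of_norm_le ((integrable_exp_neg_mul_sq hc).const_mul _)
      (Eventually.of_forall fun x => ?_)
    rw [hn]
    have := h.le (x + s * Complex.I) (by simpa using hs)
    simp only [Complex.add_re, Complex.ofReal_re, Complex.mul_re, Complex.I_re, mul_zero,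
      Complex.ofReal_im, Complex.I_im, mul_one, sub_zero, add_zero, Complex.add_im, Complex.mul_im,
      zero_add] at this ⊢
    rw [hsξ]
    calc _ ≤ (B * Real.exp (-c * x ^ 2)) * Real.exp (-|ξ|) :=
          mul_le_mul_of_nonneg_right this (Real.exp_pos _).le
      _ = _ := by ring
  rw [integral_const_mul, integral_gaussian] at hint
  rw [syn, norm_mul, pwConst]
  have h2 : ‖(1 / (2 * Real.pi) : ℂ)‖ = 1 / (2 * Real.pi) := by
    simp [abs_of_pos Real.pi_pos]
  rw [h2]
  calc _ ≤ 1 / (2 * Real.pi) * (B * Real.exp (-|ξ|) * Real.sqrt (Real.pi / c)) := by gcongr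
    _ = _ := by ring

/-- Multiplication by a factor of exponential growth. -/
theorem StripBound.mul_exp_type (hc : 0 < c) (h : StripBound c B H) {P : ℂ → ℂ} {A a : ℝ}
    (ha : 0 ≤ a) (hA : 0 ≤ A)
    (hP : Differentiable ℂ P) (hle : ∀ κ : ℂ, |κ.im| ≤ 1 → ‖P κ‖ ≤ A * Real.exp (a * ‖κ‖)) :
    StripBound (c / 2) (B * A * Real.exp (a + a ^ 2 / (2 * c))) (fun κ => H κ * P κ) := by
  refine ⟨h.differentiable.mul hP, fun κ hκ => ?_⟩
  rw [norm_mul]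
  have h1 : ‖κ‖ ≤ |κ.re| + 1 := (Complex.norm_le_abs_re_add_abs_im κ).trans (by linarith)
  have h2 : a * ‖κ‖ + -c * κ.re ^ 2 ≤ a + a ^ 2 / (2 * c) + -(c / 2) * κ.re ^ 2 := by
    have h3 : a ^ 2 / (2 * c) - a * |κ.re| + c / 2 * |κ.re| ^ 2 =
        (a - c * |κ.re|) ^ 2 / (2 * c) := by field_simp; ring
    have h4 : 0 ≤ (a - c * |κ.re|) ^ 2 / (2 * c) := by positivity
    have h5 := mul_le_mul_of_nonneg_left h1 ha
    rw [sq_abs] at h3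
    nlinarith
  calc _ ≤ (B * Real.exp (-c * κ.re ^ 2)) * (A * Real.exp (a * ‖κ‖)) :=
        mul_le_mul (h.le κ hκ) (hle κ hκ) (norm_nonneg _)
          (mul_nonneg h.nonneg (Real.exp_pos _).le)
    _ = B * A * Real.exp (a * ‖κ‖ + -c * κ.re ^ 2) := by rw [Real.exp_add]; ring
    _ ≤ B * A * Real.exp (a + a ^ 2 / (2 * c) + -(c / 2) * κ.re ^ 2) := by
        have := h.nonneg
        gcongr
    _ = _ := by rw [Real.exp_add]; ring

theorem integrable_mul_exp {G : ℝ → ℂ} (hG : Integrable G) (ξ : ℝ) :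
    Integrable fun κ : ℝ => G κ * Complex.exp (Complex.I * κ * ξ) := by
  refine hG.mono (hG.1.mul (by fun_prop)) (Eventually.of_forall fun κ => ?_)
  rw [norm_mul, Complex.norm_exp]
  simp

theorem syn_sub {F G : ℝ → ℂ} (hF : Integrable F) (hG : Integrable G) (ξ : ℝ) :
    syn (fun κ => F κ - G κ) ξ = syn F ξ - syn G ξ := by
  rw [syn, syn, syn, ← mul_sub, ← integral_sub (integrable_mul_exp hF ξ) (integrable_mul_exp hG ξ)]
  simp only [sub_mul]

theorem syn_add {F G : ℝ → ℂ} (hF : Integrable F) (hG : Integrable G) (ξ : ℝ) :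
    syn (fun κ => F κ + G κ) ξ = syn F ξ + syn G ξ := by
  rw [syn, syn, syn, ← mul_add, ← integral_add (integrable_mul_exp hF ξ) (integrable_mul_exp hG ξ)]
  simp only [add_mul]

theorem syn_const_mul (a : ℂ) (F : ℝ → ℂ) (ξ : ℝ) :
    syn (fun κ => a * F κ) ξ = a * syn F ξ := by
  simp only [syn, mul_assoc, integral_const_mul]
  ring

theorem syn_mul_exp (F : ℝ → ℂ) (η ξ : ℝ) :
    syn (fun κ => F κ * Complex.exp (-(Complex.I * κ * η))) ξ = syn F (ξ - η) := by
  simp only [syn, mul_assoc, ← Complex.exp_add]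
  congr 1
  refine integral_congr_ae (Eventually.of_forall fun κ => ?_)
  simp only
  congr 2
  push_cast
  ring

theorem continuous_syn {G : ℝ → ℂ} (hG : Integrable G) : Continuous (syn G) := by
  refine continuous_const.mul (continuous_of_dominated (bound := fun κ => ‖G κ‖)
    (fun ξ => (integrable_mul_exp hG ξ).1) (fun ξ => Eventually.of_forall fun κ => ?_) hG.norm
    (Eventually.of_forall fun κ => by fun_prop))
  rw [norm_mul, Complex.norm_exp]
  simp

theorem syn_comp_mul (F : ℝ → ℂ) {a : ℝ} (ha : 0 < a) (ξ : ℝ) :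
    syn (fun κ => F (a * κ)) (a * ξ) = (1 / a : ℂ) * syn F ξ := by
  have h := Measure.integral_comp_mul_left
    (fun κ : ℝ => F κ * Complex.exp (Complex.I * κ * ξ)) a
  simp only [syn]
  have e : (fun κ : ℝ => F (a * κ) * Complex.exp (Complex.I * κ * (a * ξ : ℝ))) =
      fun κ : ℝ => F (a * κ) * Complex.exp (Complex.I * (a * κ : ℝ) * ξ) := by
    funext κ; congr 2; push_cast; ring
  rw [e, h, abs_of_pos (inv_pos.2 ha), Complex.real_smul]
  push_cast
  ring

end Synthesis
end
end TaylorDispersion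

namespace TaylorDispersion
noncomputable section
section Remainder

open PowerSeries

/-! ### Fourier transforms of weighted functions and their Taylor remainders -/

/-- `∫ e^{-ikx} f(x) dx`. -/
def ft (f : ℝ → ℝ) (k : ℝ) : ℂ := ∫ x : ℝ, Complex.exp (-(Complex.I * k * x)) * f x

/-- The series `∑ (-1)^j/j! ∫ x^j f · X^j`, the Taylor series of the Fourier transform in `ik`. -/
def momentSeries (f : ℝ → ℝ) : ℝ⟦X⟧ :=
  mk fun j => (-1) ^ j / (j.factorial : ℝ) * ∫ x : ℝ, x ^ j * f x

/-- The value at `z` of the truncation of `F` at the order `N`. -/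
def evalTrunc (N : ℕ) (F : ℝ⟦X⟧) (z : ℂ) : ℂ :=
  ∑ j ∈ Finset.range (N + 1), ((coeff j F : ℝ) : ℂ) * z ^ j

/-- `e^w - ∑_{j ≤ N} w^j / j!`. -/
def expTail (N : ℕ) (w : ℂ) : ℂ :=
  Complex.exp w - ∑ j ∈ Finset.range (N + 1), w ^ j / (j.factorial : ℂ)

variable {m : ℝ} {N : ℕ} {f : ℝ → ℝ} {c : ℝ}

theorem MemL2m.of_integrable (hm : 0 ≤ m) (hf : AEStronglyMeasurable f volume)
    (h : Integrable (fun ξ : ℝ => (1 + ξ ^ 2) ^ m * f ξ ^ 2) volume) : MemL2m m f := by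
  refine ⟨(memLp_two_iff_integrable_sq hf).2 (h.mono' (hf.pow 2) ?_), h⟩
  refine Eventually.of_forall fun ξ => ?_
  rw [Real.norm_of_nonneg (sq_nonneg _)]
  exact le_mul_of_one_le_left (sq_nonneg _)
    (Real.one_le_rpow (by nlinarith [sq_nonneg ξ]) hm)

theorem MemL2m.integrable_pow (hm : (N : ℝ) + 1 / 2 < m) (hf : MemL2m m f) :
    Integrable fun x => (1 + |x|) ^ N * |f x| := by
  have h1 : Integrable fun x : ℝ => (1 + ‖x‖ ^ 2) ^ (-(2 * (m - N)) / 2) :=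
    integrable_rpow_neg_one_add_norm_sq (by
      rw [Module.finrank_self, Nat.cast_one]; linarith)
  refine ((h1.const_mul (2 ^ N)).add hf.2).mono' ?_ (Eventually.of_forall fun x => ?_)
  · exact (Continuous.aestronglyMeasurable (by fun_prop)).mul hf.1.1.norm
  · have hp : (0 : ℝ) < 1 + x ^ 2 := by positivity
    rw [Real.norm_of_nonneg (by positivity), Pi.add_apply, Real.norm_eq_abs, sq_abs,
      show -(2 * (m - N)) / 2 = (N : ℝ) - m by ring, Real.rpow_sub hp, Real.rpow_natCast]
    set P : ℝ := (1 + x ^ 2) ^ m with hP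
    have hP0 : 0 < P := by positivity
    have h2 : ((1 + |x|) ^ N) ^ 2 ≤ 2 ^ N * (1 + x ^ 2) ^ N := by
      rw [← pow_mul, mul_comm, pow_mul, ← mul_pow]
      refine pow_le_pow_left₀ (by positivity) ?_ N
      nlinarith [sq_abs x, sq_nonneg (|x| - 1)]
    have h3 : (1 + |x|) ^ N * |f x| ≤ ((1 + |x|) ^ N) ^ 2 / P + P * f x ^ 2 := by
      rw [← sq_abs (f x)]
      set a := (1 + |x|) ^ N
      have ha : 0 ≤ a := by positivity
      have : a ^ 2 / P + P * |f x| ^ 2 - 2 * (a * |f x|) = (a - P * |f x|) ^ 2 / P := by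
        field_simp; ring
      have h5 : 0 ≤ (a - P * |f x|) ^ 2 / P := by positivity
      have h6 : 0 ≤ a * |f x| := by positivity
      linarith
    refine h3.trans ?_
    rw [← mul_div_assoc]
    gcongr

theorem MemL2m.integrable_pow_mul (hm : (N : ℝ) + 1 / 2 < m) (hf : MemL2m m f) {j : ℕ}
    (hj : j ≤ N) : Integrable fun x => x ^ j * f x := by
  refine (hf.integrable_pow hm).mono' ((Continuous.aestronglyMeasurable (by fun_prop)).mul hf.1.1)
    (Eventually.of_forall fun x => ?_)
  rw [norm_mul, norm_pow, Real.norm_eq_abs, Real.norm_eq_abs]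
  refine mul_le_mul_of_nonneg_right ?_ (abs_nonneg _)
  exact (pow_le_pow_left₀ (abs_nonneg x) (by linarith) j).trans
    (pow_le_pow_right₀ (by linarith [abs_nonneg x]) hj)

theorem MemL2m.integrable (hm : (N : ℝ) + 1 / 2 < m) (hf : MemL2m m f) : Integrable f := by
  simpa using hf.integrable_pow_mul hm (Nat.zero_le N)

theorem continuous_ft (hf : Integrable f) : Continuous (ft f) := by
  refine continuous_of_dominated (bound := fun x => ‖f x‖)
    (fun k => (by fun_prop : Continuous _).aestronglyMeasurable.mul
      (Complex.continuous_ofReal.comp_aestronglyMeasurable hf.1))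
    (fun k => Eventually.of_forall fun x => ?_) hf.norm
    (Eventually.of_forall fun x => by fun_prop)
  rw [norm_mul, Complex.norm_exp]
  simp

theorem norm_ft_le (f : ℝ → ℝ) (k : ℝ) : ‖ft f k‖ ≤ ∫ x, |f x| := by
  refine (norm_integral_le_integral_norm _).trans (le_of_eq ?_)
  refine integral_congr_ae (Eventually.of_forall fun x => ?_)
  simp [Complex.norm_exp]

/-- The Taylor remainder of the Fourier transform. -/
theorem ft_sub_evalTrunc (hm : (N : ℝ) + 1 / 2 < m) (hf : MemL2m m f) (k : ℝ) :
    ft f k - evalTrunc N (momentSeries f) (Complex.I * k) =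
      ∫ x : ℝ, expTail N (-(Complex.I * k * x)) * f x := by
  have h1 : Integrable fun x : ℝ => Complex.exp (-(Complex.I * k * x)) * f x := by
    refine (hf.integrable hm).norm.mono' ((by fun_prop : Continuous _).aestronglyMeasurable.mul
      (Complex.continuous_ofReal.comp_aestronglyMeasurable hf.1.1))
      (Eventually.of_forall fun x => ?_)
    rw [norm_mul, Complex.norm_exp]
    simp
  have h2 : ∀ j ∈ Finset.range (N + 1), Integrable fun x : ℝ =>
      (-(Complex.I * k * x)) ^ j / (j.factorial : ℂ) * f x := fun j hj => by
    have := ((hf.integrable_pow_mul hm (Finset.mem_range_succ_iff.1 hj)).ofReal (𝕜 := ℂ)).const_mul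
      ((-(Complex.I * k)) ^ j / (j.factorial : ℂ))
    refine this.congr (Eventually.of_forall fun x => ?_)
    change (-(Complex.I * k)) ^ j / (j.factorial : ℂ) * ((x ^ j * f x : ℝ) : ℂ) = _
    beta_reduce
    rw [show -(Complex.I * k * x) = -(Complex.I * k) * x by ring, mul_pow]
    push_cast; ring
  simp only [expTail, sub_mul, Finset.sum_mul]
  rw [integral_sub h1 (integrable_finsetSum _ h2), integral_finsetSum _ h2, ft, evalTrunc]
  congr 1
  refine Finset.sum_congr rfl fun j hj => ?_
  have e : ∀ x : ℝ, (-(Complex.I * k * x)) ^ j / (j.factorial : ℂ) * f x =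
      (-(Complex.I * k)) ^ j / (j.factorial : ℂ) * ((x ^ j * f x : ℝ) : ℂ) := fun x => by
    rw [show -(Complex.I * k * x) = -(Complex.I * k) * x by ring, mul_pow]
    push_cast; ring
  simp only [e]
  rw [integral_const_mul, integral_complex_ofReal, momentSeries, coeff_mk,
    neg_eq_neg_one_mul (Complex.I * (k : ℂ)), mul_pow]
  push_cast
  ring

theorem continuous_expTail (N : ℕ) : Continuous (expTail N) := by
  unfold expTail; fun_prop

theorem differentiable_expTail (N : ℕ) : Differentiable ℂ (expTail N) := by
  unfold expTail; fun_prop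

theorem sum_pow_div_factorial_le {x : ℝ} (hx : 0 ≤ x) (N : ℕ) :
    ∑ j ∈ Finset.range (N + 1), x ^ j / (j.factorial : ℝ) ≤ Real.exp x :=
  Real.sum_le_exp_of_nonneg hx _

theorem norm_expSum_le (N : ℕ) (κ : ℂ) {t : ℝ} (ht : 1 ≤ t) (w : ℂ) (hw : ‖w‖ ≤ t * ‖κ‖) :
    ‖∑ j ∈ Finset.range (N + 1), w ^ j / (j.factorial : ℂ)‖ ≤ t ^ N * Real.exp ‖κ‖ := by
  calc _ ≤ ∑ j ∈ Finset.range (N + 1), t ^ N * (‖κ‖ ^ j / (j.factorial : ℝ)) := by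
        refine (norm_sum_le _ _).trans (Finset.sum_le_sum fun j hj => ?_)
        rw [norm_div, norm_pow, Complex.norm_natCast, ← mul_div_assoc]
        refine div_le_div_of_nonneg_right ?_ (by positivity)
        calc ‖w‖ ^ j ≤ (t * ‖κ‖) ^ j := pow_le_pow_left₀ (norm_nonneg w) hw j
          _ = t ^ j * ‖κ‖ ^ j := mul_pow _ _ _
          _ ≤ _ := by
              gcongr
              exact Finset.mem_range_succ_iff.1 hj
    _ = t ^ N * ∑ j ∈ Finset.range (N + 1), ‖κ‖ ^ j / (j.factorial : ℝ) :=
        (Finset.mul_sum _ _ _).symm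
    _ ≤ _ := by
        gcongr
        exact sum_pow_div_factorial_le (norm_nonneg κ) N

/-- Pointwise bound for the kernel of the Taylor remainder. -/
theorem exists_tailKernel_le (N : ℕ) (hc : 0 < c) : ∃ K : ℝ, 0 ≤ K ∧ ∀ (B : ℝ) (M : ℂ → ℂ),
    StripBound c B M → ∀ t ξ : ℝ,
      ‖syn (fun κ => M κ * expTail N (-(Complex.I * κ * t))) ξ‖ ≤
        B * K * (|t| ^ N * Real.exp (-|ξ|) + if 1 ≤ |t| then Real.exp (-|ξ - t|) else 0) := by
  set K₁ : ℝ := ((N + 1).factorial : ℝ) * Real.exp (2 + 2 ^ 2 / (2 * c)) * pwConst (c / 2)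
  set K₂ : ℝ := Real.exp (1 + 1 ^ 2 / (2 * c)) * pwConst (c / 2)
  have hp := pwConst_nonneg (c / 2)
  have hp1 := pwConst_nonneg c
  have hK₁ : 0 ≤ K₁ := by positivity
  have hK₂ : 0 ≤ K₂ := by positivity
  refine ⟨K₁ + K₂ + pwConst c, by positivity, fun B M hM t ξ => ?_⟩
  have hB := hM.nonneg
  have hE := (Real.exp_pos (-|ξ|)).le
  have hc2 : 0 < c / 2 := by positivity
  have hnorm : ∀ κ : ℂ, ‖-(Complex.I * κ * t)‖ = |t| * ‖κ‖ := fun κ => by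
    rw [norm_neg, norm_mul, norm_mul, Complex.norm_I, one_mul, Complex.norm_real,
      Real.norm_eq_abs, mul_comm]
  split_ifs with ht
  · have hS := hM.mul_exp_type hc (P := fun κ => ∑ j ∈ Finset.range (N + 1),
        (-(Complex.I * κ * t)) ^ j / (j.factorial : ℂ)) (A := |t| ^ N) (a := 1) zero_le_one
      (by positivity) (by fun_prop) fun κ _ => by
        rw [one_mul]; exact norm_expSum_le N κ ht _ (hnorm κ).le
    have e : ∀ κ : ℝ, M κ * expTail N (-(Complex.I * κ * t)) =
        M κ * Complex.exp (-(Complex.I * κ * t)) - M κ * ∑ j ∈ Finset.range (N + 1),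
          (-(Complex.I * κ * t)) ^ j / (j.factorial : ℂ) := fun κ => by
      rw [expTail, mul_sub]
    have hi : Integrable fun κ : ℝ => M κ * Complex.exp (-(Complex.I * κ * t)) := by
      refine (integrable_mul_exp (hM.integrable hc) (-t)).congr (Eventually.of_forall fun κ => ?_)
      simp
    simp only [e]
    rw [syn_sub hi (hS.integrable hc2), syn_mul_exp]
    have h1 := hM.norm_syn_le hc (ξ - t)
    have h2 := hS.norm_syn_le hc2 ξ
    have hE' := (Real.exp_pos (-|ξ - t|)).le
    calc _ ≤ B * pwConst c * Real.exp (-|ξ - t|) + B * |t| ^ N * Real.exp (1 + 1 ^ 2 / (2 * c)) *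
          pwConst (c / 2) * Real.exp (-|ξ|) := (norm_sub_le _ _).trans (add_le_add h1 h2)
      _ = B * pwConst c * Real.exp (-|ξ - t|) + B * K₂ * (|t| ^ N * Real.exp (-|ξ|)) := by
          simp only [K₂]; ring
      _ ≤ B * (K₁ + K₂ + pwConst c) * Real.exp (-|ξ - t|) +
          B * (K₁ + K₂ + pwConst c) * (|t| ^ N * Real.exp (-|ξ|)) := by
          gcongr <;> linarith
      _ = _ := by ring
  · have ht' : |t| ≤ 1 := (not_le.1 ht).le
    have hS := hM.mul_exp_type hc (P := fun κ => expTail N (-(Complex.I * κ * t)))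
      (A := |t| ^ N * ((N + 1).factorial : ℝ)) (a := 2) zero_le_two (by positivity)
      ((differentiable_expTail N).comp (by fun_prop)) fun κ _ => by
        have h1 := Complex.norm_exp_sub_sum_le_norm_mul_exp (-(Complex.I * κ * t)) (N + 1)
        rw [hnorm] at h1
        have hκ := norm_nonneg κ
        have h2 : ‖κ‖ ^ (N + 1) ≤ ((N + 1).factorial : ℝ) * Real.exp ‖κ‖ := by
          have := Real.pow_div_factorial_le_exp ‖κ‖ hκ (N + 1)
          rw [div_le_iff₀ (by positivity)] at this
          linarith
        calc _ ≤ (|t| * ‖κ‖) ^ (N + 1) * Real.exp (|t| * ‖κ‖) := h1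
          _ ≤ (|t| ^ N * ‖κ‖ ^ (N + 1)) * Real.exp ‖κ‖ := by
              rw [mul_pow]
              refine mul_le_mul (mul_le_mul_of_nonneg_right (pow_le_pow_of_le_one (abs_nonneg t) ht'
                (Nat.le_succ N)) (by positivity)) (Real.exp_le_exp.2
                (mul_le_of_le_one_left hκ ht')) (Real.exp_pos _).le (by positivity)
          _ ≤ (|t| ^ N * (((N + 1).factorial : ℝ) * Real.exp ‖κ‖)) * Real.exp ‖κ‖ := by gcongr
          _ = _ := by rw [two_mul, Real.exp_add]; ring
    have h2 := hS.norm_syn_le hc2 ξ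
    rw [add_zero]
    calc _ ≤ _ := h2
      _ = B * K₁ * (|t| ^ N * Real.exp (-|ξ|)) := by simp only [K₁]; ring
      _ ≤ _ := by gcongr; linarith

end Remainder
end
end TaylorDispersion

namespace TaylorDispersion
noncomputable section
section RemainderNorm

open PowerSeries

variable {m : ℝ} {N : ℕ} {f : ℝ → ℝ} {c : ℝ}

theorem sq_integral_mul_le {a b : ℝ → ℝ} (ha : ∀ x, 0 ≤ a x) (hb : ∀ x, 0 ≤ b x)
    (ha2 : MemLp a 2) (hb2 : MemLp b 2) :
    (∫ x, a x * b x) ^ 2 ≤ (∫ x, a x ^ 2) * ∫ x, b x ^ 2 := by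
  have h := integral_mul_le_Lp_mul_Lq_of_nonneg (μ := volume) Real.HolderConjugate.two_two
    (Eventually.of_forall ha) (Eventually.of_forall hb) (by simpa using ha2) (by simpa using hb2)
  simp only [Real.rpow_two, ← Real.sqrt_eq_rpow] at h
  have h0 : 0 ≤ ∫ x, a x * b x := integral_nonneg fun x => mul_nonneg (ha x) (hb x)
  calc _ ≤ (Real.sqrt (∫ x, a x ^ 2) * Real.sqrt (∫ x, b x ^ 2)) ^ 2 := pow_le_pow_left₀ h0 h 2
    _ = _ := by
        rw [mul_pow, Real.sq_sqrt (integral_nonneg fun x => sq_nonneg _),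
          Real.sq_sqrt (integral_nonneg fun x => sq_nonneg _)]

/-- Exchange of the synthesis and the Taylor remainder of the Fourier transform. -/
theorem syn_remainder (hc : 0 < c) (hm : (N : ℝ) + 1 / 2 < m) (hf : MemL2m m f) {B : ℝ}
    {M : ℂ → ℂ} (hM : StripBound c B M) {ε : ℝ} (h0 : 0 < ε) (h1 : ε ≤ 1) (ξ : ℝ) :
    syn (fun κ => M κ * (ft f (ε * κ) -
      evalTrunc N (momentSeries f) (Complex.I * (ε * κ : ℝ)))) ξ =
      ∫ y : ℝ, syn (fun κ => M κ * expTail N (-(Complex.I * κ * (ε * y : ℝ)))) ξ * f y := by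
  have hB := hM.nonneg
  have hi1 : Integrable fun κ : ℝ => ‖M κ‖ * (2 * Real.exp |κ|) := by
    refine ((integrable_exp_neg_mul_sq (half_pos hc)).const_mul
      (2 * B * Real.exp (1 / (2 * c)))).mono' ?_ (Eventually.of_forall fun κ => ?_)
    · exact (hM.continuous.norm.mul (by fun_prop)).aestronglyMeasurable
    · rw [Real.norm_of_nonneg (by positivity)]
      have h3 : -c * κ ^ 2 + |κ| ≤ 1 / (2 * c) + -(c / 2) * κ ^ 2 := by
        have h4 : 1 / (2 * c) - |κ| + c / 2 * |κ| ^ 2 = (1 - c * |κ|) ^ 2 / (2 * c) := by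
          field_simp; ring
        have h5 : 0 ≤ (1 - c * |κ|) ^ 2 / (2 * c) := by positivity
        rw [sq_abs] at h4
        linarith
      calc _ ≤ B * Real.exp (-c * κ ^ 2) * (2 * Real.exp |κ|) := by
            gcongr; exact hM.real_le κ
        _ = 2 * B * Real.exp (-c * κ ^ 2 + |κ|) := by rw [Real.exp_add]; ring
        _ ≤ 2 * B * Real.exp (1 / (2 * c) + -(c / 2) * κ ^ 2) := by gcongr
        _ = _ := by rw [Real.exp_add]; ring
  have hint : Integrable (Function.uncurry fun κ y : ℝ =>
      M κ * expTail N (-(Complex.I * κ * (ε * y : ℝ))) * Complex.exp (Complex.I * κ * ξ) *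
        (f y : ℂ)) (volume.prod volume) := by
    refine (hi1.mul_prod (hf.integrable_pow hm)).mono' ?_ (Eventually.of_forall fun p => ?_)
    · refine AEStronglyMeasurable.mul (Continuous.aestronglyMeasurable ?_) ?_
      · exact (((hM.continuous.comp continuous_fst).mul ((continuous_expTail N).comp
          (by fun_prop))).mul (by fun_prop))
      · exact Complex.continuous_ofReal.comp_aestronglyMeasurable hf.1.1.comp_snd
    · simp only [Function.uncurry, norm_mul, Complex.norm_real, Real.norm_eq_abs]
      have e1 : ‖Complex.exp (Complex.I * p.1 * ξ)‖ = 1 := by simp [Complex.norm_exp]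
      have e2 : ‖Complex.exp (-(Complex.I * p.1 * (ε * p.2 : ℝ)))‖ = 1 := by
        simp [Complex.norm_exp]
      have hp : (1 : ℝ) ≤ 1 + |p.2| := by linarith [abs_nonneg p.2]
      have e3 : ‖-(Complex.I * p.1 * (ε * p.2 : ℝ))‖ ≤ (1 + |p.2|) * ‖(p.1 : ℂ)‖ := by
        rw [norm_neg, norm_mul, norm_mul, Complex.norm_I, one_mul, Complex.norm_real (ε * p.2),
          Real.norm_eq_abs, abs_mul, abs_of_pos h0, mul_comm]
        gcongr
        nlinarith [abs_nonneg p.2]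
      have e4 := norm_expSum_le N (p.1 : ℂ) hp _ e3
      rw [Complex.norm_real, Real.norm_eq_abs] at e4
      have hpN : (1 : ℝ) ≤ (1 + |p.2|) ^ N := one_le_pow₀ hp
      have e5 : ‖expTail N (-(Complex.I * p.1 * (ε * p.2 : ℝ)))‖ ≤
          2 * Real.exp |p.1| * (1 + |p.2|) ^ N := by
        refine (norm_sub_le _ _).trans ?_
        rw [e2]
        have h5 : 1 ≤ Real.exp |p.1| := Real.one_le_exp (abs_nonneg _)
        nlinarith [mul_le_mul h5 hpN zero_le_one (by positivity)]
      rw [e1, mul_one]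
      calc _ ≤ ‖M p.1‖ * (2 * Real.exp |p.1| * (1 + |p.2|) ^ N) * |f p.2| := by gcongr
        _ = _ := by ring
  have e : ∀ κ : ℝ, M κ * (ft f (ε * κ) -
      evalTrunc N (momentSeries f) (Complex.I * (ε * κ : ℝ))) * Complex.exp (Complex.I * κ * ξ) =
      ∫ y : ℝ, M κ * expTail N (-(Complex.I * κ * (ε * y : ℝ))) *
        Complex.exp (Complex.I * κ * ξ) * (f y : ℂ) := fun κ => by
    rw [ft_sub_evalTrunc hm hf, mul_right_comm, ← integral_const_mul]
    refine integral_congr_ae (Eventually.of_forall fun y => ?_)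
    beta_reduce
    rw [show -(Complex.I * (ε * κ : ℝ) * y) = -(Complex.I * κ * (ε * y : ℝ)) by push_cast; ring]
    ring
  simp only [syn, e]
  rw [integral_integral_swap hint, ← integral_const_mul]
  refine integral_congr_ae (Eventually.of_forall fun y => ?_)
  beta_reduce
  rw [integral_mul_const, mul_assoc]

theorem integrable_exp_neg_abs : Integrable fun u : ℝ => Real.exp (-|u|) := by
  have := (memL2m_exp_neg_abs 2).integrable (N := 0) (by norm_num)
  exact this

theorem integrable_weight_exp (m : ℝ) : Integrable fun u : ℝ => (1 + u ^ 2) ^ m * Real.exp (-|u|) := by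
  have h := (memL2m_exp_neg_abs m).2.comp_mul_left' (R := 1 / 2) (by norm_num)
  refine (h.const_mul (4 ^ |m|)).mono' ?_ (Eventually.of_forall fun u => ?_)
  · exact (((measurable_const.add (measurable_id.pow_const 2)).pow_const m).mul
      (continuous_abs.neg.rexp).measurable).aestronglyMeasurable
  · rw [Real.norm_of_nonneg (by positivity), ← Real.exp_nat_mul, ← mul_assoc]
    have e : ((2 : ℕ) : ℝ) * -|1 / 2 * u| = -|u| := by
      rw [abs_mul]; norm_num; ring
    rw [e]
    refine mul_le_mul_of_nonneg_right ?_ (Real.exp_pos _).le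
    have hp : (0 : ℝ) < 1 + (1 / 2 * u) ^ 2 := by positivity
    have hq : (0 : ℝ) < 1 + u ^ 2 := by positivity
    rcases le_total 0 m with hm | hm
    · rw [abs_of_nonneg hm, ← Real.mul_rpow (by norm_num) hp.le]
      exact Real.rpow_le_rpow hq.le (by nlinarith [sq_nonneg u]) hm
    · have h4 : (1 : ℝ) ≤ 4 ^ |m| := Real.one_le_rpow (by norm_num) (abs_nonneg m)
      refine (Real.rpow_le_rpow_of_nonpos hp (by nlinarith [sq_nonneg u]) hm).trans ?_
      exact le_mul_of_one_le_left (by positivity) h4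

/-- The weighted convolution that bounds the far part of the remainder. -/
theorem integrable_conv (hf : MemL2m m f) (ε : ℝ) :
    Integrable (Function.uncurry fun ξ y : ℝ => ((1 + (ξ - ε * y) ^ 2) ^ m *
      Real.exp (-|ξ - ε * y|)) * ((1 + y ^ 2) ^ m * f y ^ 2)) (volume.prod volume) ∧
    ∫ ξ : ℝ, ∫ y : ℝ, ((1 + (ξ - ε * y) ^ 2) ^ m *
      Real.exp (-|ξ - ε * y|)) * ((1 + y ^ 2) ^ m * f y ^ 2) =
      (∫ u : ℝ, (1 + u ^ 2) ^ m * Real.exp (-|u|)) * ∫ y : ℝ, (1 + y ^ 2) ^ m * f y ^ 2 := by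
  have hJ := integrable_weight_exp m
  have hm1 : Measurable fun u : ℝ => (1 + u ^ 2) ^ m * Real.exp (-|u|) :=
    ((measurable_const.add (measurable_id.pow_const 2)).pow_const m).mul
      (continuous_abs.neg.rexp).measurable
  have hint : Integrable (Function.uncurry fun ξ y : ℝ => ((1 + (ξ - ε * y) ^ 2) ^ m *
      Real.exp (-|ξ - ε * y|)) * ((1 + y ^ 2) ^ m * f y ^ 2)) (volume.prod volume) := by
    rw [integrable_prod_iff']
    · refine ⟨Eventually.of_forall fun y => ?_, ?_⟩
      · exact (hJ.comp_sub_right (ε * y)).mul_const ((1 + y ^ 2) ^ m * f y ^ 2)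
      · have e : ∀ y : ℝ, ∫ ξ : ℝ, ‖(Function.uncurry fun ξ y : ℝ => ((1 + (ξ - ε * y) ^ 2) ^ m *
            Real.exp (-|ξ - ε * y|)) * ((1 + y ^ 2) ^ m * f y ^ 2)) (ξ, y)‖ =
            (∫ u : ℝ, (1 + u ^ 2) ^ m * Real.exp (-|u|)) * ((1 + y ^ 2) ^ m * f y ^ 2) := by
          intro y
          rw [← integral_sub_right_eq_self (fun u : ℝ => (1 + u ^ 2) ^ m * Real.exp (-|u|)) (ε * y),
            ← integral_mul_const]
          refine integral_congr_ae (Eventually.of_forall fun ξ => ?_)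
          simp only [Function.uncurry]
          exact Real.norm_of_nonneg (by positivity)
        simp only [e]
        exact hf.2.const_mul _
    · refine AEStronglyMeasurable.mul ?_ ?_
      · exact (hm1.comp (measurable_fst.sub (measurable_snd.const_mul ε))).aestronglyMeasurable
      · exact hf.2.1.comp_snd
  refine ⟨hint, ?_⟩
  rw [integral_integral_swap hint, ← integral_const_mul]
  refine integral_congr_ae (Eventually.of_forall fun y => ?_)
  beta_reduce
  rw [integral_mul_const, integral_sub_right_eq_self (fun u : ℝ => (1 + u ^ 2) ^ m *
    Real.exp (-|u|)) (ε * y)]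

/-- The far part `∫_{|εy| ≥ 1} e^{-|ξ - εy|} |f(y)| dy`. -/
def farPart (f : ℝ → ℝ) (ε ξ : ℝ) : ℝ :=
  ∫ y : ℝ, (if 1 ≤ |ε * y| then Real.exp (-|ξ - ε * y|) else 0) * |f y|

theorem measurableSet_far (ε : ℝ) : MeasurableSet {y : ℝ | 1 ≤ |ε * y|} :=
  measurableSet_le measurable_const (measurable_const.mul measurable_id).abs

theorem weight_mul_farPart_sq_le (hm : 0 ≤ m) (hf : MemL2m m f) {ε : ℝ} (h0 : 0 < ε) :
    ∀ᵐ ξ : ℝ, (1 + ξ ^ 2) ^ m * farPart f ε ξ ^ 2 ≤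
      (4 * ε ^ 2) ^ m * (1 / ε * ∫ u : ℝ, Real.exp (-|u|)) *
        ∫ y : ℝ, ((1 + (ξ - ε * y) ^ 2) ^ m * Real.exp (-|ξ - ε * y|)) *
          ((1 + y ^ 2) ^ m * f y ^ 2) := by
  filter_upwards [(integrable_conv hf ε).1.prod_right_ae] with ξ hξ
  set k : ℝ → ℝ := fun y => if 1 ≤ |ε * y| then Real.exp (-|ξ - ε * y| / 2) else 0 with hk
  have hkm : Measurable k := Measurable.ite (measurableSet_far ε) (by fun_prop) measurable_const
  have hk0 : ∀ y, 0 ≤ k y := fun y => by simp only [hk]; split_ifs <;> positivity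
  have hk1 : ∀ y, k y ≤ 1 := fun y => by
    simp only [hk]
    split_ifs
    · exact Real.exp_le_one_iff.2 (by have := abs_nonneg (ξ - ε * y); linarith)
    · exact zero_le_one
  have hk2 : ∀ y, k y ^ 2 = if 1 ≤ |ε * y| then Real.exp (-|ξ - ε * y|) else 0 := fun y => by
    simp only [hk]
    split_ifs
    · rw [← Real.exp_nat_mul]; congr 1; push_cast; ring
    · simp
  have hE : Integrable fun y : ℝ => Real.exp (-|ξ - ε * y|) := by
    have := (integrable_exp_neg_abs.comp_sub_left ξ).comp_mul_left' h0.ne'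
    exact this
  have hka : MemLp k 2 := (memLp_two_iff_integrable_sq hkm.aestronglyMeasurable).2 (by
    refine hE.mono' (hkm.pow_const 2).aestronglyMeasurable (Eventually.of_forall fun y => ?_)
    rw [Real.norm_of_nonneg (sq_nonneg _), hk2]
    split_ifs
    · exact le_rfl
    · exact (Real.exp_pos _).le)
  have hkb : MemLp (fun y => k y * |f y|) 2 := by
    refine hf.1.of_le_mul (c := 1) (hkm.aestronglyMeasurable.mul hf.1.1.norm)
      (Eventually.of_forall fun y => ?_)
    rw [norm_mul, Real.norm_of_nonneg (hk0 y), Real.norm_eq_abs, abs_abs]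
    exact mul_le_mul_of_nonneg_right (hk1 y) (abs_nonneg _)
  have hcs := sq_integral_mul_le hk0 (fun y => mul_nonneg (hk0 y) (abs_nonneg (f y))) hka hkb
  have e1 : farPart f ε ξ = ∫ y, k y * (k y * |f y|) := by
    refine integral_congr_ae (Eventually.of_forall fun y => ?_)
    beta_reduce
    rw [← hk2]; ring
  have e2 : ∫ y, k y ^ 2 ≤ 1 / ε * ∫ u : ℝ, Real.exp (-|u|) := by
    have h3 : ∫ y : ℝ, Real.exp (-|ξ - ε * y|) = 1 / ε * ∫ u : ℝ, Real.exp (-|u|) := by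
      rw [Measure.integral_comp_mul_left (fun v : ℝ => Real.exp (-|ξ - v|)) ε,
        integral_sub_left_eq_self (fun v : ℝ => Real.exp (-|v|)), abs_of_pos (inv_pos.2 h0),
        smul_eq_mul, one_div]
    rw [← h3]
    refine integral_mono ((memLp_two_iff_integrable_sq hkm.aestronglyMeasurable).1 hka) hE
      fun y => ?_
    beta_reduce
    rw [hk2]
    split_ifs
    · exact le_rfl
    · exact (Real.exp_pos _).le
  have e3 : (1 + ξ ^ 2) ^ m * ∫ y, (k y * |f y|) ^ 2 ≤ (4 * ε ^ 2) ^ m *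
      ∫ y : ℝ, ((1 + (ξ - ε * y) ^ 2) ^ m * Real.exp (-|ξ - ε * y|)) *
          ((1 + y ^ 2) ^ m * f y ^ 2) := by
    rw [← integral_const_mul, ← integral_const_mul]
    refine integral_mono (((memLp_two_iff_integrable_sq hkb.1).1 hkb).const_mul _)
      (hξ.const_mul _) fun y => ?_
    beta_reduce
    rw [mul_pow, hk2, sq_abs]
    split_ifs with hy
    · have h5 : 1 + ξ ^ 2 ≤ (4 * ε ^ 2) * ((1 + (ξ - ε * y) ^ 2) * (1 + y ^ 2)) := by
        set η := ε * y with hη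
        have h6 : 1 ≤ η ^ 2 := by rw [← sq_abs]; nlinarith
        have h7 : 1 + ξ ^ 2 ≤ 4 * ((1 + (ξ - η) ^ 2) * η ^ 2) := by
          nlinarith [sq_nonneg (ξ - 2 * η), mul_le_mul_of_nonneg_left h6 (sq_nonneg (ξ - η))]
        have h8 : η ^ 2 ≤ ε ^ 2 * (1 + y ^ 2) := by rw [hη]; nlinarith [sq_nonneg ε]
        have h9 : (1 + (ξ - η) ^ 2) * η ^ 2 ≤ (1 + (ξ - η) ^ 2) * (ε ^ 2 * (1 + y ^ 2)) := by gcongr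
        nlinarith
      have h6 : (1 + ξ ^ 2) ^ m ≤
          (4 * ε ^ 2) ^ m * ((1 + (ξ - ε * y) ^ 2) ^ m * (1 + y ^ 2) ^ m) := by
        rw [← Real.mul_rpow (by positivity) (by positivity),
          ← Real.mul_rpow (by positivity) (by positivity)]
        exact Real.rpow_le_rpow (by positivity) h5 hm
      calc _ ≤ ((4 * ε ^ 2) ^ m * ((1 + (ξ - ε * y) ^ 2) ^ m * (1 + y ^ 2) ^ m)) *
            (Real.exp (-|ξ - ε * y|) * f y ^ 2) := by gcongr
        _ = _ := by ring
    · rw [zero_mul, mul_zero]; positivity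
  have hI : 0 ≤ ∫ u : ℝ, Real.exp (-|u|) := integral_nonneg fun u => (Real.exp_pos _).le
  have hb0 : 0 ≤ ∫ y, (k y * |f y|) ^ 2 := integral_nonneg fun y => sq_nonneg _
  rw [e1]
  calc _ ≤ (1 + ξ ^ 2) ^ m * ((∫ y, k y ^ 2) * ∫ y, (k y * |f y|) ^ 2) := by gcongr
    _ ≤ (1 + ξ ^ 2) ^ m * ((1 / ε * ∫ u : ℝ, Real.exp (-|u|)) * ∫ y, (k y * |f y|) ^ 2) := by
        gcongr
    _ = (1 / ε * ∫ u : ℝ, Real.exp (-|u|)) * ((1 + ξ ^ 2) ^ m * ∫ y, (k y * |f y|) ^ 2) := by ring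
    _ ≤ (1 / ε * ∫ u : ℝ, Real.exp (-|u|)) * _ := mul_le_mul_of_nonneg_left e3 (by positivity)
    _ = _ := by ring

/-- The Taylor remainder of order `N` of the datum, evolved by a multiplier which is analytic in
a strip, is `O(ε^N)` in `L²(m)`. -/
theorem exists_remainder_bound (hc : 0 < c) (hm : (N : ℝ) + 1 / 2 < m) (hf : MemL2m m f) :
    ∃ K : ℝ, 0 ≤ K ∧ ∀ (B : ℝ) (M : ℂ → ℂ), StripBound c B M → ∀ ε : ℝ, 0 < ε → ε ≤ 1 →
      MemL2m m (fun ξ => ‖syn (fun κ => M κ * (ft f (ε * κ) -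
        evalTrunc N (momentSeries f) (Complex.I * (ε * κ : ℝ)))) ξ‖) ∧
      normL2m m (fun ξ => ‖syn (fun κ => M κ * (ft f (ε * κ) -
        evalTrunc N (momentSeries f) (Complex.I * (ε * κ : ℝ)))) ξ‖) ≤ K * B * ε ^ N := by
  obtain ⟨K, hK, hker⟩ := exists_tailKernel_le N hc
  have hm0 : 0 ≤ m := by have : (0 : ℝ) ≤ N := Nat.cast_nonneg N; linarith
  set A : ℝ := ∫ y, (1 + |y|) ^ N * |f y| with hA
  have hA0 : 0 ≤ A := integral_nonneg fun y => by positivity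
  set J₂ : ℝ := ∫ ξ : ℝ, (1 + ξ ^ 2) ^ m * Real.exp (-|ξ|) ^ 2 with hJ₂
  have hJ₂0 : 0 ≤ J₂ := integral_nonneg fun y => by positivity
  set J₁ : ℝ := ∫ u : ℝ, (1 + u ^ 2) ^ m * Real.exp (-|u|) with hJ₁
  have hJ₁0 : 0 ≤ J₁ := integral_nonneg fun y => by positivity
  set J₀ : ℝ := ∫ u : ℝ, Real.exp (-|u|) with hJ₀
  have hJ₀0 : 0 ≤ J₀ := integral_nonneg fun y => by positivity
  set F : ℝ := ∫ y : ℝ, (1 + y ^ 2) ^ m * f y ^ 2 with hF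
  have hF0 : 0 ≤ F := integral_nonneg fun y => by positivity
  set Q : ℝ := 2 * (A ^ 2 * J₂) + 2 * (4 ^ m * J₀ * (J₁ * F)) with hQ
  have hQ0 : 0 ≤ Q := by positivity
  refine ⟨K * Real.sqrt Q, by positivity, fun B M hM ε h0 h1 => ?_⟩
  have hB := hM.nonneg
  set g : ℝ → ℂ := syn (fun κ => M κ * (ft f (ε * κ) -
    evalTrunc N (momentSeries f) (Complex.I * (ε * κ : ℝ)))) with hg
  have hpt : ∀ ξ, ‖g ξ‖ ≤ B * K * (ε ^ N * A * Real.exp (-|ξ|) + farPart f ε ξ) := fun ξ => by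
    have hfi := hf.integrable hm
    have hi1 : Integrable fun y => |ε * y| ^ N * Real.exp (-|ξ|) * |f y| := by
      have := ((hf.integrable_pow_mul hm le_rfl).abs.const_mul (ε ^ N * Real.exp (-|ξ|)))
      refine this.congr (Eventually.of_forall fun y => ?_)
      beta_reduce
      rw [abs_mul, abs_mul, mul_pow, abs_pow, abs_of_pos h0]; ring
    have hi2 : Integrable fun y =>
        (if 1 ≤ |ε * y| then Real.exp (-|ξ - ε * y|) else 0) * |f y| := by
      refine hfi.abs.mono' (Measurable.ite (measurableSet_far ε) (by fun_prop)
        measurable_const |>.aestronglyMeasurable.mul hfi.1.norm) (Eventually.of_forall fun y => ?_)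
      rw [norm_mul, Real.norm_eq_abs |f y|, abs_abs]
      refine mul_le_of_le_one_left (abs_nonneg _) ?_
      split_ifs
      · rw [Real.norm_of_nonneg (Real.exp_pos _).le]
        exact Real.exp_le_one_iff.2 (by have := abs_nonneg (ξ - ε * y); linarith)
      · simp
    rw [hg, syn_remainder hc hm hf hM h0 h1]
    calc _ ≤ ∫ y, B * K * (|ε * y| ^ N * Real.exp (-|ξ|) * |f y| +
          (if 1 ≤ |ε * y| then Real.exp (-|ξ - ε * y|) else 0) * |f y|) := by
          refine norm_integral_le_of_norm_le ((hi1.add hi2).const_mul _)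
            (Eventually.of_forall fun y => ?_)
          rw [norm_mul, Complex.norm_real, Real.norm_eq_abs, ← add_mul, ← mul_assoc]
          exact mul_le_mul_of_nonneg_right (hker B M hM (ε * y) ξ) (abs_nonneg _)
      _ = B * K * ((∫ y, |ε * y| ^ N * Real.exp (-|ξ|) * |f y|) + farPart f ε ξ) := by
          rw [integral_const_mul, integral_add hi1 hi2, farPart]
      _ ≤ _ := by
          gcongr
          rw [hA, mul_right_comm, mul_comm (ε ^ N * _), ← integral_mul_const]
          refine integral_mono hi1 ((hf.integrable_pow hm).mul_const _) fun y => ?_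
          beta_reduce
          rw [abs_mul, mul_pow, abs_of_pos h0]
          have : |y| ^ N ≤ (1 + |y|) ^ N := pow_le_pow_left₀ (abs_nonneg y) (by linarith) N
          calc _ = |y| ^ N * (|f y| * (ε ^ N * Real.exp (-|ξ|))) := by ring
            _ ≤ (1 + |y|) ^ N * (|f y| * (ε ^ N * Real.exp (-|ξ|))) := by gcongr
            _ = _ := by ring
  have hgc : Continuous g := by
    refine continuous_syn ?_
    have h2 : Integrable fun κ : ℝ => M κ * ft f (ε * κ) := by
      refine (hM.integrable hc).norm.mul_const (∫ x, |f x|) |>.mono'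
        (hM.continuous.mul ((continuous_ft (hf.integrable hm)).comp
          (by fun_prop))).aestronglyMeasurable (Eventually.of_forall fun κ => ?_)
      rw [norm_mul]
      exact mul_le_mul_of_nonneg_left (norm_ft_le f _) (norm_nonneg _)
    have h3 : Integrable fun κ : ℝ => M κ *
        evalTrunc N (momentSeries f) (Complex.I * (ε * κ : ℝ)) := by
      have h4 : Integrable fun κ : ℝ => M κ * evalTrunc N (momentSeries f)
          (Complex.I * (ε * κ)) := by
        refine StripBound.integrable (half_pos hc) (hM.mul_exp_type hc
          (P := fun κ => evalTrunc N (momentSeries f) (Complex.I * (ε * κ)))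
          (A := ∑ j ∈ Finset.range (N + 1), |coeff j (momentSeries f)| * j.factorial) (a := 1)
          zero_le_one (by positivity) (by unfold evalTrunc; fun_prop) fun κ _ => ?_)
        rw [one_mul, evalTrunc, Finset.sum_mul]
        refine (norm_sum_le _ _).trans (Finset.sum_le_sum fun j _ => ?_)
        rw [norm_mul, Complex.norm_real, Real.norm_eq_abs, mul_assoc]
        refine mul_le_mul_of_nonneg_left ?_ (abs_nonneg _)
        have h5 := Real.pow_div_factorial_le_exp ‖κ‖ (norm_nonneg κ) j
        rw [div_le_iff₀ (by positivity)] at h5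
        rw [norm_pow, norm_mul, norm_mul, Complex.norm_I, one_mul, Complex.norm_real,
          Real.norm_of_nonneg h0.le, mul_pow]
        calc ε ^ j * ‖κ‖ ^ j ≤ 1 * ‖κ‖ ^ j := by
              gcongr; exact pow_le_one₀ h0.le h1
          _ ≤ _ := by linarith
      refine h4.congr (Eventually.of_forall fun κ => ?_)
      beta_reduce; push_cast; rfl
    simpa only [mul_sub] using! h2.sub h3
  have hbig : ∀ᵐ ξ : ℝ, (1 + ξ ^ 2) ^ m * ‖g ξ‖ ^ 2 ≤ (B * K) ^ 2 *
      (2 * ((ε ^ N * A) ^ 2 * ((1 + ξ ^ 2) ^ m * Real.exp (-|ξ|) ^ 2)) +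
        2 * ((4 * ε ^ 2) ^ m * (1 / ε * J₀) *
        ∫ y : ℝ, ((1 + (ξ - ε * y) ^ 2) ^ m * Real.exp (-|ξ - ε * y|)) *
          ((1 + y ^ 2) ^ m * f y ^ 2))) := by
    filter_upwards [weight_mul_farPart_sq_le hm0 hf h0] with ξ hξ
    have hw : (0 : ℝ) ≤ (1 + ξ ^ 2) ^ m := by positivity
    set P := farPart f ε ξ
    set R : ℝ := (4 * ε ^ 2) ^ m * (1 / ε * J₀) * ∫ y : ℝ, ((1 + (ξ - ε * y) ^ 2) ^ m *
      Real.exp (-|ξ - ε * y|)) * ((1 + y ^ 2) ^ m * f y ^ 2)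
    set E := ε ^ N * A * Real.exp (-|ξ|)
    have h3 : ‖g ξ‖ ^ 2 ≤ (B * K) ^ 2 * (2 * E ^ 2 + 2 * P ^ 2) := by
      calc _ ≤ (B * K * (E + P)) ^ 2 := pow_le_pow_left₀ (norm_nonneg _) (hpt ξ) 2
        _ = (B * K) ^ 2 * (E + P) ^ 2 := mul_pow _ _ _
        _ ≤ _ := mul_le_mul_of_nonneg_left (by nlinarith [sq_nonneg (E - P)]) (sq_nonneg _)
    calc _ ≤ (1 + ξ ^ 2) ^ m * ((B * K) ^ 2 * (2 * E ^ 2 + 2 * P ^ 2)) := by gcongr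
      _ = (B * K) ^ 2 * (2 * ((1 + ξ ^ 2) ^ m * E ^ 2) + 2 * ((1 + ξ ^ 2) ^ m * P ^ 2)) := by ring
      _ ≤ (B * K) ^ 2 * (2 * ((1 + ξ ^ 2) ^ m * E ^ 2) + 2 * R) := by gcongr
      _ = _ := by simp only [E]; ring
  obtain ⟨hci, hce⟩ := integrable_conv hf ε
  have hR : Integrable fun ξ : ℝ => (B * K) ^ 2 *
      (2 * ((ε ^ N * A) ^ 2 * ((1 + ξ ^ 2) ^ m * Real.exp (-|ξ|) ^ 2)) +
        2 * ((4 * ε ^ 2) ^ m * (1 / ε * J₀) *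
        ∫ y : ℝ, ((1 + (ξ - ε * y) ^ 2) ^ m * Real.exp (-|ξ - ε * y|)) *
          ((1 + y ^ 2) ^ m * f y ^ 2))) :=
    (((((memL2m_exp_neg_abs m).2.const_mul _).const_mul 2).add
      ((hci.integral_prod_left.const_mul _).const_mul 2)).const_mul _)
  have hgi : Integrable fun ξ : ℝ => (1 + ξ ^ 2) ^ m * ‖g ξ‖ ^ 2 := by
    refine hR.mono' ?_ ?_
    · exact ((measurable_const.add (measurable_id.pow_const 2)).pow_const
        m).aestronglyMeasurable.mul (hgc.norm.pow 2).aestronglyMeasurable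
    · filter_upwards [hbig] with ξ hξ
      rw [Real.norm_of_nonneg (by positivity)]
      exact hξ
  refine ⟨MemL2m.of_integrable hm0 hgc.norm.aestronglyMeasurable hgi, ?_⟩
  have hpow : (4 * ε ^ 2) ^ m * (1 / ε) ≤ 4 ^ m * (ε ^ N) ^ 2 := by
    rw [Real.mul_rpow (by norm_num) (by positivity), mul_assoc]
    refine mul_le_mul_of_nonneg_left ?_ (by positivity)
    rw [mul_one_div, div_le_iff₀ h0, ← Real.rpow_natCast ε 2, ← Real.rpow_mul h0.le, ← pow_mul,
      ← pow_succ, ← Real.rpow_natCast ε (N * 2 + 1)]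
    refine Real.rpow_le_rpow_of_exponent_ge h0 h1 ?_
    push_cast; linarith
  have hval : ∫ ξ : ℝ, (1 + ξ ^ 2) ^ m * ‖g ξ‖ ^ 2 ≤ (K * Real.sqrt Q * B * ε ^ N) ^ 2 := by
    refine (integral_mono_ae hgi hR hbig).trans ?_
    rw [integral_const_mul, integral_add, integral_const_mul, integral_const_mul,
      integral_const_mul, integral_const_mul, hce]
    · have e : (K * Real.sqrt Q * B * ε ^ N) ^ 2 = (B * K) ^ 2 * ((ε ^ N) ^ 2 * Q) := by
        rw [mul_pow, mul_pow, mul_pow, Real.sq_sqrt hQ0]; ring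
      rw [e, hQ]
      refine mul_le_mul_of_nonneg_left ?_ (sq_nonneg _)
      have := mul_le_mul_of_nonneg_right hpow (by positivity : 0 ≤ J₀ * (J₁ * F))
      nlinarith
    · exact ((memL2m_exp_neg_abs m).2.const_mul _).const_mul 2
    · exact (hci.integral_prod_left.const_mul _).const_mul 2
  rw [normL2m]
  exact Real.sqrt_le_iff.2 ⟨by positivity, hval⟩

end RemainderNorm
end
end TaylorDispersion

namespace TaylorDispersion
noncomputable section
section FrequencySide

open FourierTransform

/-! ### The weak equations on the Fourier side -/

/-- Complexification of `L²`. -/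
def cxL2 : L2 →L[ℝ] Lp ℂ 2 (volume : Measure ℝ) := Complex.ofRealCLM.compLpL 2 volume

theorem cxL2_ae (f : L2) : ∀ᵐ x, cxL2 f x = (f x : ℂ) :=
  Complex.ofRealCLM.coeFn_compLpL f

/-- The `L²` Fourier transform of a real function, in Mathlib's normalization. -/
def freq (f : L2) : Lp ℂ 2 (volume : Measure ℝ) := 𝓕 (cxL2 f)

theorem integral_freq_mul (f : L2) (θ : 𝓢(ℝ, ℂ)) :
    ∫ x, freq f x * θ x = ∫ x, (f x : ℂ) * (𝓕 θ) x := by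
  have h := congrArg (fun T => T θ) (Lp.fourier_toTemperedDistribution_eq (cxL2 f))
  simp only [TemperedDistribution.fourier_apply, Lp.toTemperedDistribution_apply,
    smul_eq_mul] at h
  rw [freq]
  calc _ = ∫ x, θ x * (𝓕 (cxL2 f) : Lp ℂ 2 (volume : Measure ℝ)) x := by simp only [mul_comm]
    _ = ∫ x, (𝓕 θ) x * cxL2 f x := h.symm
    _ = _ := by
      refine integral_congr_ae ?_
      filter_upwards [cxL2_ae f] with x hx
      rw [hx, mul_comm]

/-- The pairing with `θ` as a continuous functional on complex `L²`. -/
theorem exists_pairing {θ : ℝ → ℂ} (hθ : MemLp θ 2) :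
    ∃ g : Lp ℂ 2 (volume : Measure ℝ), (∀ᵐ x, ‖g x‖ = ‖θ x‖) ∧
      ∀ f : Lp ℂ 2 (volume : Measure ℝ), ∫ x, f x * θ x = inner ℂ g f := by
  have hc : MemLp (fun x => (starRingEnd ℂ) (θ x)) 2 := hθ.star
  refine ⟨hc.toLp _, ?_, fun f => ?_⟩
  · filter_upwards [hc.coeFn_toLp] with x hx
    rw [hx]
    exact RCLike.norm_conj _
  · rw [L2.inner_def]
    refine integral_congr_ae ?_
    filter_upwards [hc.coeFn_toLp] with x hx
    rw [hx]
    simp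

theorem continuousOn_pairing {W : ℝ → L2} {s : Set ℝ} (hW : ContinuousOn W s) {θ : ℝ → ℂ}
    (hθ : MemLp θ 2) : ContinuousOn (fun t => ∫ x, freq (W t) x * θ x) s := by
  obtain ⟨g, -, hg⟩ := exists_pairing hθ
  simp only [hg]
  have h1 : ContinuousOn (fun t => freq (W t)) s :=
    (Lp.fourierTransformₗᵢ ℝ ℂ).continuous.comp_continuousOn (cxL2.continuous.comp_continuousOn hW)
  exact ContinuousOn.inner continuousOn_const h1

/-- Pairings with dominated test functions. -/
theorem norm_pairing_le (f : L2) {θ θ₀ : ℝ → ℂ} (hθ : MemLp θ 2) (hθ₀ : MemLp θ₀ 2) {C : ℝ}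
    (h : ∀ x, ‖θ x‖ ≤ C * ‖θ₀ x‖) :
    ‖∫ x, freq f x * θ x‖ ≤ C * ‖hθ₀.toLp θ₀‖ * ‖cxL2 f‖ := by
  obtain ⟨g, hg1, hg⟩ := exists_pairing hθ
  rw [hg]
  refine (norm_inner_le_norm g (freq f)).trans ?_
  rw [freq, Lp.norm_fourier_eq]
  refine mul_le_mul_of_nonneg_right (Lp.norm_le_mul_norm_of_ae_le_mul ?_) (norm_nonneg _)
  filter_upwards [hg1, hθ₀.coeFn_toLp] with x hx hy
  rw [hx, hy]
  exact h x

/-- Test functions on the Fourier side. -/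
structure IsTest (θ : ℝ → ℂ) : Prop where
  contDiff : ContDiff ℝ ∞ θ
  compact : HasCompactSupport θ

theorem IsTest.memLp {θ : ℝ → ℂ} (h : IsTest θ) : MemLp θ 2 :=
  h.contDiff.continuous.memLp_of_hasCompactSupport h.compact

theorem IsTest.add {θ η : ℝ → ℂ} (h : IsTest θ) (h' : IsTest η) : IsTest (fun x => θ x + η x) :=
  ⟨h.contDiff.add h'.contDiff, h.compact.add h'.compact⟩

theorem IsTest.mul_left {θ p : ℝ → ℂ} (h : IsTest θ) (hp : ContDiff ℝ ∞ p) :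
    IsTest (fun x => p x * θ x) := ⟨hp.mul h.contDiff, h.compact.mul_left⟩

theorem freq_mul_integrable (f : L2) {θ : ℝ → ℂ} (h : IsTest θ) :
    Integrable fun x => freq f x * θ x :=
  (Lp.memLp (freq f)).integrable_mul h.memLp

theorem real_mul_schwartz_integrable (f : L2) (φ : 𝓢(ℝ, ℝ)) : Integrable fun x => f x * φ x :=
  (Lp.memLp f).integrable_mul (φ.memLp 2)

theorem cx_mul_schwartz_integrable (f : L2) (φ : 𝓢(ℝ, ℂ)) :
    Integrable fun x => (f x : ℂ) * φ x :=
  (Lp.memLp f).ofReal.integrable_mul (φ.memLp 2)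

theorem integral_cx_mul_schwartz (f : L2) (φ : 𝓢(ℝ, ℂ)) :
    ∫ x, (f x : ℂ) * φ x = ((∫ x, f x * (φ x).re : ℝ) : ℂ) +
      ((∫ x, f x * (φ x).im : ℝ) : ℂ) * Complex.I := by
  rw [← integral_re_add_im (cx_mul_schwartz_integrable f φ)]
  simp

/-- The frequency variable in Mathlib's normalization: `2πi x`. -/
def zf (x : ℝ) : ℂ := 2 * Real.pi * Complex.I * x

theorem contDiff_zf : ContDiff ℝ ∞ zf :=
  contDiff_const.mul Complex.ofRealCLM.contDiff

theorem fourier_deriv_test {θ : ℝ → ℂ} (h : IsTest θ) (w : ℝ) :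
    HasDerivAt (𝓕 θ) (𝓕 (fun x => -zf x * θ x) w) w := by
  have h1 : Integrable θ := h.contDiff.continuous.integrable_of_hasCompactSupport h.compact
  have h2 : IsTest fun x => (x : ℂ) * θ x := h.mul_left Complex.ofRealCLM.contDiff
  have h3 : Integrable fun x : ℝ => x • θ x :=
    h2.contDiff.continuous.integrable_of_hasCompactSupport h2.compact
  have := Real.hasDerivAt_fourier h1 h3 w
  have e : (fun x : ℝ => (-2 * (Real.pi : ℂ) * Complex.I * x) • θ x) = fun x => -zf x * θ x := by
    funext x
    rw [zf, smul_eq_mul]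
    ring
  rwa [e] at this

variable {ν : ℝ} {w₀ v₀ : L2} {W V : ℝ → L2}

/-- Complex test functions in the weak equations. -/
theorem weak_complex {A B : ℝ → L2} {c d : ℝ}
    (h : ∀ φ : 𝓢(ℝ, ℝ), ∀ t : ℝ, 0 < t → HasDerivAt (fun s => ∫ x, A s x * φ x)
      (∫ x, (A t x * (c * iteratedDeriv 2 (⇑φ) x - d * φ x) + B t x * deriv (⇑φ) x)) t)
    {θ : ℝ → ℂ} (hθ : IsTest θ) {t : ℝ} (ht : 0 < t) :
    HasDerivAt (fun s => ∫ x, freq (A s) x * θ x)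
      ((∫ x, freq (A t) x * ((c * zf x ^ 2 - d) * θ x)) + ∫ x, freq (B t) x * (-zf x * θ x)) t := by
  have h1 : IsTest fun x => -zf x * θ x := hθ.mul_left contDiff_zf.neg
  have h2 : IsTest fun x => -zf x * (-zf x * θ x) := h1.mul_left contDiff_zf.neg
  set φ₀ : 𝓢(ℝ, ℂ) := 𝓕 (hθ.compact.toSchwartzMap hθ.contDiff) with hφ₀
  set φ₁ : 𝓢(ℝ, ℂ) := 𝓕 (h1.compact.toSchwartzMap h1.contDiff) with hφ₁
  set φ₂ : 𝓢(ℝ, ℂ) := 𝓕 (h2.compact.toSchwartzMap h2.contDiff) with hφ₂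
  have c0 : ⇑φ₀ = 𝓕 θ := by rw [hφ₀, SchwartzMap.fourier_coe]; rfl
  have c1 : ⇑φ₁ = 𝓕 fun x => -zf x * θ x := by rw [hφ₁, SchwartzMap.fourier_coe]; rfl
  have c2 : ⇑φ₂ = 𝓕 fun x => -zf x * (-zf x * θ x) := by rw [hφ₂, SchwartzMap.fourier_coe]; rfl
  have d0 : ∀ x, HasDerivAt φ₀ (φ₁ x) x := fun x => by
    rw [c0, c1]; exact fourier_deriv_test hθ x
  have d1 : ∀ x, HasDerivAt φ₁ (φ₂ x) x := fun x => by
    rw [c1, c2]; exact fourier_deriv_test h1 x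
  have p0 : ∀ f : L2, ∫ x, freq f x * θ x = ∫ x, (f x : ℂ) * φ₀ x := fun f => by
    rw [hφ₀, ← integral_freq_mul]; rfl
  have p1 : ∀ f : L2, ∫ x, freq f x * (-zf x * θ x) = ∫ x, (f x : ℂ) * φ₁ x := fun f => by
    rw [hφ₁, ← integral_freq_mul]; rfl
  have p2 : ∀ f : L2, ∫ x, freq f x * (-zf x * (-zf x * θ x)) = ∫ x, (f x : ℂ) * φ₂ x :=
    fun f => by rw [hφ₂, ← integral_freq_mul]; rfl
  have key : ∀ L : ℂ →L[ℝ] ℝ, HasDerivAt (fun s => ∫ x, A s x * L (φ₀ x))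
      (c * (∫ x, A t x * L (φ₂ x)) - d * (∫ x, A t x * L (φ₀ x)) +
        ∫ x, B t x * L (φ₁ x)) t := fun L => by
    have e0 : ∀ x, HasDerivAt (fun x => L (φ₀ x)) (L (φ₁ x)) x := fun x =>
      L.hasFDerivAt.comp_hasDerivAt x (d0 x)
    have e1 : ∀ x, HasDerivAt (fun x => L (φ₁ x)) (L (φ₂ x)) x := fun x =>
      L.hasFDerivAt.comp_hasDerivAt x (d1 x)
    have := h (SchwartzMap.postcompCLM L φ₀) t ht
    have f0 : ⇑(SchwartzMap.postcompCLM L φ₀) = fun x => L (φ₀ x) := rfl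
    have f1 : deriv (fun x => L (φ₀ x)) = fun x => L (φ₁ x) := funext fun x => (e0 x).deriv
    have f2 : iteratedDeriv 2 (fun x => L (φ₀ x)) = fun x => L (φ₂ x) := by
      rw [iteratedDeriv_succ, iteratedDeriv_one, f1]
      exact funext fun x => (e1 x).deriv
    rw [f0, f1, f2] at this
    refine this.congr_deriv ?_
    have i0 := real_mul_schwartz_integrable (A t) (SchwartzMap.postcompCLM L φ₀)
    have i2 := real_mul_schwartz_integrable (A t) (SchwartzMap.postcompCLM L φ₂)
    have i1 := real_mul_schwartz_integrable (B t) (SchwartzMap.postcompCLM L φ₁)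
    simp only [SchwartzMap.postcompCLM_apply] at i0 i1 i2
    have e : ∀ x, A t x * (c * L (φ₂ x) - d * L (φ₀ x)) + B t x * L (φ₁ x) =
        c * (A t x * L (φ₂ x)) - d * (A t x * L (φ₀ x)) + B t x * L (φ₁ x) := fun x => by ring
    have i3 : Integrable fun x => c * (A t x * L (φ₂ x)) - d * (A t x * L (φ₀ x)) :=
      (i2.const_mul c).sub (i0.const_mul d)
    simp only [e]
    rw [integral_add i3 i1,
      integral_sub (i2.const_mul c) (i0.const_mul d), integral_const_mul, integral_const_mul]
  have kr := key Complex.reCLM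
  have ki := key Complex.imCLM
  simp only [Complex.reCLM_apply, Complex.imCLM_apply] at kr ki
  simp only [p0, p1, integral_cx_mul_schwartz]
  refine (kr.ofReal_comp.fun_add (ki.ofReal_comp.mul_const Complex.I)).congr_deriv ?_
  have j0 := freq_mul_integrable (A t) hθ
  have j2 := freq_mul_integrable (A t) h2
  have e : ∀ x, freq (A t) x * ((c * zf x ^ 2 - d) * θ x) =
      c * (freq (A t) x * (-zf x * (-zf x * θ x))) - d * (freq (A t) x * θ x) := fun x => by ring
  simp only [e]
  rw [integral_sub (j2.const_mul _) (j0.const_mul _), integral_const_mul, integral_const_mul, p0,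
    p2, integral_cx_mul_schwartz, integral_cx_mul_schwartz]
  push_cast
  ring

theorem IsSolution.freq_w (h : IsSolution ν w₀ v₀ W V) {θ : ℝ → ℂ} (hθ : IsTest θ) {t : ℝ}
    (ht : 0 < t) : HasDerivAt (fun s => ∫ x, freq (W s) x * θ x)
      ((∫ x, freq (W t) x * (ν * zf x ^ 2 * θ x)) + ∫ x, freq (V t) x * (-zf x * θ x)) t := by
  have := weak_complex (A := W) (B := V) (c := ν) (d := 0)
    (fun φ t ht => by simpa using h.eq_w φ t ht) hθ ht
  simpa using this

theorem IsSolution.freq_v (h : IsSolution ν w₀ v₀ W V) {θ : ℝ → ℂ} (hθ : IsTest θ) {t : ℝ}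
    (ht : 0 < t) : HasDerivAt (fun s => ∫ x, freq (V s) x * θ x)
      ((∫ x, freq (V t) x * ((ν * zf x ^ 2 - ν) * θ x)) +
        ∫ x, freq (W t) x * (-zf x * θ x)) t :=
  weak_complex (A := V) (B := W) (c := ν) (d := ν) h.eq_v hθ ht

/-! ### An abstract uniqueness principle -/

/-- A sequence of continuous functions, each the derivative of the preceding one, with geometric
bounds and zero initial values, vanishes. -/
theorem eq_zero_of_deriv_chain {g : ℕ → ℝ → ℂ} {T M C : ℝ} (hT : 0 < T)
    (hc : ∀ n, ContinuousOn (g n) (Ici 0))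
    (hd : ∀ n t, 0 < t → HasDerivAt (g n) (g (n + 1) t) t)
    (hb : ∀ n, ∀ t ∈ Icc 0 T, ‖g n t‖ ≤ M * C ^ n) (h0 : ∀ n, g n 0 = 0) : g 0 T = 0 := by
  have hr : ∀ n, ∀ x ∈ Ici (0 : ℝ), HasDerivWithinAt (g n) (g (n + 1) x) (Ici x) x := by
    intro n x hx
    rcases (mem_Ici.1 hx).eq_or_lt with rfl | hx
    · refine hasDerivWithinAt_Ici_of_tendsto_deriv (s := Ioi 0)
        (fun y hy => (hd n y hy).differentiableAt.differentiableWithinAt)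
        ((hc n 0 self_mem_Ici).mono Ioi_subset_Ici_self) self_mem_nhdsWithin ?_
      have h1 : Tendsto (g (n + 1)) (𝓝[>] 0) (𝓝 (g (n + 1) 0)) :=
        (hc (n + 1) 0 self_mem_Ici).mono Ioi_subset_Ici_self
      refine h1.congr' ?_
      filter_upwards [self_mem_nhdsWithin] with y hy
      exact (hd n y hy).deriv.symm
    · exact (hd n x hx).hasDerivWithinAt
  have key : ∀ J n : ℕ, ∀ t ∈ Icc 0 T,
      ‖g n t‖ ≤ M * C ^ n * ((C * t) ^ J / (J.factorial : ℝ)) := by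
    intro J
    induction J with
    | zero => intro n t ht; simpa using hb n t ht
    | succ J ih =>
      intro n t ht
      have hB : ∀ s : ℝ, HasDerivAt
          (fun s : ℝ => M * C ^ n * ((C * s) ^ (J + 1) / ((J + 1).factorial : ℝ)))
          (M * C ^ (n + 1) * ((C * s) ^ J / (J.factorial : ℝ))) s := fun s => by
        have := ((((hasDerivAt_id s).const_mul C).pow (J + 1)).div_const
          ((J + 1).factorial : ℝ)).const_mul (M * C ^ n)
        refine this.congr_deriv ?_
        rw [Nat.factorial_succ]
        have : (J.factorial : ℝ) ≠ 0 := by positivity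
        push_cast
        field_simp
        simp only [id]
        ring
      refine image_norm_le_of_norm_deriv_right_le_deriv_boundary' (a := 0) (b := T)
        ((hc n).mono Icc_subset_Ici_self) (fun x hx => hr n x hx.1) ?_
        (fun x _ => (hB x).continuousAt.continuousWithinAt)
        (fun x _ => (hB x).hasDerivWithinAt)
        (fun x hx => ih (n + 1) x ⟨hx.1, hx.2.le⟩) ht
      simp [h0]
  have hl : Tendsto (fun J : ℕ => M * C ^ 0 * ((C * T) ^ J / (J.factorial : ℝ))) atTop (𝓝 0) := by
    have := (FloorSemiring.tendsto_pow_div_factorial_atTop (C * T)).const_mul (M * C ^ 0)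
    rwa [mul_zero] at this
  have := ge_of_tendsto' hl fun J => key J 0 T ⟨hT.le, le_rfl⟩
  simpa using this

end FrequencySide
end
end TaylorDispersion

namespace TaylorDispersion
noncomputable section
section Representation

open FourierTransform

/-! ### The solution formula -/

/-- The first component of the solution at the frequency `k`, with data `F`, `G`. -/
def specW (ν t : ℝ) (F G k : ℂ) : ℂ :=
  Complex.exp (-(ν * k ^ 2 * t)) * (oscC ν t k * F - Complex.I * k * oscS ν t k * G)

/-- The second component of the solution at the frequency `k`. -/
def specV (ν t : ℝ) (F G k : ℂ) : ℂ :=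
  Complex.exp (-(ν * k ^ 2 * t)) * (oscD ν t k * G - Complex.I * k * oscS ν t k * F)

theorem hasDerivAt_heat (ν t : ℝ) (k : ℂ) : HasDerivAt (fun t : ℝ => Complex.exp (-(ν * k ^ 2 * t)))
    (Complex.exp (-(ν * k ^ 2 * t)) * -(ν * k ^ 2)) t := by
  have h : HasDerivAt (fun t : ℝ => -(ν * k ^ 2 * (t : ℂ))) (-(ν * k ^ 2 * 1)) t :=
    ((Complex.ofRealCLM.hasDerivAt (x := t)).const_mul ((ν : ℂ) * k ^ 2)).neg
  simpa using h.cexp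

theorem hasDerivAt_specW (ν t : ℝ) (F G k : ℂ) : HasDerivAt (fun t => specW ν t F G k)
    (-(ν * k ^ 2) * specW ν t F G k - Complex.I * k * specV ν t F G k) t := by
  refine ((hasDerivAt_heat ν t k).fun_mul (((hasDerivAt_oscC ν t k).mul_const F).fun_sub
    (((hasDerivAt_oscS ν t k).const_mul (Complex.I * k)).mul_const G))).congr_deriv ?_
  simp only [specW, specV]
  linear_combination (-Complex.exp (-(ν * k ^ 2 * t)) * k ^ 2 * oscS ν t k * F) * Complex.I_sq

theorem hasDerivAt_specV (ν t : ℝ) (F G k : ℂ) : HasDerivAt (fun t => specV ν t F G k)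
    ((-(ν * k ^ 2) - ν) * specV ν t F G k - Complex.I * k * specW ν t F G k) t := by
  refine ((hasDerivAt_heat ν t k).fun_mul (((hasDerivAt_oscD ν t k).mul_const G).fun_sub
    (((hasDerivAt_oscS ν t k).const_mul (Complex.I * k)).mul_const F))).congr_deriv ?_
  simp only [specW, specV, oscC]
  linear_combination (-Complex.exp (-(ν * k ^ 2 * t)) * k ^ 2 * oscS ν t k * G) * Complex.I_sq

theorem continuous_spec (ν : ℝ) {F G : ℝ → ℂ} (hF : Continuous F) (hG : Continuous G) :
    (Continuous fun p : ℝ × ℝ => specW ν p.1 (F p.2) (G p.2) p.2) ∧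
      Continuous fun p : ℝ × ℝ => specV ν p.1 (F p.2) (G p.2) p.2 := by
  have h1 : Continuous fun p : ℝ × ℝ => (p.1, (p.2 : ℂ)) := by fun_prop
  have hC := (continuous_oscC ν).comp h1
  have hS := (continuous_oscS ν).comp h1
  have hD := (continuous_oscD ν).comp h1
  simp only [Function.comp_def] at hC hS hD
  unfold specW specV
  constructor <;> fun_prop

theorem norm_spec_le {ν t : ℝ} (hν : 0 < ν) (ht : 0 ≤ t) (F G : ℂ) (k : ℝ) :
    ‖specW ν t F G k‖ ≤ Real.exp (-(ν * t) * k ^ 2) * (‖F‖ + ‖G‖) ∧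
      ‖specV ν t F G k‖ ≤ Real.exp (-(ν * t) * k ^ 2) * (‖F‖ + ‖G‖) := by
  have hE : oscBound ν t (k : ℂ) = 1 := by simp [oscBound]
  have h1 := norm_oscC_le hν (k := (k : ℂ)) ht
  have h2 := norm_oscS_mul_le hν (k := (k : ℂ)) ht
  rw [hE] at h1 h2
  have e : ‖Complex.exp (-(ν * (k : ℂ) ^ 2 * t))‖ = Real.exp (-(ν * t) * k ^ 2) := by
    rw [Complex.norm_exp]
    congr 1
    norm_cast
    ring
  have h3 : ‖Complex.I * k * oscS ν t k‖ ≤ 1 := by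
    rw [mul_assoc, norm_mul, Complex.norm_I, one_mul]; exact h2.1
  have hF := norm_nonneg F
  have hG := norm_nonneg G
  constructor
  · rw [specW, norm_mul, e]
    refine mul_le_mul_of_nonneg_left ((norm_sub_le _ _).trans ?_) (Real.exp_pos _).le
    rw [norm_mul, norm_mul _ G]
    exact add_le_add (mul_le_of_le_one_left hF h1) (mul_le_of_le_one_left hG h3)
  · rw [specV, norm_mul, e]
    refine mul_le_mul_of_nonneg_left ((norm_sub_le _ _).trans ?_) (Real.exp_pos _).le
    rw [norm_mul, norm_mul _ F, add_comm]
    exact add_le_add (mul_le_of_le_one_left hF h3) (mul_le_of_le_one_left hG h2.2)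

/-- The pairing of an integrable function with a Fourier transform. -/
theorem integral_mul_fourier {f : ℝ → ℝ} (hf : Integrable f) {θ : ℝ → ℂ} (hθ : Integrable θ) :
    ∫ x, (f x : ℂ) * 𝓕 θ x = ∫ v, ft f (2 * Real.pi * v) * θ v := by
  have hint : Integrable (Function.uncurry fun x v : ℝ =>
      (f x : ℂ) * (Complex.exp (-(Complex.I * (2 * Real.pi * v : ℝ) * x)) * θ v))
      (volume.prod volume) := by
    refine (hf.ofReal.mul_prod hθ).mono ?_ (Eventually.of_forall fun p => ?_)
    · exact (Complex.continuous_ofReal.comp_aestronglyMeasurable hf.1).comp_fst.mul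
        ((by fun_prop : Continuous _).aestronglyMeasurable.mul hθ.1.comp_snd)
    · simp only [Function.uncurry, norm_mul]
      rw [Complex.norm_exp]
      simp
  have e : ∀ x, (f x : ℂ) * 𝓕 θ x =
      ∫ v : ℝ, (f x : ℂ) * (Complex.exp (-(Complex.I * (2 * Real.pi * v : ℝ) * x)) * θ v) :=
    fun x => by
    rw [integral_const_mul, Real.fourier_real_eq_integral_exp_smul]
    congr 1
    refine integral_congr_ae (Eventually.of_forall fun v => ?_)
    beta_reduce
    rw [smul_eq_mul]
    congr 2
    push_cast; ring
  simp only [e]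
  rw [integral_integral_swap hint]
  refine integral_congr_ae (Eventually.of_forall fun v => ?_)
  beta_reduce
  rw [ft, ← integral_mul_const]
  refine integral_congr_ae (Eventually.of_forall fun x => ?_)
  beta_reduce
  ring

theorem ae_eq_of_test {f g : ℝ → ℂ} (hf : LocallyIntegrable f) (hg : LocallyIntegrable g)
    (h : ∀ θ, IsTest θ → ∫ x, f x * θ x = ∫ x, g x * θ x) : ∀ᵐ x, f x = g x := by
  refine ae_eq_of_integral_contDiff_smul_eq hf hg fun θ h1 h2 => ?_
  have ht : IsTest (fun x => (θ x : ℂ)) :=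
    ⟨Complex.ofRealCLM.contDiff.comp h1, h2.comp_left (g := ((↑) : ℝ → ℂ)) Complex.ofReal_zero⟩
  have e : ∀ u : ℝ → ℂ, ∫ x, θ x • u x = ∫ x, u x * (θ x : ℂ) := fun u =>
    integral_congr_ae (Eventually.of_forall fun x => by
      beta_reduce
      rw [Complex.real_smul, mul_comm])
  rw [e, e]
  exact h _ ht

theorem freq_eq_ft (f : L2) (hf : Integrable f) : ∀ᵐ x, freq f x = ft f (2 * Real.pi * x) := by
  refine ae_eq_of_test ((Lp.memLp (freq f)).locallyIntegrable (by norm_num))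
    ((continuous_ft hf).comp (by fun_prop)).locallyIntegrable fun θ hθ => ?_
  have h1 := integral_freq_mul f (hθ.compact.toSchwartzMap hθ.contDiff)
  rw [SchwartzMap.fourier_coe] at h1
  exact h1.trans (integral_mul_fourier hf
    (hθ.contDiff.continuous.integrable_of_hasCompactSupport hθ.compact))

/-- Fourier inversion in `L²` for an integrable Fourier transform. -/
theorem ae_eq_syn_of_freq (f : L2) {Y : ℝ → ℂ} (hY : Integrable Y)
    (h : ∀ᵐ x, freq f x = Y (2 * Real.pi * x)) : ∀ᵐ x, (f x : ℂ) = syn Y x := by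
  have h2π : (2 * Real.pi) ≠ 0 := by positivity
  refine ae_eq_of_test ((Lp.memLp f).ofReal.locallyIntegrable (by norm_num))
    (continuous_syn hY).locallyIntegrable fun θ hθ => ?_
  set φ : 𝓢(ℝ, ℂ) := hθ.compact.toSchwartzMap hθ.contDiff with hφ
  have hφθ : ∀ x, φ x = θ x := fun x => rfl
  have hθi : Integrable θ := hθ.contDiff.continuous.integrable_of_hasCompactSupport hθ.compact
  have h1 := integral_freq_mul f (𝓕⁻ φ)
  rw [FourierInvPair.fourier_fourierInv_eq] at h1
  simp only [hφθ] at h1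
  rw [← h1]
  have hY2 : Integrable fun x => Y (2 * Real.pi * x) := hY.comp_mul_left' h2π
  have hint : Integrable (Function.uncurry fun x v : ℝ =>
      Y (2 * Real.pi * x) * (Complex.exp (Complex.I * (2 * Real.pi * x : ℝ) * v) * θ v))
      (volume.prod volume) := by
    refine (hY2.mul_prod hθi).mono ?_ (Eventually.of_forall fun p => ?_)
    · exact hY2.1.comp_fst.mul
        ((by fun_prop : Continuous _).aestronglyMeasurable.mul hθi.1.comp_snd)
    · simp only [Function.uncurry, norm_mul]
      rw [Complex.norm_exp]
      simp
  calc _ = ∫ x, ∫ v : ℝ, Y (2 * Real.pi * x) *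
        (Complex.exp (Complex.I * (2 * Real.pi * x : ℝ) * v) * θ v) := by
        refine integral_congr_ae ?_
        filter_upwards [h] with x hx
        rw [hx, integral_const_mul, SchwartzMap.fourierInv_coe, Real.fourierInv_eq']
        congr 1
        refine integral_congr_ae (Eventually.of_forall fun v => ?_)
        beta_reduce
        rw [smul_eq_mul, hφθ]
        congr 2
        simp only [RCLike.inner_apply, conj_trivial]
        push_cast; ring
    _ = _ := by
        rw [integral_integral_swap hint]
        refine integral_congr_ae (Eventually.of_forall fun v => ?_)
        beta_reduce
        have := Measure.integral_comp_mul_left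
          (fun x : ℝ => Y x * Complex.exp (Complex.I * x * v)) (2 * Real.pi)
        rw [abs_of_pos (by positivity), Complex.real_smul] at this
        have e : ∀ x : ℝ, Y (2 * Real.pi * x) *
            (Complex.exp (Complex.I * (2 * Real.pi * x : ℝ) * v) * θ v) = Y (2 * Real.pi * x) *
            Complex.exp (Complex.I * (2 * Real.pi * x : ℝ) * v) * θ v := fun x => by ring
        simp only [e]
        rw [integral_mul_const, this, syn]
        push_cast; ring

/-- Differentiation under the integral for functions with a fixed compact support. -/
theorem hasDerivAt_integral_of_compact {F F' : ℝ → ℝ → ℂ} {K : Set ℝ} (hK : IsCompact K)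
    (hF : ∀ t, Continuous (F t)) (hF' : Continuous fun p : ℝ × ℝ => F' p.1 p.2)
    (hd : ∀ t x, HasDerivAt (fun t => F t x) (F' t x) t)
    (h0 : ∀ t, ∀ x ∉ K, F t x = 0) (h0' : ∀ t, ∀ x ∉ K, F' t x = 0) (t : ℝ) :
    HasDerivAt (fun t => ∫ x, F t x) (∫ x, F' t x) t := by
  obtain ⟨C, hC⟩ := ((isCompact_Icc (a := t - 1) (b := t + 1)).prod hK).exists_bound_of_continuousOn
    hF'.continuousOn
  have hsupp : ∀ G : ℝ → ℂ, (∀ x ∉ K, G x = 0) → HasCompactSupport G := fun G hG =>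
    HasCompactSupport.intro hK hG
  refine (hasDerivAt_integral_of_dominated_loc_of_deriv_le (bound := K.indicator fun _ => C)
    (Icc_mem_nhds (a := t - 1) (b := t + 1) (by linarith) (by linarith))
    (Eventually.of_forall fun s => (hF s).aestronglyMeasurable)
    ((hF t).integrable_of_hasCompactSupport (hsupp _ (h0 t)))
    (hF'.comp (by fun_prop : Continuous fun x : ℝ => (t, x))).aestronglyMeasurable
    (Eventually.of_forall fun x s hs => ?_)
    ((integrable_indicator_iff hK.measurableSet).2
      (integrableOn_const hK.measure_lt_top.ne))
    (Eventually.of_forall fun x s _ => hd s x)).2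
  by_cases hx : x ∈ K
  · rw [indicator_of_mem hx]; exact hC (s, x) ⟨hs, hx⟩
  · rw [indicator_of_notMem hx, h0' s x hx, norm_zero]

/-- The iterates of the adjoint generator on a pair of test functions. -/
def testSeq (ν : ℝ) (θ : (ℝ → ℂ) × (ℝ → ℂ)) : ℕ → (ℝ → ℂ) × (ℝ → ℂ)
  | 0 => θ
  | n + 1 => (fun x => ν * zf x ^ 2 * (testSeq ν θ n).1 x + -zf x * (testSeq ν θ n).2 x,
      fun x => (ν * zf x ^ 2 - ν) * (testSeq ν θ n).2 x + -zf x * (testSeq ν θ n).1 x)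

theorem isTest_testSeq (ν : ℝ) {θ : (ℝ → ℂ) × (ℝ → ℂ)} (h1 : IsTest θ.1) (h2 : IsTest θ.2) (n : ℕ) :
    IsTest (testSeq ν θ n).1 ∧ IsTest (testSeq ν θ n).2 := by
  induction n with
  | zero => exact ⟨h1, h2⟩
  | succ n ih =>
    have hz : ContDiff ℝ ∞ fun x => -zf x := contDiff_zf.neg
    have hz2 : ContDiff ℝ ∞ fun x => (ν : ℂ) * zf x ^ 2 := contDiff_const.mul (contDiff_zf.pow 2)
    exact ⟨(ih.1.mul_left hz2).add (ih.2.mul_left hz),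
      (ih.2.mul_left (hz2.sub contDiff_const)).add (ih.1.mul_left hz)⟩

theorem norm_testSeq_le {ν R : ℝ} (hν : 0 < ν) (θ : (ℝ → ℂ) × (ℝ → ℂ))
    (hR : ∀ x, R < |x| → θ.1 x = 0 ∧ θ.2 x = 0) (n : ℕ) (x : ℝ) :
    ‖(testSeq ν θ n).1 x‖ + ‖(testSeq ν θ n).2 x‖ ≤
      (ν * (2 * Real.pi * R) ^ 2 + ν + 2 * Real.pi * |R|) ^ n * (‖θ.1 x‖ + ‖θ.2 x‖) := by
  induction n with
  | zero => simp [testSeq]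
  | succ n ih =>
    have hz : ‖zf x‖ = 2 * Real.pi * |x| := by
      simp [zf, abs_of_pos Real.pi_pos]
    set p := (testSeq ν θ n).1 x
    set q := (testSeq ν θ n).2 x
    set C := ν * (2 * Real.pi * R) ^ 2 + ν + 2 * Real.pi * |R|
    set c := ν * (2 * Real.pi * x) ^ 2 + ν + 2 * Real.pi * |x|
    have hc0 : 0 ≤ c := by positivity
    have hC0 : 0 ≤ C := by positivity
    have hz2 : ‖(ν : ℂ) * zf x ^ 2‖ = ν * (2 * Real.pi * x) ^ 2 := by
      rw [norm_mul, norm_pow, hz, Complex.norm_real, Real.norm_of_nonneg hν.le, mul_pow, sq_abs,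
        ← mul_pow]
    have h1 : ‖(testSeq ν θ (n + 1)).1 x‖ ≤
        ν * (2 * Real.pi * x) ^ 2 * ‖p‖ + 2 * Real.pi * |x| * ‖q‖ := by
      refine (norm_add_le _ _).trans (le_of_eq ?_)
      rw [norm_mul, hz2, norm_mul, norm_neg, hz]
    have h2 : ‖(testSeq ν θ (n + 1)).2 x‖ ≤
        (ν * (2 * Real.pi * x) ^ 2 + ν) * ‖q‖ + 2 * Real.pi * |x| * ‖p‖ := by
      refine (norm_add_le _ _).trans ?_
      rw [norm_mul, norm_mul, norm_neg, hz]
      gcongr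
      refine (norm_sub_le _ _).trans (le_of_eq ?_)
      rw [hz2, Complex.norm_real, Real.norm_of_nonneg hν.le]
    have h3 : ‖(testSeq ν θ (n + 1)).1 x‖ + ‖(testSeq ν θ (n + 1)).2 x‖ ≤ c * (‖p‖ + ‖q‖) := by
      have : 0 ≤ ν * ‖p‖ := by positivity
      simp only [c]
      nlinarith
    by_cases hx : R < |x|
    · obtain ⟨e1, e2⟩ := hR x hx
      have h4 : ‖p‖ + ‖q‖ ≤ 0 := by simpa [e1, e2] using ih
      have h5 : c * (‖p‖ + ‖q‖) ≤ 0 := mul_nonpos_of_nonneg_of_nonpos hc0 h4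
      refine (h3.trans h5).trans (by positivity)
    · have hx' : |x| ≤ R := not_lt.1 hx
      have hR0 : 0 ≤ R := (abs_nonneg x).trans hx'
      have hcC : c ≤ C := by
        simp only [c, C]
        rw [abs_of_nonneg hR0]
        have : (2 * Real.pi * x) ^ 2 ≤ (2 * Real.pi * R) ^ 2 := by
          rw [mul_pow, mul_pow _ R, ← sq_abs x]
          gcongr
        gcongr
      calc _ ≤ c * (‖p‖ + ‖q‖) := h3
        _ ≤ C * (C ^ n * (‖θ.1 x‖ + ‖θ.2 x‖)) := by gcongr
        _ = _ := by ring

variable {ν : ℝ} {w₀ v₀ : L2} {W V : ℝ → L2}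

theorem continuous_spec_scaled (ν : ℝ) {f g : ℝ → ℝ} (hf : Integrable f) (hg : Integrable g) :
    (Continuous fun p : ℝ × ℝ => specW ν p.1 (ft f (2 * Real.pi * p.2)) (ft g (2 * Real.pi * p.2))
      (2 * Real.pi * p.2 : ℝ)) ∧
    Continuous fun p : ℝ × ℝ => specV ν p.1 (ft f (2 * Real.pi * p.2)) (ft g (2 * Real.pi * p.2))
      (2 * Real.pi * p.2 : ℝ) := by
  have hs : Continuous fun p : ℝ × ℝ => (p.1, 2 * Real.pi * p.2) := by fun_prop
  obtain ⟨c1, c2⟩ := continuous_spec ν (continuous_ft hf) (continuous_ft hg)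
  have d1 := c1.comp hs
  have d2 := c2.comp hs
  simp only [Function.comp_def] at d1 d2
  exact ⟨d1, d2⟩

theorem hasDerivAt_spec_testSeq (ν : ℝ) (F G : ℂ) (θ : (ℝ → ℂ) × (ℝ → ℂ)) (n : ℕ) (t x : ℝ) :
    HasDerivAt (fun t => specW ν t F G (2 * Real.pi * x : ℝ) * (testSeq ν θ n).1 x +
        specV ν t F G (2 * Real.pi * x : ℝ) * (testSeq ν θ n).2 x)
      (specW ν t F G (2 * Real.pi * x : ℝ) * (testSeq ν θ (n + 1)).1 x +
        specV ν t F G (2 * Real.pi * x : ℝ) * (testSeq ν θ (n + 1)).2 x) t := by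
  refine (((hasDerivAt_specW ν t F G (2 * Real.pi * x : ℝ)).mul_const ((testSeq ν θ n).1 x)).fun_add
    ((hasDerivAt_specV ν t F G (2 * Real.pi * x : ℝ)).mul_const
      ((testSeq ν θ n).2 x))).congr_deriv ?_
  have hz2 : zf x ^ 2 = -((2 * Real.pi * x : ℝ) : ℂ) ^ 2 := by
    rw [zf, mul_pow, mul_pow, Complex.I_sq]; push_cast; ring
  have hz1 : zf x = Complex.I * ((2 * Real.pi * x : ℝ) : ℂ) := by
    rw [zf]; push_cast; ring
  simp only [testSeq, hz2]
  rw [hz1]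
  ring

theorem IsTest.exists_support {θ : ℝ → ℂ} (h : IsTest θ) : ∃ R : ℝ, ∀ x, R < |x| → θ x = 0 := by
  obtain ⟨R, hR⟩ := h.compact.isCompact.isBounded.subset_closedBall 0
  refine ⟨R, fun x hx => ?_⟩
  by_contra h0
  have := hR (subset_tsupport _ h0)
  rw [mem_closedBall_zero_iff, Real.norm_eq_abs] at this
  linarith

/-- The pairing of the solution formula with the iterates of the adjoint generator. -/
theorem hasDerivAt_integral_spec (hν : 0 < ν) (hw : Integrable w₀)
    (hv : Integrable v₀) {θ : (ℝ → ℂ) × (ℝ → ℂ)} (h1 : IsTest θ.1) (h2 : IsTest θ.2) (n : ℕ)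
    (t : ℝ) :
    HasDerivAt (fun t => ∫ x : ℝ, (specW ν t (ft w₀ (2 * Real.pi * x)) (ft v₀ (2 * Real.pi * x))
        (2 * Real.pi * x : ℝ) * (testSeq ν θ n).1 x +
        specV ν t (ft w₀ (2 * Real.pi * x)) (ft v₀ (2 * Real.pi * x))
        (2 * Real.pi * x : ℝ) * (testSeq ν θ n).2 x))
      (∫ x : ℝ, (specW ν t (ft w₀ (2 * Real.pi * x)) (ft v₀ (2 * Real.pi * x))
        (2 * Real.pi * x : ℝ) * (testSeq ν θ (n + 1)).1 x +
        specV ν t (ft w₀ (2 * Real.pi * x)) (ft v₀ (2 * Real.pi * x))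
        (2 * Real.pi * x : ℝ) * (testSeq ν θ (n + 1)).2 x)) t := by
  obtain ⟨R₁, hR₁⟩ := h1.exists_support
  obtain ⟨R₂, hR₂⟩ := h2.exists_support
  have hR : ∀ x, max R₁ R₂ < |x| → θ.1 x = 0 ∧ θ.2 x = 0 := fun x hx =>
    ⟨hR₁ x ((le_max_left _ _).trans_lt hx), hR₂ x ((le_max_right _ _).trans_lt hx)⟩
  obtain ⟨R, hRdef⟩ : ∃ R, R = max R₁ R₂ := ⟨_, rfl⟩
  rw [← hRdef] at hR
  have hbd := norm_testSeq_le hν θ hR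
  have htest := isTest_testSeq ν h1 h2
  have hYc := continuous_spec_scaled ν hw hv
  obtain ⟨y, hy⟩ : ∃ y : ℕ → ℝ → ℝ → ℂ, ∀ n t x, y n t x =
      specW ν t (ft w₀ (2 * Real.pi * x)) (ft v₀ (2 * Real.pi * x))
        (2 * Real.pi * x : ℝ) * (testSeq ν θ n).1 x +
      specV ν t (ft w₀ (2 * Real.pi * x)) (ft v₀ (2 * Real.pi * x))
        (2 * Real.pi * x : ℝ) * (testSeq ν θ n).2 x := ⟨_, fun _ _ _ => rfl⟩
  have hyc : ∀ n, Continuous fun p : ℝ × ℝ => y n p.1 p.2 := fun n => by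
    simp only [hy]
    exact (hYc.1.mul ((htest n).1.contDiff.continuous.comp continuous_snd)).add
      (hYc.2.mul ((htest n).2.contDiff.continuous.comp continuous_snd))
  have hy0 : ∀ n t, ∀ x ∉ Metric.closedBall (0 : ℝ) R, y n t x = 0 := fun n t x hx => by
    rw [mem_closedBall_zero_iff, Real.norm_eq_abs, not_le] at hx
    obtain ⟨e1, e2⟩ := hR x hx
    have h4 := hbd n x
    rw [e1, e2, norm_zero, add_zero, mul_zero] at h4
    have h5 : (testSeq ν θ n).1 x = 0 :=
      norm_le_zero_iff.1 (by linarith [norm_nonneg ((testSeq ν θ n).2 x)])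
    have h6 : (testSeq ν θ n).2 x = 0 :=
      norm_le_zero_iff.1 (by linarith [norm_nonneg ((testSeq ν θ n).1 x)])
    rw [hy, h5, h6, mul_zero, mul_zero, add_zero]
  have hyd : ∀ n t x, HasDerivAt (fun t => y n t x) (y (n + 1) t x) t := fun n t x => by
    simp only [hy]
    exact hasDerivAt_spec_testSeq ν _ _ θ n t x
  simp only [← hy]
  exact hasDerivAt_integral_of_compact (isCompact_closedBall (0 : ℝ) R)
      (fun t => (hyc n).comp (by fun_prop : Continuous fun x : ℝ => (t, x))) (hyc (n + 1))
      (hyd n) (hy0 n) (hy0 (n + 1)) t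

set_option maxHeartbeats 800000 in
/-- The solution is determined on the Fourier side. -/
theorem IsSolution.freq_pairing (hν : 0 < ν) (h : IsSolution ν w₀ v₀ W V) (hw : Integrable w₀)
    (hv : Integrable v₀) {θ : (ℝ → ℂ) × (ℝ → ℂ)} (h1 : IsTest θ.1) (h2 : IsTest θ.2) {T : ℝ}
    (hT : 0 < T) :
    (∫ x, freq (W T) x * θ.1 x) + ∫ x, freq (V T) x * θ.2 x =
      ∫ x : ℝ, (specW ν T (ft w₀ (2 * Real.pi * x)) (ft v₀ (2 * Real.pi * x))
        (2 * Real.pi * x : ℝ) * θ.1 x +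
        specV ν T (ft w₀ (2 * Real.pi * x)) (ft v₀ (2 * Real.pi * x))
        (2 * Real.pi * x : ℝ) * θ.2 x) := by
  obtain ⟨R₁, hR₁⟩ := h1.exists_support
  obtain ⟨R₂, hR₂⟩ := h2.exists_support
  have hR : ∀ x, max R₁ R₂ < |x| → θ.1 x = 0 ∧ θ.2 x = 0 := fun x hx =>
    ⟨hR₁ x ((le_max_left _ _).trans_lt hx), hR₂ x ((le_max_right _ _).trans_lt hx)⟩
  set R := max R₁ R₂
  set C := ν * (2 * Real.pi * R) ^ 2 + ν + 2 * Real.pi * |R|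
  have hC : 0 ≤ C := by positivity
  have hbd := norm_testSeq_le hν θ hR
  have htest := isTest_testSeq ν h1 h2
  have hF : Continuous fun x : ℝ => ft w₀ (2 * Real.pi * x) := (continuous_ft hw).comp (by fun_prop)
  have hG : Continuous fun x : ℝ => ft v₀ (2 * Real.pi * x) := (continuous_ft hv).comp (by fun_prop)
  set YW : ℝ → ℝ → ℂ := fun t x => specW ν t (ft w₀ (2 * Real.pi * x))
    (ft v₀ (2 * Real.pi * x)) (2 * Real.pi * x : ℝ) with hYW
  set YV : ℝ → ℝ → ℂ := fun t x => specV ν t (ft w₀ (2 * Real.pi * x))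
    (ft v₀ (2 * Real.pi * x)) (2 * Real.pi * x : ℝ) with hYV
  set y : ℕ → ℝ → ℝ → ℂ := fun n t x =>
    YW t x * (testSeq ν θ n).1 x + YV t x * (testSeq ν θ n).2 x with hy
  have hyd : ∀ n t, HasDerivAt (fun t => ∫ x, y n t x) (∫ x, y (n + 1) t x) t :=
    hasDerivAt_integral_spec hν hw hv h1 h2
  set g : ℕ → ℝ → ℂ := fun n t => (∫ x, freq (W t) x * (testSeq ν θ n).1 x) +
    (∫ x, freq (V t) x * (testSeq ν θ n).2 x) - ∫ x, y n t x with hg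
  have hcw : ContinuousOn (fun t => ‖cxL2 (W t)‖) (Icc 0 T) :=
    (cxL2.continuous.comp_continuousOn (h.continuousOn_w.mono Icc_subset_Ici_self)).norm
  have hcv : ContinuousOn (fun t => ‖cxL2 (V t)‖) (Icc 0 T) :=
    (cxL2.continuous.comp_continuousOn (h.continuousOn_v.mono Icc_subset_Ici_self)).norm
  obtain ⟨Bw, hBw⟩ := isCompact_Icc.exists_bound_of_continuousOn hcw
  obtain ⟨Bv, hBv⟩ := isCompact_Icc.exists_bound_of_continuousOn hcv
  simp only [norm_norm] at hBw hBv
  set θ₀ : ℝ → ℝ := fun x => ‖θ.1 x‖ + ‖θ.2 x‖ with hθ₀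
  have hθ₀m : MemLp θ₀ 2 := h1.memLp.norm.add h2.memLp.norm
  have hθ₀c : MemLp (fun x => (θ₀ x : ℂ)) 2 := hθ₀m.ofReal
  have hθ₀i : Integrable θ₀ :=
    (h1.contDiff.continuous.integrable_of_hasCompactSupport h1.compact).norm.add
      (h2.contDiff.continuous.integrable_of_hasCompactSupport h2.compact).norm
  have hn0 : ∀ x, ‖(θ₀ x : ℂ)‖ = θ₀ x := fun x => by
    rw [Complex.norm_real, Real.norm_of_nonneg (by positivity)]
  set I₀ : ℝ := (∫ x, |w₀ x|) + ∫ x, |v₀ x| with hI₀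
  set Q : ℝ := ‖hθ₀c.toLp fun x => (θ₀ x : ℂ)‖
  have hmain : g 0 T = 0 := by
    refine eq_zero_of_deriv_chain (M := Q * Bw + Q * Bv + I₀ * ∫ x, θ₀ x) (C := C) hT
      (fun n => ?_) (fun n t ht => ?_) (fun n t ht => ?_) (fun n => ?_)
    · refine ((continuousOn_pairing h.continuousOn_w (htest n).1.memLp).add
        (continuousOn_pairing h.continuousOn_v (htest n).2.memLp)).sub
        (fun t _ => (hyd n t).continuousAt.continuousWithinAt)
    · refine (((h.freq_w (htest n).1 ht).fun_add (h.freq_v (htest n).2 ht)).fun_sub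
        (hyd n t)).congr_deriv ?_
      simp only [hg]
      congr 1
      have hz : ContDiff ℝ ∞ fun x => -zf x := contDiff_zf.neg
      have hz2 : ContDiff ℝ ∞ fun x => (ν : ℂ) * zf x ^ 2 := contDiff_const.mul (contDiff_zf.pow 2)
      simp only [testSeq, mul_add]
      rw [integral_add (freq_mul_integrable (W t) ((htest n).1.mul_left hz2))
        (freq_mul_integrable (W t) ((htest n).2.mul_left hz)),
        integral_add (freq_mul_integrable (V t) ((htest n).2.mul_left (hz2.sub contDiff_const)))
        (freq_mul_integrable (V t) ((htest n).1.mul_left hz))]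
      ring
    · have b1 : ‖∫ x, freq (W t) x * (testSeq ν θ n).1 x‖ ≤ C ^ n * Q * ‖cxL2 (W t)‖ :=
        norm_pairing_le (W t) (htest n).1.memLp hθ₀c fun x => by
          rw [hn0]
          exact (le_add_of_nonneg_right (norm_nonneg _)).trans (hbd n x)
      have b2 : ‖∫ x, freq (V t) x * (testSeq ν θ n).2 x‖ ≤ C ^ n * Q * ‖cxL2 (V t)‖ :=
        norm_pairing_le (V t) (htest n).2.memLp hθ₀c fun x => by
          rw [hn0]
          exact (le_add_of_nonneg_left (norm_nonneg _)).trans (hbd n x)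
      have b3 : ‖∫ x, y n t x‖ ≤ ∫ x, I₀ * C ^ n * θ₀ x := by
        refine norm_integral_le_of_norm_le (hθ₀i.const_mul _) (Eventually.of_forall fun x => ?_)
        obtain ⟨s1, s2⟩ := norm_spec_le hν ht.1 (ft w₀ (2 * Real.pi * x)) (ft v₀ (2 * Real.pi * x))
          (2 * Real.pi * x)
        have he : Real.exp (-(ν * t) * (2 * Real.pi * x) ^ 2) ≤ 1 := by
          refine Real.exp_le_one_iff.2 ?_
          have : 0 ≤ ν * t := mul_nonneg hν.le ht.1
          nlinarith [mul_nonneg this (sq_nonneg (2 * Real.pi * x))]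
        have hI : ‖ft w₀ (2 * Real.pi * x)‖ + ‖ft v₀ (2 * Real.pi * x)‖ ≤ I₀ :=
          add_le_add (norm_ft_le _ _) (norm_ft_le _ _)
        have hle : Real.exp (-(ν * t) * (2 * Real.pi * x) ^ 2) *
            (‖ft w₀ (2 * Real.pi * x)‖ + ‖ft v₀ (2 * Real.pi * x)‖) ≤ I₀ :=
          (mul_le_of_le_one_left (by positivity) he).trans hI
        calc _ ≤ ‖YW t x‖ * ‖(testSeq ν θ n).1 x‖ + ‖YV t x‖ * ‖(testSeq ν θ n).2 x‖ := by
              rw [← norm_mul, ← norm_mul]; exact norm_add_le _ _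
          _ ≤ I₀ * ‖(testSeq ν θ n).1 x‖ + I₀ * ‖(testSeq ν θ n).2 x‖ := by
              gcongr
              · exact s1.trans hle
              · exact s2.trans hle
          _ = I₀ * (‖(testSeq ν θ n).1 x‖ + ‖(testSeq ν θ n).2 x‖) := by ring
          _ ≤ I₀ * (C ^ n * θ₀ x) := by
              have : 0 ≤ I₀ := (by positivity : (0 : ℝ) ≤ _ ).trans hI
              gcongr
              exact hbd n x
          _ = _ := by ring
      rw [integral_const_mul] at b3
      have hQ : 0 ≤ Q := norm_nonneg _
      calc ‖g n t‖ ≤ C ^ n * Q * ‖cxL2 (W t)‖ + C ^ n * Q * ‖cxL2 (V t)‖ +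
            I₀ * C ^ n * ∫ x, θ₀ x :=
            (norm_sub_le _ _).trans (add_le_add ((norm_add_le _ _).trans (add_le_add b1 b2)) b3)
        _ ≤ C ^ n * Q * Bw + C ^ n * Q * Bv + I₀ * C ^ n * ∫ x, θ₀ x := by
            gcongr
            · exact hBw t ht
            · exact hBv t ht
        _ = _ := by ring
    · simp only [hg, h.initial_w, h.initial_v]
      have e1 : ∫ x, freq w₀ x * (testSeq ν θ n).1 x =
          ∫ x : ℝ, ft w₀ (2 * Real.pi * x) * (testSeq ν θ n).1 x := integral_congr_ae (by
        filter_upwards [freq_eq_ft w₀ hw] with x hx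
        rw [hx])
      have e2 : ∫ x, freq v₀ x * (testSeq ν θ n).2 x =
          ∫ x : ℝ, ft v₀ (2 * Real.pi * x) * (testSeq ν θ n).2 x := integral_congr_ae (by
        filter_upwards [freq_eq_ft v₀ hv] with x hx
        rw [hx])
      have t1 := (htest n).1
      have t2 := (htest n).2
      have i1 : Integrable fun x : ℝ => ft w₀ (2 * Real.pi * x) * (testSeq ν θ n).1 x :=
        (hF.mul t1.contDiff.continuous).integrable_of_hasCompactSupport t1.compact.mul_left
      have i2 : Integrable fun x : ℝ => ft v₀ (2 * Real.pi * x) * (testSeq ν θ n).2 x :=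
        (hG.mul t2.contDiff.continuous).integrable_of_hasCompactSupport t2.compact.mul_left
      rw [e1, e2, ← integral_add i1 i2, sub_eq_zero]
      refine integral_congr_ae (Eventually.of_forall fun x => ?_)
      simp [hy, YW, YV, specW, specV, oscC_zero, oscS_zero, oscD_zero]
  simp only [hg] at hmain
  exact sub_eq_zero.1 hmain

theorem integrable_spec (hν : 0 < ν) (hw : Integrable w₀) (hv : Integrable v₀) {T : ℝ}
    (hT : 0 < T) : (Integrable fun κ : ℝ => specW ν T (ft w₀ κ) (ft v₀ κ) κ) ∧
      Integrable fun κ : ℝ => specV ν T (ft w₀ κ) (ft v₀ κ) κ := by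
  obtain ⟨c1, c2⟩ := continuous_spec ν (continuous_ft hw) (continuous_ft hv)
  have hs : Continuous fun x : ℝ => (T, x) := by fun_prop
  have hi := (integrable_exp_neg_mul_sq (mul_pos hν hT)).mul_const ((∫ x, |w₀ x|) + ∫ x, |v₀ x|)
  have hb : ∀ κ : ℝ, Real.exp (-(ν * T) * κ ^ 2) * (‖ft w₀ κ‖ + ‖ft v₀ κ‖) ≤
      Real.exp (-(ν * T) * κ ^ 2) * ((∫ x, |w₀ x|) + ∫ x, |v₀ x|) := fun κ =>
    mul_le_mul_of_nonneg_left (add_le_add (norm_ft_le _ _) (norm_ft_le _ _)) (Real.exp_pos _).le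
  exact ⟨hi.mono' (c1.comp hs).aestronglyMeasurable (Eventually.of_forall fun κ =>
      ((norm_spec_le hν hT.le _ _ κ).1).trans (hb κ)),
    hi.mono' (c2.comp hs).aestronglyMeasurable (Eventually.of_forall fun κ =>
      ((norm_spec_le hν hT.le _ _ κ).2).trans (hb κ))⟩

/-- The solution formula for integrable data. -/
theorem IsSolution.freq_eq (hν : 0 < ν) (h : IsSolution ν w₀ v₀ W V) (hw : Integrable w₀)
    (hv : Integrable v₀) {T : ℝ} (hT : 0 < T) :
    (∀ᵐ x, freq (W T) x = specW ν T (ft w₀ (2 * Real.pi * x)) (ft v₀ (2 * Real.pi * x))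
      (2 * Real.pi * x : ℝ)) ∧
    ∀ᵐ x, freq (V T) x = specV ν T (ft w₀ (2 * Real.pi * x)) (ft v₀ (2 * Real.pi * x))
      (2 * Real.pi * x : ℝ) := by
  obtain ⟨c1, c2⟩ := continuous_spec ν (continuous_ft hw) (continuous_ft hv)
  have hs : Continuous fun x : ℝ => (T, 2 * Real.pi * x) := by fun_prop
  have hz : IsTest (fun _ => 0) := ⟨contDiff_const, HasCompactSupport.zero⟩
  refine ⟨ae_eq_of_test ((Lp.memLp (freq (W T))).locallyIntegrable (by norm_num))
      (c1.comp hs).locallyIntegrable fun θ hθ => ?_,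
    ae_eq_of_test ((Lp.memLp (freq (V T))).locallyIntegrable (by norm_num))
      (c2.comp hs).locallyIntegrable fun θ hθ => ?_⟩
  · simpa using! h.freq_pairing hν hw hv (θ := (θ, fun _ => 0)) hθ hz hT
  · simpa using! h.freq_pairing hν hw hv (θ := (fun _ => 0, θ)) hz hθ hT

theorem IsSolution.eq_syn (hν : 0 < ν) (h : IsSolution ν w₀ v₀ W V) (hw : Integrable w₀)
    (hv : Integrable v₀) {T : ℝ} (hT : 0 < T) :
    (∀ᵐ x, (W T x : ℂ) = syn (fun κ => specW ν T (ft w₀ κ) (ft v₀ κ) κ) x) ∧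
      ∀ᵐ x, (V T x : ℂ) = syn (fun κ => specV ν T (ft w₀ κ) (ft v₀ κ) κ) x :=
  ⟨ae_eq_syn_of_freq _ (integrable_spec hν hw hv hT).1 (h.freq_eq hν hw hv hT).1,
    ae_eq_syn_of_freq _ (integrable_spec hν hw hv hT).2 (h.freq_eq hν hw hv hT).2⟩

end Representation
end
end TaylorDispersion

namespace TaylorDispersion
noncomputable section
section Duhamel
open PowerSeries

/-! ### Truncated series solutions are approximate solutions -/

theorem evalTrunc_add (N : ℕ) (F G : ℝ⟦X⟧) (z : ℂ) :
    evalTrunc N (F + G) z = evalTrunc N F z + evalTrunc N G z := by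
  simp only [evalTrunc, map_add, Complex.ofReal_add, add_mul, Finset.sum_add_distrib]

theorem evalTrunc_neg (N : ℕ) (F : ℝ⟦X⟧) (z : ℂ) : evalTrunc N (-F) z = -evalTrunc N F z := by
  simp only [evalTrunc, map_neg, Complex.ofReal_neg, neg_mul, Finset.sum_neg_distrib]

theorem evalTrunc_sub (N : ℕ) (F G : ℝ⟦X⟧) (z : ℂ) :
    evalTrunc N (F - G) z = evalTrunc N F z - evalTrunc N G z := by
  rw [sub_eq_add_neg, evalTrunc_add, evalTrunc_neg, ← sub_eq_add_neg]

theorem evalTrunc_C_mul (N : ℕ) (r : ℝ) (F : ℝ⟦X⟧) (z : ℂ) :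
    evalTrunc N (C r * F) z = r * evalTrunc N F z := by
  simp only [evalTrunc, coeff_C_mul, Complex.ofReal_mul, Finset.mul_sum, mul_assoc]

theorem evalTrunc_succ (N : ℕ) (F : ℝ⟦X⟧) (z : ℂ) :
    evalTrunc (N + 1) F z = evalTrunc N F z + (coeff (N + 1) F : ℝ) * z ^ (N + 1) := by
  rw [evalTrunc, Finset.sum_range_succ, evalTrunc]

theorem evalTrunc_succ_X_mul (N : ℕ) (F : ℝ⟦X⟧) (z : ℂ) :
    evalTrunc (N + 1) (X * F) z = z * evalTrunc N F z := by
  rw [evalTrunc, Finset.sum_range_succ', evalTrunc, Finset.mul_sum]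
  simp only [coeff_succ_X_mul, coeff_zero_X_mul, Complex.ofReal_zero, zero_mul, add_zero]
  exact Finset.sum_congr rfl fun j _ => by ring

theorem evalTrunc_X_mul (N : ℕ) (F : ℝ⟦X⟧) (z : ℂ) :
    evalTrunc N (X * F) z = z * (evalTrunc N F z - (coeff N F : ℝ) * z ^ N) := by
  have h1 := evalTrunc_succ_X_mul N F z
  rw [evalTrunc_succ, coeff_succ_X_mul] at h1
  linear_combination h1

theorem evalTrunc_X_sq_mul (N : ℕ) (F : ℝ⟦X⟧) (z : ℂ) :
    evalTrunc N (X ^ 2 * F) z = z ^ 2 * evalTrunc N F z - (coeff N F : ℝ) * z ^ (N + 2) -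
      (coeff N (X * F) : ℝ) * z ^ (N + 1) := by
  rw [pow_two, mul_assoc, evalTrunc_X_mul, evalTrunc_X_mul]
  ring

theorem hasDerivAt_evalTrunc {N : ℕ} {F : ℝ → ℝ⟦X⟧} {F' : ℝ⟦X⟧} {t : ℝ}
    (h : CoeffDeriv N F F' univ t) (z : ℂ) :
    HasDerivAt (fun t => evalTrunc N (F t) z) (evalTrunc N F' z) t := by
  simp only [evalTrunc]
  refine HasDerivAt.fun_sum fun j hj => ?_
  have := (h j (Finset.mem_range_succ_iff.1 hj)).hasDerivAt univ_mem
  exact this.ofReal_comp.mul_const _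

/-- The heat flow with the enhanced diffusion coefficient, applied to a truncated series. -/
def heatTrunc (ν t : ℝ) (N : ℕ) (F : ℝ⟦X⟧) (k : ℂ) : ℂ :=
  Complex.exp (-(nuT ν * k ^ 2 * t)) * evalTrunc N F (Complex.I * k)

theorem hasDerivAt_heatTrunc {ν : ℝ} {N : ℕ} {F : ℝ → ℝ⟦X⟧} {F' : ℝ⟦X⟧} {t : ℝ}
    (h : CoeffDeriv N F F' univ t) (k : ℂ) :
    HasDerivAt (fun t => heatTrunc ν t N (F t) k)
      (-(nuT ν * k ^ 2) * heatTrunc ν t N (F t) k + heatTrunc ν t N F' k) t := by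
  refine ((hasDerivAt_heat (nuT ν) t k).fun_mul (hasDerivAt_evalTrunc h _)).congr_deriv ?_
  simp only [heatTrunc]
  ring

variable {ν : ℝ} (a₀ c₀ : ℝ⟦X⟧)

/-- The residual of the first component, without the Gaussian factor. -/
def resW (ν : ℝ) (a₀ c₀ : ℝ⟦X⟧) (N : ℕ) (t : ℝ) (z : ℂ) : ℂ :=
  (coeff N (C (1 / ν) * (X * solA ν a₀ c₀ t) + solC ν a₀ c₀ t) : ℝ) * z ^ (N + 1) +
    (coeff (N + 1) (C (1 / ν) * (X * solA ν a₀ c₀ t) + solC ν a₀ c₀ t) : ℝ) * z ^ (N + 2)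

/-- The residual of the second component, without the Gaussian factor. -/
def resV (ν : ℝ) (a₀ c₀ : ℝ⟦X⟧) (N : ℕ) (t : ℝ) (z : ℂ) : ℂ :=
  (1 / ν : ℝ) * ((coeff N (solC ν a₀ c₀ t) : ℝ) * z ^ (N + 2) +
    (coeff (N + 1) (solC ν a₀ c₀ t) : ℝ) * z ^ (N + 3))

theorem hasDerivAt_heatTrunc_solA (hν : 0 < ν) (N : ℕ) (t : ℝ) (k : ℂ) :
    HasDerivAt (fun t => heatTrunc ν t N (solA ν a₀ c₀ t) k)
      (-(ν * k ^ 2) * heatTrunc ν t N (solA ν a₀ c₀ t) k -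
        Complex.I * k * heatTrunc ν t (N + 1) (solC ν a₀ c₀ t) k +
        Complex.exp (-(nuT ν * k ^ 2 * t)) * resW ν a₀ c₀ N t (Complex.I * k)) t := by
  refine (hasDerivAt_heatTrunc (solA_deriv a₀ c₀ hν.ne') k).congr_deriv ?_
  have hν' : (ν : ℂ) ≠ 0 := by exact_mod_cast hν.ne'
  simp only [heatTrunc, resW, evalTrunc_sub, evalTrunc_neg, mul_assoc (C (1 / ν)), evalTrunc_C_mul,
    evalTrunc_X_sq_mul, evalTrunc_X_mul, evalTrunc_succ, map_add, coeff_C_mul, coeff_succ_X_mul,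
    nuT]
  push_cast
  linear_combination (-Complex.exp (-((ν + 1 / ν) * k ^ 2 * t)) * (1 / ν) * k ^ 2 *
    evalTrunc N (solA ν a₀ c₀ t) (Complex.I * k)) * Complex.I_sq

theorem hasDerivAt_heatTrunc_solC (hν : 0 < ν) (N : ℕ) (t : ℝ) (k : ℂ) :
    HasDerivAt (fun t => heatTrunc ν t (N + 1) (solC ν a₀ c₀ t) k)
      ((-(ν * k ^ 2) - ν) * heatTrunc ν t (N + 1) (solC ν a₀ c₀ t) k -
        Complex.I * k * heatTrunc ν t N (solA ν a₀ c₀ t) k +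
        Complex.exp (-(nuT ν * k ^ 2 * t)) * resV ν a₀ c₀ N t (Complex.I * k)) t := by
  refine (hasDerivAt_heatTrunc (solC_deriv a₀ c₀ hν.ne') k).congr_deriv ?_
  simp only [heatTrunc, resV, evalTrunc_sub, evalTrunc_neg, mul_assoc (C (1 / ν)), evalTrunc_C_mul,
    evalTrunc_X_sq_mul, evalTrunc_succ_X_mul, coeff_succ_X_mul, nuT]
  push_cast
  linear_combination (-Complex.exp (-((ν + 1 / ν) * k ^ 2 * t)) * (1 / ν) * k ^ 2 *
    evalTrunc (N + 1) (solC ν a₀ c₀ t) (Complex.I * k)) * Complex.I_sq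

/-- The error of the truncated series solution, first component. -/
def errW (ν : ℝ) (a₀ c₀ : ℝ⟦X⟧) (N : ℕ) (t : ℝ) (k : ℂ) : ℂ :=
  specW ν t (evalTrunc N a₀ (Complex.I * k)) (evalTrunc (N + 1) c₀ (Complex.I * k)) k -
    heatTrunc ν t N (solA ν a₀ c₀ t) k

/-- The error of the truncated series solution, second component. -/
def errV (ν : ℝ) (a₀ c₀ : ℝ⟦X⟧) (N : ℕ) (t : ℝ) (k : ℂ) : ℂ :=
  specV ν t (evalTrunc N a₀ (Complex.I * k)) (evalTrunc (N + 1) c₀ (Complex.I * k)) k -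
    heatTrunc ν t (N + 1) (solC ν a₀ c₀ t) k

theorem spec_zero (ν : ℝ) (F G k : ℂ) : specW ν 0 F G k = F ∧ specV ν 0 F G k = G := by
  simp [specW, specV]

theorem err_zero (N : ℕ) (k : ℂ) : errW ν a₀ c₀ N 0 k = 0 ∧ errV ν a₀ c₀ N 0 k = 0 := by
  simp [errW, errV, spec_zero, heatTrunc, solA_zero, solC_zero]

theorem hasDerivAt_spec_comp (ν t : ℝ) {F G : ℝ → ℂ} {f g k : ℂ} {s : ℝ}
    (hF : HasDerivAt F (-(ν * k ^ 2) * F s - Complex.I * k * G s - f) s)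
    (hG : HasDerivAt G ((-(ν * k ^ 2) - ν) * G s - Complex.I * k * F s - g) s) :
    HasDerivAt (fun s => specW ν (t - s) (F s) (G s) k) (-specW ν (t - s) f g k) s ∧
      HasDerivAt (fun s => specV ν (t - s) (F s) (G s) k) (-specV ν (t - s) f g k) s := by
  have hs : HasDerivAt (fun s => t - s) (-1) s := by
    simpa using (hasDerivAt_id s).const_sub t
  have h0 := (hasDerivAt_heat ν (t - s) k).scomp s hs
  have hC := (hasDerivAt_oscC ν (t - s) k).scomp s hs
  have hD := (hasDerivAt_oscD ν (t - s) k).scomp s hs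
  have hS := (hasDerivAt_oscS ν (t - s) k).scomp s hs
  simp only [Function.comp_def] at h0 hC hD hS
  constructor
  · refine (h0.fun_mul ((hC.fun_mul hF).fun_sub
      (((hS.const_mul (Complex.I * k))).fun_mul hG))).congr_deriv ?_
    simp only [specW, oscC, neg_smul, one_smul]
    linear_combination (Complex.exp (-(ν * k ^ 2 * (t - s : ℝ))) * k ^ 2 * oscS ν (t - s) k * F s) *
      Complex.I_sq
  · refine (h0.fun_mul ((hD.fun_mul hG).fun_sub
      (((hS.const_mul (Complex.I * k))).fun_mul hF))).congr_deriv ?_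
    simp only [specV, neg_smul, one_smul]
    linear_combination (Complex.exp (-(ν * k ^ 2 * (t - s : ℝ))) * k ^ 2 * oscS ν (t - s) k * G s) *
      Complex.I_sq

theorem hasDerivAt_err (hν : 0 < ν) (N : ℕ) (s : ℝ) (k : ℂ) :
    HasDerivAt (fun s => errW ν a₀ c₀ N s k) (-(ν * k ^ 2) * errW ν a₀ c₀ N s k -
      Complex.I * k * errV ν a₀ c₀ N s k -
      Complex.exp (-(nuT ν * k ^ 2 * s)) * resW ν a₀ c₀ N s (Complex.I * k)) s ∧
    HasDerivAt (fun s => errV ν a₀ c₀ N s k) ((-(ν * k ^ 2) - ν) * errV ν a₀ c₀ N s k -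
      Complex.I * k * errW ν a₀ c₀ N s k -
      Complex.exp (-(nuT ν * k ^ 2 * s)) * resV ν a₀ c₀ N s (Complex.I * k)) s := by
  constructor
  · refine ((hasDerivAt_specW ν s _ _ k).fun_sub
      (hasDerivAt_heatTrunc_solA a₀ c₀ hν N s k)).congr_deriv ?_
    simp only [errW, errV]; ring
  · refine ((hasDerivAt_specV ν s _ _ k).fun_sub
      (hasDerivAt_heatTrunc_solC a₀ c₀ hν N s k)).congr_deriv ?_
    simp only [errW, errV]; ring

/-- The Gaussian weight of the Duhamel integrand. -/
theorem norm_heat_mul_le (hν : 0 < ν) {s : ℝ} (hs : 0 ≤ s) (t : ℝ) (k : ℂ) :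
    ‖Complex.exp (-(ν * k ^ 2 * (t - s : ℝ)))‖ * oscBound ν (t - s) k *
      ‖Complex.exp (-(nuT ν * k ^ 2 * s))‖ ≤ Real.exp (nuT ν * k.im ^ 2 * t - ν * k.re ^ 2 * t) := by
  have e : ∀ r u : ℝ, (-((r : ℂ) * k ^ 2 * (u : ℂ))).re = -(r * (k.re ^ 2 - k.im ^ 2) * u) := by
    intro r u
    simp [pow_two, Complex.mul_re, Complex.mul_im]
  rw [Complex.norm_exp, Complex.norm_exp, oscBound, ← Real.exp_add, ← Real.exp_add, e, e]
  refine Real.exp_le_exp.2 ?_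
  have h1 : 0 ≤ 1 / ν * s * k.re ^ 2 := by positivity
  have h2 : k.im ^ 2 / ν = 1 / ν * k.im ^ 2 := by ring
  rw [h2]
  simp only [nuT]
  nlinarith

theorem norm_spec_duhamel_le (hν : 0 < ν) {s t : ℝ} (hs : 0 ≤ s) (hst : s ≤ t) (f g k : ℂ) :
    ‖specW ν (t - s) (Complex.exp (-(nuT ν * k ^ 2 * s)) * f)
        (Complex.exp (-(nuT ν * k ^ 2 * s)) * g) k‖ ≤
      Real.exp (nuT ν * k.im ^ 2 * t - ν * k.re ^ 2 * t) * (‖f‖ + ‖g‖) ∧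
    ‖specV ν (t - s) (Complex.exp (-(nuT ν * k ^ 2 * s)) * f)
        (Complex.exp (-(nuT ν * k ^ 2 * s)) * g) k‖ ≤
      Real.exp (nuT ν * k.im ^ 2 * t - ν * k.re ^ 2 * t) *
        ((Real.exp (-ν * (t - s)) + ‖k‖ ^ 2 / ν ^ 2) * ‖g‖ + ‖k‖ / ν * ‖f‖) := by
  have hw := norm_heat_mul_le hν hs t k
  have hts : 0 ≤ t - s := sub_nonneg.2 hst
  set b := oscBound ν (t - s) k
  set e₁ := Complex.exp (-(ν * k ^ 2 * (t - s : ℝ)))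
  set e₂ := Complex.exp (-(nuT ν * k ^ 2 * s))
  set w := Real.exp (nuT ν * k.im ^ 2 * t - ν * k.re ^ 2 * t)
  have hb : 1 ≤ b := Real.one_le_exp (by positivity)
  have h1 : ‖Complex.I * k * oscS ν (t - s) k‖ ≤ b := by
    rw [mul_assoc, norm_mul, Complex.norm_I, one_mul]; exact (norm_oscS_mul_le hν hts).1
  have h2 : ‖Complex.I * k * oscS ν (t - s) k‖ ≤ ‖k‖ / ν * b := by
    rw [norm_mul, norm_mul, Complex.norm_I, one_mul]
    refine (mul_le_mul_of_nonneg_left (norm_oscS_le hν hts) (norm_nonneg k)).trans (le_of_eq ?_)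
    ring
  have h3 := norm_oscC_le hν (k := k) hts
  have h4 : ‖oscD ν (t - s) k‖ ≤ (Real.exp (-ν * (t - s)) + ‖k‖ ^ 2 / ν ^ 2) * b := by
    refine (norm_oscD_le hν (k := k) hts).trans ?_
    rw [add_mul]
    exact add_le_add_left (le_mul_of_one_le_right (Real.exp_pos _).le hb) _
  have hf := norm_nonneg f
  have hg := norm_nonneg g
  have h0 : 0 ≤ ‖e₁‖ * ‖e₂‖ := by positivity
  constructor
  · have e : specW ν (t - s) (e₂ * f) (e₂ * g) k =
        (e₁ * e₂) * (oscC ν (t - s) k * f - Complex.I * k * oscS ν (t - s) k * g) := by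
      simp only [specW, e₁]; ring
    rw [e, norm_mul, norm_mul]
    calc _ ≤ ‖e₁‖ * ‖e₂‖ * (b * ‖f‖ + b * ‖g‖) := by
          refine mul_le_mul_of_nonneg_left ((norm_sub_le _ _).trans ?_) h0
          rw [norm_mul, norm_mul _ g]
          gcongr
      _ = ‖e₁‖ * b * ‖e₂‖ * (‖f‖ + ‖g‖) := by ring
      _ ≤ _ := by gcongr
  · have e : specV ν (t - s) (e₂ * f) (e₂ * g) k =
        (e₁ * e₂) * (oscD ν (t - s) k * g - Complex.I * k * oscS ν (t - s) k * f) := by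
      simp only [specV, e₁]; ring
    rw [e, norm_mul, norm_mul]
    calc _ ≤ ‖e₁‖ * ‖e₂‖ * ((Real.exp (-ν * (t - s)) + ‖k‖ ^ 2 / ν ^ 2) * b * ‖g‖ +
          ‖k‖ / ν * b * ‖f‖) := by
          refine mul_le_mul_of_nonneg_left ((norm_sub_le _ _).trans ?_) h0
          rw [norm_mul, norm_mul _ f]
          gcongr
      _ = ‖e₁‖ * b * ‖e₂‖ *
          ((Real.exp (-ν * (t - s)) + ‖k‖ ^ 2 / ν ^ 2) * ‖g‖ + ‖k‖ / ν * ‖f‖) := by ring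
      _ ≤ _ := by gcongr

theorem norm_le_of_norm_deriv_le_Icc {f f' : ℝ → ℂ} {B B' : ℝ → ℝ} {t : ℝ} (ht : 0 ≤ t)
    (hf : ∀ s, HasDerivAt f (f' s) s) (hB : ∀ s, 0 ≤ s → HasDerivWithinAt B (B' s) (Ici 0) s)
    (h : ∀ s, 0 ≤ s → s ≤ t → ‖f' s‖ ≤ B' s) (h0 : f 0 = 0) : ‖f t‖ ≤ B t - B 0 := by
  refine image_norm_le_of_norm_deriv_right_le_deriv_boundary' (a := 0) (b := t) (f := f) (f' := f')
    (B := fun t => B t - B 0) (B' := B')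
    (fun x _ => (hf x).continuousAt.continuousWithinAt) (fun x _ => (hf x).hasDerivWithinAt)
    (by simp [h0]) (fun x hx => ?_) (fun x hx => ?_) (fun x hx => h x hx.1 hx.2.le)
    (right_mem_Icc.2 ht)
  · exact (((hB x hx.1).continuousWithinAt).mono Icc_subset_Ici_self).sub
      continuousWithinAt_const
  · exact ((hB x hx.1).sub_const _).mono (Ici_subset_Ici.2 hx.1)

theorem exists_res_bound (hν : 0 < ν) (N : ℕ) : ∃ K, 0 ≤ K ∧ ∀ s t : ℝ, 0 ≤ s → s ≤ t → ∀ k : ℂ,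
    ‖resW ν a₀ c₀ N s (Complex.I * k)‖ ≤
      K * (1 + s) ^ (((N : ℝ) - 3) / 4) * (‖k‖ ^ (N + 1) * (1 + ‖k‖ * √(1 + t)) ^ 2) ∧
    ‖resV ν a₀ c₀ N s (Complex.I * k)‖ ≤
      K * (1 + s) ^ (((N : ℝ) - 3) / 4) * (‖k‖ ^ (N + 1) * (1 + ‖k‖ * √(1 + t)) ^ 2) ∧
    ‖resV ν a₀ c₀ N s (Complex.I * k)‖ ≤
      K * (1 + t) ^ (((N : ℝ) + 1) / 4) * (‖k‖ ^ (N + 2) * (1 + ‖k‖ * √(1 + t))) := by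
  obtain ⟨C₁, h₁⟩ := solA_add_solC_growth a₀ c₀ hν N
  obtain ⟨C₂, h₂⟩ := solA_add_solC_growth a₀ c₀ hν (N + 1)
  obtain ⟨C₃, h₃⟩ := solC_growth a₀ c₀ hν N
  obtain ⟨C₄, h₄⟩ := solC_growth a₀ c₀ hν (N + 1)
  set K := |C₁| + |C₂| + 1 / ν * (|C₃| + |C₄|)
  have hK1 : |C₁| + |C₂| ≤ K := le_add_of_nonneg_right (by positivity)
  have hK2 : 1 / ν * (|C₃| + |C₄|) ≤ K := le_add_of_nonneg_left (by positivity)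
  refine ⟨K, by positivity, fun s t hs hst k => ?_⟩
  have hx := norm_nonneg k
  set x := ‖k‖
  set r := √(1 + t)
  have hs1 : (0 : ℝ) < 1 + s := by linarith
  have hr1 : 1 ≤ r := Real.one_le_sqrt.2 (by linarith)
  have hr2 : r ^ 2 = 1 + t := Real.sq_sqrt (by linarith)
  set g := (1 + s) ^ (((N : ℝ) - 3) / 4)
  have hg : 0 < g := Real.rpow_pos_of_pos hs1 _
  have hpow : ∀ (p : ℝ) (n : ℕ), 0 ≤ p → p ≤ n / 2 →
      (1 + s) ^ (((N : ℝ) - 3) / 4 + p) ≤ g * r ^ n := fun p n hp hpn => by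
    rw [Real.rpow_add hs1]
    refine mul_le_mul_of_nonneg_left ?_ hg.le
    calc (1 + s) ^ p ≤ (1 + t) ^ p := Real.rpow_le_rpow hs1.le (by linarith) hp
      _ ≤ (1 + t) ^ ((n : ℝ) / 2) := Real.rpow_le_rpow_of_exponent_le (by linarith) hpn
      _ = r ^ n := by
        rw [← hr2, ← Real.rpow_natCast r 2, ← Real.rpow_mul (by linarith), ← Real.rpow_natCast]
        congr 1; push_cast; ring
  have hpow' : ∀ p : ℝ, p ≤ ((N : ℝ) + 1) / 4 → (1 + s) ^ p ≤ (1 + t) ^ (((N : ℝ) + 1) / 4) :=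
    fun p hp => (Real.rpow_le_rpow_of_exponent_le (by linarith) hp).trans
      (Real.rpow_le_rpow hs1.le (by linarith) (by positivity))
  have hcoef : ∀ {b C p u v : ℝ}, b ≤ C * u → u ≤ v → 0 ≤ u → b ≤ |C| * v := fun h1 h2 h3 =>
    h1.trans ((mul_le_mul_of_nonneg_right (le_abs_self _) h3).trans
      (mul_le_mul_of_nonneg_left h2 (abs_nonneg _)))
  have hnn : ∀ p : ℝ, 0 ≤ (1 + s) ^ p := fun p => (Real.rpow_pos_of_pos hs1 p).le
  have b1 : |coeff N (C (1 / ν) * (X * solA ν a₀ c₀ s) + solC ν a₀ c₀ s)| ≤ |C₁| * g :=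
    hcoef (p := 0) (h₁ s hs) le_rfl (hnn _)
  have b2 : |coeff (N + 1) (C (1 / ν) * (X * solA ν a₀ c₀ s) + solC ν a₀ c₀ s)| ≤
      |C₂| * (g * r ^ 1) := by
    refine hcoef (p := 0) (h₂ s hs) ?_ (hnn _)
    have := hpow (1 / 4) 1 (by norm_num) (by norm_num)
    refine le_of_eq_of_le ?_ this
    congr 1; push_cast; ring
  have b3 : |coeff N (solC ν a₀ c₀ s)| ≤ |C₃| * (g * r ^ 1) := by
    refine hcoef (p := 0) (h₃ s hs) ?_ (hnn _)
    have := hpow (1 / 2) 1 (by norm_num) (by norm_num)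
    refine le_of_eq_of_le ?_ this
    congr 1; ring
  have b4 : |coeff (N + 1) (solC ν a₀ c₀ s)| ≤ |C₄| * (g * r ^ 2) := by
    refine hcoef (p := 0) (h₄ s hs) ?_ (hnn _)
    have := hpow (3 / 4) 2 (by norm_num) (by norm_num)
    refine le_of_eq_of_le ?_ this
    congr 1; push_cast; ring
  have b3' : |coeff N (solC ν a₀ c₀ s)| ≤ |C₃| * (1 + t) ^ (((N : ℝ) + 1) / 4) :=
    hcoef (p := 0) (h₃ s hs) (hpow' _ (by linarith)) (hnn _)
  have b4' : |coeff (N + 1) (solC ν a₀ c₀ s)| ≤ |C₄| * (1 + t) ^ (((N : ℝ) + 1) / 4) :=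
    hcoef (p := 0) (h₄ s hs) (hpow' _ (by push_cast; linarith)) (hnn _)
  have hz : ∀ n : ℕ, ∀ u : ℝ, ‖((u : ℝ) : ℂ) * (Complex.I * k) ^ n‖ = |u| * x ^ n := fun n u => by
    rw [norm_mul, norm_pow, norm_mul, Complex.norm_I, one_mul, Complex.norm_real, Real.norm_eq_abs]
  have hW : ‖resW ν a₀ c₀ N s (Complex.I * k)‖ ≤
      |C₁| * g * x ^ (N + 1) + |C₂| * (g * r ^ 1) * x ^ (N + 2) := by
    rw [resW]
    refine (norm_add_le _ _).trans ?_
    rw [hz, hz]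
    gcongr
  have hV : ‖resV ν a₀ c₀ N s (Complex.I * k)‖ ≤ 1 / ν *
      (|coeff N (solC ν a₀ c₀ s)| * x ^ (N + 2) +
        |coeff (N + 1) (solC ν a₀ c₀ s)| * x ^ (N + 3)) := by
    rw [resV, norm_mul, Complex.norm_real, Real.norm_of_nonneg (by positivity)]
    refine mul_le_mul_of_nonneg_left ((norm_add_le _ _).trans ?_) (by positivity)
    rw [hz, hz]
  have hy : 0 ≤ x * r := by positivity
  have hxr : x ≤ x * r := le_mul_of_one_le_right hx hr1
  refine ⟨hW.trans ?_, hV.trans ?_, hV.trans ?_⟩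
  · calc _ = g * x ^ (N + 1) * (|C₁| + |C₂| * (x * r)) := by ring
      _ ≤ g * x ^ (N + 1) * ((|C₁| + |C₂|) * (1 + x * r) ^ 2) := by
        have : 0 ≤ |C₁| * (x * r) + |C₁| * (x * r) ^ 2 + |C₂| * (1 + x * r + (x * r) ^ 2) := by
          positivity
        refine mul_le_mul_of_nonneg_left ?_ (by positivity)
        have h3 : 0 ≤ |C₁| * (x * r) := by positivity
        linear_combination this + h3
      _ ≤ g * x ^ (N + 1) * (K * (1 + x * r) ^ 2) := by gcongr
      _ = _ := by ring
  · calc _ ≤ 1 / ν * (|C₃| * (g * r ^ 1) * x ^ (N + 2) + |C₄| * (g * r ^ 2) * x ^ (N + 3)) := by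
          gcongr
      _ = g * x ^ (N + 1) * (1 / ν * (|C₃| * (x * r) + |C₄| * (x * r) ^ 2)) := by ring
      _ ≤ g * x ^ (N + 1) * (1 / ν * ((|C₃| + |C₄|) * (1 + x * r) ^ 2)) := by
        have : 0 ≤ |C₃| * (1 + x * r + (x * r) ^ 2) + |C₄| * (1 + 2 * (x * r)) := by
          positivity
        refine mul_le_mul_of_nonneg_left (mul_le_mul_of_nonneg_left ?_ (by positivity))
          (by positivity)
        linear_combination this
      _ = g * x ^ (N + 1) * (1 / ν * (|C₃| + |C₄|) * (1 + x * r) ^ 2) := by ring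
      _ ≤ g * x ^ (N + 1) * (K * (1 + x * r) ^ 2) := by gcongr
      _ = _ := by ring
  · set G := (1 + t) ^ (((N : ℝ) + 1) / 4)
    have hG : 0 ≤ G := Real.rpow_nonneg (by linarith) _
    calc _ ≤ 1 / ν * (|C₃| * G * x ^ (N + 2) + |C₄| * G * x ^ (N + 3)) := by
          gcongr
      _ = G * x ^ (N + 2) * (1 / ν * (|C₃| + |C₄| * x)) := by ring
      _ ≤ G * x ^ (N + 2) * (1 / ν * ((|C₃| + |C₄|) * (1 + x * r))) := by
        refine mul_le_mul_of_nonneg_left (mul_le_mul_of_nonneg_left ?_ (by positivity))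
          (by positivity)
        have h1 : |C₄| * x ≤ |C₄| * (x * r) := by gcongr
        have : 0 ≤ |C₃| * (x * r) + |C₄| := by positivity
        linear_combination this + h1
      _ = G * x ^ (N + 2) * (1 / ν * (|C₃| + |C₄|) * (1 + x * r)) := by ring
      _ ≤ G * x ^ (N + 2) * (K * (1 + x * r)) := by gcongr
      _ = _ := by ring

theorem hasDerivWithinAt_rpow_barrier (N : ℕ) (s : ℝ) (hs : 0 ≤ s) :
    HasDerivWithinAt (fun s : ℝ => 4 / ((N : ℝ) + 1) * (1 + s) ^ (((N : ℝ) + 1) / 4))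
      ((1 + s) ^ (((N : ℝ) - 3) / 4)) (Ici 0) s := by
  have h1 : HasDerivAt (fun s : ℝ => 1 + s) 1 s := (hasDerivAt_id s).const_add 1
  have h2 := (h1.rpow_const (p := ((N : ℝ) + 1) / 4) (Or.inl (by linarith))).const_mul
    (4 / ((N : ℝ) + 1))
  refine (h2.congr_deriv ?_).hasDerivWithinAt
  have : ((N : ℝ) + 1) ≠ 0 := by positivity
  rw [show ((N : ℝ) + 1) / 4 - 1 = ((N : ℝ) - 3) / 4 by ring]
  field_simp

theorem norm_errW_le (hν : 0 < ν) {N : ℕ} {t : ℝ} (ht : 0 ≤ t) {k : ℂ} {P : ℝ} (hP : 0 ≤ P)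
    (hres : ∀ s, 0 ≤ s → s ≤ t → ‖resW ν a₀ c₀ N s (Complex.I * k)‖ +
      ‖resV ν a₀ c₀ N s (Complex.I * k)‖ ≤ P * (1 + s) ^ (((N : ℝ) - 3) / 4)) :
    ‖errW ν a₀ c₀ N t k‖ ≤ Real.exp (nuT ν * k.im ^ 2 * t - ν * k.re ^ 2 * t) * P *
      (4 / ((N : ℝ) + 1) * (1 + t) ^ (((N : ℝ) + 1) / 4)) := by
  have hd : ∀ s, HasDerivAt (fun s => specW ν (t - s) (errW ν a₀ c₀ N s k) (errV ν a₀ c₀ N s k) k)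
      (-specW ν (t - s) (Complex.exp (-(nuT ν * k ^ 2 * s)) * resW ν a₀ c₀ N s (Complex.I * k))
        (Complex.exp (-(nuT ν * k ^ 2 * s)) * resV ν a₀ c₀ N s (Complex.I * k)) k) s := fun s =>
    (hasDerivAt_spec_comp ν t (F := fun s => errW ν a₀ c₀ N s k) (G := fun s => errV ν a₀ c₀ N s k)
      (f := Complex.exp (-(nuT ν * k ^ 2 * s)) * resW ν a₀ c₀ N s (Complex.I * k))
      (g := Complex.exp (-(nuT ν * k ^ 2 * s)) * resV ν a₀ c₀ N s (Complex.I * k)) (k := k) (s := s)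
      (hasDerivAt_err a₀ c₀ hν N s k).1 (hasDerivAt_err a₀ c₀ hν N s k).2).1
  have h0 : specW ν (t - 0) (errW ν a₀ c₀ N 0 k) (errV ν a₀ c₀ N 0 k) k = 0 := by
    rw [(err_zero a₀ c₀ N k).1, (err_zero a₀ c₀ N k).2]
    simp [specW]
  obtain ⟨w, hw⟩ : ∃ w, w = Real.exp (nuT ν * k.im ^ 2 * t - ν * k.re ^ 2 * t) := ⟨_, rfl⟩
  have hw0 : 0 ≤ w := by rw [hw]; positivity
  have hB : ∀ s, 0 ≤ s → HasDerivWithinAt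
      (fun s : ℝ => w * P * (4 / ((N : ℝ) + 1) * (1 + s) ^ (((N : ℝ) + 1) / 4)))
      (w * P * (1 + s) ^ (((N : ℝ) - 3) / 4)) (Ici 0) s := fun s hs =>
    (hasDerivWithinAt_rpow_barrier N s hs).const_mul (w * P)
  have h := norm_le_of_norm_deriv_le_Icc ht hd hB (fun s hs hst => ?_) h0
  · rw [← hw]
    rw [sub_self, (spec_zero ν _ _ k).1] at h
    exact h.trans (sub_le_self _ (by positivity))
  · have h1 := (norm_spec_duhamel_le hν hs hst (resW ν a₀ c₀ N s (Complex.I * k))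
      (resV ν a₀ c₀ N s (Complex.I * k)) k).1
    rw [← hw] at h1
    rw [norm_neg, mul_assoc w]
    exact h1.trans (mul_le_mul_of_nonneg_left (hres s hs hst) hw0)

theorem norm_errV_le (hν : 0 < ν) {N : ℕ} {t : ℝ} (ht : 0 ≤ t) {k : ℂ} {P P' : ℝ} (hP : 0 ≤ P)
    (hP' : 0 ≤ P')
    (hW : ∀ s, 0 ≤ s → s ≤ t → ‖resW ν a₀ c₀ N s (Complex.I * k)‖ ≤
      P * (1 + s) ^ (((N : ℝ) - 3) / 4))
    (hV : ∀ s, 0 ≤ s → s ≤ t → ‖resV ν a₀ c₀ N s (Complex.I * k)‖ ≤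
      P * (1 + s) ^ (((N : ℝ) - 3) / 4))
    (hV' : ∀ s, 0 ≤ s → s ≤ t → ‖resV ν a₀ c₀ N s (Complex.I * k)‖ ≤ P') :
    ‖errV ν a₀ c₀ N t k‖ ≤ Real.exp (nuT ν * k.im ^ 2 * t - ν * k.re ^ 2 * t) *
      ((‖k‖ ^ 2 / ν ^ 2 + ‖k‖ / ν) * P * (4 / ((N : ℝ) + 1) * (1 + t) ^ (((N : ℝ) + 1) / 4)) +
        P' * (1 / ν)) := by
  have hd : ∀ s, HasDerivAt (fun s => specV ν (t - s) (errW ν a₀ c₀ N s k) (errV ν a₀ c₀ N s k) k)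
      (-specV ν (t - s) (Complex.exp (-(nuT ν * k ^ 2 * s)) * resW ν a₀ c₀ N s (Complex.I * k))
        (Complex.exp (-(nuT ν * k ^ 2 * s)) * resV ν a₀ c₀ N s (Complex.I * k)) k) s := fun s =>
    (hasDerivAt_spec_comp ν t (F := fun s => errW ν a₀ c₀ N s k) (G := fun s => errV ν a₀ c₀ N s k)
      (f := Complex.exp (-(nuT ν * k ^ 2 * s)) * resW ν a₀ c₀ N s (Complex.I * k))
      (g := Complex.exp (-(nuT ν * k ^ 2 * s)) * resV ν a₀ c₀ N s (Complex.I * k)) (k := k) (s := s)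
      (hasDerivAt_err a₀ c₀ hν N s k).1 (hasDerivAt_err a₀ c₀ hν N s k).2).2
  have h0 : specV ν (t - 0) (errW ν a₀ c₀ N 0 k) (errV ν a₀ c₀ N 0 k) k = 0 := by
    rw [(err_zero a₀ c₀ N k).1, (err_zero a₀ c₀ N k).2]
    simp [specV]
  have he : ∀ s : ℝ, HasDerivAt (fun s : ℝ => 1 / ν * Real.exp (-ν * (t - s)))
      (Real.exp (-ν * (t - s))) s := fun s => by
    have h1 : HasDerivAt (fun s : ℝ => -ν * (t - s)) (-ν * -1) s := by
      simpa using ((hasDerivAt_id s).const_sub t).const_mul (-ν)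
    refine (h1.exp.const_mul (1 / ν)).congr_deriv ?_
    field_simp
  obtain ⟨w, hw⟩ : ∃ w, w = Real.exp (nuT ν * k.im ^ 2 * t - ν * k.re ^ 2 * t) := ⟨_, rfl⟩
  have hw0 : 0 ≤ w := by rw [hw]; positivity
  have hB : ∀ s, 0 ≤ s → HasDerivWithinAt
      (fun s : ℝ => w * ((‖k‖ ^ 2 / ν ^ 2 + ‖k‖ / ν) * P *
        (4 / ((N : ℝ) + 1) * (1 + s) ^ (((N : ℝ) + 1) / 4)) +
        P' * (1 / ν * Real.exp (-ν * (t - s)))))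
      (w * ((‖k‖ ^ 2 / ν ^ 2 + ‖k‖ / ν) * P * (1 + s) ^ (((N : ℝ) - 3) / 4) +
        P' * Real.exp (-ν * (t - s)))) (Ici 0) s := fun s hs =>
    (((hasDerivWithinAt_rpow_barrier N s hs).const_mul
      ((‖k‖ ^ 2 / ν ^ 2 + ‖k‖ / ν) * P)).fun_add
      ((he s).hasDerivWithinAt.const_mul P')).const_mul w
  have h := norm_le_of_norm_deriv_le_Icc ht hd hB (fun s hs hst => ?_) h0
  · rw [← hw]
    rw [sub_self, (spec_zero ν _ _ k).2] at h
    refine (h.trans (sub_le_self _ (by positivity))).trans (le_of_eq ?_)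
    rw [mul_zero, Real.exp_zero, mul_one]
  · have h0 := (norm_spec_duhamel_le hν hs hst (resW ν a₀ c₀ N s (Complex.I * k))
      (resV ν a₀ c₀ N s (Complex.I * k)) k).2
    rw [← hw] at h0
    rw [norm_neg]
    refine h0.trans ?_
    refine mul_le_mul_of_nonneg_left ?_ hw0
    have h1 := mul_le_mul_of_nonneg_left (hV' s hs hst) (Real.exp_pos (-ν * (t - s))).le
    have h2 := mul_le_mul_of_nonneg_left (hV s hs hst) (by positivity : 0 ≤ ‖k‖ ^ 2 / ν ^ 2)
    have h3 := mul_le_mul_of_nonneg_left (hW s hs hst) (by positivity : 0 ≤ ‖k‖ / ν)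
    linear_combination h1 + h2 + h3

/-- The Duhamel estimate. -/
theorem exists_err_bound (hν : 0 < ν) (N : ℕ) : ∃ K, 0 ≤ K ∧ ∀ t : ℝ, 0 ≤ t → ∀ k : ℂ,
    ‖errW ν a₀ c₀ N t k‖ ≤ K * (Real.exp (nuT ν * k.im ^ 2 * t - ν * k.re ^ 2 * t) *
      (1 + t) ^ (((N : ℝ) + 1) / 4) * (‖k‖ ^ (N + 1) * (1 + ‖k‖ * √(1 + t)) ^ 4)) ∧
    ‖errV ν a₀ c₀ N t k‖ ≤ K * (Real.exp (nuT ν * k.im ^ 2 * t - ν * k.re ^ 2 * t) *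
      (1 + t) ^ (((N : ℝ) + 1) / 4) * (‖k‖ ^ (N + 2) * (1 + ‖k‖ * √(1 + t)) ^ 4)) := by
  obtain ⟨K₀, hK₀, hres⟩ := exists_res_bound a₀ c₀ hν N
  obtain ⟨A, hA⟩ : ∃ A : ℝ, A = 4 / ((N : ℝ) + 1) := ⟨_, rfl⟩
  have hA0 : 0 ≤ A := by rw [hA]; positivity
  refine ⟨2 * K₀ * A + K₀ * (1 / ν ^ 2 + 1 / ν) * A + K₀ / ν, by positivity, fun t ht k => ?_⟩
  have hr1 : 1 ≤ √(1 + t) := Real.one_le_sqrt.2 (by linarith)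
  obtain ⟨y, hy⟩ : ∃ y : ℝ, y = 1 + ‖k‖ * √(1 + t) := ⟨_, rfl⟩
  have hxy : ‖k‖ ≤ y := by
    have := le_mul_of_one_le_right (norm_nonneg k) hr1
    linarith
  have hy1 : 1 ≤ y := by rw [hy]; exact le_add_of_nonneg_right (by positivity)
  obtain ⟨G, hG⟩ : ∃ G : ℝ, G = (1 + t) ^ (((N : ℝ) + 1) / 4) := ⟨_, rfl⟩
  have hG0 : 0 ≤ G := by rw [hG]; exact Real.rpow_nonneg (by linarith) _
  obtain ⟨w, hw⟩ : ∃ w, w = Real.exp (nuT ν * k.im ^ 2 * t - ν * k.re ^ 2 * t) := ⟨_, rfl⟩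
  have hw0 : 0 ≤ w := by rw [hw]; positivity
  have hr := fun s hs hst => hres s t hs hst k
  rw [← hy] at hr ⊢
  have hx := norm_nonneg k
  have hyn : ∀ n ≤ 4, y ^ n ≤ y ^ 4 := fun n hn => pow_le_pow_right₀ hy1 hn
  have h1 := norm_errW_le a₀ c₀ hν ht (P := 2 * (K₀ * (‖k‖ ^ (N + 1) * y ^ 2))) (by positivity)
    fun s hs hst => by linear_combination (hr s hs hst).1 + (hr s hs hst).2.1
  have h2 := norm_errV_le a₀ c₀ hν ht (P := K₀ * (‖k‖ ^ (N + 1) * y ^ 2))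
    (P' := K₀ * (1 + t) ^ (((N : ℝ) + 1) / 4) * (‖k‖ ^ (N + 2) * y)) (by positivity)
    (by positivity)
    (fun s hs hst => by linear_combination (hr s hs hst).1)
    (fun s hs hst => by linear_combination (hr s hs hst).2.1)
    (fun s hs hst => (hr s hs hst).2.2)
  rw [← hG, ← hw, ← hA] at h1 h2
  rw [← hG, ← hw]
  obtain ⟨p, hp⟩ : ∃ p, p = ‖k‖ ^ (N + 1) := ⟨_, rfl⟩
  have hp0 : 0 ≤ p := by rw [hp]; positivity
  have hp2 : ‖k‖ ^ (N + 2) = ‖k‖ * p := by rw [hp]; ring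
  rw [hp2] at h2 ⊢
  rw [← hp] at h1 h2 ⊢
  have hT : 0 ≤ w * G * (p * y ^ 4) := by positivity
  have hT' : 0 ≤ w * G * (‖k‖ * p * y ^ 4) := by positivity
  constructor
  · refine h1.trans ?_
    calc _ = 2 * K₀ * A * (w * G * (p * y ^ 2)) := by ring
      _ ≤ 2 * K₀ * A * (w * G * (p * y ^ 4)) := by
        have := hyn 2 (by norm_num)
        gcongr
      _ ≤ _ := by
        refine mul_le_mul_of_nonneg_right ?_ hT
        have : 0 ≤ K₀ * (1 / ν ^ 2 + 1 / ν) * A + K₀ / ν := by positivity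
        linarith
  · refine h2.trans ?_
    calc _ = K₀ * (1 / ν ^ 2) * A * (w * G * (‖k‖ * p * (‖k‖ * y ^ 2))) +
          K₀ * (1 / ν) * A * (w * G * (‖k‖ * p * y ^ 2)) +
          K₀ / ν * (w * G * (‖k‖ * p * y)) := by ring
      _ ≤ K₀ * (1 / ν ^ 2) * A * (w * G * (‖k‖ * p * y ^ 4)) +
          K₀ * (1 / ν) * A * (w * G * (‖k‖ * p * y ^ 4)) +
          K₀ / ν * (w * G * (‖k‖ * p * y ^ 4)) := by
        have e1 : ‖k‖ * y ^ 2 ≤ y ^ 4 := by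
          calc _ ≤ y * y ^ 2 := by gcongr
            _ = y ^ 3 := by ring
            _ ≤ _ := hyn 3 (by norm_num)
        have e2 := hyn 2 (by norm_num)
        have e3 : y ≤ y ^ 4 := by simpa using hyn 1 (by norm_num)
        gcongr
      _ ≤ _ := by
        have : 0 ≤ 2 * K₀ * A * (w * G * (‖k‖ * p * y ^ 4)) := by positivity
        linear_combination this

end Duhamel
end
end TaylorDispersion

namespace TaylorDispersion
noncomputable section
section Approximants
open PowerSeries

/-! ### Moments and Fourier transforms of the Hermite functions -/

theorem integrable_pow_mul_hermiteFun {ν : ℝ} (hν : 0 < ν) (l r : ℕ) :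
    Integrable fun ξ : ℝ => ξ ^ l * hermiteFun ν r ξ :=
  (memL2m_hermiteFun hν r (l + 1)).integrable_pow_mul (N := l) (by linarith) le_rfl

theorem momentSeries_hermiteFun_succ {ν : ℝ} (hν : 0 < ν) (r : ℕ) :
    momentSeries (hermiteFun ν (r + 1)) = X * momentSeries (hermiteFun ν r) := by
  ext l
  have h : ∫ ξ : ℝ, ξ ^ l * hermiteFun ν (r + 1) ξ =
      -∫ ξ : ℝ, (l : ℝ) * ξ ^ (l - 1) * hermiteFun ν r ξ := by
    refine integral_mul_deriv_eq_deriv_mul_of_integrable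
      (fun x _ => by simpa using hasDerivAt_pow l x) (fun x _ => hasDerivAt_hermiteFun ν r x)
      (integrable_pow_mul_hermiteFun hν l _) ?_ (integrable_pow_mul_hermiteFun hν l r)
    simpa [Pi.mul_def, mul_assoc] using
      (integrable_pow_mul_hermiteFun hν (l - 1) r).const_mul (l : ℝ)
  rw [momentSeries, coeff_mk, h]
  rcases l with _ | l
  · simp
  · rw [coeff_succ_X_mul, momentSeries, coeff_mk, add_tsub_cancel_right]
    simp only [mul_assoc, integral_const_mul]
    rw [Nat.factorial_succ]
    have : ((l : ℝ) + 1) ≠ 0 := by positivity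
    have : ((l.factorial : ℕ) : ℝ) ≠ 0 := by positivity
    push_cast
    field_simp
    ring

theorem hermiteFun_zero (ν : ℝ) (ξ : ℝ) : hermiteFun ν 0 ξ =
    1 / Real.sqrt (4 * Real.pi * nuT ν) * Real.exp (-1 / (4 * nuT ν) * ξ ^ 2) := by
  rw [hermiteFun_eq, gaussGen, coeff_mul]
  simp [coeff_gaussSeries]

theorem hermiteFun_one {ν : ℝ} (hν : 0 < ν) (ξ : ℝ) :
    ξ * hermiteFun ν 0 ξ = -(2 * nuT ν) * hermiteFun ν 1 ξ := by
  have hT := (nuT_pos hν).ne'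
  have h : coeff 1 (gaussGen (-1 / (4 * nuT ν)) ξ) = 2 * (-1 / (4 * nuT ν)) * ξ := by
    rw [gaussGen, coeff_mul, Finset.Nat.sum_antidiagonal_eq_sum_range_succ_mk]
    simp [Finset.sum_range_succ, coeff_gaussSeries]
  rw [hermiteFun_zero, hermiteFun_eq, h]
  simp only [Nat.factorial_one, Nat.cast_one, one_mul]
  field_simp
  ring

theorem integral_hermiteFun_zero {ν : ℝ} (hν : 0 < ν) : ∫ ξ, hermiteFun ν 0 ξ = 1 := by
  have hT := nuT_pos hν
  simp only [hermiteFun_zero]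
  have e : ∀ ξ : ℝ, -1 / (4 * nuT ν) * ξ ^ 2 = -(1 / (4 * nuT ν)) * ξ ^ 2 := fun ξ => by ring
  simp only [e]
  rw [integral_const_mul, integral_gaussian, show Real.pi / (1 / (4 * nuT ν)) =
    4 * Real.pi * nuT ν by field_simp]
  rw [one_div_mul_cancel]
  positivity

theorem momentSeries_hermiteFun {ν : ℝ} (hν : 0 < ν) (r : ℕ) :
    momentSeries (hermiteFun ν r) = X ^ r * gaussSeries (nuT ν) := by
  induction r with
  | succ r ih => rw [momentSeries_hermiteFun_succ hν, ih]; ring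
  | zero =>
    rw [pow_zero, one_mul]
    have hrec : ∀ l : ℕ, ((l : ℝ) + 1) * coeff (l + 1) (momentSeries (hermiteFun ν 0)) =
        2 * nuT ν * coeff l (X * momentSeries (hermiteFun ν 0)) := fun l => by
      have h1 : ∫ ξ : ℝ, ξ ^ (l + 1) * hermiteFun ν 0 ξ =
          -(2 * nuT ν) * ∫ ξ : ℝ, ξ ^ l * hermiteFun ν 1 ξ := by
        rw [← integral_const_mul]
        refine integral_congr_ae (Eventually.of_forall fun ξ => ?_)
        beta_reduce
        rw [pow_succ, mul_assoc, hermiteFun_one hν]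
        ring
      rw [← momentSeries_hermiteFun_succ hν, momentSeries, coeff_mk, momentSeries, coeff_mk, h1,
        Nat.factorial_succ]
      have : ((l : ℝ) + 1) ≠ 0 := by positivity
      have : ((l.factorial : ℕ) : ℝ) ≠ 0 := by positivity
      push_cast
      field_simp
      ring
    have hrec' : ∀ l : ℕ, ((l : ℝ) + 1) * coeff (l + 1) (gaussSeries (nuT ν)) =
        2 * nuT ν * coeff l (X * gaussSeries (nuT ν)) := fun l => by
      have := congrArg (coeff l) (derivative_gaussSeries (nuT ν))
      rw [coeff_derivative, mul_assoc, coeff_C_mul] at this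
      linarith
    ext n
    induction n using Nat.strong_induction_on with
    | _ n ih =>
      rcases n with _ | n
      · rw [momentSeries, coeff_mk]
        simp [integral_hermiteFun_zero hν, coeff_gaussSeries]
      · refine mul_left_cancel₀ (show ((n : ℝ) + 1) ≠ 0 by positivity) ?_
        rw [hrec, hrec']
        rcases n with _ | n
        · simp
        · rw [coeff_succ_X_mul, coeff_succ_X_mul, ih n (by omega)]

theorem hasDerivAt_syn {F : ℝ → ℂ} (hF : Integrable F) (hF' : Integrable fun κ : ℝ => κ * F κ)
    (ξ : ℝ) : HasDerivAt (syn F) (syn (fun κ => Complex.I * κ * F κ) ξ) ξ := by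
  have h := (hasDerivAt_integral_of_dominated_loc_of_deriv_le (μ := volume) (x₀ := ξ)
    (bound := fun κ : ℝ => ‖κ * F κ‖)
    (F := fun ξ κ : ℝ => F κ * Complex.exp (Complex.I * κ * ξ))
    (F' := fun ξ κ : ℝ => Complex.I * κ * F κ * Complex.exp (Complex.I * κ * ξ))
    univ_mem (Eventually.of_forall fun x => (integrable_mul_exp hF x).1)
    (integrable_mul_exp hF ξ) ?_ (Eventually.of_forall fun κ x _ => ?_) hF'.norm
    (Eventually.of_forall fun κ x _ => ?_)).2
  · exact h.const_mul _
  · have := (integrable_mul_exp (hF'.const_mul Complex.I) ξ).1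
    simpa only [mul_assoc] using this
  · rw [norm_mul, Complex.norm_exp, mul_assoc, norm_mul]
    simp
  · have h1 : HasDerivAt (fun x : ℝ => Complex.I * κ * (x : ℂ)) (Complex.I * κ * 1) x :=
      (Complex.ofRealCLM.hasDerivAt (x := x)).const_mul _
    refine (h1.cexp.const_mul (F κ)).congr_deriv ?_
    ring

theorem integrable_pow_mul_gaussian {b : ℝ} (hb : 0 < b) (j : ℕ) :
    Integrable fun κ : ℝ => (Complex.I * κ) ^ j * Complex.exp (-(b * (κ : ℂ) ^ 2)) := by
  have h := (integrable_rpow_mul_exp_neg_mul_sq hb (s := j) (by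
    have : (0 : ℝ) ≤ j := by positivity
    linarith)).norm
  refine h.mono' (by fun_prop) (Eventually.of_forall fun κ => le_of_eq ?_)
  rw [norm_mul, norm_pow, norm_mul, Complex.norm_I, one_mul, Complex.norm_real, Complex.norm_exp,
    norm_mul, Real.rpow_natCast, norm_pow, Real.norm_of_nonneg (Real.exp_pos _).le]
  congr 2
  norm_cast
  ring

theorem hermiteFun_eq_syn {ν : ℝ} (hν : 0 < ν) (j : ℕ) (ξ : ℝ) : (hermiteFun ν j ξ : ℂ) =
    syn (fun κ => (Complex.I * κ) ^ j * Complex.exp (-(nuT ν * (κ : ℂ) ^ 2))) ξ := by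
  have hT := nuT_pos hν
  induction j generalizing ξ with
  | zero =>
    have h := fourierIntegral_gaussian (b := (nuT ν : ℂ)) (by simpa using hT) ξ
    rw [syn, hermiteFun_zero]
    have e : ∀ κ : ℝ, (Complex.I * κ) ^ 0 * Complex.exp (-(nuT ν * (κ : ℂ) ^ 2)) *
        Complex.exp (Complex.I * κ * ξ) =
        Complex.exp (Complex.I * ξ * κ) * Complex.exp (-nuT ν * (κ : ℂ) ^ 2) := fun κ => by
      rw [pow_zero, one_mul, mul_comm, mul_right_comm Complex.I, neg_mul]
    simp only [e]
    rw [h]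
    have h2 : ((Real.pi : ℂ) / (nuT ν : ℂ)) ^ (1 / 2 : ℂ) = (√(Real.pi / nuT ν) : ℝ) := by
      rw [Real.sqrt_eq_rpow, Complex.ofReal_cpow (by positivity)]
      push_cast; rfl
    have h3 : √(4 * Real.pi * nuT ν) = 2 * nuT ν * √(Real.pi / nuT ν) := by
      rw [show 4 * Real.pi * nuT ν = (2 * nuT ν) ^ 2 * (Real.pi / nuT ν) by field_simp; ring,
        Real.sqrt_mul (by positivity), Real.sqrt_sq (by positivity)]
    have h4 : √(Real.pi / nuT ν) ^ 2 = Real.pi / nuT ν := Real.sq_sqrt (by positivity)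
    have h5 : 1 / √(4 * Real.pi * nuT ν) = 1 / (2 * Real.pi) * √(Real.pi / nuT ν) := by
      rw [h3]
      have : √(Real.pi / nuT ν) ≠ 0 := by positivity
      field_simp
      rw [h4]
      field_simp
    rw [h2, h5]
    push_cast
    rw [mul_assoc]
    congr 3
    ring
  | succ j ih =>
    have h1 : HasDerivAt (fun ξ : ℝ => (hermiteFun ν j ξ : ℂ)) (hermiteFun ν (j + 1) ξ : ℂ) ξ :=
      (hasDerivAt_hermiteFun ν j ξ).ofReal_comp
    have h2 := hasDerivAt_syn (integrable_pow_mul_gaussian hT j) (by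
      refine ((integrable_pow_mul_gaussian hT (j + 1)).const_mul (-Complex.I)).congr
        (Eventually.of_forall fun κ => ?_)
      beta_reduce
      rw [pow_succ]
      linear_combination (-κ * (Complex.I * κ) ^ j * Complex.exp (-(nuT ν * (κ : ℂ) ^ 2))) *
        Complex.I_sq) ξ
    rw [show (fun ξ : ℝ => (hermiteFun ν j ξ : ℂ)) = _ from funext ih] at h1
    rw [h1.unique h2]
    congr 1
    funext κ
    ring

/-! ### The coefficients of the approximate solutions -/

theorem appConst_eq (ν : ℝ) (j l : ℕ) : appConst ν j l = (j.choose l : ℝ) *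
    Real.sqrt (nuT ν) ^ (j - l) * (((j - l).factorial : ℝ) * coeff (j - l) (gaussSeries 1)) := by
  have h := congrFun (iteratedDeriv_exp_sq 1 (j - l)) 0
  simp only [one_mul] at h
  have h2 : gaussGen 1 0 = gaussSeries 1 := by
    rw [gaussGen, mul_zero, rescale_zero]
    simp
  rw [appConst, h, h2]
  simp

theorem appCoeff_eq {ν : ℝ} (hν : 0 < ν) {N : ℕ} (c : Fin (N + 1) → ℝ) {t : ℝ} (ht : 0 < t)
    (j : ℕ) : appCoeff ν c (Real.log t) j = coeff j (gaussSeries (-nuT ν) *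
      rescale √((1 + t) / t) ((∑ r : Fin (N + 1), C (c r) * X ^ (r : ℕ)) *
        gaussSeries (nuT ν))) := by
  have hT := nuT_pos hν
  have hρ : √(1 + Real.exp (-Real.log t)) = √((1 + t) / t) := by
    rw [Real.exp_neg, Real.exp_log ht]
    congr 1
    field_simp
    ring
  rw [appCoeff, hρ, Finset.sum_mul, map_sum, Finset.mul_sum, Finset.mul_sum, map_sum]
  refine Finset.sum_congr rfl fun r _ => ?_
  have e : gaussSeries (-nuT ν) * rescale √((1 + t) / t) (C (c r) * X ^ (r : ℕ) *
      gaussSeries (nuT ν)) = C (c r) * (rescale √((1 + t) / t)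
        (momentSeries (hermiteFun ν r)) * gaussSeries (-nuT ν)) := by
    rw [momentSeries_hermiteFun hν, mul_assoc (C (c r)), map_mul (rescale _) (C (c r))]
    have : rescale √((1 + t) / t) (C (c r)) = C (c r) := by
      ext n; rw [coeff_rescale, coeff_C]; split_ifs with h <;> simp [h]
    rw [this]; ring
  rw [e, coeff_C_mul, coeff_mul, Finset.Nat.sum_antidiagonal_eq_sum_range_succ_mk, mul_left_comm,
    Finset.mul_sum]
  congr 1
  refine Finset.sum_congr rfl fun l hl => ?_
  have hl' : l ≤ j := Finset.mem_range_succ_iff.1 hl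
  simp only [coeff_rescale]
  rw [appConst_eq, momentSeries, coeff_mk, coeff_gaussSeries, coeff_gaussSeries]
  by_cases h : 2 ∣ j - l
  · rw [if_pos h, if_pos h]
    obtain ⟨p, hp⟩ := h
    have hj : j = l + 2 * p := by omega
    have h1 : (j + l) / 2 = l + p := by omega
    have h2 : (j - l) / 2 = p := by omega
    have h3 : √(nuT ν) ^ (j - l) = nuT ν ^ p := by
      rw [hp, pow_mul, Real.sq_sqrt hT.le]
    have h4 : (j.choose l : ℝ) * l.factorial * (j - l).factorial = j.factorial := by
      exact_mod_cast Nat.choose_mul_factorial_mul_factorial hl'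
    have h5 : ((l.factorial : ℕ) : ℝ) ≠ 0 := by positivity
    have h6 : ((p.factorial : ℕ) : ℝ) ≠ 0 := by positivity
    have h7 : ((j.factorial : ℕ) : ℝ) ≠ 0 := by positivity
    have h8 : (-nuT ν) ^ p = (-1) ^ p * nuT ν ^ p := by rw [← mul_pow]; ring
    rw [h1, h2, h3, one_pow, pow_add, h8]
    generalize ∫ ξ : ℝ, ξ ^ l * hermiteFun ν (↑r) ξ = I
    field_simp
    linear_combination I * h4
  · rw [if_neg h, if_neg h]
    simp

theorem rescale_gaussSeries (r c : ℝ) : rescale r (gaussSeries c) = gaussSeries (c * r ^ 2) := by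
  ext n
  rw [coeff_rescale, coeff_gaussSeries, coeff_gaussSeries]
  split_ifs with h
  · obtain ⟨p, rfl⟩ := h
    rw [Nat.mul_div_cancel_left p two_pos, mul_pow, pow_mul]
    ring
  · rw [mul_zero]

theorem coeff_mul_congr_left {F G : ℝ⟦X⟧} {j : ℕ} (h : ∀ i ≤ j, coeff i F = coeff i G) (H : ℝ⟦X⟧) :
    coeff j (F * H) = coeff j (G * H) := by
  rw [coeff_mul, coeff_mul]
  refine Finset.sum_congr rfl fun p hp => ?_
  rw [h p.1 (by have := Finset.HasAntidiagonal.mem_antidiagonal.1 hp; omega)]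

theorem appCoeff_toHermite {ν : ℝ} (hν : 0 < ν) {N : ℕ} (A : ℝ → ℝ⟦X⟧) {τ : ℝ} (hτ : 0 < τ) {j : ℕ}
    (hj : j ≤ N) : appCoeff ν (toHermite ν N A τ) (Real.log (Real.exp τ - 1)) j =
      (1 / √(Real.exp τ - 1)) ^ j * coeff j (A (Real.exp τ - 1)) := by
  set t := Real.exp τ - 1 with ht
  have ht0 : 0 < t := sub_pos.2 (Real.one_lt_exp_iff.2 hτ)
  have hL : 1 + t = Real.exp τ := by rw [ht]; ring
  have hst : 0 < √t := Real.sqrt_pos.2 ht0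
  have hst2 : √t ^ 2 = t := Real.sq_sqrt ht0.le
  set ρ := √((1 + t) / t) with hρ
  have hρ2 : ρ ^ 2 = (1 + t) / t := Real.sq_sqrt (by positivity)
  have hρt : ρ = Real.exp (τ / 2) * (1 / √t) := by
    rw [hρ, hL, Real.sqrt_div (Real.exp_pos _).le, ← Real.exp_half, mul_one_div]
  set P : ℝ⟦X⟧ := ∑ r : Fin (N + 1), C (toHermite ν N A τ r) * X ^ (r : ℕ) with hP
  have hPc : ∀ i ≤ N, coeff i (rescale (Real.exp (τ / 2)) P) =
      coeff i (gaussSeries (-nuT ν) * A t) := fun i hi => by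
    rw [coeff_rescale, hP, map_sum]
    simp only [coeff_C_mul, coeff_X_pow]
    rw [Finset.sum_eq_single (⟨i, by omega⟩ : Fin (N + 1))
      (fun b _ hb => by rw [if_neg fun h => hb (Fin.ext h.symm), mul_zero]) (by simp)]
    rw [if_pos rfl, mul_one, toHermite, ← mul_assoc, ← Real.exp_nat_mul, ← Real.exp_add,
      show (i : ℝ) * (τ / 2) + -((i : ℝ) / 2) * τ = 0 by ring, Real.exp_zero, one_mul]
  rw [appCoeff_eq hν _ ht0, map_mul (rescale _), rescale_gaussSeries, hρ2]
  have e : gaussSeries (-nuT ν) * (rescale ρ P * gaussSeries (nuT ν * ((1 + t) / t))) =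
      rescale (1 / √t) (rescale (Real.exp (τ / 2)) P * gaussSeries (nuT ν)) := by
    rw [mul_left_comm, gaussSeries_mul, map_mul, rescale_gaussSeries, div_pow, one_pow, hst2,
      rescale_rescale, hρt, mul_comm (Real.exp _)]
    congr 2
    field_simp
    ring
  rw [e, coeff_rescale, coeff_mul_congr_left (fun i hi => hPc i (hi.trans hj))]
  rw [mul_right_comm, mul_comm (gaussSeries (-nuT ν)), gaussSeries_mul_neg, one_mul]

theorem stretch_eq {τ : ℝ} (hτ : 0 < τ) :
    0 < stretch τ ∧ 1 / stretch τ = Real.exp (-(τ / 2)) * √(Real.exp τ - 1) := by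
  have ht0 : 0 < Real.exp τ - 1 := sub_pos.2 (Real.one_lt_exp_iff.2 hτ)
  have h := Real.exp_pos τ
  refine ⟨Real.sqrt_pos.2 (by positivity), ?_⟩
  rw [stretch, Real.sqrt_div h.le, ← Real.exp_half, one_div_div, Real.exp_neg]
  ring

theorem syn_comp_div (F : ℝ → ℂ) {s : ℝ} (hs : 0 < s) (ξ : ℝ) :
    s * syn F (s * ξ) = syn (fun κ => F (1 / s * κ)) ξ := by
  have h := syn_comp_mul (fun κ => F (1 / s * κ)) hs ξ
  have e : ∀ κ, F (1 / s * (s * κ)) = F κ := fun κ => by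
    rw [← mul_assoc, one_div_mul_cancel hs.ne', one_mul]
  simp only [e] at h
  rw [h, ← mul_assoc, mul_one_div_cancel (by exact_mod_cast hs.ne'), one_mul]

theorem syn_sum {ι : Type*} (s : Finset ι) (F : ι → ℝ → ℂ) (h : ∀ i ∈ s, Integrable (F i)) (ξ : ℝ) :
    syn (fun κ => ∑ i ∈ s, F i κ) ξ = ∑ i ∈ s, syn (F i) ξ := by
  simp only [syn, Finset.sum_mul]
  rw [integral_finsetSum s fun i hi => integrable_mul_exp (h i hi) ξ, Finset.mul_sum]

/-- A stretched Hermite expansion on the Fourier side. -/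
theorem stretch_hermite_sum {ν : ℝ} (hν : 0 < ν) {N : ℕ} {τ : ℝ} (hτ : 0 < τ) (p : ℕ) (d : ℕ → ℝ)
    (ξ : ℝ) :
    ((stretch τ ^ (p + 1) * ∑ j : Fin (N + 1), (1 / √(Real.exp τ - 1)) ^ (j : ℕ) * d j *
      hermiteFun ν ((j : ℕ) + p) (stretch τ * ξ) : ℝ) : ℂ) =
    syn (fun κ => Complex.exp (-(nuT ν * ((Real.exp (-(τ / 2)) * κ : ℝ) : ℂ) ^ 2 *
      (Real.exp τ - 1 : ℝ))) * ((Real.exp (τ / 2) : ℝ) ^ p * ∑ j ∈ Finset.range (N + 1),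
        (d j : ℂ) * (Complex.I * (Real.exp (-(τ / 2)) * κ : ℝ)) ^ (j + p))) ξ := by
  obtain ⟨hs, hs1⟩ := stretch_eq hτ
  have ht0 : 0 < Real.exp τ - 1 := sub_pos.2 (Real.one_lt_exp_iff.2 hτ)
  set s := stretch τ
  set r := √(Real.exp τ - 1)
  have hr : 0 < r := Real.sqrt_pos.2 ht0
  have hr2 : r ^ 2 = Real.exp τ - 1 := Real.sq_sqrt ht0.le
  have he : Real.exp (-(τ / 2)) * Real.exp (τ / 2) = 1 := by rw [← Real.exp_add]; simp
  have hexp : ∀ κ : ℝ, (nuT ν * ((1 / s * κ : ℝ) : ℂ) ^ 2) =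
      nuT ν * ((Real.exp (-(τ / 2)) * κ : ℝ) : ℂ) ^ 2 * (Real.exp τ - 1 : ℝ) := fun κ => by
    rw [hs1, ← hr2]; push_cast; ring
  have hsr : s * r = Real.exp (τ / 2) := by
    have : s * (1 / s) = 1 := mul_one_div_cancel hs.ne'
    rw [hs1] at this
    linear_combination Real.exp (τ / 2) * this - s * r * he
  rw [Fin.sum_univ_eq_sum_range (fun j => (1 / r) ^ j * d j * hermiteFun ν (j + p) (s * ξ))]
  push_cast
  rw [pow_succ, mul_assoc, Finset.mul_sum, Finset.mul_sum]
  have hterm : ∀ j ∈ Finset.range (N + 1), (s : ℂ) ^ p * ((s : ℂ) * ((1 / (r : ℂ)) ^ j * d j *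
      hermiteFun ν (j + p) (s * ξ))) = syn (fun κ => (s ^ p * (1 / r) ^ j * d j : ℝ) *
        ((Complex.I * (1 / s * κ : ℝ)) ^ (j + p) *
          Complex.exp (-(nuT ν * ((1 / s * κ : ℝ) : ℂ) ^ 2)))) ξ := fun j _ => by
    rw [syn_const_mul, ← syn_comp_div (fun κ => (Complex.I * (κ : ℝ)) ^ (j + p) *
      Complex.exp (-(nuT ν * ((κ : ℝ) : ℂ) ^ 2))) hs, ← hermiteFun_eq_syn hν]
    push_cast
    ring
  rw [Finset.sum_congr rfl hterm, ← syn_sum _ _ fun j _ => ?_]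
  · congr 1
    funext κ
    rw [Finset.mul_sum, Finset.mul_sum]
    refine Finset.sum_congr rfl fun j _ => ?_
    have hk := hexp κ
    push_cast at hk ⊢
    rw [← hk]
    have h1 : s ^ p * (1 / r) ^ j * (1 / s) ^ (j + p) =
        Real.exp (τ / 2) ^ p * Real.exp (-(τ / 2)) ^ (j + p) := by
      have h2 : (s * (1 / s)) ^ p = 1 := by rw [mul_one_div_cancel hs.ne', one_pow]
      have h3 : ((1 / r) * (1 / s)) = Real.exp (-(τ / 2)) := by
        rw [hs1]; field_simp
      calc _ = (s * (1 / s)) ^ p * ((1 / r) * (1 / s)) ^ j := by rw [mul_pow, mul_pow]; ring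
        _ = (Real.exp (-(τ / 2)) * Real.exp (τ / 2)) ^ p * Real.exp (-(τ / 2)) ^ j := by
          rw [h2, h3, he, one_pow]
        _ = _ := by rw [mul_pow]; ring
    have h4 := congrArg (fun x : ℝ => (x : ℂ)) h1
    push_cast at h4 ⊢
    rw [mul_pow, mul_pow, mul_pow Complex.I (_ * _), mul_pow (Complex.exp _) (κ : ℂ)]
    linear_combination (d j * Complex.I ^ (j + p) * κ ^ (j + p) *
      Complex.exp (-(nuT ν * (1 / s * κ) ^ 2))) * h4
  · refine Integrable.const_mul ?_ _
    exact (integrable_pow_mul_gaussian (nuT_pos hν) (j + p)).comp_mul_left'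
      (one_div_ne_zero hs.ne')

theorem wAppScaled_eq_syn {ν : ℝ} (hν : 0 < ν) {N : ℕ} (A : ℝ → ℝ⟦X⟧) {τ : ℝ} (hτ : 0 < τ) (ξ : ℝ) :
    (wAppScaled ν (toHermite ν N A) τ ξ : ℂ) = syn (fun κ => heatTrunc ν (Real.exp τ - 1) N
      (A (Real.exp τ - 1)) (Real.exp (-(τ / 2)) * κ : ℝ)) ξ := by
  have ht0 : 0 < Real.exp τ - 1 := sub_pos.2 (Real.one_lt_exp_iff.2 hτ)
  have h := stretch_hermite_sum hν (N := N) hτ 0 (fun j => coeff j (A (Real.exp τ - 1))) ξ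
  have hlog : Real.log (1 + Real.exp (Real.log (Real.exp τ - 1))) = τ := by
    rw [Real.exp_log ht0, add_sub_cancel, Real.log_exp]
  rw [wAppScaled, wApp, hlog]
  simp only [zero_add, pow_one, add_zero, pow_zero, one_mul] at h
  simp only [heatTrunc, evalTrunc]
  rw [← h]
  refine congrArg (fun x : ℝ => (x : ℂ)) (congrArg (stretch τ * ·)
    (Finset.sum_congr rfl fun j _ => ?_))
  rw [appCoeff_toHermite hν A hτ (by omega)]

theorem vAppScaled_eq_syn {ν : ℝ} (hν : 0 < ν) {N : ℕ} (A : ℝ → ℝ⟦X⟧) {τ : ℝ} (hτ : 0 < τ)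
    (h0 : coeff 0 (A (Real.exp τ - 1)) = 0) (ξ : ℝ) :
    (vAppScaled ν (toHermite ν N fun t => shiftSeries (A t)) τ ξ : ℂ) =
      syn (fun κ => (Real.exp (τ / 2) : ℝ) * heatTrunc ν (Real.exp τ - 1) (N + 1)
      (A (Real.exp τ - 1)) (Real.exp (-(τ / 2)) * κ : ℝ)) ξ := by
  have ht0 : 0 < Real.exp τ - 1 := sub_pos.2 (Real.one_lt_exp_iff.2 hτ)
  have h := stretch_hermite_sum hν (N := N) hτ 1 (fun j => coeff (j + 1) (A (Real.exp τ - 1))) ξ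
  have hlog : Real.log (1 + Real.exp (Real.log (Real.exp τ - 1))) = τ := by
    rw [Real.exp_log ht0, add_sub_cancel, Real.log_exp]
  rw [vAppScaled, vApp, hlog]
  have e : ∀ z : ℂ, evalTrunc (N + 1) (A (Real.exp τ - 1)) z = ∑ j ∈ Finset.range (N + 1),
      ((coeff (j + 1) (A (Real.exp τ - 1)) : ℝ) : ℂ) * z ^ (j + 1) := fun z => by
    rw [evalTrunc, Finset.sum_range_succ', h0]
    simp
  simp only [heatTrunc, e]
  rw [show (fun κ : ℝ => (Real.exp (τ / 2) : ℂ) * (Complex.exp (-(nuT ν *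
      ((Real.exp (-(τ / 2)) * κ : ℝ) : ℂ) ^ 2 * (Real.exp τ - 1 : ℝ))) *
      ∑ j ∈ Finset.range (N + 1), ((coeff (j + 1) (A (Real.exp τ - 1)) : ℝ) : ℂ) *
      (Complex.I * (Real.exp (-(τ / 2)) * κ : ℝ)) ^ (j + 1))) = _ from
      funext fun κ => mul_left_comm _ _ _]
  rw [pow_one] at h
  rw [← h]
  refine congrArg (fun x : ℝ => (x : ℂ)) (congrArg (stretch τ ^ 2 * ·)
    (Finset.sum_congr rfl fun j _ => ?_))
  rw [appCoeff_toHermite hν _ hτ (by omega), shiftSeries, coeff_mk]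

/-! ### Hermite coefficients -/

theorem hermitePoly_eq {ν : ℝ} (hν : 0 < ν) (k : ℕ) (ξ : ℝ) : hermitePoly ν k ξ =
    coeff k (gaussSeries (-nuT ν) * rescale (-ξ) (PowerSeries.exp ℝ)) := by
  have hT := (nuT_pos hν).ne'
  have h : (fun y : ℝ => Real.exp (-y ^ 2 / (4 * nuT ν))) =
      fun y => Real.exp (-1 / (4 * nuT ν) * y ^ 2) := by
    funext y; congr 1; ring
  have e : rescale (2 * nuT ν) (gaussGen (-1 / (4 * nuT ν)) ξ) =
      gaussSeries (-nuT ν) * rescale (-ξ) (PowerSeries.exp ℝ) := by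
    rw [gaussGen, map_mul, rescale_gaussSeries, rescale_rescale]
    congr 2
    · field_simp; ring
    · congr 1; field_simp; norm_num
  rw [← e, coeff_rescale, hermitePoly, h, iteratedDeriv_exp_sq]
  have h2 : Real.exp (ξ ^ 2 / (4 * nuT ν)) * Real.exp (-1 / (4 * nuT ν) * ξ ^ 2) = 1 := by
    rw [← Real.exp_add, Real.exp_eq_one_iff]; ring
  have h3 : ((k.factorial : ℕ) : ℝ) ≠ 0 := by positivity
  rw [mul_pow]
  beta_reduce
  rw [div_mul_eq_mul_div, div_mul_eq_mul_div, div_eq_iff h3]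
  linear_combination (2 ^ k * nuT ν ^ k * coeff k (gaussGen (-1 / (4 * nuT ν)) ξ) *
    (k.factorial : ℝ)) * h2

theorem hermiteCoeff_eq {ν : ℝ} (hν : 0 < ν) {N : ℕ} {f : ℝ → ℝ}
    (hf : ∀ j ≤ N, Integrable fun x => x ^ j * f x) (k : Fin (N + 1)) :
    hermiteCoeff ν N f k = coeff (k : ℕ) (gaussSeries (-nuT ν) * momentSeries f) := by
  have e : ∀ ξ : ℝ, hermitePoly ν k ξ * f ξ =
      ∑ p ∈ Finset.HasAntidiagonal.antidiagonal (k : ℕ), coeff p.1 (gaussSeries (-nuT ν)) *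
        ((-1) ^ p.2 / (p.2.factorial : ℝ)) * (ξ ^ p.2 * f ξ) := fun ξ => by
    rw [hermitePoly_eq hν, coeff_mul, Finset.sum_mul]
    refine Finset.sum_congr rfl fun p _ => ?_
    rw [coeff_rescale, coeff_exp, neg_pow]
    simp only [map_div₀, map_one, map_natCast]
    ring
  rw [hermiteCoeff]
  simp only [e]
  rw [integral_finsetSum _ fun p hp => (hf p.2 (by
    have := Finset.HasAntidiagonal.mem_antidiagonal.1 hp
    omega)).const_mul _, coeff_mul]
  refine Finset.sum_congr rfl fun p _ => ?_
  rw [integral_const_mul, momentSeries, coeff_mk, mul_assoc]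

end Approximants
end
end TaylorDispersion

namespace TaylorDispersion
noncomputable section
section Approximation
open PowerSeries

/-! ### Approximation of the solution by the truncated series solution -/

theorem stripBound_of_poly {c B : ℝ} (hc : 0 < c) (hB : 0 ≤ B) {n : ℕ} {H : ℂ → ℂ}
    (hd : Differentiable ℂ H)
    (hle : ∀ κ : ℂ, |κ.im| ≤ 1 → ‖H κ‖ ≤ B * ((1 + ‖κ‖) ^ n * Real.exp (-(2 * c) * κ.re ^ 2))) :
    StripBound c (B * ((n.factorial : ℝ) * Real.exp (2 + 1 / (4 * c)))) H := by
  refine ⟨hd, fun κ hκ => (hle κ hκ).trans ?_⟩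
  rw [mul_assoc]
  refine mul_le_mul_of_nonneg_left ?_ hB
  have h1 : ‖κ‖ ≤ |κ.re| + 1 := (Complex.norm_le_abs_re_add_abs_im κ).trans (by linarith)
  have h2 : (1 + ‖κ‖) ^ n ≤ (n.factorial : ℝ) * Real.exp (1 + ‖κ‖) := by
    have := Real.pow_div_factorial_le_exp (1 + ‖κ‖) (by positivity) n
    rwa [div_le_iff₀ (by positivity), mul_comm] at this
  have h3 : |κ.re| ≤ c * κ.re ^ 2 + 1 / (4 * c) := by
    have h4 : c * κ.re ^ 2 + 1 / (4 * c) - |κ.re| = c * (|κ.re| - 1 / (2 * c)) ^ 2 := by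
      rw [← sq_abs κ.re]; field_simp; ring
    have : 0 ≤ c * (|κ.re| - 1 / (2 * c)) ^ 2 := by positivity
    linarith
  calc _ ≤ (n.factorial : ℝ) * Real.exp (1 + ‖κ‖) * Real.exp (-(2 * c) * κ.re ^ 2) := by gcongr
    _ = (n.factorial : ℝ) * Real.exp (1 + ‖κ‖ + -(2 * c) * κ.re ^ 2) := by
      rw [mul_assoc, ← Real.exp_add]
    _ ≤ (n.factorial : ℝ) * Real.exp (2 + 1 / (4 * c) + -c * κ.re ^ 2) := by
      refine mul_le_mul_of_nonneg_left (Real.exp_le_exp.2 ?_) (by positivity)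
      linarith
    _ = _ := by rw [Real.exp_add]; ring

theorem norm_evalTrunc_le (N : ℕ) (F : ℝ⟦X⟧) (z : ℂ) :
    ‖evalTrunc N F z‖ ≤ (∑ j ∈ Finset.range (N + 1), |coeff j F|) * (1 + ‖z‖) ^ N := by
  rw [evalTrunc, Finset.sum_mul]
  refine (norm_sum_le _ _).trans (Finset.sum_le_sum fun j hj => ?_)
  rw [norm_mul, norm_pow, Complex.norm_real, Real.norm_eq_abs]
  refine mul_le_mul_of_nonneg_left ?_ (abs_nonneg _)
  exact (pow_le_pow_left₀ (norm_nonneg z) (by linarith) j).trans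
    (pow_le_pow_right₀ (by linarith [norm_nonneg z]) (Finset.mem_range_succ_iff.1 hj))

theorem differentiable_evalTrunc (N : ℕ) (F : ℝ⟦X⟧) : Differentiable ℂ (evalTrunc N F) := by
  unfold evalTrunc
  fun_prop

theorem differentiable_spec (ν t : ℝ) (ε : ℂ) {F G : ℂ → ℂ} (hF : Differentiable ℂ F)
    (hG : Differentiable ℂ G) : Differentiable ℂ (fun κ => specW ν t (F κ) (G κ) (ε * κ)) ∧
      Differentiable ℂ (fun κ => specV ν t (F κ) (G κ) (ε * κ)) := by
  have h1 : Differentiable ℂ fun κ : ℂ => ε * κ := by fun_prop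
  have hC := (differentiable_oscC ν t).comp h1
  have hS := (differentiable_oscS ν t).comp h1
  have hD := (differentiable_oscD ν t).comp h1
  simp only [Function.comp_def] at hC hS hD
  unfold specW specV
  constructor <;> fun_prop

theorem norm_specWV_le {ν t : ℝ} (hν : 0 < ν) (ht : 0 ≤ t) (F G k : ℂ) :
    ‖specW ν t F G k‖ ≤ Real.exp (nuT ν * k.im ^ 2 * t - ν * k.re ^ 2 * t) * (‖F‖ + ‖G‖) ∧
    ‖specV ν t F G k‖ ≤ Real.exp (nuT ν * k.im ^ 2 * t - ν * k.re ^ 2 * t) *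
        ((Real.exp (-ν * t) + ‖k‖ ^ 2 / ν ^ 2) * ‖G‖ + ‖k‖ / ν * ‖F‖) := by
  have h := norm_spec_duhamel_le hν le_rfl ht F G k
  simpa only [Complex.ofReal_zero, mul_zero, neg_zero, Complex.exp_zero, one_mul, sub_zero] using h

theorem spec_linear (ν t : ℝ) (F G k : ℂ) :
    specW ν t F G k = specW ν t 1 0 k * F + specW ν t 0 1 k * G ∧
      specV ν t F G k = specV ν t 1 0 k * F + specV ν t 0 1 k * G := by
  simp only [specW, specV]
  constructor <;> ring

variable {ν τ : ℝ}

theorem scaled_weight_le (hν : 0 < ν) (hτ : 2 ≤ Real.exp τ) {κ : ℂ} (hκ : |κ.im| ≤ 1) :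
    Real.exp (nuT ν * ((Real.exp (-(τ / 2)) : ℂ) * κ).im ^ 2 * (Real.exp τ - 1) -
      ν * ((Real.exp (-(τ / 2)) : ℂ) * κ).re ^ 2 * (Real.exp τ - 1)) ≤
      Real.exp (nuT ν) * Real.exp (-(2 * (ν / 4)) * κ.re ^ 2) := by
  have hT := nuT_pos hν
  set L := Real.exp τ
  set ε := Real.exp (-(τ / 2)) with hε
  have hεL : ε ^ 2 * L = 1 := by
    rw [hε, ← Real.exp_nat_mul, ← Real.exp_add, Real.exp_eq_one_iff]; push_cast; ring
  have hre : ((ε : ℂ) * κ).re = ε * κ.re := Complex.re_ofReal_mul _ _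
  have him : ((ε : ℂ) * κ).im = ε * κ.im := Complex.im_ofReal_mul _ _
  rw [hre, him, ← Real.exp_add]
  refine Real.exp_le_exp.2 ?_
  have h1 : κ.im ^ 2 ≤ 1 := by rw [← sq_abs]; exact pow_le_one₀ (abs_nonneg _) hκ
  have h2 : ε ^ 2 * (L - 1) = 1 - ε ^ 2 := by linear_combination hεL
  have h3 : ε ^ 2 ≤ 1 / 2 := by nlinarith [sq_nonneg ε]
  have h4 : nuT ν * (κ.im ^ 2 * (1 - ε ^ 2)) ≤ nuT ν * 1 := by
    refine mul_le_mul_of_nonneg_left ?_ hT.le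
    nlinarith [sq_nonneg ε, sq_nonneg κ.im]
  have h5 : ν * κ.re ^ 2 * (1 / 2) ≤ ν * κ.re ^ 2 * (1 - ε ^ 2) := by
    refine mul_le_mul_of_nonneg_left (by linarith) (by positivity)
  have e1 : nuT ν * (ε * κ.im) ^ 2 * (L - 1) - ν * (ε * κ.re) ^ 2 * (L - 1) =
      nuT ν * (κ.im ^ 2 * (1 - ε ^ 2)) - ν * κ.re ^ 2 * (1 - ε ^ 2) := by
    rw [← h2]; ring
  rw [e1]
  linarith

theorem StripBound.add {c B B' : ℝ} {H G : ℂ → ℂ} (h : StripBound c B H) (h' : StripBound c B' G) :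
    StripBound c (B + B') (fun κ => H κ + G κ) :=
  ⟨h.differentiable.add h'.differentiable, fun κ hκ => by
    rw [add_mul]
    exact (norm_add_le _ _).trans (add_le_add (h.le κ hκ) (h'.le κ hκ))⟩

theorem StripBound.mono {c B B' : ℝ} {H : ℂ → ℂ} (h : StripBound c B H) (hB : B ≤ B') :
    StripBound c B' H :=
  ⟨h.differentiable, fun κ hκ => (h.le κ hκ).trans
    (mul_le_mul_of_nonneg_right hB (Real.exp_pos _).le)⟩

/-- The norm of a frequency in the original variables. -/
theorem norm_scaled (τ : ℝ) (κ : ℂ) :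
    ‖(Real.exp (-(τ / 2)) : ℂ) * κ‖ = Real.exp (-(τ / 2)) * ‖κ‖ := by
  rw [norm_mul, Complex.norm_real, Real.norm_of_nonneg (Real.exp_pos _).le]

theorem norm_exp_half_mul (τ : ℝ) (z : ℂ) :
    ‖((Real.exp (τ / 2) : ℝ) : ℂ) * z‖ = Real.exp (τ / 2) * ‖z‖ := by
  rw [norm_mul, Complex.norm_real, Real.norm_of_nonneg (Real.exp_pos _).le]

theorem exp_half_mul_exp (τ : ℝ) : Real.exp (τ / 2) * Real.exp (-(τ / 2)) = 1 := by
  rw [← Real.exp_add]; simp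

theorem pos_of_two_le_exp (hτ : 2 ≤ Real.exp τ) : 0 < τ := by
  rw [← Real.one_lt_exp_iff]; linarith

/-- Synthesis bound with polynomial data: the solution operator is bounded in the strip. -/
theorem exists_strip_spec (hν : 0 < ν) (n : ℕ) : ∃ B : ℝ, 0 ≤ B ∧ ∀ τ : ℝ, 2 ≤ Real.exp τ →
    ∀ (D : ℝ) (P : ℂ → ℂ), 0 ≤ D → Differentiable ℂ P → (∀ κ, ‖P κ‖ ≤ D * (1 + ‖κ‖) ^ n) →
    StripBound (ν / 4) (B * D)
      (fun κ => specW ν (Real.exp τ - 1) (P κ) 0 ((Real.exp (-(τ / 2)) : ℂ) * κ)) ∧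
    StripBound (ν / 4) (B * D)
      (fun κ => specW ν (Real.exp τ - 1) 0 (P κ) ((Real.exp (-(τ / 2)) : ℂ) * κ)) ∧
    StripBound (ν / 4) (B * D) (fun κ => (Real.exp (τ / 2) : ℝ) *
      specV ν (Real.exp τ - 1) (P κ) 0 ((Real.exp (-(τ / 2)) : ℂ) * κ)) ∧
    StripBound (ν / 4) (B * D) (fun κ => (Real.exp (τ / 2) : ℝ) *
      specV ν (Real.exp τ - 1) 0 (P κ) ((Real.exp (-(τ / 2)) : ℂ) * κ)) := by
  obtain ⟨C, hC, hexp⟩ := exists_rpow_le_exp (1 / 2) hν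
  obtain ⟨E, hE⟩ : ∃ E, E = Real.exp (nuT ν) := ⟨_, rfl⟩
  have hE0 : 0 ≤ E := by rw [hE]; positivity
  obtain ⟨Q, hQ⟩ : ∃ Q, Q = 1 + 1 / ν + C + 1 / ν ^ 2 := ⟨_, rfl⟩
  have hν1 : 0 < 1 / ν := by positivity
  have hν2 : 0 < 1 / ν ^ 2 := by positivity
  refine ⟨E * Q * (((n + 2).factorial : ℝ) * Real.exp (2 + 1 / (4 * (ν / 4)))),
    by rw [hQ]; positivity, fun τ hτ D P hD hP hle => ?_⟩
  have hc : 0 < ν / 4 := by positivity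
  have ht : 0 ≤ Real.exp τ - 1 := by linarith
  have hz : Differentiable ℂ fun _ : ℂ => (0 : ℂ) := differentiable_const _
  obtain ⟨d1, d3⟩ := differentiable_spec ν (Real.exp τ - 1) (Real.exp (-(τ / 2)) : ℂ) hP hz
  obtain ⟨d2, d4⟩ := differentiable_spec ν (Real.exp τ - 1) (Real.exp (-(τ / 2)) : ℂ) hz hP
  have hsqrt : Real.exp (τ / 2) * Real.exp (-ν * (Real.exp τ - 1)) ≤ C := by
    have h := hexp (Real.exp τ - 1) ht
    rw [add_sub_cancel, ← Real.exp_mul, show τ * (1 / 2) = τ / 2 by ring] at h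
    calc _ ≤ C * Real.exp (ν * (Real.exp τ - 1)) * Real.exp (-ν * (Real.exp τ - 1)) := by gcongr
      _ = C := by rw [mul_assoc, ← Real.exp_add]; simp
  have hεx := exp_half_mul_exp τ
  have hε1 : Real.exp (-(τ / 2)) ≤ 1 := by
    rw [Real.exp_le_one_iff]; linarith [pos_of_two_le_exp hτ]
  have key : ∀ {H : ℂ → ℂ}, Differentiable ℂ H → (∀ κ : ℂ, |κ.im| ≤ 1 → ‖H κ‖ ≤
      E * Real.exp (-(2 * (ν / 4)) * κ.re ^ 2) * (Q * (1 + ‖κ‖) ^ 2 * ‖P κ‖)) →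
      StripBound (ν / 4)
        (E * Q * (((n + 2).factorial : ℝ) * Real.exp (2 + 1 / (4 * (ν / 4)))) * D) H := by
    intro H hd h
    have hQ0 : 0 ≤ Q := by rw [hQ]; positivity
    have h1 := stripBound_of_poly hc (by positivity : 0 ≤ E * Q * D) (n := n + 2) hd
      fun κ hκ => (h κ hκ).trans (by
        have e0 : 0 ≤ E * Real.exp (-(2 * (ν / 4)) * κ.re ^ 2) * (Q * (1 + ‖κ‖) ^ 2) := by
          positivity
        have := mul_le_mul_of_nonneg_left (hle κ) e0
        rw [pow_add]
        linear_combination this)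
    exact h1.mono (le_of_eq (by ring))
  have hw : ∀ κ : ℂ, |κ.im| ≤ 1 → _ := fun κ hκ => scaled_weight_le hν hτ hκ
  rw [← hE] at hw
  have h1 : ∀ κ : ℂ, (1 : ℝ) ≤ (1 + ‖κ‖) ^ 2 := fun κ =>
    one_le_pow₀ (by linarith [norm_nonneg κ])
  have hQ1 : 1 ≤ Q := by rw [hQ]; linarith
  have hWle : ∀ κ : ℂ, ‖P κ‖ ≤ Q * (1 + ‖κ‖) ^ 2 * ‖P κ‖ := fun κ =>
    le_mul_of_one_le_left (norm_nonneg _) (one_le_mul_of_one_le_of_one_le hQ1 (h1 κ))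
  refine ⟨key d1 fun κ hκ => ?_, key d2 fun κ hκ => ?_,
    key (d3.const_mul _) fun κ hκ => ?_, key (d4.const_mul _) fun κ hκ => ?_⟩
  · have h := (norm_specWV_le hν ht (P κ) 0 ((Real.exp (-(τ / 2)) : ℂ) * κ)).1
    rw [norm_zero, add_zero] at h
    exact h.trans (mul_le_mul (hw κ hκ) (hWle κ) (norm_nonneg _) (by positivity))
  · have h := (norm_specWV_le hν ht 0 (P κ) ((Real.exp (-(τ / 2)) : ℂ) * κ)).1
    rw [norm_zero, zero_add] at h
    exact h.trans (mul_le_mul (hw κ hκ) (hWle κ) (norm_nonneg _) (by positivity))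
  · have h := (norm_specWV_le hν ht (P κ) 0 ((Real.exp (-(τ / 2)) : ℂ) * κ)).2
    rw [norm_zero, mul_zero, zero_add, norm_scaled] at h
    rw [norm_exp_half_mul]
    calc _ ≤ Real.exp (τ / 2) * _ := mul_le_mul_of_nonneg_left h (Real.exp_pos _).le
      _ = _ * (1 / ν * (Real.exp (τ / 2) * Real.exp (-(τ / 2))) * ‖κ‖ * ‖P κ‖) := by
        rw [mul_left_comm]
        congr 1
        ring
      _ ≤ _ := by
        refine mul_le_mul (hw κ hκ) ?_ (by positivity) (by positivity)
        rw [hεx, mul_one]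
        refine mul_le_mul_of_nonneg_right ?_ (norm_nonneg _)
        refine mul_le_mul (by rw [hQ]; linarith) ?_ (norm_nonneg _) (by linarith)
        nlinarith [norm_nonneg κ]
  · have h := (norm_specWV_le hν ht 0 (P κ) ((Real.exp (-(τ / 2)) : ℂ) * κ)).2
    rw [norm_zero, mul_zero, add_zero, norm_scaled] at h
    rw [norm_exp_half_mul]
    calc _ ≤ Real.exp (τ / 2) * _ := mul_le_mul_of_nonneg_left h (Real.exp_pos _).le
      _ = _ * ((Real.exp (τ / 2) * Real.exp (-ν * (Real.exp τ - 1)) + 1 / ν ^ 2 *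
          ((Real.exp (τ / 2) * Real.exp (-(τ / 2))) * Real.exp (-(τ / 2)) * ‖κ‖ ^ 2)) *
          ‖P κ‖) := by
        rw [mul_left_comm]
        congr 1
        ring
      _ ≤ _ := by
        refine mul_le_mul (hw κ hκ) ?_ (by positivity) (by positivity)
        rw [hεx, one_mul]
        refine mul_le_mul_of_nonneg_right ?_ (norm_nonneg _)
        have e1 : Real.exp (-(τ / 2)) * ‖κ‖ ^ 2 ≤ (1 + ‖κ‖) ^ 2 := by
          refine (mul_le_of_le_one_left (by positivity) hε1).trans ?_
          nlinarith [norm_nonneg κ]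
        calc _ ≤ C * (1 + ‖κ‖) ^ 2 + 1 / ν ^ 2 * (1 + ‖κ‖) ^ 2 := by
              refine add_le_add (hsqrt.trans (le_mul_of_one_le_right hC.le (h1 κ))) ?_
              gcongr
          _ = (C + 1 / ν ^ 2) * (1 + ‖κ‖) ^ 2 := by ring
          _ ≤ _ := by
              refine mul_le_mul_of_nonneg_right ?_ (by positivity)
              rw [hQ]; linarith

theorem exp_neg_le_rate (N : ℕ) (hτ : 0 ≤ τ) :
    Real.exp (-(τ / 2)) ^ (N + 1) ≤ Real.exp (-(((N : ℝ) + 1) / 4) * τ) := by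
  rw [← Real.exp_nat_mul]
  refine Real.exp_le_exp.2 ?_
  push_cast
  nlinarith [mul_nonneg (by positivity : (0 : ℝ) ≤ (N : ℝ) + 1) hτ]

/-- The contribution of the top coefficient of the second component. -/
theorem exists_strip_top (hν : 0 < ν) (N : ℕ) (γ : ℝ) : ∃ B : ℝ, 0 ≤ B ∧ ∀ τ : ℝ, 2 ≤ Real.exp τ →
    StripBound (ν / 4) (B * Real.exp (-(((N : ℝ) + 1) / 4) * τ))
      (fun κ => specW ν (Real.exp τ - 1) 0
        (γ * (Complex.I * ((Real.exp (-(τ / 2)) : ℂ) * κ)) ^ (N + 1))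
        ((Real.exp (-(τ / 2)) : ℂ) * κ)) ∧
    StripBound (ν / 4) (B * Real.exp (-(((N : ℝ) + 1) / 4) * τ))
      (fun κ => (Real.exp (τ / 2) : ℝ) * specV ν (Real.exp τ - 1) 0
        (γ * (Complex.I * ((Real.exp (-(τ / 2)) : ℂ) * κ)) ^ (N + 1))
        ((Real.exp (-(τ / 2)) : ℂ) * κ)) := by
  obtain ⟨B, hB, h⟩ := exists_strip_spec hν (N + 1)
  refine ⟨B * |γ|, by positivity, fun τ hτ => ?_⟩
  obtain ⟨-, h2, -, h4⟩ := h τ hτ (|γ| * Real.exp (-(((N : ℝ) + 1) / 4) * τ))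
    (fun κ => γ * (Complex.I * ((Real.exp (-(τ / 2)) : ℂ) * κ)) ^ (N + 1)) (by positivity)
    (by fun_prop) fun κ => by
      rw [norm_mul, norm_pow, norm_mul, Complex.norm_I, one_mul, norm_scaled, Complex.norm_real,
        Real.norm_eq_abs, mul_pow, mul_assoc]
      refine mul_le_mul_of_nonneg_left ?_ (abs_nonneg _)
      refine mul_le_mul (exp_neg_le_rate N (pos_of_two_le_exp hτ).le) ?_ (by positivity)
        (by positivity)
      exact pow_le_pow_left₀ (norm_nonneg _) (by linarith) _
  rw [← mul_assoc] at h2 h4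
  exact ⟨h2, h4⟩

theorem differentiable_heatTrunc (ν t : ℝ) (N : ℕ) (F : ℝ⟦X⟧) (ε : ℂ) :
    Differentiable ℂ fun κ => heatTrunc ν t N F (ε * κ) := by
  have := (differentiable_evalTrunc N F).comp
    (by fun_prop : Differentiable ℂ fun κ => Complex.I * (ε * κ))
  simp only [Function.comp_def] at this
  unfold heatTrunc
  fun_prop

theorem differentiable_err (ν t : ℝ) (a₀ c₀ : ℝ⟦X⟧) (N : ℕ) (ε : ℂ) :
    Differentiable ℂ (fun κ => errW ν a₀ c₀ N t (ε * κ)) ∧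
      Differentiable ℂ (fun κ => errV ν a₀ c₀ N t (ε * κ)) := by
  have hz : Differentiable ℂ fun κ => Complex.I * (ε * κ) := by fun_prop
  have hF := (differentiable_evalTrunc N a₀).comp hz
  have hG := (differentiable_evalTrunc (N + 1) c₀).comp hz
  obtain ⟨h1, h2⟩ := differentiable_spec ν t ε hF hG
  exact ⟨h1.sub (differentiable_heatTrunc ν t N _ ε),
    h2.sub (differentiable_heatTrunc ν t (N + 1) _ ε)⟩

/-- The contribution of the Duhamel error. -/
theorem exists_strip_err (hν : 0 < ν) (N : ℕ) (a₀ c₀ : ℝ⟦X⟧) : ∃ B : ℝ, 0 ≤ B ∧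
    ∀ τ : ℝ, 2 ≤ Real.exp τ →
    StripBound (ν / 4) (B * Real.exp (-(((N : ℝ) + 1) / 4) * τ))
      (fun κ => errW ν a₀ c₀ N (Real.exp τ - 1) ((Real.exp (-(τ / 2)) : ℂ) * κ)) ∧
    StripBound (ν / 4) (B * Real.exp (-(((N : ℝ) + 1) / 4) * τ)) (fun κ =>
      (Real.exp (τ / 2) : ℝ) * errV ν a₀ c₀ N (Real.exp τ - 1) ((Real.exp (-(τ / 2)) : ℂ) * κ)) := by
  obtain ⟨K, hK, h⟩ := exists_err_bound a₀ c₀ hν N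
  have hc : 0 < ν / 4 := by positivity
  refine ⟨K * Real.exp (nuT ν) * (((N + 6).factorial : ℝ) * Real.exp (2 + 1 / (4 * (ν / 4)))),
    by positivity, fun τ hτ => ?_⟩
  have ht : 0 ≤ Real.exp τ - 1 := by linarith
  obtain ⟨d1, d2⟩ := differentiable_err ν (Real.exp τ - 1) a₀ c₀ N (Real.exp (-(τ / 2)) : ℂ)
  obtain ⟨q, hq⟩ : ∃ q, q = Real.exp (-(((N : ℝ) + 1) / 4) * τ) := ⟨_, rfl⟩
  have hq0 : 0 ≤ q := by rw [hq]; positivity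
  have hεx := exp_half_mul_exp τ
  have hL : (1 + (Real.exp τ - 1)) ^ (((N : ℝ) + 1) / 4) * Real.exp (-(τ / 2)) ^ (N + 1) = q := by
    rw [add_sub_cancel, ← Real.exp_mul, ← Real.exp_nat_mul, ← Real.exp_add, hq]
    congr 1; push_cast; ring
  have hs : √(1 + (Real.exp τ - 1)) = Real.exp (τ / 2) := by
    rw [add_sub_cancel, ← Real.exp_half]
  have hy : ∀ κ : ℂ, Real.exp (-(τ / 2)) * ‖κ‖ * Real.exp (τ / 2) = ‖κ‖ := fun κ => by
    linear_combination ‖κ‖ * hεx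
  rw [← hq]
  have key : ∀ {H : ℂ → ℂ} {n : ℕ}, n ≤ 2 → Differentiable ℂ H →
      (∀ κ : ℂ, |κ.im| ≤ 1 → ‖H κ‖ ≤ K * q *
        (Real.exp (nuT ν) * Real.exp (-(2 * (ν / 4)) * κ.re ^ 2)) *
          (‖κ‖ ^ (N + n) * (1 + ‖κ‖) ^ 4)) → StripBound (ν / 4)
      (K * Real.exp (nuT ν) * (((N + 6).factorial : ℝ) * Real.exp (2 + 1 / (4 * (ν / 4)))) * q)
      H := by
    intro H n hn hd hH
    refine (stripBound_of_poly hc (by positivity : 0 ≤ K * Real.exp (nuT ν) * q) (n := N + 6) hd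
      fun κ hκ => (hH κ hκ).trans ?_).mono (le_of_eq (by ring))
    have e1 : ‖κ‖ ^ (N + n) * (1 + ‖κ‖) ^ 4 ≤ (1 + ‖κ‖) ^ (N + 6) := by
      rw [show N + 6 = N + 2 + 4 by ring, pow_add _ (N + 2)]
      refine mul_le_mul_of_nonneg_right ?_ (by positivity)
      exact (pow_le_pow_left₀ (norm_nonneg _) (by linarith) _).trans
        (pow_le_pow_right₀ (by linarith [norm_nonneg κ]) (by omega))
    have e0 : 0 ≤ K * q * (Real.exp (nuT ν) * Real.exp (-(2 * (ν / 4)) * κ.re ^ 2)) := by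
      positivity
    have := mul_le_mul_of_nonneg_left e1 e0
    linear_combination this
  constructor
  · refine key (n := 1) (by norm_num) d1 fun κ hκ => ?_
    have h1 := (h _ ht ((Real.exp (-(τ / 2)) : ℂ) * κ)).1
    rw [norm_scaled, hs, hy, mul_pow] at h1
    have hw := scaled_weight_le hν hτ hκ
    generalize Real.exp (nuT ν * ((Real.exp (-(τ / 2)) : ℂ) * κ).im ^ 2 * (Real.exp τ - 1) -
      ν * ((Real.exp (-(τ / 2)) : ℂ) * κ).re ^ 2 * (Real.exp τ - 1)) = w₁ at h1 hw
    refine h1.trans ?_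
    calc _ = K * w₁ * (((1 + (Real.exp τ - 1)) ^ (((N : ℝ) + 1) / 4) *
          Real.exp (-(τ / 2)) ^ (N + 1)) * (‖κ‖ ^ (N + 1) * (1 + ‖κ‖) ^ 4)) := by ring
      _ ≤ K * (Real.exp (nuT ν) * Real.exp (-(2 * (ν / 4)) * κ.re ^ 2)) *
          (q * (‖κ‖ ^ (N + 1) * (1 + ‖κ‖) ^ 4)) := by
        rw [hL]
        gcongr
      _ = _ := by ring
  · refine key (n := 2) le_rfl (d2.const_mul _) fun κ hκ => ?_
    have h1 := (h _ ht ((Real.exp (-(τ / 2)) : ℂ) * κ)).2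
    rw [norm_scaled, hs, hy, mul_pow] at h1
    rw [norm_exp_half_mul]
    have hw := scaled_weight_le hν hτ hκ
    generalize Real.exp (nuT ν * ((Real.exp (-(τ / 2)) : ℂ) * κ).im ^ 2 * (Real.exp τ - 1) -
      ν * ((Real.exp (-(τ / 2)) : ℂ) * κ).re ^ 2 * (Real.exp τ - 1)) = w₁ at h1 hw
    refine (mul_le_mul_of_nonneg_left h1 (Real.exp_pos _).le).trans ?_
    calc _ = K * w₁ * (((1 + (Real.exp τ - 1)) ^ (((N : ℝ) + 1) / 4) *
          Real.exp (-(τ / 2)) ^ (N + 1)) * (Real.exp (τ / 2) * Real.exp (-(τ / 2))) *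
          (‖κ‖ ^ (N + 2) * (1 + ‖κ‖) ^ 4)) := by ring
      _ ≤ K * (Real.exp (nuT ν) * Real.exp (-(2 * (ν / 4)) * κ.re ^ 2)) *
          (q * 1 * (‖κ‖ ^ (N + 2) * (1 + ‖κ‖) ^ 4)) := by
        rw [hL, hεx]
        gcongr
      _ = _ := by ring

/-- The contribution of an exponentially decaying series. -/
theorem exists_strip_decay (hν : 0 < ν) (N n : ℕ) {δ : ℝ} (hδ : 0 < δ) {D : ℝ → ℝ⟦X⟧}
    (hD : Decay δ D) : ∃ B : ℝ, 0 ≤ B ∧ ∀ τ : ℝ, 2 ≤ Real.exp τ →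
    StripBound (ν / 4) (B * Real.exp (-(((N : ℝ) + 1) / 4) * τ)) (fun κ =>
      (Real.exp (τ / 2) : ℝ) * heatTrunc ν (Real.exp τ - 1) n (D (Real.exp τ - 1))
        ((Real.exp (-(τ / 2)) : ℂ) * κ)) := by
  choose C hC using hD
  obtain ⟨K, hK, hexp⟩ := exists_rpow_le_exp (((N : ℝ) + 1) / 4 + 1 / 2) hδ
  obtain ⟨S, hS⟩ : ∃ S, S = ∑ j ∈ Finset.range (n + 1), |C j| := ⟨_, rfl⟩
  have hS0 : 0 ≤ S := by rw [hS]; positivity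
  have hc : 0 < ν / 4 := by positivity
  refine ⟨Real.exp (nuT ν) * S * K * ((n.factorial : ℝ) * Real.exp (2 + 1 / (4 * (ν / 4)))),
    by positivity, fun τ hτ => ?_⟩
  have ht : 0 ≤ Real.exp τ - 1 := by linarith
  have hε1 : Real.exp (-(τ / 2)) ≤ 1 := by
    rw [Real.exp_le_one_iff]; linarith [pos_of_two_le_exp hτ]
  obtain ⟨q, hq⟩ : ∃ q, q = Real.exp (-(((N : ℝ) + 1) / 4) * τ) := ⟨_, rfl⟩
  have hq0 : 0 ≤ q := by rw [hq]; positivity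
  have hdec : Real.exp (τ / 2) * Real.exp (-δ * (Real.exp τ - 1)) ≤ K * q := by
    have h := hexp _ ht
    rw [add_sub_cancel, ← Real.exp_mul] at h
    have e1 : Real.exp (τ * (((N : ℝ) + 1) / 4 + 1 / 2)) * q = Real.exp (τ / 2) := by
      rw [hq, ← Real.exp_add]; congr 1; ring
    calc _ = Real.exp (τ * (((N : ℝ) + 1) / 4 + 1 / 2)) * q *
          Real.exp (-δ * (Real.exp τ - 1)) := by rw [e1]
      _ ≤ K * Real.exp (δ * (Real.exp τ - 1)) * q * Real.exp (-δ * (Real.exp τ - 1)) := by gcongr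
      _ = K * q * (Real.exp (δ * (Real.exp τ - 1)) * Real.exp (-δ * (Real.exp τ - 1))) := by ring
      _ = K * q := by rw [← Real.exp_add]; simp
  rw [← hq]
  refine (stripBound_of_poly hc (by positivity : 0 ≤ Real.exp (nuT ν) * S * K * q) (n := n)
    ((differentiable_heatTrunc ν _ n _ _).const_mul _) fun κ hκ => ?_).mono (le_of_eq (by ring))
  have h1 : ‖Complex.exp (-(nuT ν * ((Real.exp (-(τ / 2)) : ℂ) * κ) ^ 2 *
      (Real.exp τ - 1 : ℝ)))‖ ≤ Real.exp (nuT ν) * Real.exp (-(2 * (ν / 4)) * κ.re ^ 2) := by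
    refine le_trans ?_ (scaled_weight_le hν hτ hκ)
    have h := norm_heat_mul_le hν ht (Real.exp τ - 1) ((Real.exp (-(τ / 2)) : ℂ) * κ)
    simpa [oscBound] using h
  have h2 : ‖evalTrunc n (D (Real.exp τ - 1)) (Complex.I * ((Real.exp (-(τ / 2)) : ℂ) * κ))‖ ≤
      S * Real.exp (-δ * (Real.exp τ - 1)) * (1 + ‖κ‖) ^ n := by
    refine (norm_evalTrunc_le _ _ _).trans ?_
    rw [norm_mul, Complex.norm_I, one_mul, norm_scaled]
    refine mul_le_mul ?_ ?_ (by positivity) (by positivity)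
    · rw [hS, Finset.sum_mul]
      refine Finset.sum_le_sum fun j _ => (hC j _ ht).trans ?_
      exact mul_le_mul_of_nonneg_right (le_abs_self _) (Real.exp_pos _).le
    · refine pow_le_pow_left₀ (by positivity) ?_ _
      have := mul_le_of_le_one_left (norm_nonneg κ) hε1
      linarith
  rw [norm_exp_half_mul, heatTrunc, norm_mul]
  calc _ ≤ Real.exp (τ / 2) * (Real.exp (nuT ν) * Real.exp (-(2 * (ν / 4)) * κ.re ^ 2) *
        (S * Real.exp (-δ * (Real.exp τ - 1)) * (1 + ‖κ‖) ^ n)) := by gcongr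
    _ = Real.exp (nuT ν) * Real.exp (-(2 * (ν / 4)) * κ.re ^ 2) * S * (1 + ‖κ‖) ^ n *
        (Real.exp (τ / 2) * Real.exp (-δ * (Real.exp τ - 1))) := by ring
    _ ≤ Real.exp (nuT ν) * Real.exp (-(2 * (ν / 4)) * κ.re ^ 2) * S * (1 + ‖κ‖) ^ n *
        (K * q) := by gcongr
    _ = _ := by ring

end Approximation
end
end TaylorDispersion

namespace TaylorDispersion
noncomputable section
section Assembly
open PowerSeries

/-! ### The error in the weighted norm -/

theorem ae_comp_mul {p : ℝ → Prop} (h : ∀ᵐ x, p x) {a : ℝ} (ha : a ≠ 0) : ∀ᵐ ξ, p (a * ξ) := by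
  refine ae_of_ae_map (f := fun ξ => a * ξ) (by fun_prop) ?_
  rw [Real.map_volume_mul_left ha]
  exact Measure.ae_smul_measure h _

variable {ν τ m c B : ℝ} {N : ℕ}

/-- The solution in scaling variables on the Fourier side. -/
theorem IsSolution.scaled_eq_syn {w₀ v₀ : L2} {W V : ℝ → L2} (hν : 0 < ν)
    (h : IsSolution ν w₀ v₀ W V) (hw : Integrable w₀) (hv : Integrable v₀) (hτ : 0 < τ) :
    (∀ᵐ ξ, (scaleHalf W τ ξ : ℂ) = syn (fun κ => specW ν (Real.exp τ - 1)
      (ft w₀ (Real.exp (-(τ / 2)) * κ)) (ft v₀ (Real.exp (-(τ / 2)) * κ))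
      (Real.exp (-(τ / 2)) * κ : ℝ)) ξ) ∧
    ∀ᵐ ξ, (scaleOne V τ ξ : ℂ) = syn (fun κ => (Real.exp (τ / 2) : ℝ) * specV ν (Real.exp τ - 1)
      (ft w₀ (Real.exp (-(τ / 2)) * κ)) (ft v₀ (Real.exp (-(τ / 2)) * κ))
      (Real.exp (-(τ / 2)) * κ : ℝ)) ξ := by
  have ht0 : 0 < Real.exp τ - 1 := sub_pos.2 (Real.one_lt_exp_iff.2 hτ)
  obtain ⟨h1, h2⟩ := h.eq_syn hν hw hv ht0
  have hs := Real.exp_pos (τ / 2)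
  have e : 1 / Real.exp (τ / 2) = Real.exp (-(τ / 2)) := by rw [Real.exp_neg, one_div]
  constructor
  · filter_upwards [ae_comp_mul h1 hs.ne'] with ξ hξ
    rw [scaleHalf, Complex.ofReal_mul, hξ, syn_comp_div _ hs, e]
  · filter_upwards [ae_comp_mul h2 hs.ne'] with ξ hξ
    have e2 : Real.exp τ = Real.exp (τ / 2) * Real.exp (τ / 2) := by
      rw [← Real.exp_add]; congr 1; ring
    rw [syn_const_mul, scaleOne]
    nth_rewrite 1 [e2]
    rw [Complex.ofReal_mul, Complex.ofReal_mul, hξ, mul_assoc, syn_comp_div _ hs, e]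

theorem StripBound.memL2m (hc : 0 < c) {H : ℂ → ℂ} (h : StripBound c B H) (m : ℝ) :
    MemL2m m (fun ξ => ‖syn (fun κ => H κ) ξ‖) ∧ normL2m m (fun ξ => ‖syn (fun κ => H κ) ξ‖) ≤
      pwConst c * normL2m m (fun ξ => Real.exp (-|ξ|)) * B := by
  have h1 := (memL2m_exp_neg_abs m).of_abs_le (f := fun ξ => ‖syn (fun κ => H κ) ξ‖)
    (C := B * pwConst c) (continuous_syn (h.integrable hc)).norm.aestronglyMeasurable
    (mul_nonneg h.nonneg (pwConst_nonneg c)) (Eventually.of_forall fun ξ => by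
      rw [abs_norm, abs_of_pos (Real.exp_pos _)]
      exact h.norm_syn_le hc ξ)
  exact ⟨h1.1, h1.2.trans (le_of_eq (by ring))⟩

theorem MemL2m.of_syn {f : ℝ → ℝ} {R₁ R₂ G : ℝ → ℂ} {b₁ b₂ b₃ : ℝ} (i₁ : Integrable R₁)
    (i₂ : Integrable R₂) (i₃ : Integrable G)
    (hf : ∀ᵐ ξ, (f ξ : ℂ) = syn (fun κ => R₁ κ + R₂ κ + G κ) ξ)
    (h₁ : MemL2m m (fun ξ => ‖syn R₁ ξ‖) ∧ normL2m m (fun ξ => ‖syn R₁ ξ‖) ≤ b₁)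
    (h₂ : MemL2m m (fun ξ => ‖syn R₂ ξ‖) ∧ normL2m m (fun ξ => ‖syn R₂ ξ‖) ≤ b₂)
    (h₃ : MemL2m m (fun ξ => ‖syn G ξ‖) ∧ normL2m m (fun ξ => ‖syn G ξ‖) ≤ b₃) :
    MemL2m m f ∧ normL2m m f ≤ 4 * (b₁ + b₂ + b₃) := by
  obtain ⟨m₁, n₁⟩ := h₁.1.add h₂.1
  obtain ⟨m₂, n₂⟩ := m₁.add h₃.1
  have i₁₂ : Integrable fun κ => R₁ κ + R₂ κ := i₁.add i₂
  have i : Integrable fun κ => R₁ κ + R₂ κ + G κ := i₁₂.add i₃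
  have hmeas : AEStronglyMeasurable f volume := by
    refine (Complex.continuous_re.comp (continuous_syn i)).aestronglyMeasurable.congr ?_
    filter_upwards [hf] with ξ hξ
    simp only [Function.comp_apply, ← hξ, Complex.ofReal_re]
  have h := m₂.of_abs_le hmeas zero_le_one (by
    filter_upwards [hf] with ξ hξ
    rw [one_mul]
    refine le_trans ?_ (le_abs_self _)
    rw [← Real.norm_eq_abs, ← Complex.norm_real, hξ, syn_add i₁₂ i₃, syn_add i₁ i₂]
    exact (norm_add_le _ _).trans (add_le_add (norm_add_le _ _) le_rfl))
  refine ⟨h.1, h.2.trans ?_⟩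
  have hn : 0 ≤ normL2m m (fun ξ => ‖syn G ξ‖) := Real.sqrt_nonneg _
  linarith [h₁.2, h₂.2, h₃.2]

theorem StripBound.integrable_remainder (hc : 0 < c) {M : ℂ → ℂ} (h : StripBound c B M) {f : ℝ → ℝ}
    (hf : Integrable f) (F : ℝ⟦X⟧) (ε : ℝ) : Integrable fun κ : ℝ =>
      M κ * (ft f (ε * κ) - evalTrunc N F (Complex.I * (ε * κ : ℝ))) := by
  have h1 : Integrable fun κ : ℝ => M κ * ft f (ε * κ) :=
    (h.integrable hc).mul_bdd (c := ∫ x, |f x|)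
      ((continuous_ft hf).comp (by fun_prop)).aestronglyMeasurable
      (Eventually.of_forall fun κ => norm_ft_le f _)
  have h2 : Integrable fun κ : ℝ => M κ * evalTrunc N F (Complex.I * (ε * κ : ℝ)) := by
    have hd : Differentiable ℂ fun κ : ℂ => evalTrunc N F (Complex.I * (ε * κ)) :=
      (differentiable_evalTrunc N F).comp (by fun_prop)
    have := (h.mul_exp_type hc (a := |ε|)
      (A := (∑ j ∈ Finset.range (N + 1), |coeff j F|) * ((N.factorial : ℝ) * Real.exp 1))
      (abs_nonneg _) (by positivity) hd fun κ _ => by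
        refine (norm_evalTrunc_le _ _ _).trans ?_
        rw [mul_assoc]
        refine mul_le_mul_of_nonneg_left ?_ (by positivity)
        have h3 := Real.pow_div_factorial_le_exp (1 + |ε| * ‖κ‖) (by positivity) N
        rw [div_le_iff₀ (by positivity), Real.exp_add] at h3
        simp only [norm_mul, Complex.norm_I, one_mul, Complex.norm_real, Real.norm_eq_abs]
        linarith).integrable (by positivity)
    simpa using this
  refine (h1.sub h2).congr (Eventually.of_forall fun κ => ?_)
  simp only [Pi.sub_apply]
  ring

theorem evalTrunc_congr {F G : ℝ⟦X⟧} (h : ∀ j ≤ N, coeff j F = coeff j G) (z : ℂ) :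
    evalTrunc N F z = evalTrunc N G z :=
  Finset.sum_congr rfl fun j hj => by rw [h j (Finset.mem_range_succ_iff.1 hj)]

theorem heatTrunc_sub (ν t : ℝ) (N : ℕ) (F G : ℝ⟦X⟧) (k : ℂ) :
    heatTrunc ν t N (F - G) k = heatTrunc ν t N F k - heatTrunc ν t N G k := by
  rw [heatTrunc, evalTrunc_sub, heatTrunc, heatTrunc, mul_sub]

/-- The error of an approximation by truncated series, on the Fourier side. -/
theorem error_decomposition (ν t : ℝ) {a₀ c₀ μ₁ μ₂ : ℝ⟦X⟧} (h₁ : ∀ j ≤ N, coeff j a₀ = coeff j μ₁)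
    (h₂ : ∀ j ≤ N, coeff j c₀ = coeff j μ₂) (A C : ℝ⟦X⟧) (F G k : ℂ) :
    specW ν t F G k - heatTrunc ν t N A k =
      specW ν t 1 0 k * (F - evalTrunc N μ₁ (Complex.I * k)) +
      specW ν t 0 1 k * (G - evalTrunc N μ₂ (Complex.I * k)) +
      (errW ν a₀ c₀ N t k + specW ν t 0 (((-coeff (N + 1) c₀ : ℝ) : ℂ) *
        (Complex.I * k) ^ (N + 1)) k + heatTrunc ν t N (solA ν a₀ c₀ t - A) k) ∧
    specV ν t F G k - heatTrunc ν t (N + 1) C k =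
      specV ν t 1 0 k * (F - evalTrunc N μ₁ (Complex.I * k)) +
      specV ν t 0 1 k * (G - evalTrunc N μ₂ (Complex.I * k)) +
      (errV ν a₀ c₀ N t k + specV ν t 0 (((-coeff (N + 1) c₀ : ℝ) : ℂ) *
        (Complex.I * k) ^ (N + 1)) k + heatTrunc ν t (N + 1) (solC ν a₀ c₀ t - C) k) := by
  rw [heatTrunc_sub, heatTrunc_sub, errW, errV, evalTrunc_succ, evalTrunc_congr h₁,
    evalTrunc_congr h₂, (spec_linear ν t F G k).1, (spec_linear ν t F G k).2]
  simp only [spec_linear ν t (evalTrunc N μ₁ _), spec_linear ν t 0 (_ * _)]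
  constructor <;> · push_cast; ring

theorem exp_half_pow_le_rate (hN : 0 < N) (hτ : 0 ≤ τ) :
    Real.exp (-(τ / 2)) ^ N ≤ Real.exp (-(((N : ℝ) + 1) / 4) * τ) := by
  rw [← Real.exp_nat_mul]
  refine Real.exp_le_exp.2 ?_
  have : (1 : ℝ) ≤ N := by exact_mod_cast hN
  nlinarith

/-- The approximation of the solution by truncated series with the right Taylor coefficients. -/
theorem exists_approx_bound (hν : 0 < ν) (hN : 0 < N) (hm : (N : ℝ) + 1 / 2 < m) {w₀ v₀ : L2}
    (hw : MemL2m m w₀) (hv : MemL2m m v₀) {a₀ c₀ : ℝ⟦X⟧}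
    (h₁ : ∀ j ≤ N, coeff j a₀ = coeff j (momentSeries w₀))
    (h₂ : ∀ j ≤ N, coeff j c₀ = coeff j (momentSeries v₀)) {δ : ℝ} (hδ : 0 < δ) {A C : ℝ → ℝ⟦X⟧}
    (hA : Decay δ fun t => solA ν a₀ c₀ t - A t) (hC : Decay δ fun t => solC ν a₀ c₀ t - C t) :
    ∃ K : ℝ, 0 ≤ K ∧ ∀ τ : ℝ, 2 ≤ Real.exp τ → ∀ f g : ℝ → ℝ,
      (∀ᵐ ξ, (f ξ : ℂ) = syn (fun κ => specW ν (Real.exp τ - 1)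
        (ft w₀ (Real.exp (-(τ / 2)) * κ)) (ft v₀ (Real.exp (-(τ / 2)) * κ))
        (Real.exp (-(τ / 2)) * κ : ℝ) -
        heatTrunc ν (Real.exp τ - 1) N (A (Real.exp τ - 1)) (Real.exp (-(τ / 2)) * κ : ℝ)) ξ) →
      (∀ᵐ ξ, (g ξ : ℂ) = syn (fun κ => (Real.exp (τ / 2) : ℝ) * (specV ν (Real.exp τ - 1)
        (ft w₀ (Real.exp (-(τ / 2)) * κ)) (ft v₀ (Real.exp (-(τ / 2)) * κ))
        (Real.exp (-(τ / 2)) * κ : ℝ) -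
        heatTrunc ν (Real.exp τ - 1) (N + 1) (C (Real.exp τ - 1))
          (Real.exp (-(τ / 2)) * κ : ℝ))) ξ) →
      MemL2m m f ∧ MemL2m m g ∧
        normL2m m f + normL2m m g ≤ K * Real.exp (-(((N : ℝ) + 1) / 4) * τ) := by
  have hc : 0 < ν / 4 := by positivity
  obtain ⟨K₁, hK₁, r₁⟩ := exists_remainder_bound hc hm hw
  obtain ⟨K₂, hK₂, r₂⟩ := exists_remainder_bound hc hm hv
  obtain ⟨B₀, hB₀, s₀⟩ := exists_strip_spec hν 0
  obtain ⟨B₁, hB₁, s₁⟩ := exists_strip_err hν N a₀ c₀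
  obtain ⟨B₂, hB₂, s₂⟩ := exists_strip_top hν N (-coeff (N + 1) c₀)
  obtain ⟨B₃, hB₃, s₃⟩ := exists_strip_decay hν N N hδ hA
  obtain ⟨B₄, hB₄, s₄⟩ := exists_strip_decay hν N (N + 1) hδ hC
  obtain ⟨Q, hQ⟩ : ∃ Q, Q = pwConst (ν / 4) * normL2m m (fun ξ => Real.exp (-|ξ|)) := ⟨_, rfl⟩
  have hQ0 : 0 ≤ Q := by
    rw [hQ]; exact mul_nonneg (pwConst_nonneg _) (Real.sqrt_nonneg _)
  refine ⟨4 * (K₁ * (B₀ * 1) + K₂ * (B₀ * 1) + Q * (B₁ + B₂ + B₃)) +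
    4 * (K₁ * (B₀ * 1) + K₂ * (B₀ * 1) + Q * (B₁ + B₂ + B₄)), by positivity,
    fun τ hτ f g hf hg => ?_⟩
  have hτ0 := pos_of_two_le_exp hτ
  have hε0 := Real.exp_pos (-(τ / 2))
  have hε1 : Real.exp (-(τ / 2)) ≤ 1 := by rw [Real.exp_le_one_iff]; linarith
  have hh1 : 1 ≤ Real.exp (τ / 2) := Real.one_le_exp (by linarith)
  have hrate := exp_half_pow_le_rate hN hτ0.le
  obtain ⟨q, hq⟩ : ∃ q, q = Real.exp (-(((N : ℝ) + 1) / 4) * τ) := ⟨_, rfl⟩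
  have s₁ := s₁ τ hτ
  have s₂ := s₂ τ hτ
  have s₃ := s₃ τ hτ
  have s₄ := s₄ τ hτ
  rw [← hq] at hrate s₁ s₂ s₃ s₄ ⊢
  have hq0 : 0 ≤ q := by rw [hq]; positivity
  obtain ⟨p₁, p₂, p₃, p₄⟩ := s₀ τ hτ 1 (fun _ => 1) zero_le_one (differentiable_const _)
    fun κ => by simp
  have s₃' : StripBound (ν / 4) (B₃ * q) (fun κ => heatTrunc ν (Real.exp τ - 1) N
      (solA ν a₀ c₀ (Real.exp τ - 1) - A (Real.exp τ - 1)) ((Real.exp (-(τ / 2)) : ℂ) * κ)) :=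
    ⟨differentiable_heatTrunc _ _ _ _ _, fun κ hκ => by
      refine le_trans ?_ (s₃.le κ hκ)
      rw [norm_exp_half_mul]
      exact le_mul_of_one_le_left (norm_nonneg _) hh1⟩
  have gW := (s₁.1.add s₂.1).add s₃'
  have gV := (s₁.2.add s₂.2).add s₄
  have wt : ∀ {K : ℝ}, 0 ≤ K → K * (B₀ * 1) * Real.exp (-(τ / 2)) ^ N ≤ K * (B₀ * 1) * q :=
    fun hK => mul_le_mul_of_nonneg_left hrate (by positivity)
  have nf := MemL2m.of_syn (f := f) (p₁.integrable_remainder hc (hw.integrable hm) _ _)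
    (p₂.integrable_remainder hc (hv.integrable hm) _ _) (gW.integrable hc) (by
      filter_upwards [hf] with ξ hξ
      rw [hξ]
      congr 1
      funext κ
      rw [(error_decomposition ν _ h₁ h₂ _ (C (Real.exp τ - 1)) _ _ _).1, Complex.ofReal_mul])
    (r₁ _ _ p₁ _ hε0 hε1) (r₂ _ _ p₂ _ hε0 hε1) (gW.memL2m hc m)
  have ng := MemL2m.of_syn (f := g) (p₃.integrable_remainder hc (hw.integrable hm) _ _)
    (p₄.integrable_remainder hc (hv.integrable hm) _ _) (gV.integrable hc) (by
      filter_upwards [hg] with ξ hξ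
      rw [hξ]
      congr 1
      funext κ
      rw [(error_decomposition ν _ h₁ h₂ (A (Real.exp τ - 1)) _ _ _ _).2, Complex.ofReal_mul]
      ring)
    (r₁ _ _ p₃ _ hε0 hε1) (r₂ _ _ p₄ _ hε0 hε1) (gV.memL2m hc m)
  refine ⟨nf.1, ng.1, (add_le_add nf.2 ng.2).trans ?_⟩
  rw [← hQ]
  linear_combination 8 * wt hK₁ + 8 * wt hK₂

/-- The decay of the error beats every admissible exponential rate. -/
theorem exists_rate_lt {K D M : ℝ} (hD : 0 < D) (hM : 4 * M ≤ N) : ∃ τ₀ : ℝ, 0 < τ₀ ∧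
    ∀ τ : ℝ, τ₀ ≤ τ → K * Real.exp (-(((N : ℝ) + 1) / 4) * τ) ≤ D * Real.exp (-M * τ) := by
  refine ⟨max 1 (4 * (|K| / D)), by positivity, fun τ hτ => ?_⟩
  have h1 : 4 * (|K| / D) ≤ τ := (le_max_right _ _).trans hτ
  have h0 : 1 ≤ τ := (le_max_left _ _).trans hτ
  have h2 : |K| / D ≤ Real.exp (τ / 4) := by
    have := Real.add_one_le_exp (τ / 4)
    linarith
  rw [div_le_iff₀ hD] at h2
  have h3 : Real.exp (τ / 4) * Real.exp (-(((N : ℝ) + 1) / 4) * τ) ≤ Real.exp (-M * τ) := by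
    rw [← Real.exp_add]
    refine Real.exp_le_exp.2 ?_
    nlinarith
  calc _ ≤ |K| * Real.exp (-(((N : ℝ) + 1) / 4) * τ) :=
        mul_le_mul_of_nonneg_right (le_abs_self _) (Real.exp_pos _).le
    _ ≤ Real.exp (τ / 4) * D * Real.exp (-(((N : ℝ) + 1) / 4) * τ) :=
        mul_le_mul_of_nonneg_right h2 (Real.exp_pos _).le
    _ = D * (Real.exp (τ / 4) * Real.exp (-(((N : ℝ) + 1) / 4) * τ)) := by ring
    _ ≤ _ := mul_le_mul_of_nonneg_left h3 hD.le

theorem integrable_heatTrunc (hν : 0 < ν) (N : ℕ) (F : ℝ⟦X⟧) (hτ : 2 ≤ Real.exp τ) :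
    Integrable fun κ : ℝ => heatTrunc ν (Real.exp τ - 1) N F (Real.exp (-(τ / 2)) * κ : ℝ) := by
  obtain ⟨B, -, h⟩ := exists_strip_decay hν N N one_pos (D := fun t => C (Real.exp (-1 * t)) * F)
    (fun j => ⟨|coeff j F|, fun t _ => by
      rw [coeff_C_mul, abs_mul, abs_of_pos (Real.exp_pos _), mul_comm]⟩)
  have h1 := (h τ hτ).integrable (by positivity)
  have h2 := h1.const_mul
    (((Real.exp (τ / 2) : ℝ) : ℂ) * (Real.exp (-1 * (Real.exp τ - 1)) : ℝ))⁻¹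
  refine h2.congr (Eventually.of_forall fun κ => ?_)
  have e1 : ((Real.exp (τ / 2) : ℝ) : ℂ) ≠ 0 := by exact_mod_cast (Real.exp_pos _).ne'
  have e2 : ((Real.exp (-1 * (Real.exp τ - 1)) : ℝ) : ℂ) ≠ 0 := by
    exact_mod_cast (Real.exp_pos _).ne'
  beta_reduce
  rw [heatTrunc, evalTrunc_C_mul, heatTrunc, Complex.ofReal_mul]
  field_simp

theorem integrable_scaled_spec (hν : 0 < ν) {w₀ v₀ : L2} (hw : Integrable w₀)
    (hv : Integrable v₀) (hτ : 0 < τ) :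
    (Integrable fun κ : ℝ => specW ν (Real.exp τ - 1) (ft w₀ (Real.exp (-(τ / 2)) * κ))
      (ft v₀ (Real.exp (-(τ / 2)) * κ)) (Real.exp (-(τ / 2)) * κ : ℝ)) ∧
    Integrable fun κ : ℝ => specV ν (Real.exp τ - 1) (ft w₀ (Real.exp (-(τ / 2)) * κ))
      (ft v₀ (Real.exp (-(τ / 2)) * κ)) (Real.exp (-(τ / 2)) * κ : ℝ) := by
  obtain ⟨h1, h2⟩ := integrable_spec hν hw hv (sub_pos.2 (Real.one_lt_exp_iff.2 hτ))
  exact ⟨h1.comp_mul_left' (Real.exp_pos (-(τ / 2))).ne',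
    h2.comp_mul_left' (Real.exp_pos (-(τ / 2))).ne'⟩

/-- The approximate solutions built from truncated series with the right Taylor coefficients. -/
theorem IsSolution.approxWithin {w₀ v₀ : L2} {W V : ℝ → L2} (hν : 0 < ν)
    (h : IsSolution ν w₀ v₀ W V) (hN : 0 < N) (hm : (N : ℝ) + 1 / 2 < m)
    (hw : MemL2m m w₀) (hv : MemL2m m v₀) {a₀ c₀ : ℝ⟦X⟧}
    (h₁ : ∀ j ≤ N, coeff j a₀ = coeff j (momentSeries w₀))
    (h₂ : ∀ j ≤ N, coeff j c₀ = coeff j (momentSeries v₀)) {δ : ℝ} (hδ : 0 < δ) {A C : ℝ → ℝ⟦X⟧}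
    (hA : Decay δ fun t => solA ν a₀ c₀ t - A t) (hC : Decay δ fun t => solC ν a₀ c₀ t - C t)
    (hC0 : ∀ t, coeff 0 (C t) = 0) {D M : ℝ} (hD : 0 < D) (hM : 4 * M ≤ N) :
    ∃ τ₀ : ℝ, 0 < τ₀ ∧ ∀ τ : ℝ, τ₀ ≤ τ → ApproxWithin ν m W V (toHermite ν N A)
      (toHermite ν N fun t => shiftSeries (C t)) τ (D * Real.exp (-M * τ)) := by
  obtain ⟨K, -, hK⟩ := exists_approx_bound hν hN hm hw hv h₁ h₂ hδ hA hC
  obtain ⟨τ₀, hτ₀, hlt⟩ := exists_rate_lt (K := K) hD hM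
  refine ⟨max τ₀ 1, by positivity, fun τ hτ => ?_⟩
  have hτ1 : 1 ≤ τ := (le_max_right _ _).trans hτ
  have hτ2 : 2 ≤ Real.exp τ := by linarith [Real.add_one_le_exp τ]
  have hτ0 : 0 < τ := by linarith
  have iw := hw.integrable hm
  have iv := hv.integrable hm
  obtain ⟨e₁, e₂⟩ := h.scaled_eq_syn hν iw iv hτ0
  obtain ⟨i₁, i₂⟩ := integrable_scaled_spec hν iw iv hτ0
  obtain ⟨m₁, m₂, n⟩ := hK τ hτ2
    (fun ξ => scaleHalf W τ ξ - wAppScaled ν (toHermite ν N A) τ ξ)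
    (fun ξ => scaleOne V τ ξ - vAppScaled ν (toHermite ν N fun t => shiftSeries (C t)) τ ξ) (by
      filter_upwards [e₁] with ξ hξ
      rw [syn_sub i₁ (integrable_heatTrunc hν N _ hτ2), ← wAppScaled_eq_syn hν A hτ0, ← hξ,
        Complex.ofReal_sub]) (by
      filter_upwards [e₂] with ξ hξ
      rw [syn_const_mul, syn_sub i₂ (integrable_heatTrunc hν (N + 1) _ hτ2), mul_sub,
        ← syn_const_mul, ← syn_const_mul, ← vAppScaled_eq_syn hν C hτ0 (hC0 _), ← hξ,
        Complex.ofReal_sub])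
  exact ⟨m₁, m₂, n.trans (hlt τ ((le_max_left _ _).trans hτ))⟩

end Assembly
end
end TaylorDispersion

namespace TaylorDispersion
noncomputable section
section Antiderivative

/-! ### The antiderivative of the second component -/

variable {ν t m c B : ℝ} {N : ℕ}

theorem ft_of_freq {f : L2} (hf : Integrable f) {Y : ℝ → ℂ} (hY : Continuous Y)
    (h : ∀ᵐ x, freq f x = Y (2 * Real.pi * x)) (k : ℝ) : ft f k = Y k := by
  have h1 : Continuous fun x : ℝ => ft f (2 * Real.pi * x) := (continuous_ft hf).comp (by fun_prop)
  have h2 : Continuous fun x : ℝ => Y (2 * Real.pi * x) := hY.comp (by fun_prop)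
  have h3 := (Continuous.ae_eq_iff_eq volume h1 h2).1 (by
    filter_upwards [h, freq_eq_ft f hf] with x hx hx'
    rw [← hx, hx'])
  have h4 := congrFun h3 (k / (2 * Real.pi))
  simpa only [mul_div_cancel₀ _ (by positivity : 2 * Real.pi ≠ 0)] using h4

/-- The weak derivative on the Fourier side. -/
theorem IsWeakDeriv.freq_eq {u v : L2} (h : IsWeakDeriv u v) (hu : Integrable u) :
    ∀ᵐ x, freq v x = zf x * ft u (2 * Real.pi * x) := by
  refine ae_eq_of_test ((Lp.memLp (freq v)).locallyIntegrable (by norm_num))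
    (contDiff_zf.continuous.mul ((continuous_ft hu).comp (by fun_prop))).locallyIntegrable
    fun θ hθ => ?_
  have h1 := weak_complex (A := fun _ => v) (B := fun _ => u) (c := 0) (d := -1)
    (fun φ t _ => (hasDerivAt_const t (∫ x, v x * φ x)).congr_deriv (by
      have i1 := real_mul_schwartz_integrable v φ
      have i2 := real_mul_schwartz_integrable u (SchwartzMap.derivCLM ℝ ℝ φ)
      simp only [SchwartzMap.derivCLM_apply] at i2
      simp only [zero_mul, zero_sub, neg_mul, one_mul, neg_neg]
      rw [integral_add i1 i2, h φ, add_neg_cancel])) hθ one_pos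
  have h2 := h1.unique (hasDerivAt_const 1 _)
  simp only [Complex.ofReal_zero, zero_mul, zero_sub, Complex.ofReal_neg, Complex.ofReal_one,
    neg_neg, one_mul] at h2
  have e : ∀ x, freq u x * (-zf x * θ x) = -(freq u x * (zf x * θ x)) := fun x => by ring
  simp only [e] at h2
  rw [integral_neg, add_neg_eq_zero] at h2
  rw [h2]
  refine integral_congr_ae ?_
  filter_upwards [freq_eq_ft u hu] with x hx
  rw [hx]; ring

theorem IsWeakDeriv.ft_eq {u v : L2} (h : IsWeakDeriv u v) (hu : Integrable u)
    (hv : Integrable v) (k : ℝ) : ft v k = Complex.I * k * ft u k :=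
  ft_of_freq hv (Y := fun k => Complex.I * k * ft u k)
    ((by fun_prop : Continuous fun k : ℝ => Complex.I * k).mul (continuous_ft hu)) (by
      filter_upwards [h.freq_eq hu] with x hx
      rw [hx, zf]; push_cast; ring) k

/-- The antiderivative of the second component at the frequency `k`. -/
def specU (ν t : ℝ) (F G k : ℂ) : ℂ :=
  Complex.exp (-(ν * k ^ 2 * t)) * (oscD ν t k * G - oscS ν t k * F)

theorem specV_mul (ν t : ℝ) (F G k : ℂ) :
    specV ν t F (Complex.I * k * G) k = Complex.I * k * specU ν t F G k := by
  rw [specV, specU]; ring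

theorem specU_linear (ν t : ℝ) (F G k : ℂ) :
    specU ν t F G k = specU ν t 1 0 k * F + specU ν t 0 1 k * G := by
  simp only [specU]; ring

theorem stripBound_heat (hν : 0 < ν) (ht : 0 ≤ t) {g : ℂ → ℂ} (hg : Differentiable ℂ g) {A : ℝ}
    (hA : 0 ≤ A) (hle : ∀ k, ‖g k‖ ≤ A * oscBound ν t k) :
    StripBound (ν * t) (A * Real.exp (nuT ν * t))
      (fun k => Complex.exp (-(ν * k ^ 2 * t)) * g k) := by
  refine ⟨by fun_prop, fun k hk => ?_⟩
  have h1 := norm_heat_mul_le hν le_rfl t k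
  simp only [sub_zero, Complex.ofReal_zero, mul_zero, neg_zero, Complex.exp_zero, norm_one,
    mul_one] at h1
  have h2 : k.im ^ 2 ≤ 1 := by rw [← sq_abs]; exact pow_le_one₀ (abs_nonneg _) hk
  rw [norm_mul]
  calc _ ≤ ‖Complex.exp (-(ν * k ^ 2 * t))‖ * (A * oscBound ν t k) :=
        mul_le_mul_of_nonneg_left (hle k) (norm_nonneg _)
    _ = A * (‖Complex.exp (-(ν * k ^ 2 * t))‖ * oscBound ν t k) := by ring
    _ ≤ A * Real.exp (nuT ν * k.im ^ 2 * t - ν * k.re ^ 2 * t) := mul_le_mul_of_nonneg_left h1 hA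
    _ ≤ A * Real.exp (nuT ν * t + -(ν * t) * k.re ^ 2) := by
        refine mul_le_mul_of_nonneg_left (Real.exp_le_exp.2 ?_) hA
        have := mul_le_mul_of_nonneg_left h2 (mul_nonneg (nuT_pos hν).le ht)
        linarith
    _ = _ := by rw [Real.exp_add]; ring

theorem exists_stripBound_spec (hν : 0 < ν) (ht : 0 ≤ t) :
    (∃ B, StripBound (ν * t) B (specW ν t 1 0)) ∧ (∃ B, StripBound (ν * t) B (specW ν t 0 1)) ∧
    (∃ B, StripBound (ν * t) B (specU ν t 1 0)) ∧ ∃ B, StripBound (ν * t) B (specU ν t 0 1) := by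
  have hC := differentiable_oscC ν t
  have hS := differentiable_oscS ν t
  have hD := differentiable_oscD ν t
  have h1 : ∀ k, ‖Complex.I * k * oscS ν t k‖ ≤ 1 * oscBound ν t k := fun k => by
    rw [mul_assoc, norm_mul, Complex.norm_I]
    exact mul_le_mul_of_nonneg_left (norm_oscS_mul_le hν ht).1 zero_le_one
  refine ⟨⟨_, stripBound_heat hν ht (g := fun k => oscC ν t k * 1 - Complex.I * k * oscS ν t k * 0)
      (by fun_prop) zero_le_one fun k => ?_⟩,
    ⟨_, stripBound_heat hν ht (g := fun k => oscC ν t k * 0 - Complex.I * k * oscS ν t k * 1)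
      (by fun_prop) zero_le_one fun k => ?_⟩,
    ⟨_, stripBound_heat hν ht (g := fun k => oscD ν t k * 0 - oscS ν t k * 1)
      (by fun_prop) (one_div_pos.2 hν).le fun k => ?_⟩,
    ⟨_, stripBound_heat hν ht (g := fun k => oscD ν t k * 1 - oscS ν t k * 0)
      (by fun_prop) zero_le_one fun k => ?_⟩⟩
  · simpa using norm_oscC_le hν (k := k) ht
  · simpa using h1 k
  · simpa using norm_oscS_le hν (k := k) ht
  · simpa using (norm_oscS_mul_le hν (k := k) ht).2

theorem StripBound.memL2m_mul_ft (hc : 0 < c) {M : ℂ → ℂ} (h : StripBound c B M)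
    (hm : (N : ℝ) + 1 / 2 < m) {f : ℝ → ℝ} (hf : MemL2m m f) :
    (Integrable fun κ : ℝ => M κ * ft f κ) ∧ MemL2m m fun ξ => ‖syn (fun κ => M κ * ft f κ) ξ‖ := by
  obtain ⟨K, -, hK⟩ := exists_remainder_bound hc hm hf
  obtain ⟨m1, -⟩ := hK B M h 1 one_pos le_rfl
  have i1 := h.integrable_remainder hc (N := N) (hf.integrable hm) (momentSeries f) 1
  have hd : Differentiable ℂ fun κ : ℂ => evalTrunc N (momentSeries f) (Complex.I * κ) :=
    (differentiable_evalTrunc N _).comp (by fun_prop)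
  have hT := h.mul_exp_type hc (a := 1)
    (A := (∑ j ∈ Finset.range (N + 1), |PowerSeries.coeff j (momentSeries f)|) *
      ((N.factorial : ℝ) * Real.exp 1)) zero_le_one (by positivity) hd fun κ _ => by
        refine (norm_evalTrunc_le _ _ _).trans ?_
        rw [mul_assoc]
        refine mul_le_mul_of_nonneg_left ?_ (by positivity)
        have h3 := Real.pow_div_factorial_le_exp (1 + 1 * ‖κ‖) (by positivity) N
        rw [div_le_iff₀ (by positivity), Real.exp_add] at h3
        simp only [norm_mul, Complex.norm_I, one_mul] at h3 ⊢
        linarith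
  have i2 := hT.integrable (half_pos hc)
  have m2 := (hT.memL2m (half_pos hc) m).1
  simp only [one_mul] at i1 m1
  have e : (fun κ : ℝ => M κ * ft f κ) = fun κ : ℝ =>
      M κ * (ft f κ - evalTrunc N (momentSeries f) (Complex.I * κ)) +
        M κ * evalTrunc N (momentSeries f) (Complex.I * κ) := by
    funext κ; ring
  have i : Integrable fun κ : ℝ => M κ * ft f κ := by rw [e]; exact i1.add i2
  refine ⟨i, ((m1.add m2).1.of_abs_le (C := 1) (continuous_syn i).norm.aestronglyMeasurable
    zero_le_one (Eventually.of_forall fun ξ => ?_)).1⟩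
  rw [one_mul]
  refine le_trans ?_ (le_abs_self _)
  rw [abs_norm, e, syn_add i1 i2]
  exact norm_add_le _ _

theorem memL2m_of_syn_mul_ft (hc : 0 < c) {M₁ M₂ : ℂ → ℂ} (h₁ : ∃ B, StripBound c B M₁)
    (h₂ : ∃ B, StripBound c B M₂) (hm : (N : ℝ) + 1 / 2 < m) {f g F : ℝ → ℝ} (hf : MemL2m m f)
    (hg : MemL2m m g)
    (h : ∀ᵐ x, (F x : ℂ) = syn (fun κ => M₁ κ * ft f κ + M₂ κ * ft g κ) x) : MemL2m m F := by
  obtain ⟨B₁, h₁⟩ := h₁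
  obtain ⟨B₂, h₂⟩ := h₂
  obtain ⟨i1, m1⟩ := h₁.memL2m_mul_ft hc hm hf
  obtain ⟨i2, m2⟩ := h₂.memL2m_mul_ft hc hm hg
  have hz : StripBound c 0 (fun _ => 0) := ⟨differentiable_const _, fun κ _ => by simp⟩
  refine (MemL2m.of_syn i1 i2 (hz.integrable hc) ?_ ⟨m1, le_rfl⟩ ⟨m2, le_rfl⟩
    (hz.memL2m hc m)).1
  simpa using h

variable {w₀ v₀ u₀ : L2} {W V : ℝ → L2}

theorem IsSolution.memL2m_w (hν : 0 < ν) (h : IsSolution ν w₀ v₀ W V) (hm : (N : ℝ) + 1 / 2 < m)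
    (hw : MemL2m m w₀) (hv : MemL2m m v₀) (ht : 0 ≤ t) : MemL2m m (W t) := by
  rcases ht.eq_or_lt with rfl | ht
  · rwa [h.initial_w]
  obtain ⟨h1, h2, -, -⟩ := exists_stripBound_spec hν ht.le
  refine memL2m_of_syn_mul_ft (mul_pos hν ht) h1 h2 hm hw hv ?_
  simpa only [← (spec_linear ν t _ _ _).1] using
    (h.eq_syn hν (hw.integrable hm) (hv.integrable hm) ht).1

theorem IsSolution.ft_w (hν : 0 < ν) (h : IsSolution ν w₀ v₀ W V) (hm : (N : ℝ) + 1 / 2 < m)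
    (hw : MemL2m m w₀) (hv : MemL2m m v₀) (ht : 0 < t) (k : ℝ) :
    ft (W t) k = specW ν t (ft w₀ k) (ft v₀ k) k := by
  have iw := hw.integrable hm
  have iv := hv.integrable hm
  have hc := (continuous_spec ν (continuous_ft iw) (continuous_ft iv)).1.comp
    (by fun_prop : Continuous fun k : ℝ => (t, k))
  exact ft_of_freq ((h.memL2m_w hν hm hw hv ht.le).integrable hm) hc (h.freq_eq hν iw iv ht).1 k

/-- The second component has an antiderivative in the weighted space. -/
theorem IsSolution.exists_antiderivative (hν : 0 < ν) (h : IsSolution ν w₀ v₀ W V)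
    (hm : (N : ℝ) + 1 / 2 < m) (hw : MemL2m m w₀) (hv : MemL2m m v₀) (hu : MemL2m m u₀)
    (huv : IsWeakDeriv u₀ v₀) (ht : 0 < t) : ∃ u : L2, MemL2m m u ∧ IsWeakDeriv u (V t) := by
  have iw := hw.integrable hm
  have iv := hv.integrable hm
  have iu := hu.integrable hm
  obtain ⟨-, -, h1, h2⟩ := exists_stripBound_spec hν ht.le
  obtain ⟨Y, hY⟩ : ∃ Y : ℝ → ℂ, Y = fun κ => specU ν t (ft w₀ κ) (ft u₀ κ) κ := ⟨_, rfl⟩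
  have hYl : Y = fun κ : ℝ => specU ν t 1 0 κ * ft w₀ κ + specU ν t 0 1 κ * ft u₀ κ := by
    rw [hY]; funext κ; rw [← specU_linear]
  have hYi : Integrable Y := by
    rw [hYl]
    obtain ⟨B₁, h1⟩ := h1
    obtain ⟨B₂, h2⟩ := h2
    exact (h1.memL2m_mul_ft (mul_pos hν ht) hm hw).1.add
      (h2.memL2m_mul_ft (mul_pos hν ht) hm hu).1
  have hYV : ∀ κ : ℝ, Complex.I * κ * Y κ = specV ν t (ft w₀ κ) (ft v₀ κ) κ := fun κ => by
    rw [hY, huv.ft_eq iu iv, specV_mul]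
  have hVi := (integrable_spec hν iw iv ht).2
  have hYi' : Integrable fun κ : ℝ => κ * Y κ := by
    refine (hVi.const_mul (-Complex.I)).congr (Eventually.of_forall fun κ => ?_)
    beta_reduce
    rw [← hYV]
    linear_combination (-(κ : ℂ) * Y κ) * Complex.I_sq
  have hd : ∀ x, HasDerivAt (fun x => (syn Y x).re)
      (syn (fun κ => Complex.I * κ * Y κ) x).re x := fun x =>
    Complex.reCLM.hasFDerivAt.comp_hasDerivAt x (hasDerivAt_syn hYi hYi' x)
  have hmem : MemL2m m fun x => (syn Y x).re := by
    have hs : MemL2m m fun ξ => ‖syn Y ξ‖ := by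
      obtain ⟨B₁, h1⟩ := h1
      obtain ⟨B₂, h2⟩ := h2
      obtain ⟨i1, m1⟩ := h1.memL2m_mul_ft (mul_pos hν ht) hm hw
      obtain ⟨i2, m2⟩ := h2.memL2m_mul_ft (mul_pos hν ht) hm hu
      refine ((m1.add m2).1.of_abs_le (C := 1) (continuous_syn hYi).norm.aestronglyMeasurable
        zero_le_one (Eventually.of_forall fun ξ => ?_)).1
      rw [one_mul]
      refine le_trans ?_ (le_abs_self _)
      rw [abs_norm, hYl, syn_add i1 i2]
      exact norm_add_le _ _
    refine (hs.of_abs_le (C := 1)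
      (Complex.continuous_re.comp (continuous_syn hYi)).aestronglyMeasurable zero_le_one
      (Eventually.of_forall fun ξ => ?_)).1
    rw [one_mul, abs_norm]
    exact Complex.abs_re_le_norm _
  have hcoe := hmem.1.coeFn_toLp
  refine ⟨hmem.1.toLp _, ⟨Lp.memLp _, hmem.2.congr ?_⟩, fun φ => ?_⟩
  · filter_upwards [hcoe] with x hx
    rw [hx]
  · have hV : ∀ᵐ x, V t x = (syn (fun κ => Complex.I * κ * Y κ) x).re := by
      filter_upwards [(h.eq_syn hν iw iv ht).2] with x hx
      simp only [hYV, ← hx, Complex.ofReal_re]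
    have e1 : ∀ ψ : ℝ → ℝ, (fun x => hmem.1.toLp _ x * ψ x) =ᵐ[volume]
        (fun x => (syn Y x).re) * ψ := fun ψ => by
      filter_upwards [hcoe] with x hx
      rw [hx, Pi.mul_apply]
    have e2 : (fun x => V t x * φ x) =ᵐ[volume]
        (fun x => (syn (fun κ => Complex.I * κ * Y κ) x).re) * φ := by
      filter_upwards [hV] with x hx
      rw [hx, Pi.mul_apply]
    have j1 := real_mul_schwartz_integrable (hmem.1.toLp _) φ
    have j2 := real_mul_schwartz_integrable (hmem.1.toLp _) (SchwartzMap.derivCLM ℝ ℝ φ)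
    have j3 := real_mul_schwartz_integrable (V t) φ
    simp only [SchwartzMap.derivCLM_apply] at j2
    rw [integral_congr_ae (e1 _), integral_congr_ae e2]
    exact integral_mul_deriv_eq_deriv_mul_of_integrable (fun x _ => hd x)
      (fun x _ => φ.differentiableAt.hasDerivAt) (j2.congr (e1 _)) (j3.congr e2) (j1.congr (e1 _))

/-- The Fourier transform of the antiderivative. -/
theorem IsSolution.ft_u (hν : 0 < ν) (h : IsSolution ν w₀ v₀ W V) (hm : (N : ℝ) + 1 / 2 < m)
    (hw : MemL2m m w₀) (hv : MemL2m m v₀) (hu : MemL2m m u₀) (huv : IsWeakDeriv u₀ v₀)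
    (ht : 0 < t) {u : L2} (hum : MemL2m m u) (hud : IsWeakDeriv u (V t)) {k : ℝ} (hk : k ≠ 0) :
    ft u k = specU ν t (ft w₀ k) (ft u₀ k) k := by
  have iw := hw.integrable hm
  have iv := hv.integrable hm
  have iu := hum.integrable hm
  have c1 := (continuous_spec ν (continuous_ft iw) (continuous_ft iv)).2.comp
    (by fun_prop : Continuous fun x : ℝ => (t, 2 * Real.pi * x))
  have c2 : Continuous fun x : ℝ => zf x * ft u (2 * Real.pi * x) :=
    contDiff_zf.continuous.mul ((continuous_ft iu).comp (by fun_prop))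
  have h3 := (Continuous.ae_eq_iff_eq volume c1 c2).1 (by
    filter_upwards [(h.freq_eq hν iw iv ht).2, hud.freq_eq iu] with x hx hx'
    rw [← hx', hx]; rfl)
  have h4 := congrFun h3 (k / (2 * Real.pi))
  simp only [Function.comp_apply, zf] at h4
  have e : (2 * Real.pi * Complex.I * (k / (2 * Real.pi) : ℝ) : ℂ) = Complex.I * k := by
    have : (Real.pi : ℂ) ≠ 0 := by exact_mod_cast Real.pi_ne_zero
    push_cast
    field_simp
  rw [e, mul_div_cancel₀ _ (by positivity : 2 * Real.pi ≠ 0),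
    huv.ft_eq (hu.integrable hm) iv, specV_mul] at h4
  exact (mul_left_cancel₀ (mul_ne_zero Complex.I_ne_zero (by exact_mod_cast hk)) h4).symm

end Antiderivative
end
end TaylorDispersion

namespace TaylorDispersion
noncomputable section
section Taylor
open PowerSeries

/-! ### Taylor expansions at the frequency zero -/

/-- The series `G` is the expansion of `F` in powers of `ik` up to an error `o(k^N)`. -/
def TaylorAt (N : ℕ) (F : ℝ → ℂ) (G : ℝ⟦X⟧) : Prop :=
  Tendsto (fun k : ℝ => (F k - evalTrunc N G (Complex.I * k)) / (k : ℂ) ^ N) (𝓝[≠] 0) (𝓝 0)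

variable {N : ℕ} {F F' : ℝ → ℂ} {G G' : ℝ⟦X⟧} {m : ℝ} {f : ℝ → ℝ}

theorem tendsto_nhdsNE_of_continuous {Φ : ℝ → ℂ} (h : Continuous Φ) :
    Tendsto Φ (𝓝[≠] 0) (𝓝 (Φ 0)) := (h.tendsto 0).mono_left nhdsWithin_le_nhds

theorem eventually_ne_zero : ∀ᶠ k : ℝ in 𝓝[≠] 0, (k : ℂ) ≠ 0 := by
  filter_upwards [self_mem_nhdsWithin] with k hk
  exact_mod_cast hk

theorem continuous_evalTrunc (N : ℕ) (G : ℝ⟦X⟧) :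
    Continuous fun k : ℝ => evalTrunc N G (Complex.I * k) :=
  (differentiable_evalTrunc N G).continuous.comp (by fun_prop)

theorem TaylorAt.congr (h : TaylorAt N F G) (e : ∀ k : ℝ, k ≠ 0 → F k = F' k) :
    TaylorAt N F' G := by
  refine Tendsto.congr' ?_ h
  filter_upwards [self_mem_nhdsWithin] with k hk
  rw [e k hk]

theorem taylorAt_evalTrunc (N : ℕ) (G : ℝ⟦X⟧) :
    TaylorAt N (fun k => evalTrunc N G (Complex.I * k)) G := by
  simp [TaylorAt]

theorem TaylorAt.tendsto (h : TaylorAt N F G) :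
    Tendsto F (𝓝[≠] 0) (𝓝 (evalTrunc N G 0)) := by
  have h1 := (h.mul (tendsto_nhdsNE_of_continuous
    (by fun_prop : Continuous fun k : ℝ => (k : ℂ) ^ N))).add
      (tendsto_nhdsNE_of_continuous (continuous_evalTrunc N G))
  simp only [zero_mul, zero_add, Complex.ofReal_zero, mul_zero] at h1
  refine h1.congr' ?_
  filter_upwards [eventually_ne_zero] with k hk
  rw [div_mul_cancel₀ _ (pow_ne_zero N hk), sub_add_cancel]

theorem coeff_eq_zero_of_tendsto (N : ℕ) : ∀ G : ℝ⟦X⟧,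
    Tendsto (fun k : ℝ => evalTrunc N G (Complex.I * k) / (k : ℂ) ^ N) (𝓝[≠] 0) (𝓝 0) →
    ∀ j ≤ N, coeff j G = 0 := by
  have hz : ∀ N (G : ℝ⟦X⟧),
      Tendsto (fun k : ℝ => evalTrunc N G (Complex.I * k) / (k : ℂ) ^ N) (𝓝[≠] 0) (𝓝 0) →
      coeff 0 G = 0 := fun N G h => by
    have h1 : TaylorAt N (fun _ => 0) G := by
      have := h.neg
      rw [neg_zero] at this
      refine this.congr fun k => ?_
      rw [zero_sub, neg_div]
    have h2 := tendsto_nhds_unique h1.tendsto tendsto_const_nhds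
    rw [evalTrunc, Finset.sum_range_succ'] at h2
    simpa using h2
  induction N with
  | zero =>
    intro G h j hj
    rw [Nat.le_zero.1 hj]
    exact hz 0 G h
  | succ N ih =>
    intro G h j hj
    have h0 := hz _ G h
    cases j with
    | zero => exact h0
    | succ j =>
      have h1 : Tendsto (fun k : ℝ => evalTrunc N (shiftSeries G) (Complex.I * k) / (k : ℂ) ^ N)
          (𝓝[≠] 0) (𝓝 0) := by
        have h2 := h.const_mul (-Complex.I)
        rw [mul_zero] at h2
        refine h2.congr' ?_
        filter_upwards [eventually_ne_zero] with k hk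
        conv_lhs => rw [← X_mul_shiftSeries h0]
        rw [evalTrunc_succ_X_mul, pow_succ]
        field_simp
        linear_combination (-evalTrunc N (shiftSeries G) (Complex.I * k)) * Complex.I_sq
      have h3 := ih _ h1 j (by omega)
      rwa [shiftSeries, coeff_mk] at h3

theorem TaylorAt.unique (h : TaylorAt N F G) (h' : TaylorAt N F G') {j : ℕ} (hj : j ≤ N) :
    coeff j G = coeff j G' := by
  have h1 := h'.sub h
  rw [sub_zero] at h1
  have h2 := coeff_eq_zero_of_tendsto N (G - G') (h1.congr fun k => by
    rw [evalTrunc_sub, ← sub_div]; ring) j hj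
  rwa [map_sub, sub_eq_zero] at h2

theorem exists_evalTrunc_mul (N : ℕ) (G G' : ℝ⟦X⟧) : ∃ Q : ℂ → ℂ, Continuous Q ∧ ∀ z : ℂ,
    evalTrunc N G z * evalTrunc N G' z - evalTrunc N (G * G') z = z ^ (N + 1) * Q z := by
  have e : ∀ (F : ℝ⟦X⟧) (z : ℂ), evalTrunc N F z =
      (trunc (N + 1) F).eval₂ Complex.ofRealHom z := fun F z => by
    rw [eval₂_trunc_eq_sum_range]; rfl
  obtain ⟨Q, hQ⟩ : Polynomial.X ^ (N + 1) ∣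
      trunc (N + 1) G * trunc (N + 1) G' - trunc (N + 1) (G * G') := by
    rw [Polynomial.X_pow_dvd_iff]
    intro d hd
    rw [Polynomial.coeff_sub, coeff_trunc, if_pos hd, coeff_mul_eq_coeff_trunc_mul_trunc _ _ hd,
      ← Polynomial.coe_mul, Polynomial.coeff_coe, sub_self]
  refine ⟨fun z => Q.eval₂ Complex.ofRealHom z, ?_, fun z => ?_⟩
  · simp only [← Polynomial.eval_map]
    exact Polynomial.continuous _
  · have := congrArg (fun P : Polynomial ℝ => P.eval₂ Complex.ofRealHom z) hQ
    simpa only [Polynomial.eval₂_sub, Polynomial.eval₂_mul, Polynomial.eval₂_pow,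
      Polynomial.eval₂_X, ← e] using this

theorem TaylorAt.mul (h : TaylorAt N F G) (h' : TaylorAt N F' G') :
    TaylorAt N (fun k => F k * F' k) (G * G') := by
  obtain ⟨Q, hQ, hQe⟩ := exists_evalTrunc_mul N G G'
  have h1 := ((Tendsto.mul h h'.tendsto).add (Tendsto.mul (tendsto_nhdsNE_of_continuous
    (continuous_evalTrunc N G)) h')).add (tendsto_nhdsNE_of_continuous
    (by fun_prop : Continuous fun k : ℝ => Complex.I ^ (N + 1) * k * Q (Complex.I * k)))
  simp only [zero_mul, mul_zero, Complex.ofReal_zero, add_zero] at h1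
  refine h1.congr' ?_
  filter_upwards [eventually_ne_zero] with k hk
  have e : Complex.I ^ (N + 1) * k * Q (Complex.I * k) =
      (Complex.I * k) ^ (N + 1) * Q (Complex.I * k) / (k : ℂ) ^ N := by
    rw [mul_pow, pow_succ (k : ℂ)]
    field_simp
  rw [e, ← hQe]
  ring

/-- The remainder of the exponential series near zero. -/
theorem norm_expTail_le {w : ℂ} (hw : ‖w‖ ≤ 1) (N : ℕ) : ‖expTail N w‖ ≤ 2 * ‖w‖ ^ (N + 1) := by
  refine (Complex.exp_bound hw N.succ_pos).trans ?_
  rw [mul_comm 2]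
  refine mul_le_mul_of_nonneg_left ?_ (by positivity)
  rw [mul_inv_le_iff₀ (by positivity)]
  have h1 : (1 : ℝ) ≤ (N + 1).factorial := by exact_mod_cast Nat.one_le_iff_ne_zero.2 (Nat.factorial_ne_zero _)
  have h2 : (0 : ℝ) ≤ N := Nat.cast_nonneg N
  push_cast
  nlinarith

theorem norm_expTail_imag_le {w : ℂ} (hw : w.re = 0) (N : ℕ) :
    ‖expTail N w‖ ≤ (N + 2) * ‖w‖ ^ N := by
  rcases le_total ‖w‖ 1 with h | h
  · refine (norm_expTail_le h N).trans ?_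
    rw [pow_succ, ← mul_assoc]
    have h1 : (0 : ℝ) ≤ N := Nat.cast_nonneg N
    have h2 := pow_nonneg (norm_nonneg w) N
    have h3 := mul_le_mul_of_nonneg_left h (by positivity : 0 ≤ 2 * ‖w‖ ^ N)
    nlinarith
  · have h1 : ‖Complex.exp w‖ = 1 := by rw [Complex.norm_exp, hw, Real.exp_zero]
    have h2 : ‖∑ j ∈ Finset.range (N + 1), w ^ j / (j.factorial : ℂ)‖ ≤
        ∑ j ∈ Finset.range (N + 1), ‖w‖ ^ N := by
      refine (norm_sum_le _ _).trans (Finset.sum_le_sum fun j hj => ?_)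
      rw [norm_div, norm_pow, Complex.norm_natCast]
      refine (div_le_self (by positivity) ?_).trans
        (pow_le_pow_right₀ h (Finset.mem_range_succ_iff.1 hj))
      exact_mod_cast Nat.one_le_iff_ne_zero.2 (Nat.factorial_ne_zero _)
    rw [Finset.sum_const, Finset.card_range, nsmul_eq_mul] at h2
    push_cast at h2
    have h3 : 1 ≤ ‖w‖ ^ N := one_le_pow₀ h
    calc _ ≤ ‖Complex.exp w‖ + ‖∑ j ∈ Finset.range (N + 1), w ^ j / (j.factorial : ℂ)‖ :=
          norm_sub_le _ _
      _ ≤ _ := by rw [h1]; linarith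

/-- The Taylor expansion of the Fourier transform. -/
theorem taylorAt_ft (hm : (N : ℝ) + 1 / 2 < m) (hf : MemL2m m f) :
    TaylorAt N (ft f) (momentSeries f) := by
  have e : ∀ k : ℝ, (ft f k - evalTrunc N (momentSeries f) (Complex.I * k)) / (k : ℂ) ^ N =
      ∫ x : ℝ, expTail N (-(Complex.I * k * x)) * f x / (k : ℂ) ^ N := fun k => by
    rw [ft_sub_evalTrunc hm hf, integral_div]
  rw [TaylorAt]
  simp only [e]
  have hn : ∀ k x : ℝ, ‖-(Complex.I * k * x)‖ = |k| * |x| := fun k x => by simp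
  have h0 : (0 : ℂ) = ∫ x : ℝ, (0 : ℂ) := by simp
  rw [h0]
  refine tendsto_integral_filter_of_dominated_convergence
    (fun x => (N + 2) * |x ^ N * f x|) (Eventually.of_forall fun k => ?_) ?_
    ((hf.integrable_pow_mul hm le_rfl).abs.const_mul _) (Eventually.of_forall fun x => ?_)
  · exact (((continuous_expTail N).comp (by fun_prop)).aestronglyMeasurable.mul
      (Complex.continuous_ofReal.comp_aestronglyMeasurable hf.1.1)).mul_const _
  · filter_upwards [self_mem_nhdsWithin] with k hk
    refine Eventually.of_forall fun x => ?_
    have hk0 : 0 < |k| := abs_pos.2 hk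
    rw [norm_div, norm_mul, norm_pow, Complex.norm_real, Complex.norm_real, Real.norm_eq_abs,
      Real.norm_eq_abs, div_le_iff₀ (by positivity)]
    have h1 := norm_expTail_imag_le (w := -(Complex.I * k * x)) (by simp) N
    rw [hn, mul_pow] at h1
    rw [abs_mul, abs_pow]
    calc _ ≤ (N + 2) * (|k| ^ N * |x| ^ N) * |f x| :=
          mul_le_mul_of_nonneg_right h1 (abs_nonneg _)
      _ = _ := by ring
  · have h1 : Tendsto (fun k : ℝ => 2 * (|k| * |x| ^ (N + 1)) * |f x|) (𝓝[≠] 0) (𝓝 0) := by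
      have : Continuous fun k : ℝ => 2 * (|k| * |x| ^ (N + 1)) * |f x| := by fun_prop
      simpa using (this.tendsto 0).mono_left nhdsWithin_le_nhds
    refine squeeze_zero_norm' ?_ h1
    have h2 : ∀ᶠ k : ℝ in 𝓝[≠] 0, |k| * |x| < 1 := by
      have : Continuous fun k : ℝ => |k| * |x| := by fun_prop
      exact ((this.tendsto 0).mono_left nhdsWithin_le_nhds).eventually_lt_const (by simp)
    filter_upwards [h2, self_mem_nhdsWithin] with k hk hk'
    have hk0 : 0 < |k| := abs_pos.2 hk'
    have h3 := norm_expTail_le (w := -(Complex.I * k * x)) (by rw [hn]; exact hk.le) N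
    rw [hn, mul_pow] at h3
    rw [norm_div, norm_mul, norm_pow, Complex.norm_real, Complex.norm_real, Real.norm_eq_abs,
      Real.norm_eq_abs, div_le_iff₀ (by positivity)]
    calc _ ≤ 2 * (|k| ^ (N + 1) * |x| ^ (N + 1)) * |f x| :=
          mul_le_mul_of_nonneg_right h3 (abs_nonneg _)
      _ = _ := by ring

theorem evalTrunc_gaussSeries (c : ℝ) (n : ℕ) (z : ℂ) :
    evalTrunc (2 * n) (gaussSeries c) z =
      ∑ i ∈ Finset.range (n + 1), (c * z ^ 2) ^ i / (i.factorial : ℂ) ∧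
    evalTrunc (2 * n + 1) (gaussSeries c) z =
      ∑ i ∈ Finset.range (n + 1), (c * z ^ 2) ^ i / (i.factorial : ℂ) := by
  have ho : ∀ n, coeff (2 * n + 1) (gaussSeries c) = 0 := fun n => by
    rw [coeff_gaussSeries, if_neg (by omega)]
  have hs : ∀ n, evalTrunc (2 * n + 1) (gaussSeries c) z = evalTrunc (2 * n) (gaussSeries c) z :=
    fun n => by rw [evalTrunc_succ, ho]; simp
  rw [hs, and_self]
  induction n with
  | zero => simp [evalTrunc, coeff_gaussSeries]
  | succ n ih =>
    rw [show 2 * (n + 1) = 2 * n + 1 + 1 by ring, evalTrunc_succ, hs, ih,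
      Finset.sum_range_succ _ (n + 1), coeff_gaussSeries, if_pos (by omega),
      show (2 * n + 1 + 1) / 2 = n + 1 by omega]
    push_cast
    rw [mul_pow, ← pow_mul, show 2 * (n + 1) = 2 * n + 1 + 1 by ring]
    ring

theorem taylorAt_gauss (c : ℝ) (N : ℕ) :
    TaylorAt N (fun k => Complex.exp (-(c * k ^ 2))) (gaussSeries c) := by
  obtain ⟨n, hn, e⟩ : ∃ n : ℕ, N + 1 ≤ 2 * (n + 1) ∧ ∀ z, evalTrunc N (gaussSeries c) z =
      ∑ i ∈ Finset.range (n + 1), (c * z ^ 2) ^ i / (i.factorial : ℂ) := by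
    rcases Nat.even_or_odd' N with ⟨n, rfl | rfl⟩
    · exact ⟨n, by omega, fun z => (evalTrunc_gaussSeries c n z).1⟩
    · exact ⟨n, by omega, fun z => (evalTrunc_gaussSeries c n z).2⟩
  obtain ⟨p, hp⟩ : ∃ p, 2 * (n + 1) = N + 1 + p := ⟨_, (Nat.add_sub_cancel' hn).symm⟩
  have h1 : Tendsto (fun k : ℝ => 2 * (|c| ^ (n + 1) * |k| ^ (p + 1))) (𝓝[≠] 0) (𝓝 0) := by
    have : Continuous fun k : ℝ => 2 * (|c| ^ (n + 1) * |k| ^ (p + 1)) := by fun_prop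
    simpa using (this.tendsto 0).mono_left nhdsWithin_le_nhds
  have h2 : ∀ᶠ k : ℝ in 𝓝[≠] 0, |c| * |k| ^ 2 < 1 := by
    have : Continuous fun k : ℝ => |c| * |k| ^ 2 := by fun_prop
    exact ((this.tendsto 0).mono_left nhdsWithin_le_nhds).eventually_lt_const (by simp)
  refine squeeze_zero_norm' ?_ h1
  filter_upwards [h2, self_mem_nhdsWithin] with k hk hk'
  have hk0 : 0 < |k| := abs_pos.2 hk'
  have e1 : (c : ℂ) * (Complex.I * k) ^ 2 = -(c * k ^ 2) := by
    rw [mul_pow, Complex.I_sq]; ring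
  have e2 : ‖(-(c * k ^ 2) : ℂ)‖ = |c| * |k| ^ 2 := by simp
  have h3 := norm_expTail_le (w := -(c * k ^ 2)) (by rw [e2]; exact hk.le) n
  rw [e2, mul_pow, ← pow_mul, hp] at h3
  rw [e, e1, norm_div, norm_pow, Complex.norm_real, Real.norm_eq_abs,
    div_le_iff₀ (by positivity)]
  refine h3.trans (le_of_eq ?_)
  ring

theorem taylorAt_heatTrunc (ν t : ℝ) (N : ℕ) (A : ℝ⟦X⟧) :
    TaylorAt N (fun k => heatTrunc ν t N A k) (gaussSeries (nuT ν * t) * A) := by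
  refine ((taylorAt_gauss (nuT ν * t) N).mul (taylorAt_evalTrunc N A)).congr fun k _ => ?_
  rw [heatTrunc]
  push_cast
  congr 2
  ring

theorem TaylorAt.of_sub (h : TaylorAt N F G)
    (hd : Tendsto (fun k : ℝ => (F' k - F k) / (k : ℂ) ^ N) (𝓝[≠] 0) (𝓝 0)) : TaylorAt N F' G := by
  have := hd.add h
  rw [add_zero] at this
  refine this.congr fun k => ?_
  rw [← add_div, sub_add_sub_cancel]

variable {ν t : ℝ} {w₀ v₀ u₀ : L2} {W V : ℝ → L2}

theorem tendsto_err (hν : 0 < ν) (ht : 0 ≤ t) (a₀ c₀ : ℝ⟦X⟧) (N : ℕ) :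
    Tendsto (fun k : ℝ => errW ν a₀ c₀ N t k / (k : ℂ) ^ N) (𝓝[≠] 0) (𝓝 0) ∧
    Tendsto (fun k : ℝ => errV ν a₀ c₀ N t k / (k : ℂ) ^ (N + 1)) (𝓝[≠] 0) (𝓝 0) := by
  obtain ⟨K, hK, h⟩ := exists_err_bound a₀ c₀ hν N
  obtain ⟨q, hq⟩ : ∃ q : ℝ, q = (1 + t) ^ (((N : ℝ) + 1) / 4) := ⟨_, rfl⟩
  obtain ⟨Φ, hΦ⟩ : ∃ Φ : ℝ → ℝ, Φ = fun k => K * (Real.exp (-(ν * k ^ 2 * t)) * q *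
    (1 + |k| * √(1 + t)) ^ 4) := ⟨_, rfl⟩
  have h1 : Tendsto (fun k : ℝ => |k| * Φ k) (𝓝[≠] 0) (𝓝 0) := by
    have : Continuous fun k : ℝ => |k| * Φ k := by rw [hΦ]; fun_prop
    simpa using (this.tendsto 0).mono_left nhdsWithin_le_nhds
  have h2 := fun k : ℝ => h t ht (k : ℂ)
  simp only [Complex.ofReal_im, Complex.ofReal_re, Complex.norm_real, Real.norm_eq_abs, ← hq]
    at h2
  have e : ∀ k : ℝ, nuT ν * 0 ^ 2 * t - ν * k ^ 2 * t = -(ν * k ^ 2 * t) := fun k => by ring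
  simp only [e] at h2
  constructor
  · refine squeeze_zero_norm' ?_ h1
    filter_upwards [self_mem_nhdsWithin] with k hk
    have hk0 : 0 < |k| := abs_pos.2 hk
    rw [norm_div, norm_pow, Complex.norm_real, Real.norm_eq_abs, div_le_iff₀ (by positivity)]
    refine (h2 k).1.trans (le_of_eq ?_)
    rw [hΦ]; ring
  · refine squeeze_zero_norm' ?_ h1
    filter_upwards [self_mem_nhdsWithin] with k hk
    have hk0 : 0 < |k| := abs_pos.2 hk
    rw [norm_div, norm_pow, Complex.norm_real, Real.norm_eq_abs, div_le_iff₀ (by positivity)]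
    refine (h2 k).2.trans (le_of_eq ?_)
    rw [hΦ]; ring

/-- The moments of the second datum. -/
theorem IsWeakDeriv.coeff_momentSeries (h : IsWeakDeriv u₀ v₀) (hm : (N : ℝ) + 1 / 2 < m)
    (hu : MemL2m m u₀) (hv : MemL2m m v₀) {j : ℕ} (hj : j ≤ N) :
    coeff j (X * momentSeries u₀) = coeff j (momentSeries v₀) := by
  have h1 : TaylorAt N (fun k : ℝ => Complex.I * k) X := by
    cases N with
    | zero =>
      rw [TaylorAt]
      have : Continuous fun k : ℝ => Complex.I * (k : ℂ) := by fun_prop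
      simpa [evalTrunc] using tendsto_nhdsNE_of_continuous this
    | succ N =>
      refine (taylorAt_evalTrunc (N + 1) X).congr fun k _ => ?_
      have := evalTrunc_succ_X_mul N 1 (Complex.I * k)
      rw [mul_one] at this
      rw [this, evalTrunc, Finset.sum_range_succ']
      simp [coeff_one]
  exact ((h1.mul (taylorAt_ft hm hu)).congr fun k _ =>
    (h.ft_eq (hu.integrable hm) (hv.integrable hm) k).symm).unique (taylorAt_ft hm hv) hj

theorem IsSolution.coeff_momentSeries_w (hν : 0 < ν) (h : IsSolution ν w₀ v₀ W V)
    (hm : (N : ℝ) + 1 / 2 < m) (hw : MemL2m m w₀) (hv : MemL2m m v₀) (hu : MemL2m m u₀)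
    (huv : IsWeakDeriv u₀ v₀) (ht : 0 ≤ t) {j : ℕ} (hj : j ≤ N) :
    coeff j (momentSeries (W t)) = coeff j (gaussSeries (nuT ν * t) *
      solA ν (momentSeries w₀) (X * momentSeries u₀) t) := by
  rcases ht.eq_or_lt with rfl | ht
  · rw [h.initial_w, mul_zero, gaussSeries_zero, one_mul, solA_zero]
  refine (taylorAt_ft hm (h.memL2m_w hν hm hw hv ht.le)).unique
    ((taylorAt_heatTrunc ν t N _).of_sub ?_) hj
  obtain ⟨⟨_, h1⟩, ⟨_, h2⟩, -, -⟩ := exists_stripBound_spec hν ht.le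
  have h3 := ((Tendsto.mul (tendsto_nhdsNE_of_continuous h1.continuous) (taylorAt_ft hm hw)).add
    (Tendsto.mul (tendsto_nhdsNE_of_continuous (Φ := fun k => specW ν t 0 1 k * (Complex.I * k))
      (h2.continuous.mul (by fun_prop))) (taylorAt_ft hm hu))).add
    (tendsto_err hν ht.le (momentSeries w₀) (X * momentSeries u₀) N).1
  simp only [mul_zero, add_zero] at h3
  refine h3.congr fun k => ?_
  rw [h.ft_w hν hm hw hv ht, huv.ft_eq (hu.integrable hm) (hv.integrable hm), errW,
    evalTrunc_succ_X_mul, (spec_linear ν t (ft w₀ k) _ k).1,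
    (spec_linear ν t (evalTrunc _ _ _) _ k).1]
  ring

theorem IsSolution.coeff_momentSeries_u (hν : 0 < ν) (h : IsSolution ν w₀ v₀ W V)
    (hm : (N : ℝ) + 1 / 2 < m) (hw : MemL2m m w₀) (hv : MemL2m m v₀) (hu : MemL2m m u₀)
    (huv : IsWeakDeriv u₀ v₀) (ht : 0 < t) {u : L2} (hum : MemL2m m u)
    (hud : IsWeakDeriv u (V t)) {j : ℕ} (hj : j ≤ N) :
    coeff j (momentSeries u) = coeff j (gaussSeries (nuT ν * t) *
      shiftSeries (solC ν (momentSeries w₀) (X * momentSeries u₀) t)) := by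
  refine (taylorAt_ft hm hum).unique ((taylorAt_heatTrunc ν t N _).of_sub ?_) hj
  obtain ⟨-, -, ⟨_, h1⟩, ⟨_, h2⟩⟩ := exists_stripBound_spec hν ht.le
  have h3 := ((Tendsto.mul (tendsto_nhdsNE_of_continuous h1.continuous) (taylorAt_ft hm hw)).add
    (Tendsto.mul (tendsto_nhdsNE_of_continuous h2.continuous) (taylorAt_ft hm hu))).add
    ((tendsto_err hν ht.le (momentSeries w₀) (X * momentSeries u₀) N).2.const_mul (-Complex.I))
  simp only [mul_zero, add_zero] at h3
  refine h3.congr' ?_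
  filter_upwards [self_mem_nhdsWithin] with k hk
  have hk0 : (k : ℂ) ≠ 0 := by exact_mod_cast hk
  obtain ⟨S, hS⟩ : ∃ S, S = shiftSeries (solC ν (momentSeries w₀) (X * momentSeries u₀) t) :=
    ⟨_, rfl⟩
  have hXS : solC ν (momentSeries w₀) (X * momentSeries u₀) t = X * S := by
    rw [hS, X_mul_shiftSeries (coeff_zero_solC (by simp) t)]
  have e : errV ν (momentSeries w₀) (X * momentSeries u₀) N t k = Complex.I * k *
      (specU ν t (evalTrunc N (momentSeries w₀) (Complex.I * k))
        (evalTrunc N (momentSeries u₀) (Complex.I * k)) k - heatTrunc ν t N S k) := by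
    rw [errV, hXS, heatTrunc, evalTrunc_succ_X_mul, evalTrunc_succ_X_mul, specV_mul, heatTrunc]
    ring
  rw [h.ft_u hν hm hw hv hu huv ht hum hud hk, ← hS, e, specU_linear ν t (ft w₀ k),
    specU_linear ν t (evalTrunc _ _ _)]
  field_simp
  ring_nf
  simp only [Complex.I_sq]
  ring

end Taylor
end
end TaylorDispersion

namespace TaylorDispersion
noncomputable section
section HermiteCoefficients
open PowerSeries

/-! ### Hermite coefficients of the solution -/

variable {ν τ m : ℝ} {N : ℕ}

theorem MemL2m.dilate {f : ℝ → ℝ} (hm : 0 ≤ m) (hf : MemL2m m f) {a : ℝ} (ha : 1 ≤ a) :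
    MemL2m m fun ξ => a * f (a * ξ) := by
  have ha0 : a ≠ 0 := by positivity
  have h1 : AEStronglyMeasurable (fun ξ => a * f (a * ξ)) volume :=
    (hf.1.1.comp_quasiMeasurePreserving
      ⟨by fun_prop, by
        rw [Real.map_volume_mul_left ha0]
        exact Measure.smul_absolutelyContinuous⟩).const_mul a
  refine MemL2m.of_integrable hm h1 (((hf.2.comp_mul_left' ha0).const_mul (a ^ 2)).mono'
    (((measurable_const.add (measurable_id.pow_const 2)).pow_const m).aestronglyMeasurable.mul
      (h1.pow 2)) (Eventually.of_forall fun ξ => ?_))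
  rw [Real.norm_of_nonneg (by positivity), mul_pow]
  have h2 : (1 + ξ ^ 2) ^ m ≤ (1 + (a * ξ) ^ 2) ^ m := by
    refine Real.rpow_le_rpow (by positivity) ?_ hm
    rw [mul_pow]
    nlinarith [mul_le_mul_of_nonneg_right (one_le_pow₀ ha (n := 2)) (sq_nonneg ξ)]
  calc _ ≤ (1 + (a * ξ) ^ 2) ^ m * (a ^ 2 * f (a * ξ) ^ 2) :=
        mul_le_mul_of_nonneg_right h2 (by positivity)
    _ = _ := by ring

theorem momentSeries_dilate (f : ℝ → ℝ) {a : ℝ} (ha : 0 < a) :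
    momentSeries (fun ξ => a * f (a * ξ)) = rescale (1 / a) (momentSeries f) := by
  ext j
  rw [coeff_rescale, momentSeries, momentSeries, coeff_mk, coeff_mk]
  have e : ∀ ξ : ℝ, ξ ^ j * (a * f (a * ξ)) =
      a * (1 / a) ^ j * ((fun x => x ^ j * f x) (a * ξ)) := fun ξ => by
    beta_reduce
    rw [mul_pow, one_div, inv_pow]
    field_simp
  simp only [e]
  rw [integral_const_mul, Measure.integral_comp_mul_left (fun x => x ^ j * f x),
    abs_of_pos (inv_pos.2 ha), smul_eq_mul]
  field_simp

theorem MemL2m.scaleHalf {F : ℝ → L2} (hm : 0 ≤ m) (hτ : 0 ≤ τ)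
    (hF : MemL2m m (F (Real.exp τ - 1))) : MemL2m m (scaleHalf F τ) :=
  hF.dilate hm (Real.one_le_exp (by linarith))

/-- The Hermite coefficients in scaling variables from the moments in the original ones. -/
theorem hermiteCoeff_scaleHalf (hν : 0 < ν) (hm : (N : ℝ) + 1 / 2 < m) (hτ : 0 ≤ τ) {F : ℝ → L2}
    (hF : MemL2m m (F (Real.exp τ - 1))) {A : ℝ → ℝ⟦X⟧}
    (h : ∀ j ≤ N, coeff j (momentSeries (F (Real.exp τ - 1))) =
      coeff j (gaussSeries (nuT ν * (Real.exp τ - 1)) * A (Real.exp τ - 1))) :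
    hermiteCoeff ν N (scaleHalf F τ) = toHermite ν N A τ := by
  have hm0 : 0 ≤ m := by have := Nat.cast_nonneg (α := ℝ) N; linarith
  have he := Real.exp_pos (τ / 2)
  funext k
  have hk := Nat.lt_succ_iff.1 k.2
  rw [hermiteCoeff_eq hν fun j hj => (hF.scaleHalf hm0 hτ).integrable_pow_mul hm hj]
  have e1 : momentSeries (scaleHalf F τ) =
      rescale (1 / Real.exp (τ / 2)) (momentSeries (F (Real.exp τ - 1))) :=
    momentSeries_dilate _ he
  have e2 : (1 / Real.exp (τ / 2)) ^ 2 * Real.exp τ = 1 := by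
    rw [one_div, ← Real.exp_neg, ← Real.exp_nat_mul, ← Real.exp_add, Real.exp_eq_one_iff]
    push_cast; ring
  have e3 : (1 / Real.exp (τ / 2)) ^ (k : ℕ) = Real.exp (-((k : ℝ) / 2) * τ) := by
    rw [one_div, ← Real.exp_neg, ← Real.exp_nat_mul]
    congr 1; ring
  rw [e1, mul_comm, coeff_mul_congr_left (G := rescale (1 / Real.exp (τ / 2))
    (gaussSeries (nuT ν * (Real.exp τ - 1)) * A (Real.exp τ - 1))) (fun i hi => by
      rw [coeff_rescale, coeff_rescale, h i (hi.trans hk)]), toHermite]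
  have e4 : rescale (1 / Real.exp (τ / 2)) (gaussSeries (nuT ν * (Real.exp τ - 1)) *
      A (Real.exp τ - 1)) * gaussSeries (-nuT ν) =
      rescale (1 / Real.exp (τ / 2)) (gaussSeries (-nuT ν) * A (Real.exp τ - 1)) := by
    rw [map_mul, map_mul, rescale_gaussSeries, rescale_gaussSeries, mul_right_comm,
      gaussSeries_mul]
    congr 2
    linear_combination nuT ν * e2
  rw [e4, coeff_rescale, e3]

variable {w₀ v₀ u₀ : L2} {W V : ℝ → L2}

/-- The antiderivative of the second component and its Hermite coefficients. -/
theorem IsSolution.exists_antiderivative_path (hν : 0 < ν) (h : IsSolution ν w₀ v₀ W V)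
    (hm : (N : ℝ) + 1 / 2 < m) (hw : MemL2m m w₀) (hv : MemL2m m v₀) (hu : MemL2m m u₀)
    (huv : IsWeakDeriv u₀ v₀) : ∃ U : ℝ → L2, U 0 = u₀ ∧
      (∀ t : ℝ, 0 ≤ t → IsWeakDeriv (U t) (V t)) ∧
      (∀ τ : ℝ, 0 ≤ τ → MemL2m m (scaleHalf W τ) ∧ MemL2m m (scaleHalf U τ)) ∧
      ∀ τ : ℝ, 0 ≤ τ → hermiteCoeff ν N (scaleHalf W τ) =
          toHermite ν N (solA ν (momentSeries w₀) (X * momentSeries u₀)) τ ∧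
        hermiteCoeff ν N (scaleHalf U τ) = toHermite ν N (fun t =>
          shiftSeries (solC ν (momentSeries w₀) (X * momentSeries u₀) t)) τ := by
  have hm0 : 0 ≤ m := by have := Nat.cast_nonneg (α := ℝ) N; linarith
  choose! u hum hud using fun t (ht : 0 < t) => h.exists_antiderivative hν hm hw hv hu huv ht
  obtain ⟨U, hU0, hUt⟩ : ∃ U : ℝ → L2, U 0 = u₀ ∧ ∀ t, 0 < t → U t = u t :=
    ⟨fun t => if 0 < t then u t else u₀, by simp, fun t ht => if_pos ht⟩
  have hUm : ∀ t, 0 ≤ t → MemL2m m (U t) := fun t ht => by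
    rcases ht.eq_or_lt with rfl | ht
    · rwa [hU0]
    · rw [hUt t ht]; exact hum t ht
  have ht : ∀ τ : ℝ, 0 ≤ τ → 0 ≤ Real.exp τ - 1 := fun τ hτ => sub_nonneg.2 (Real.one_le_exp hτ)
  refine ⟨U, hU0, fun t ht => ?_, fun τ hτ => ⟨(h.memL2m_w hν hm hw hv (ht τ hτ)).scaleHalf hm0 hτ,
    (hUm _ (ht τ hτ)).scaleHalf hm0 hτ⟩, fun τ hτ =>
    ⟨hermiteCoeff_scaleHalf hν hm hτ (h.memL2m_w hν hm hw hv (ht τ hτ)) fun j hj =>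
      h.coeff_momentSeries_w hν hm hw hv hu huv (ht τ hτ) hj,
    hermiteCoeff_scaleHalf hν hm hτ (hUm _ (ht τ hτ)) fun j hj => ?_⟩⟩
  · rcases ht.eq_or_lt with rfl | ht
    · rwa [hU0, h.initial_v]
    · rw [hUt t ht]; exact hud t ht
  · rcases (ht τ hτ).eq_or_lt with h0 | h0
    · rw [← h0, hU0, mul_zero, gaussSeries_zero, one_mul, solC_zero, shiftSeries, coeff_mk,
        coeff_succ_X_mul]
    · rw [hUt _ h0]
      exact h.coeff_momentSeries_u hν hm hw hv hu huv h0 (hum _ h0) (hud _ h0) hj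

end HermiteCoefficients
end
end TaylorDispersion

theorem theorem4p1 (N : ℕ) (hN : 0 < N) :
    -- the system is (2N+3)-dimensional
    Module.finrank ℝ (Phase N) = 2 * N + 3 ∧
    -- the `φ_j` are eigenfunctions of `L_T` in `L²(m)`
    (∀ ν : ℝ, 0 < ν → ∀ j : ℕ,
      hermiteFun ν j ≠ 0 ∧ (∀ m : ℝ, MemL2m m (hermiteFun ν j)) ∧
      ∀ ξ : ℝ, opLT ν (hermiteFun ν j) ξ = -((j : ℝ) / 2) * hermiteFun ν j ξ) ∧
    ∃ S : ℝ → Set (Phase N),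
      -- `S ν` is an attracting (N+2)-dimensional center manifold
      (∀ ν : ℝ, 0 < ν →
        IsCenterManifold (fastField ν N) (S ν) (N + 2) ∧ IsAttracting ν N (S ν)) ∧
      -- decay of the coefficients on the center manifold
      (∃ C : ℝ, ∀ ν : ℝ, 0 < ν → ν ≤ 1 → ∀ α β : ℝ → Fin (N + 1) → ℝ,
        SolvesODE ν α β → LiesOn (S ν) α β → ∀ τ : ℝ, 0 ≤ τ → ∀ k : Fin (N + 1),
          |α τ k| ≤ C * ‖α 0‖ / ν ^ ((k : ℕ) - 1) * Real.exp (-rate k * τ) ∧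
          |β τ k| ≤ C * ‖α 0‖ / ν ^ ((k : ℕ) + 1) * Real.exp (-rate k * τ)) ∧
      ∀ m : ℝ, (N : ℝ) + 1 / 2 < m →
        -- the dynamics on it is, to leading order, diffusion with the coefficient `ν + 1/ν`
        (∀ ν : ℝ, 0 < ν → ∃ K : ℝ, ∀ α β : ℝ → Fin (N + 1) → ℝ,
          SolvesODE ν α β → LiesOn (S ν) α β → ∀ τ : ℝ, 0 < τ →
            (∀ ξ : ℝ, DifferentiableAt ℝ (fun s => hermiteSum ν (α s) ξ) τ) ∧
            MemL2m m (fun ξ =>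
              deriv (fun s => hermiteSum ν (α s) ξ) τ - opLT ν (hermiteSum ν (α τ)) ξ) ∧
            normL2m m (fun ξ =>
              deriv (fun s => hermiteSum ν (α s) ξ) τ - opLT ν (hermiteSum ν (α τ)) ξ)
              ≤ K * Real.exp (-τ) * ‖α τ‖) ∧
        -- all data in `L²(m)`: approximation by a solution on the center manifold
        (∀ w₀ v₀ : L2, MemL2m m w₀ → MemL2m m v₀ → ∃ C : ℝ,
          ∀ ν : ℝ, 0 < ν → ∀ W V : ℝ → L2, IsSolution ν w₀ v₀ W V →
            ∃ α β : ℝ → Fin (N + 1) → ℝ, SolvesODE ν α β ∧ LiesOn (S ν) α β ∧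
              ∀ M : ℝ, 0 < M → 4 * M ≤ N → ∃ τ₀ : ℝ, 0 < τ₀ ∧ ∀ τ : ℝ, τ₀ ≤ τ →
                ApproxWithin ν m W V α β τ
                  (C / ν ^ ((N : ℝ) / 4 + m / 2) * Real.exp (-M * τ))) ∧
        -- data with `v₀ = ∂ₓ u₀`: approximation through the Hermite coefficients of the solution
        (∀ w₀ v₀ u₀ : L2, MemL2m m w₀ → MemL2m m v₀ → MemL2m m u₀ → IsWeakDeriv u₀ v₀ →
          ∃ C : ℝ, ∀ ν : ℝ, 0 < ν → ∀ W V : ℝ → L2, IsSolution ν w₀ v₀ W V →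
            ∃ U : ℝ → L2, U 0 = u₀ ∧ (∀ t : ℝ, 0 ≤ t → IsWeakDeriv (U t) (V t)) ∧
              (∀ τ : ℝ, 0 ≤ τ → MemL2m m (scaleHalf W τ) ∧ MemL2m m (scaleHalf U τ)) ∧
              ∃ α β : ℝ → Fin (N + 1) → ℝ,
                (∀ τ : ℝ, 0 ≤ τ → α τ = hermiteCoeff ν N (scaleHalf W τ) ∧
                  β τ = hermiteCoeff ν N (scaleHalf U τ)) ∧
                SolvesODE ν α β ∧
                (∀ M : ℝ, 0 < M → 4 * M ≤ N → ∃ τ₀ : ℝ, 0 < τ₀ ∧ ∀ τ : ℝ, τ₀ ≤ τ →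
                  ApproxWithin ν m W V α β τ
                    (C / ν ^ ((N : ℝ) / 4 + m / 2) * Real.exp (-M * τ))) ∧
                (ν ≤ 1 → ∃ τ₀ : ℝ, 0 < τ₀ ∧ ∀ τ : ℝ, τ₀ ≤ τ → ∀ k : Fin (N + 1),
                  |α τ k| ≤ C / ν ^ (if (k : ℕ) = 2 then 2 else (k : ℕ) - 1)
                    * Real.exp (-rate k * τ) ∧
                  |β τ k| ≤ C / ν ^ ((k : ℕ) + 1) * Real.exp (-rate k * τ))) := by
  refine ⟨?_, fun ν hν j => ⟨hermiteFun_ne_zero hν j, memL2m_hermiteFun hν j,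
      opLT_hermiteFun hν j⟩, fun ν => slowManifold ν N,
    fun ν hν => ⟨slowManifold_isCenterManifold hν, slowManifold_attracting hν⟩,
    slowManifold_decay N, fun m hm => ⟨fun ν hν => slowManifold_diffusion hν N m, ?_, ?_⟩⟩
  · simp only [Phase, Module.finrank_prod, Module.finrank_fin_fun, Module.finrank_self]
    ring
  · intro w₀ v₀ hw hv
    refine ⟨1, fun ν hν W V h => ?_⟩
    have hc : PowerSeries.coeff 0 (-(PowerSeries.X * slowSeries ν 1 *
        slowProj ν (momentSeries w₀) (momentSeries v₀))) = 0 := by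
      rw [map_neg, mul_assoc, PowerSeries.coeff_zero_X_mul, neg_zero]
    refine ⟨_, _, solvesODE_toHermite hν hc, liesOn_toHermite (momentSeries w₀) (momentSeries v₀),
      fun M _ hM => ?_⟩
    exact h.approxWithin hν hN hm hw hv (fun _ _ => rfl) (fun _ _ => rfl) (half_pos hν)
      (solA_sub_slow hν _ _) (solC_sub_slow hν _ _) (coeff_zero_solC hc) (by positivity) hM
  · intro w₀ v₀ u₀ hw hv hu huv
    have hc : PowerSeries.coeff 0 (PowerSeries.X * momentSeries u₀) = 0 :=
      PowerSeries.coeff_zero_X_mul _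
    obtain ⟨K, hK, hdecay⟩ := toHermite_eventually N (momentSeries w₀) hc
    refine ⟨1 + K, fun ν hν W V h => ?_⟩
    obtain ⟨U, hU0, hUd, hUm, hUc⟩ := h.exists_antiderivative_path hν hm hw hv hu huv
    have hz : ∀ F : ℝ → PowerSeries ℝ, Decay ν fun t => F t - F t := fun F j =>
      ⟨0, fun t _ => by simp⟩
    refine ⟨U, hU0, hUd, hUm, _, _, fun τ hτ => ⟨(hUc τ hτ).1.symm, (hUc τ hτ).2.symm⟩,
      solvesODE_toHermite hν hc, fun M _ hM => ?_, fun hν1 => ?_⟩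
    · exact h.approxWithin hν hN hm hw hv (fun _ _ => rfl)
        (fun j hj => huv.coeff_momentSeries hm hu hv hj) hν (hz _) (hz _) (coeff_zero_solC hc)
        (by positivity) hM
    · obtain ⟨τ₀, hτ₀, hd⟩ := hdecay ν hν hν1
      refine ⟨τ₀, hτ₀, fun τ hτ k => ⟨(hd τ hτ k).1.trans ?_, (hd τ hτ k).2.trans ?_⟩⟩
      · refine mul_le_mul_of_nonneg_right ?_ (Real.exp_pos _).le
        exact div_le_div_of_nonneg_right (by linarith) (by positivity)
      · refine mul_le_mul_of_nonneg_right ?_ (Real.exp_pos _).le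
        exact div_le_div_of_nonneg_right (by linarith) (by positivity)
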